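/- \textbf{Setting.} Let $\varphi:[0,\infty)\to[0,\infty)$ be an Orlicz function: convex, $\varphi(0)=0$ and $\varphi(u)>0$ for $u>0$; put $\varphi(\infty)=\infty$. We say that $\varphi$ satisfies $\Delta_2^0$ if there are $K>2$, $u_0>0$ with $\varphi(2u)\le K\varphi(u)$ for $0\le u\le u_0$; that it satisfies $\Delta_2^\infty$ if there are $K>2$, $u_0\ge 0$ with $\varphi(2u)\le K\varphi(u)$ for $u\ge u_0$; and that it satisfies $\Delta_2$ if it satisfies both. \emph{Functions.} Let $0<\gamma\le\infty$, $I=[0,\gamma)$ with Lebesgue measure $m$, and $L_0$ the real measurable functions on $I$ modulo a.e. equality. Let $w$ be nonnegative and decreasing (non-increasing) on $(0,\gamma)$, not a.e. zero, with $W(t)=\int_0^t w<\infty$ for $t<\gamma$, and $\int_0^\infty w=\infty$ if $\gamma=\infty$. For $f\in L_0$ let $f^*(t)=\inf\{\lambda>0: m\{|f|>\lambda\}\le t\}$ (with $\inf\emptyset=\infty$) be its decreasing rearrangement. For a nonnegative function $g$ on $I$ and $0\le a<b\le\gamma$ put $R(a,b)=\int_a^b g\big/\int_a^b w$ if $b<\infty$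 and $R(a,\infty)=\limsup_{t\to\infty}R(a,t)$ (with $0/0=0$, and $x/0=\infty$ for $x>0$). The interval $(a,b]$ is a level interval of $g$ if $R(a,t)\le R(a,b)$ for all $t\in(a,b]$; it is maximal if it is contained in no other level interval. The level function $g^0$ equals $R(a,b)\,w$ on $(a,b)$ for each maximal level interval $(a,b]$, and equals $g$ elsewhere. Write $v\prec w$ if $\int_0^t v\le\int_0^t w$ for all $t\in I$. Define \[ P_{\varphi,w}(f)=\inf\Big\{\int_I\varphi\Big(\frac{f^*}{v}\Big)v:\ v\ge 0\text{ decreasing on }(0,\gamma),\ v\prec w\Big\},\qquad Q_{\varphi,w}(f)=\int_I\varphi\Big(\frac{(f^*)^0}{w}\Big)w, \] where an integrand $\varphi(x/v)v$ is read as $0$ if $x=0$ and as $\infty$ if $v=0<x$. Let $\mathcal M_{\varphi,w}=\{f\in L_0: P_{\varphi,w}(kf)<\infty\text{ for some }k>0\}$, with the Luxemburg norm $\|f\|=\inf\{\epsilon>0:P_{\varphi,w}(f/\epsilon)\le1\}$. The \emph{appropriate} $\Delta_2$-condition is $\Delta_2^\infty$ if $\gamma<\infty$ and $\Delta_2$ if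 $\gamma=\infty$. \emph{Sequences.} For a decreasing nonnegative sequence $w$ with $\sum_i w(i)=\infty$, define $x^*$, level sequences, the modulars $\mathfrak p_{\varphi,w}$, $\mathfrak q_{\varphi,w}$, the space $\mathfrak m_{\varphi,w}$ of real sequences $x$ with $\mathfrak p_{\varphi,w}(kx)<\infty$ for some $k>0$, and its Luxemburg norm in the same way, with counting measure on $\mathbb N$, sums in place of integrals, and integer end points of level intervals. \textbf{Theorem.} (1) For every such $\gamma$ and every such weight function $w$: the equalities \[ \mathcal M_{\varphi,w}=\{f\in L_0:Q_{\varphi,w}(kf)<\infty\ \forall k>0\}=\{f\in L_0:P_{\varphi,w}(kf)<\infty\ \forall k>0\} \] hold if and only if $\varphi$ satisfies the appropriate $\Delta_2$-condition; and $\mathcal M_{\varphi,w}$ is separable if and only if $\varphi$ satisfies the appropriate $\Delta_2$-condition. (2) For every such weight sequence $w$: the equalities \[ \mathfrak m_{\varphi,w}=\{x:\mathfrak p_{\varphi,w}(kx)<\infty\ \forall k>0\}=\{x:\mathfrak q_{\varphi,w}(kx)<\infty\ \forall k>0\} \] hold if and only if $\varphi$ satisfies $\Delta_2^0$; and $\mathfrak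 m_{\varphi,w}$ is separable if and only if $\varphi$ satisfies $\Delta_2^0$. -/

import Mathlib

open MeasureTheory Filter
open scoped ENNReal NNReal

noncomputable section

namespace OrliczLorentz

/-! ### Orlicz functions and growth conditions -/

/-- An Orlicz function: a finite convex function on `[0, ∞)` vanishing exactly at `0`. -/
structure IsOrlicz (φ : ℝ → ℝ) : Prop where
  convex : ConvexOn ℝ (Set.Ici 0) φ
  zero : φ 0 = 0
  pos : ∀ u, 0 < u → 0 < φ u

/-- The `Δ₂`-condition at zero. -/
def DeltaTwoZero (φ : ℝ → ℝ) : Prop :=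
  ∃ K u₀ : ℝ, 2 < K ∧ 0 < u₀ ∧ ∀ u, 0 ≤ u → u ≤ u₀ → φ (2 * u) ≤ K * φ u

/-- The `Δ₂`-condition at infinity. -/
def DeltaTwoInfty (φ : ℝ → ℝ) : Prop :=
  ∃ K u₀ : ℝ, 2 < K ∧ 0 ≤ u₀ ∧ ∀ u, u₀ ≤ u → φ (2 * u) ≤ K * φ u

/-- The `Δ₂`-condition. -/
def DeltaTwo (φ : ℝ → ℝ) : Prop := DeltaTwoZero φ ∧ DeltaTwoInfty φ

/-- The appropriate `Δ₂`-condition for function spaces over `[0, γ)`. -/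
def AppropriateDeltaTwo (γ : ℝ≥0∞) (φ : ℝ → ℝ) : Prop :=
  (γ < ⊤ → DeltaTwoInfty φ) ∧ (γ = ⊤ → DeltaTwo φ)

/-- The extension of `φ` to `[0, ∞]` by `φ(∞) = ∞`. -/
def extend (φ : ℝ → ℝ) (x : ℝ≥0∞) : ℝ≥0∞ :=
  if x = ⊤ then ⊤ else ENNReal.ofReal (φ x.toReal)

/-- The integrand `φ(x / v) v`, which is `0` for `x = 0` and `∞` for `v = 0 < x`. -/
def integrand (φ : ℝ → ℝ) (x v : ℝ≥0∞) : ℝ≥0∞ :=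
  if x = 0 then 0 else if v = 0 then ⊤ else extend φ (x / v) * v

/-! ### Separability -/

/-- A set `M` in an additive group has a countable subset that is dense in it for the
norm `N`. -/
def SeparableFor {L : Type*} [AddGroup L] (N : L → ℝ≥0∞) (M : Set L) : Prop :=
  ∃ D : Set L, D ⊆ M ∧ D.Countable ∧ ∀ f ∈ M, ∀ ε : ℝ≥0∞, 0 < ε → ∃ g ∈ D, N (f - g) < ε

/-! ### Function spaces on `I = [0, γ)` -/

/-- The interval `I = [0, γ)`, where `γ` may be infinite. -/
def I (γ : ℝ≥0∞) : Set ℝ := {t | 0 ≤ t ∧ ENNReal.ofReal t < γ}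

/-- The open interval `(a, b)` of the real half-line, where `0 ≤ a` and `b` may be infinite. -/
def openInterval (a b : ℝ≥0∞) : Set ℝ := {t | a < ENNReal.ofReal t ∧ ENNReal.ofReal t < b}

/-- `L₀(I)`: Lebesgue measurable functions on `I` modulo equality almost everywhere. -/
abbrev L0 (γ : ℝ≥0∞) : Type := ℝ →ₘ[(volume : Measure ℝ).restrict (I γ)] ℝ

/-- The integral of `g` over `(a, b)`. -/
def intOver (g : ℝ → ℝ≥0∞) (a b : ℝ≥0∞) : ℝ≥0∞ := ∫⁻ t in openInterval a b, g t

/-- Decreasing, nonnegative, locally integrable weights on `I`, not almost everywhere zero, with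
`W(∞) = ∞` in the case `γ = ∞`. The value at the end point `0` plays no role, so that weights
with a singularity there are included. -/
structure IsWeight (γ : ℝ≥0∞) (w : ℝ → ℝ) : Prop where
  nonneg : ∀ t ∈ openInterval 0 γ, 0 ≤ w t
  antitone : AntitoneOn w (openInterval 0 γ)
  locallyIntegrable : ∀ t < γ, intOver (fun s => ENNReal.ofReal (w s)) 0 t < ⊤
  nontrivial : 0 < intOver (fun s => ENNReal.ofReal (w s)) 0 γ
  infinite : γ = ⊤ → intOver (fun s => ENNReal.ofReal (w s)) 0 ⊤ = ⊤

/-- The distribution function `d_f(c) = m {t ∈ I : |f t| > c}`. -/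
def distribution {γ : ℝ≥0∞} (f : L0 γ) (c : ℝ≥0) : ℝ≥0∞ :=
  (volume : Measure ℝ).restrict (I γ) {t | (c : ℝ) < |f t|}

/-- The decreasing rearrangement `f*(t) = inf {c > 0 : d_f(c) ≤ t}`, with `inf ∅ = ∞`. -/
def rearrangement {γ : ℝ≥0∞} (f : L0 γ) (t : ℝ) : ℝ≥0∞ :=
  ⨅ (c : ℝ≥0) (_ : 0 < c) (_ : distribution f c ≤ ENNReal.ofReal t), (c : ℝ≥0∞)

/-- The average `F(a, b) / W(a, b)` of `g` with respect to `w`. For `b = ∞` it is understood as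
the upper limit of `F(a, t) / W(a, t)` as `t → ∞`. -/
def average (w : ℝ → ℝ) (g : ℝ → ℝ≥0∞) (a b : ℝ≥0∞) : ℝ≥0∞ :=
  if b = ⊤ then
    limsup (fun t : ℝ => intOver g a (ENNReal.ofReal t) /
      intOver (fun s => ENNReal.ofReal (w s)) a (ENNReal.ofReal t)) atTop
  else intOver g a b / intOver (fun s => ENNReal.ofReal (w s)) a b

/-- `(a, b]` is a level interval of `g`. -/
def IsLevelInterval (γ : ℝ≥0∞) (w : ℝ → ℝ) (g : ℝ → ℝ≥0∞) (a b : ℝ≥0∞) : Prop :=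
  a < b ∧ b ≤ γ ∧ ∀ t, a < t → t ≤ b → average w g a t ≤ average w g a b

/-- A level interval that is not contained in another level interval. -/
def IsMaximalLevelInterval (γ : ℝ≥0∞) (w : ℝ → ℝ) (g : ℝ → ℝ≥0∞) (a b : ℝ≥0∞) : Prop :=
  IsLevelInterval γ w g a b ∧
    ∀ a' b', IsLevelInterval γ w g a' b' → a' ≤ a → b ≤ b' → a' = a ∧ b' = b

open Classical in
/-- Halperin's level function `g⁰` of `g` with respect to `w`. -/
def levelFunction (γ : ℝ≥0∞) (w : ℝ → ℝ) (g : ℝ → ℝ≥0∞) (t : ℝ) : ℝ≥0∞ :=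
  if h : ∃ p : ℝ≥0∞ × ℝ≥0∞,
      IsMaximalLevelInterval γ w g p.1 p.2 ∧ t ∈ openInterval p.1 p.2 then
    average w g h.choose.1 h.choose.2 * ENNReal.ofReal (w t)
  else g t

/-- The nonnegative decreasing functions `v` on `I` with `v ≺ w`. -/
def Submajorized (γ : ℝ≥0∞) (w v : ℝ → ℝ) : Prop :=
  (∀ t ∈ openInterval 0 γ, 0 ≤ v t) ∧ AntitoneOn v (openInterval 0 γ) ∧
    ∀ t < γ, intOver (fun s => ENNReal.ofReal (v s)) 0 t ≤
      intOver (fun s => ENNReal.ofReal (w s)) 0 t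

/-- The modular `P_{φ,w}(f) = inf {∫_I φ(f* / v) v : v ≺ w, v ↓}`. -/
def modularP {γ : ℝ≥0∞} (φ w : ℝ → ℝ) (f : L0 γ) : ℝ≥0∞ :=
  ⨅ (v : ℝ → ℝ) (_ : Submajorized γ w v),
    ∫⁻ t in I γ, integrand φ (rearrangement f t) (ENNReal.ofReal (v t))

/-- The modular `Q_{φ,w}(f) = ∫_I φ((f*)⁰ / w) w`. -/
def modularQ {γ : ℝ≥0∞} (φ w : ℝ → ℝ) (f : L0 γ) : ℝ≥0∞ :=
  ∫⁻ t in I γ,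
    integrand φ (levelFunction γ w (rearrangement f) t) (ENNReal.ofReal (w t))

/-- The space `M_{φ,w}`. -/
def spaceM (γ : ℝ≥0∞) (φ w : ℝ → ℝ) : Set (L0 γ) :=
  {f | ∃ k : ℝ, 0 < k ∧ modularP φ w (k • f) < ⊤}

/-- The Luxemburg norm of `M_{φ,w}`. -/
def normM {γ : ℝ≥0∞} (φ w : ℝ → ℝ) (f : L0 γ) : ℝ≥0∞ :=
  ⨅ (ε : ℝ) (_ : 0 < ε) (_ : modularP φ w (ε⁻¹ • f) ≤ 1), ENNReal.ofReal ε

/-- The functions `f` with `P_{φ,w}(k f) < ∞` for all `k > 0`. -/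
def finiteP (γ : ℝ≥0∞) (φ w : ℝ → ℝ) : Set (L0 γ) :=
  {f | ∀ k : ℝ, 0 < k → modularP φ w (k • f) < ⊤}

/-- The functions `f` with `Q_{φ,w}(k f) < ∞` for all `k > 0`. -/
def finiteQ (γ : ℝ≥0∞) (φ w : ℝ → ℝ) : Set (L0 γ) :=
  {f | ∀ k : ℝ, 0 < k → modularQ φ w (k • f) < ⊤}

/-! ### Sequence spaces

Sequences are indexed by `ℕ` from `0` on: the entry `i` here is the entry `i + 1` of the usual
notation, and the index interval `(a, b]` is `{i : a ≤ i < b}`. -/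

/-- Decreasing nonnegative weight sequences with divergent sum. -/
structure IsSeqWeight (w : ℕ → ℝ) : Prop where
  nonneg : ∀ i, 0 ≤ w i
  antitone : Antitone w
  infinite : ∑' i, ENNReal.ofReal (w i) = ⊤

/-- The distribution function of a sequence, for the counting measure. -/
def seqDistribution (x : ℕ → ℝ) (c : ℝ≥0) : ℝ≥0∞ :=
  (Measure.count : Measure ℕ) {i | (c : ℝ) < |x i|}

/-- The decreasing rearrangement `x*` of a sequence. -/
def seqRearrangement (x : ℕ → ℝ) (i : ℕ) : ℝ≥0∞ :=
  ⨅ (c : ℝ≥0) (_ : 0 < c) (_ : seqDistribution x c < (i : ℝ≥0∞) + 1), (c : ℝ≥0∞)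

/-- The quotient of the sums of `g` and of `w` over `{i : a ≤ i < n}`. -/
def seqQuotient (w : ℕ → ℝ) (g : ℕ → ℝ≥0∞) (a n : ℕ) : ℝ≥0∞ :=
  (∑ i ∈ Finset.Ico a n, g i) / ∑ i ∈ Finset.Ico a n, ENNReal.ofReal (w i)

/-- The average of `g` with respect to `w` over `{i : a ≤ i < b}`; an upper limit for `b = ∞`. -/
def seqAverage (w : ℕ → ℝ) (g : ℕ → ℝ≥0∞) (a : ℕ) (b : ℕ∞) : ℝ≥0∞ :=
  if b = ⊤ then limsup (fun n : ℕ => seqQuotient w g a n) atTop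
  else seqQuotient w g a b.toNat

/-- `{i : a ≤ i < b}` is a level interval of `g`. -/
def IsSeqLevelInterval (w : ℕ → ℝ) (g : ℕ → ℝ≥0∞) (a : ℕ) (b : ℕ∞) : Prop :=
  (a : ℕ∞) < b ∧ ∀ t : ℕ∞, (a : ℕ∞) < t → t ≤ b → seqAverage w g a t ≤ seqAverage w g a b

/-- A level interval that is not contained in another level interval. -/
def IsMaximalSeqLevelInterval (w : ℕ → ℝ) (g : ℕ → ℝ≥0∞) (a : ℕ) (b : ℕ∞) : Prop :=
  IsSeqLevelInterval w g a b ∧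
    ∀ a' b', IsSeqLevelInterval w g a' b' → a' ≤ a → b ≤ b' → a' = a ∧ b' = b

open Classical in
/-- The level sequence `g⁰` of `g` with respect to `w`. -/
def levelSequence (w : ℕ → ℝ) (g : ℕ → ℝ≥0∞) (i : ℕ) : ℝ≥0∞ :=
  if h : ∃ p : ℕ × ℕ∞,
      IsMaximalSeqLevelInterval w g p.1 p.2 ∧ p.1 ≤ i ∧ (i : ℕ∞) < p.2 then
    seqAverage w g h.choose.1 h.choose.2 * ENNReal.ofReal (w i)
  else g i

/-- The nonnegative decreasing sequences `v` with `v ≺ w`. -/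
def SeqSubmajorized (w v : ℕ → ℝ) : Prop :=
  (∀ i, 0 ≤ v i) ∧ Antitone v ∧
    ∀ n, ∑ i ∈ Finset.range n, v i ≤ ∑ i ∈ Finset.range n, w i

/-- The modular `p_{φ,w}` for sequences. -/
def seqModularP (φ : ℝ → ℝ) (w : ℕ → ℝ) (x : ℕ → ℝ) : ℝ≥0∞ :=
  ⨅ (v : ℕ → ℝ) (_ : SeqSubmajorized w v),
    ∑' i, integrand φ (seqRearrangement x i) (ENNReal.ofReal (v i))

/-- The modular `q_{φ,w}` for sequences. -/
def seqModularQ (φ : ℝ → ℝ) (w : ℕ → ℝ) (x : ℕ → ℝ) : ℝ≥0∞ :=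
  ∑' i, integrand φ (levelSequence w (seqRearrangement x) i) (ENNReal.ofReal (w i))

/-- The sequence space `m_{φ,w}`. -/
def seqSpaceM (φ : ℝ → ℝ) (w : ℕ → ℝ) : Set (ℕ → ℝ) :=
  {x | ∃ k : ℝ, 0 < k ∧ seqModularP φ w (k • x) < ⊤}

/-- The Luxemburg norm of `m_{φ,w}`. -/
def seqNormM (φ : ℝ → ℝ) (w : ℕ → ℝ) (x : ℕ → ℝ) : ℝ≥0∞ :=
  ⨅ (ε : ℝ) (_ : 0 < ε) (_ : seqModularP φ w (ε⁻¹ • x) ≤ 1), ENNReal.ofReal ε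

/-- The sequences `x` with `p_{φ,w}(k x) < ∞` for all `k > 0`. -/
def seqFiniteP (φ : ℝ → ℝ) (w : ℕ → ℝ) : Set (ℕ → ℝ) :=
  {x | ∀ k : ℝ, 0 < k → seqModularP φ w (k • x) < ⊤}

/-- The sequences `x` with `q_{φ,w}(k x) < ∞` for all `k > 0`. -/
def seqFiniteQ (φ : ℝ → ℝ) (w : ℕ → ℝ) : Set (ℕ → ℝ) :=
  {x | ∀ k : ℝ, 0 < k → seqModularQ φ w (k • x) < ⊤}

end OrliczLorentz

end

/-!
Let `F` and `W` be the primitives of the rearrangement of `f` and of the weight `w`. The level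
function of the rearrangement is `y w`, where `y` is the slope, with respect to `W`, of the least
`W`-concave majorant of `F`, and a maximal level interval is an interval on which the majorant
replaces `F` by a chord.

*The two modulars.* Finiteness of `P` forces `F / W` to vanish at infinity, so that the majorant
exists, and `Q(f) = ∫ φ(y) w`. For `v ≺ w` the supporting lines of `φ` at the values of `y` bound
`φ(f* / v) v` from below by an expression that is linear in `f*` and `v`. As `y` decreases and is
constant on the level intervals, this expression does not increase in the integral if `f*` is
replaced by `y w` and `v` by `w`, which gives `Q ≤ P` (`lintegral_le_lintegral_integrand`,
`modularQ_le_modularP`). Conversely `v = f* / y` is decreasing and submajorized by `w`, and it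
attains `Q` (`LevelPair.optimal_submajorized`, `modularP_le_modularQ`). Finiteness of `Q` is used
here to exclude unbounded level intervals with positive average. Hence the functions all of whose
multiples have finite `Q` are those for which they have finite `P` (`finiteQ_eq_finiteP`),
irrespective of `φ`.

*Sufficiency of the growth condition.* The condition bounds `φ (2 u)` by `K φ(u) + C`, with `C = 0`
if `γ = ∞`, so finiteness of `P` is stable under doubling (`modularP_two_smul_lt_top`). On the space
of functions all of whose multiples have finite `P` the norm is order continuous by dominated
convergence (`eventually_normM_le`), so truncations approximate, and a countable dense subset of
`L¹` yields one of the space (`separableFor_of_eq`).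

*Necessity.* If the condition fails, there are disjoint intervals and a decreasing step function `L`
with values `l n` on them such that `L w` has modular at most `1`, whereas each single piece of it
has norm bounded from below (`exists_bumpData_of_not_deltaTwoInfty`,
`exists_bumpData_of_not_deltaTwoZero`). The partial sums of the pieces, indexed by the sets of
natural numbers, form an uncountable separated family, and the sum of all pieces has a multiple with
infinite `P` (`BumpData.not_separableFor_and_ne`).

*Sequences.* By Jensen's inequality, the modular of a sequence is the modular `P` of the
corresponding step function with respect to the step weight (`seqModularP_eq`), so that the norm,
the order continuity and the pieces carry over. The modular `q` is compared with `p` by the argument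
above for counting measure, with the average over the maximal level interval around an index as the
slope there (`seqModularQ_le_seqModularP`, `seqModularP_le_seqModularQ`). Only finitely many of
these averages exceed a given bound, which is why the growth condition at zero suffices
(`seqModularP_two_smul_lt_top`). The rational sequences with finite support are dense
(`seqSeparableFor_of_eq`).
-/

namespace OrliczLorentz

/-! ### Orlicz functions -/

namespace IsOrlicz

variable {φ : ℝ → ℝ}

theorem map_mul_le (hφ : IsOrlicz φ) {c u : ℝ} (hc : 0 ≤ c) (hc1 : c ≤ 1) (hu : 0 ≤ u) :
    φ (c * u) ≤ c * φ u := by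
  have h := hφ.convex.2 (Set.mem_Ici.2 hu) (Set.mem_Ici.2 le_rfl) hc (sub_nonneg.2 hc1)
    (by ring)
  simpa [hφ.zero] using h

theorem nonneg (hφ : IsOrlicz φ) {u : ℝ} (hu : 0 ≤ u) : 0 ≤ φ u := by
  rcases hu.eq_or_lt with rfl | h
  · exact hφ.zero.ge
  · exact (hφ.pos u h).le

theorem mono (hφ : IsOrlicz φ) {u v : ℝ} (hu : 0 ≤ u) (huv : u ≤ v) : φ u ≤ φ v := by
  rcases (hu.trans huv).eq_or_lt with h | h
  · rw [show u = v by linarith]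
  · have h1 := hφ.map_mul_le (div_nonneg hu h.le) ((div_le_one h).2 huv) h.le
    rw [div_mul_cancel₀ _ h.ne'] at h1
    exact h1.trans (mul_le_of_le_one_left (hφ.nonneg h.le) ((div_le_one h).2 huv))

theorem mul_le_map (hφ : IsOrlicz φ) {c u : ℝ} (hc : 1 ≤ c) (hu : 0 ≤ u) :
    c * φ u ≤ φ (c * u) := by
  have hc0 : 0 < c := by linarith
  have h := hφ.map_mul_le (inv_nonneg.2 hc0.le) (inv_le_one_of_one_le₀ hc)
    (mul_nonneg hc0.le hu)
  rw [inv_mul_cancel_left₀ hc0.ne'] at h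
  calc c * φ u ≤ c * (c⁻¹ * φ (c * u)) := by gcongr
    _ = φ (c * u) := by field_simp

theorem exists_large (hφ : IsOrlicz φ) (C : ℝ) : ∃ u₀ : ℝ, 0 < u₀ ∧ ∀ u, u₀ ≤ u → C ≤ φ u := by
  have h1 := hφ.pos 1 one_pos
  refine ⟨max 1 (C / φ 1), by positivity, fun u hu => ?_⟩
  have hu1 : 1 ≤ u := (le_max_left _ _).trans hu
  have h2 := hφ.mul_le_map hu1 zero_le_one
  rw [mul_one] at h2
  exact ((div_le_iff₀ h1).1 ((le_max_right _ _).trans hu)).trans h2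

theorem exists_small (hφ : IsOrlicz φ) {ε : ℝ} (hε : 0 < ε) :
    ∃ u₀ : ℝ, 0 < u₀ ∧ ∀ u, 0 ≤ u → u ≤ u₀ → φ u ≤ ε := by
  have h1 := hφ.pos 1 one_pos
  refine ⟨min 1 (ε / φ 1), by positivity, fun u hu hu1 => ?_⟩
  have h2 := hφ.map_mul_le hu (hu1.trans (min_le_left _ _)) zero_le_one
  rw [mul_one] at h2
  exact h2.trans ((le_div_iff₀ h1).1 (hu1.trans (min_le_right _ _)))

theorem scale (hφ : IsOrlicz φ) {a : ℝ} (ha : 0 < a) : IsOrlicz fun u => φ (a * u) where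
  convex := by
    refine ⟨convex_Ici 0, fun x hx y hy s t hs ht hst => ?_⟩
    have h := hφ.convex.2 (Set.mem_Ici.2 (mul_nonneg ha.le hx))
      (Set.mem_Ici.2 (mul_nonneg ha.le hy)) hs ht hst
    simp only [smul_eq_mul] at h ⊢
    rwa [show a * (s * x + t * y) = s * (a * x) + t * (a * y) by ring]
  zero := by simp [hφ.zero]
  pos u hu := hφ.pos _ (mul_pos ha hu)

/-- A supporting line of `φ` at an interior point. -/
theorem exists_subgradient (hφ : IsOrlicz φ) {y : ℝ} (hy : 0 < y) :
    ∃ s : ℝ, 0 ≤ s ∧ ∀ u, 0 ≤ u → φ y + s * (u - y) ≤ φ u := by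
  have hint : y ∈ interior (Set.Ici (0 : ℝ)) := by simpa using hy
  have key : ∀ u, 0 ≤ u → φ y + derivWithin φ (Set.Ioi y) y * (u - y) ≤ φ u := by
    intro u hu
    rcases lt_trichotomy u y with h | rfl | h
    · have h1 := (hφ.convex.slope_le_leftDeriv_of_mem_interior (Set.mem_Ici.2 hu) hint h).trans
        (hφ.convex.leftDeriv_le_rightDeriv_of_mem_interior hint)
      rw [slope_def_field, div_le_iff₀ (by linarith)] at h1
      linarith
    · simp
    · have h1 := hφ.convex.rightDeriv_le_slope_of_mem_interior hint (Set.mem_Ici.2 hu) h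
      rw [slope_def_field, le_div_iff₀ (by linarith)] at h1
      linarith
  refine ⟨_, ?_, key⟩
  have h0 := key (y / 2) (by linarith)
  have h1 := hφ.mono (u := y / 2) (v := y) (by linarith) (by linarith)
  by_contra h
  push Not at h
  nlinarith [mul_pos (neg_pos.2 h) hy]

end IsOrlicz

/-! ### The integrand -/

section Integrand

variable {φ : ℝ → ℝ}

theorem extend_ofReal {u : ℝ} (hu : 0 ≤ u) : extend φ (ENNReal.ofReal u) = ENNReal.ofReal (φ u) := by
  simp [extend, ENNReal.toReal_ofReal hu]

theorem extend_mono (hφ : IsOrlicz φ) : Monotone (extend φ) := by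
  intro x y h
  unfold extend
  split_ifs with h1 h2 h2
  · exact le_rfl
  · exact absurd (top_le_iff.1 (h1 ▸ h)) h2
  · exact le_top
  · exact ENNReal.ofReal_le_ofReal (hφ.mono ENNReal.toReal_nonneg (ENNReal.toReal_mono h2 h))

@[simp] theorem integrand_zero_left (v : ℝ≥0∞) : integrand φ 0 v = 0 := by simp [integrand]

theorem integrand_mono (hφ : IsOrlicz φ) {x y : ℝ≥0∞} (h : x ≤ y) (v : ℝ≥0∞) :
    integrand φ x v ≤ integrand φ y v := by
  unfold integrand
  by_cases hx : x = 0
  · simp [hx]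
  have hy : y ≠ 0 := fun h0 => hx (le_zero_iff.1 (h0 ▸ h))
  rw [if_neg hx, if_neg hy]
  split_ifs
  · exact le_rfl
  · gcongr
    exact extend_mono hφ (ENNReal.div_le_div_right h v)

theorem integrand_of_ne {x v : ℝ≥0∞} (hx : x ≠ 0) (hv : v ≠ 0) :
    integrand φ x v = extend φ (x / v) * v := by simp [integrand, hx, hv]

theorem integrand_ofReal (hφ : IsOrlicz φ) {x v : ℝ} (hx : 0 ≤ x) (hv : 0 < v) :
    integrand φ (ENNReal.ofReal x) (ENNReal.ofReal v) = ENNReal.ofReal (φ (x / v) * v) := by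
  rcases hx.eq_or_lt with rfl | h
  · simp [hφ.zero]
  · rw [integrand_of_ne (by simpa using h) (by simpa using hv), ← ENNReal.ofReal_div_of_pos hv,
      extend_ofReal (by positivity), ENNReal.ofReal_mul (hφ.nonneg (by positivity))]

theorem integrand_top {v : ℝ≥0∞} (hv : v ≠ ⊤) : integrand φ ⊤ v = ⊤ := by
  unfold integrand
  rw [if_neg ENNReal.top_ne_zero]
  split_ifs with h
  · rfl
  · rw [ENNReal.top_div_of_ne_top hv]
    simp [extend, ENNReal.top_mul h]

theorem measurable_integrand (hφ : IsOrlicz φ) :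
    Measurable fun p : ℝ≥0∞ × ℝ≥0∞ => integrand φ p.1 p.2 := by
  unfold integrand
  refine Measurable.ite (measurable_fst (measurableSet_singleton 0)) measurable_const
    (Measurable.ite (measurable_snd (measurableSet_singleton 0)) measurable_const ?_)
  exact ((extend_mono hφ).measurable.comp (measurable_fst.div measurable_snd)).mul measurable_snd

/-- Replacing `φ` by `u ↦ φ (a u)` amounts to multiplying the function by `a`. -/
theorem integrand_scale {a : ℝ} (ha : 0 < a) (x v : ℝ≥0∞) :
    integrand φ (ENNReal.ofReal a * x) v = integrand (fun u => φ (a * u)) x v := by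
  have ha' : ENNReal.ofReal a ≠ 0 := by simpa using ha
  unfold integrand
  by_cases hx : x = 0
  · simp [hx]
  rw [if_neg (mul_ne_zero ha' hx), if_neg hx]
  split_ifs with h
  · rfl
  · congr 1
    rw [mul_div_assoc]
    unfold extend
    by_cases h1 : x / v = ⊤
    · simp [h1, ENNReal.mul_top ha']
    · rw [if_neg (ENNReal.mul_ne_top ENNReal.ofReal_ne_top h1), if_neg h1, ENNReal.toReal_mul,
        ENNReal.toReal_ofReal ha.le]

/-- An affine minorant `s u - c` of `φ` gives a minorant of the integrand that is linear in
both variables. -/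
theorem tangent_le_integrand (hφ : IsOrlicz φ) {s c : ℝ} (hs : 0 ≤ s) (hc : 0 ≤ c)
    (h : ∀ u, 0 ≤ u → s * u ≤ φ u + c) (x : ℝ≥0∞) {v : ℝ≥0∞} (hv : v ≠ ⊤) :
    ENNReal.ofReal s * x ≤ integrand φ x v + ENNReal.ofReal c * v := by
  by_cases hx : x = ⊤
  · simp [hx, integrand_top hv]
  by_cases hv0 : v = 0
  · by_cases hx0 : x = 0
    · simp [hx0]
    · simp [integrand, hx0, hv0]
  obtain ⟨x, hx0, rfl⟩ : ∃ r : ℝ, 0 ≤ r ∧ x = ENNReal.ofReal r :=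
    ⟨x.toReal, ENNReal.toReal_nonneg, (ENNReal.ofReal_toReal hx).symm⟩
  obtain ⟨v, hv1, rfl⟩ : ∃ r : ℝ, 0 < r ∧ v = ENNReal.ofReal r :=
    ⟨v.toReal, ENNReal.toReal_pos hv0 hv, (ENNReal.ofReal_toReal hv).symm⟩
  have hu : 0 ≤ x / v := by positivity
  rw [integrand_ofReal hφ hx0 hv1, ← ENNReal.ofReal_mul hs, ← ENNReal.ofReal_mul hc,
    ← ENNReal.ofReal_add (mul_nonneg (hφ.nonneg hu) hv1.le) (by positivity)]
  apply ENNReal.ofReal_le_ofReal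
  have h2 := mul_le_mul_of_nonneg_right (h _ hu) hv1.le
  calc s * x = s * (x / v) * v := by field_simp
    _ ≤ _ := by linarith

/-- The integrand is jointly subadditive, being the perspective of a convex function. -/
theorem integrand_add_le (hφ : IsOrlicz φ) (x₁ x₂ : ℝ≥0∞) {v₁ v₂ : ℝ≥0∞} (h₁ : v₁ ≠ ⊤)
    (h₂ : v₂ ≠ ⊤) : integrand φ (x₁ + x₂) (v₁ + v₂) ≤ integrand φ x₁ v₁ + integrand φ x₂ v₂ := by
  by_cases hx₁ : x₁ = ⊤
  · simp [hx₁, integrand_top h₁]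
  by_cases hx₂ : x₂ = ⊤
  · simp [hx₂, integrand_top h₂]
  by_cases hv₁ : v₁ = 0
  · by_cases hx0 : x₁ = 0
    · simp [hx0, hv₁]
    · simp [integrand, hx0, hv₁]
  by_cases hv₂ : v₂ = 0
  · by_cases hx0 : x₂ = 0
    · simp [hx0, hv₂]
    · simp [integrand, hx0, hv₂]
  obtain ⟨x, hx, rfl⟩ : ∃ r : ℝ, 0 ≤ r ∧ x₁ = ENNReal.ofReal r :=
    ⟨x₁.toReal, ENNReal.toReal_nonneg, (ENNReal.ofReal_toReal hx₁).symm⟩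
  obtain ⟨y, hy, rfl⟩ : ∃ r : ℝ, 0 ≤ r ∧ x₂ = ENNReal.ofReal r :=
    ⟨x₂.toReal, ENNReal.toReal_nonneg, (ENNReal.ofReal_toReal hx₂).symm⟩
  obtain ⟨v, hv, rfl⟩ : ∃ r : ℝ, 0 < r ∧ v₁ = ENNReal.ofReal r :=
    ⟨v₁.toReal, ENNReal.toReal_pos hv₁ h₁, (ENNReal.ofReal_toReal h₁).symm⟩
  obtain ⟨w, hw, rfl⟩ : ∃ r : ℝ, 0 < r ∧ v₂ = ENNReal.ofReal r :=
    ⟨v₂.toReal, ENNReal.toReal_pos hv₂ h₂, (ENNReal.ofReal_toReal h₂).symm⟩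
  have hu : 0 ≤ x / v := by positivity
  have hu' : 0 ≤ y / w := by positivity
  rw [← ENNReal.ofReal_add hx hy, ← ENNReal.ofReal_add hv.le hw.le,
    integrand_ofReal hφ (by positivity) (by positivity), integrand_ofReal hφ hx hv,
    integrand_ofReal hφ hy hw, ← ENNReal.ofReal_add (mul_nonneg (hφ.nonneg hu) hv.le)
      (mul_nonneg (hφ.nonneg hu') hw.le)]
  apply ENNReal.ofReal_le_ofReal
  have h := hφ.convex.2 (Set.mem_Ici.2 hu) (Set.mem_Ici.2 hu')
    (show 0 ≤ v / (v + w) by positivity) (show 0 ≤ w / (v + w) by positivity) (by field_simp)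
  simp only [smul_eq_mul] at h
  rw [show v / (v + w) * (x / v) + w / (v + w) * (y / w) = (x + y) / (v + w) by field_simp] at h
  calc _ ≤ (v / (v + w) * φ (x / v) + w / (v + w) * φ (y / w)) * (v + w) := by gcongr
    _ = _ := by field_simp

theorem integrand_mul_right (c x v : ℝ≥0∞) (hc : c ≠ 0) (hc' : c ≠ ⊤) :
    integrand φ (c * x) (c * v) = c * integrand φ x v := by
  unfold integrand
  by_cases hx : x = 0
  · simp [hx]
  by_cases hv : v = 0
  · simp [hx, hv, hc, ENNReal.mul_top]
  simp only [mul_eq_zero, hx, hv, hc, or_self, if_false]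
  rw [ENNReal.mul_div_mul_left _ _ hc hc']
  ring

end Integrand

/-! ### Level intervals of a pair of primitives -/

/-- `[a, b]` is a level interval with average `l` for the primitives `F` of the function and `W`
of the weight: over `[a, b]` the graph of `F - l W` lies below its common value at the two end
points, and `W` is not constant. -/
structure Lev {α : Type*} [LinearOrder α] (F W : α → ℝ) (l : ℝ) (a b : α) : Prop where
  lt : a < b
  wlt : W a < W b
  eq : F b - F a = l * (W b - W a)
  le : ∀ t, a ≤ t → t ≤ b → F t - F a ≤ l * (W t - W a)

/-- A level interval with end points in `E` that is contained in no other one. -/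
structure MaxLev {α : Type*} [LinearOrder α] (F W : α → ℝ) (E : Set α) (l : ℝ) (a b : α) :
    Prop where
  left_mem : a ∈ E
  right_mem : b ∈ E
  lev : Lev F W l a b
  max : ∀ l' a' b', a' ∈ E → b' ∈ E → Lev F W l' a' b' → a' ≤ a → b ≤ b' → a' = a ∧ b' = b

section Order

variable {α : Type*} [LinearOrder α] {F W : α → ℝ}

theorem Lev.ge {l : ℝ} {a b t : α} (h : Lev F W l a b) (h1 : a ≤ t) (h2 : t ≤ b) :
    l * (W b - W t) ≤ F b - F t := by
  have := h.le t h1 h2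
  have := h.eq
  linarith

/-- Two overlapping level intervals, or two adjacent ones with increasing averages, have a level
interval as their union. -/
theorem Lev.union {l m : ℝ} {a b c d : α} (h₁ : Lev F W l a b) (h₂ : Lev F W m c d) (hac : a ≤ c)
    (hcb : c ≤ b) (hbd : b ≤ d) (hW : MonotoneOn W (Set.Icc a d)) (h : W c < W b ∨ l ≤ m) :
    ∃ n, Lev F W n a d := by
  have hWac : W a ≤ W c := hW ⟨le_rfl, hac.trans (hcb.trans hbd)⟩ ⟨hac, hcb.trans hbd⟩ hac
  have hWbd : W b ≤ W d := hW ⟨hac.trans hcb, hbd⟩ ⟨hac.trans (hcb.trans hbd), le_rfl⟩ hbd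
  have hlm : l ≤ m := by
    rcases h with h | h
    · have h3 := h₁.ge hac hcb
      have h4 := h₂.le b hcb hbd
      exact le_of_mul_le_mul_right (h3.trans h4) (sub_pos.2 h)
    · exact h
  have hpos : 0 < W d - W a := by linarith [h₁.wlt]
  have hn := div_mul_cancel₀ (F d - F a) hpos.ne'
  set n := (F d - F a) / (W d - W a)
  have e1 := h₁.eq
  have e2 := h₂.eq
  have hnm : n ≤ m := by
    have h3 := h₁.le c hac hcb
    refine le_of_mul_le_mul_right ?_ hpos
    rw [hn]
    nlinarith [mul_le_mul_of_nonneg_right hlm (sub_nonneg.2 hWac)]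
  have hln : l ≤ n := by
    have h3 := h₂.ge hcb hbd
    refine le_of_mul_le_mul_right ?_ hpos
    rw [hn]
    nlinarith [mul_le_mul_of_nonneg_right hlm (sub_nonneg.2 hWbd)]
  refine ⟨n, h₁.lt.trans_le hbd, by linarith, hn.symm, fun t hat htd => ?_⟩
  rcases le_total t b with htb | hbt
  · have h3 := h₁.le t hat htb
    have h4 : W a ≤ W t := hW ⟨le_rfl, hat.trans htd⟩ ⟨hat, htd⟩ hat
    nlinarith [mul_le_mul_of_nonneg_right hln (sub_nonneg.2 h4)]
  · have h3 := h₂.ge (hcb.trans hbt) htd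
    have h4 : W t ≤ W d := hW ⟨hat, htd⟩ ⟨hat.trans htd, le_rfl⟩ htd
    nlinarith [mul_le_mul_of_nonneg_right hnm (sub_nonneg.2 h4)]

/-- A level interval may be prolonged over an interval on which `W` is constant. -/
theorem Lev.extend_flat {l : ℝ} {a b d : α} (h : Lev F W l a b) (hbd : b ≤ d)
    (hF : MonotoneOn F (Set.Icc a d)) (hW : MonotoneOn W (Set.Icc a d)) (hflat : W d = W b) :
    ∃ n, Lev F W n a d := by
  have had := h.lt.le.trans hbd
  have hpos : 0 < W d - W a := by linarith [h.wlt]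
  have hn := div_mul_cancel₀ (F d - F a) hpos.ne'
  set n := (F d - F a) / (W d - W a)
  have hFbd : F b ≤ F d := hF ⟨h.lt.le, hbd⟩ ⟨had, le_rfl⟩ hbd
  have e1 := h.eq
  have hln : l ≤ n := by
    refine le_of_mul_le_mul_right ?_ hpos
    rw [hn, hflat]
    linarith
  refine ⟨n, h.lt.trans_le hbd, by linarith, hn.symm, fun t hat htd => ?_⟩
  rcases le_total t b with htb | hbt
  · have h3 := h.le t hat htb
    have h4 : W a ≤ W t := hW ⟨le_rfl, had⟩ ⟨hat, htd⟩ hat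
    nlinarith [mul_le_mul_of_nonneg_right hln (sub_nonneg.2 h4)]
  · have h3 : W t = W d := le_antisymm (hW ⟨hat, htd⟩ ⟨had, le_rfl⟩ htd)
      (hflat.le.trans (hW ⟨h.lt.le, hbd⟩ ⟨hat, htd⟩ hbt))
    have h4 : F t ≤ F d := hF ⟨hat, htd⟩ ⟨had, le_rfl⟩ htd
    rw [h3, hn]
    linarith

end Order

/-- Between two points at which a continuous function is larger than at a point `t` in between
there is an interval around `t` at whose end points the function takes its maximum over the
interval. -/
theorem exists_hump {H : ℝ → ℝ} {r t s : ℝ} (hrt : r < t) (hts : t < s)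
    (hH : ContinuousOn H (Set.Icc r s)) (h₁ : H t < H r) (h₂ : H t < H s) :
    ∃ a b, r ≤ a ∧ a < t ∧ t < b ∧ b ≤ s ∧ H a = H b ∧ H t < H a ∧
      ∀ x, a ≤ x → x ≤ b → H x ≤ H a := by
  set m := min (H r) (H s)
  have hm : H t < m := lt_min h₁ h₂
  have hHl : ContinuousOn H (Set.Icc r t) := hH.mono (Set.Icc_subset_Icc_right hts.le)
  have hHr : ContinuousOn H (Set.Icc t s) := hH.mono (Set.Icc_subset_Icc_left hrt.le)
  obtain ⟨a, ⟨⟨hra, hat⟩, hma⟩, ha⟩ : ∃ a, IsGreatest (Set.Icc r t ∩ H ⁻¹' Set.Ici m) a :=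
    (isCompact_Icc.of_isClosed_subset (hHl.preimage_isClosed_of_isClosed isClosed_Icc isClosed_Ici)
      Set.inter_subset_left).exists_isGreatest ⟨r, ⟨le_rfl, hrt.le⟩,
        Set.mem_preimage.2 (Set.mem_Ici.2 (min_le_left _ _))⟩
  obtain ⟨b, ⟨⟨htb, hbs⟩, hmb⟩, hb⟩ : ∃ a, IsLeast (Set.Icc t s ∩ H ⁻¹' Set.Ici m) a :=
    (isCompact_Icc.of_isClosed_subset (hHr.preimage_isClosed_of_isClosed isClosed_Icc isClosed_Ici)
      Set.inter_subset_left).exists_isLeast ⟨s, ⟨hts.le, le_rfl⟩,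
        Set.mem_preimage.2 (Set.mem_Ici.2 (min_le_right _ _))⟩
  simp only [Set.mem_preimage, Set.mem_Ici] at hma hmb
  have hat' : a < t := hat.lt_of_ne (by rintro rfl; linarith)
  have htb' : t < b := htb.lt_of_ne (by rintro rfl; linarith)
  have hHa : H a = m := by
    obtain ⟨x, hx, hxm⟩ := intermediate_value_Icc' hat (hHl.mono (Set.Icc_subset_Icc_left hra))
      (show m ∈ Set.Icc (H t) (H a) from ⟨hm.le, hma⟩)
    have : x ≤ a := ha ⟨⟨hra.trans hx.1, hx.2⟩, hxm.ge⟩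
    rw [← hxm, le_antisymm hx.1 this]
  have hHb : H b = m := by
    obtain ⟨x, hx, hxm⟩ := intermediate_value_Icc htb (hHr.mono (Set.Icc_subset_Icc_right hbs))
      (show m ∈ Set.Icc (H t) (H b) from ⟨hm.le, hmb⟩)
    have : b ≤ x := hb ⟨⟨hx.1, hx.2.trans hbs⟩, hxm.ge⟩
    rw [← hxm, le_antisymm hx.2 this]
  refine ⟨a, b, hra, hat', htb', hbs, hHa.trans hHb.symm, hHa ▸ hm, fun x hax hxb => ?_⟩
  by_contra hcon
  push Not at hcon
  rw [hHa] at hcon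
  rcases le_total x t with hxt | htx
  · have : x ≤ a := ha ⟨⟨hra.trans hax, hxt⟩, hcon.le⟩
    rw [le_antisymm this hax, hHa] at hcon
    exact lt_irrefl _ hcon
  · have : b ≤ x := hb ⟨⟨htx, hxb.trans hbs⟩, hcon.le⟩
    rw [le_antisymm hxb this, hHb] at hcon
    exact lt_irrefl _ hcon

/-- The standing assumptions on the primitives `F` and `W` of a decreasing function and of a
decreasing weight over an interval `E`. The last one says that the weight vanishes from the point
on at which it vanishes for the first time. -/
structure LevelData (E : Set ℝ) (F W : ℝ → ℝ) : Prop where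
  ordConnected : E.OrdConnected
  contF : ContinuousOn F E
  contW : ContinuousOn W E
  monoF : MonotoneOn F E
  monoW : MonotoneOn W E
  flat : ∀ c b d, c ∈ E → b ∈ E → d ∈ E → c < b → W c = W b → c ≤ d → W d = W c

/-- `t` is in the interior of no level interval. -/
def NotInterior (E : Set ℝ) (F W : ℝ → ℝ) (t : ℝ) : Prop :=
  ∀ l a b, a ∈ E → b ∈ E → Lev F W l a b → ¬ (a < t ∧ t < b)

/-- `m` is the slope at `t`, with respect to `W`, of the least `W`-concave majorant of `F`: the
majorant agrees with `F` at the end points of `[a, b]`, which is a maximal level interval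
around `t` or, where `t` is in no level interval, the point `t`. -/
structure IsSlopeOn (E : Set ℝ) (F W : ℝ → ℝ) (t m a b : ℝ) : Prop where
  left_mem : a ∈ E
  right_mem : b ∈ E
  left : ∀ r ∈ E, r ≤ a → m * (W a - W r) ≤ F a - F r
  right : ∀ s ∈ E, b ≤ s → F s - F b ≤ m * (W s - W b)
  eq : F b - F a = m * (W b - W a)
  cases : (a = t ∧ b = t ∧ NotInterior E F W t ∧ ∃ s ∈ E, W t < W s) ∨
    (a < t ∧ t < b ∧ MaxLev F W E m a b)

namespace LevelData

variable {E : Set ℝ} {F W : ℝ → ℝ}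

theorem lt_of_lt (h : LevelData E F W) {r t s : ℝ} (hr : r ∈ E) (ht : t ∈ E) (hs : s ∈ E)
    (hrt : r < t) (hts : W t < W s) : W r < W t := by
  refine (h.monoW hr ht hrt.le).lt_of_ne fun he => ?_
  have h1 : t ≤ s := le_of_lt (lt_of_not_ge fun hst => (h.monoW hs ht hst).not_gt hts)
  have := h.flat r t s hr ht hs hrt he (hrt.le.trans h1)
  linarith

theorem lt_of_lt' (h : LevelData E F W) {t s s' : ℝ} (ht : t ∈ E) (hs : s ∈ E) (hs' : s' ∈ E)
    (hts : W t < W s) (hts' : t < s') : W t < W s' := by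
  refine (h.monoW ht hs' hts'.le).lt_of_ne fun he => ?_
  have h1 : t ≤ s := le_of_lt (lt_of_not_ge fun hst => (h.monoW hs ht hst).not_gt hts)
  have := h.flat t s' s ht hs' hs hts' he h1
  linarith

theorem icc_subset (h : LevelData E F W) {a b : ℝ} (ha : a ∈ E) (hb : b ∈ E) :
    Set.Icc a b ⊆ E := h.ordConnected.out ha hb

/-- A point at which `F - l W` is smaller than at points on both of its sides is in the interior of
a level interval with average `l`, which `exists_hump` provides. -/
theorem exists_lev (h : LevelData E F W) {r t s l : ℝ} (hr : r ∈ E) (hs : s ∈ E) (hrt : r < t)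
    (hts : t < s) (h₁ : F t - l * W t < F r - l * W r) (h₂ : F t - l * W t < F s - l * W s) :
    ∃ a b, a ∈ E ∧ b ∈ E ∧ r ≤ a ∧ a < t ∧ t < b ∧ b ≤ s ∧ Lev F W l a b := by
  have hsub := h.icc_subset hr hs
  obtain ⟨a, b, hra, hat, htb, hbs, he, hlt, hle⟩ := exists_hump (H := fun x => F x - l * W x)
    hrt hts ((h.contF.mono hsub).sub (continuousOn_const.mul (h.contW.mono hsub))) h₁ h₂
  have ha : a ∈ E := hsub ⟨hra, by linarith⟩
  have hb : b ∈ E := hsub ⟨by linarith, hbs⟩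
  have ht : t ∈ E := hsub ⟨hrt.le, hts.le⟩
  refine ⟨a, b, ha, hb, hra, hat, htb, hbs, by linarith, ?_, by linarith, fun x h1 h2 => ?_⟩
  · refine lt_of_lt_of_le ((h.monoW ha ht hat.le).lt_of_ne fun heq => ?_) (h.monoW ht hb htb.le)
    have := h.monoF ha ht hat.le
    rw [heq] at hlt
    linarith
  · linarith [hle x h1 h2]

/-- At a point in the interior of no level interval, `F - l W` is not smaller than at points on both
of its sides, for any `l`. So the slopes of the chords to the left dominate those to the right. -/
theorem not_both_lt (h : LevelData E F W) {r t s l : ℝ} (hr : r ∈ E) (hs : s ∈ E) (hrt : r < t)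
    (hts : t < s) (ht : NotInterior E F W t) (h₁ : F t - l * W t < F r - l * W r) :
    F s - l * W s ≤ F t - l * W t := by
  by_contra h₂
  push Not at h₂
  obtain ⟨a, b, ha, hb, -, hat, htb, -, hlev⟩ := h.exists_lev hr hs hrt hts h₁ h₂
  exact ht l a b ha hb hlev ⟨hat, htb⟩

/-- An end point of a maximal level interval is not in the interior of another level interval, since
the union of the two would be a larger one. -/
theorem notInterior_left (h : LevelData E F W) {l a b : ℝ} (hm : MaxLev F W E l a b) :
    NotInterior E F W a := by
  rintro m c d hc hd hcd ⟨hca, had⟩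
  rcases le_total d b with hdb | hbd
  · have hlt : W a < W d := h.lt_of_lt' hm.left_mem hm.right_mem hd hm.lev.wlt had
    obtain ⟨n, hn⟩ := hcd.union hm.lev hca.le had.le hdb
      (h.monoW.mono (h.icc_subset hc hm.right_mem)) (Or.inl hlt)
    exact hca.ne (hm.max n c b hc hm.right_mem hn hca.le le_rfl).1
  · exact hca.ne (hm.max m c d hc hd hcd hca.le hbd).1

theorem notInterior_right (h : LevelData E F W) {l a b : ℝ} (hm : MaxLev F W E l a b) :
    NotInterior E F W b := by
  rintro m c d hc hd hcd ⟨hcb, hbd⟩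
  rcases le_total a c with hac | hca
  · have hlt : W c < W b := h.lt_of_lt' hc hd hm.right_mem hcd.wlt hcb
    obtain ⟨n, hn⟩ := hm.lev.union hcd hac hcb.le hbd.le
      (h.monoW.mono (h.icc_subset hm.left_mem hd)) (Or.inl hlt)
    exact hbd.ne' (hm.max n a d hm.left_mem hd hn le_rfl hbd.le).2
  · exact hbd.ne' (hm.max m c d hc hd hcd hca hbd.le).2

/-- Distinct maximal level intervals do not overlap. -/
theorem disjoint (h : LevelData E F W) {l a b l' a' b' : ℝ} (hm : MaxLev F W E l a b)
    (hm' : MaxLev F W E l' a' b') : b ≤ a' ∨ b' ≤ a ∨ (a = a' ∧ b = b' ∧ l = l') := by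
  by_contra hcon
  simp only [not_or, not_le] at hcon
  obtain ⟨h1, h2, h3⟩ := hcon
  have ha : a = a' := le_antisymm
    (not_lt.1 fun hlt => h.notInterior_left hm _ _ _ hm'.left_mem hm'.right_mem hm'.lev ⟨hlt, h2⟩)
    (not_lt.1 fun hlt => h.notInterior_left hm' _ _ _ hm.left_mem hm.right_mem hm.lev ⟨hlt, h1⟩)
  have hb : b = b' := le_antisymm
    (not_lt.1 fun hlt => h.notInterior_right hm' _ _ _ hm.left_mem hm.right_mem hm.lev ⟨h2, hlt⟩)
    (not_lt.1 fun hlt => h.notInterior_right hm _ _ _ hm'.left_mem hm'.right_mem hm'.lev ⟨h1, hlt⟩)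
  subst ha hb
  have := hm.lev.eq.symm.trans hm'.lev.eq
  exact h3 ⟨rfl, rfl, mul_right_cancel₀ (sub_pos.2 hm.lev.wlt).ne' this⟩

/-- A level interval is contained in a maximal one, if the level intervals around it are
bounded. -/
theorem exists_maxLev (h : LevelData E F W) {p q l a b : ℝ} (hp : p ∈ E) (hq : q ∈ E)
    (ha : a ∈ E) (hb : b ∈ E) (hab : Lev F W l a b)
    (hpq : ∀ l' a' b', a' ∈ E → b' ∈ E → a' ≤ a → b ≤ b' → Lev F W l' a' b' → p ≤ a' ∧ b' ≤ q) :
    ∃ l' a' b', a' ≤ a ∧ b ≤ b' ∧ MaxLev F W E l' a' b' := by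
  have hpq0 := hpq l a b ha hb le_rfl le_rfl hab
  have hpq' : p ≤ q := hpq0.1.trans (hab.lt.le.trans hpq0.2)
  have hsub := h.icc_subset hp hq
  set F' := Set.IccExtend hpq' ((Set.Icc p q).domRestrict F)
  set W' := Set.IccExtend hpq' ((Set.Icc p q).domRestrict W)
  have cF : Continuous F' := (continuousOn_iff_continuous_domRestrict.1 (h.contF.mono hsub)).Icc_extend'
  have cW : Continuous W' := (continuousOn_iff_continuous_domRestrict.1 (h.contW.mono hsub)).Icc_extend'
  have eF : ∀ x, p ≤ x → x ≤ q → F' x = F x := fun x h1 h2 => by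
    simp [F', Set.IccExtend_of_mem hpq' _ (⟨h1, h2⟩ : x ∈ Set.Icc p q), Set.domRestrict_apply]
  have eW : ∀ x, p ≤ x → x ≤ q → W' x = W x := fun x h1 h2 => by
    simp [W', Set.IccExtend_of_mem hpq' _ (⟨h1, h2⟩ : x ∈ Set.Icc p q), Set.domRestrict_apply]
  -- The intermediate point is clamped to `[x.1, x.2]`, so that the condition is closed in `x`.
  let S : Set (ℝ × ℝ) := (Set.Icc p a ×ˢ Set.Icc b q) ∩ ⋂ t : ℝ,
    {x | (F' (max x.1 (min x.2 t)) - F' x.1) * (W' x.2 - W' x.1) ≤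
      (F' x.2 - F' x.1) * (W' (max x.1 (min x.2 t)) - W' x.1)}
  have hS : IsCompact S := by
    refine (isCompact_Icc.prod isCompact_Icc).inter_right (isClosed_iInter fun t => ?_)
    exact isClosed_le (by fun_prop) (by fun_prop)
  have hmem : ∀ a' b', p ≤ a' → b' ≤ q → a' ≤ a → b ≤ b' →
      ((a', b') ∈ S ↔ ∃ l', Lev F W l' a' b') := by
    intro a' b' h1 h2 h3 h4
    have hlt : a' < b' := h3.trans_lt (hab.lt.trans_le h4)
    have ha' : a' ∈ E := hsub ⟨h1, by linarith⟩
    have hb' : b' ∈ E := hsub ⟨by linarith, h2⟩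
    have hw : W a' < W b' := (h.monoW ha' ha h3).trans_lt (hab.wlt.trans_le (h.monoW hb hb' h4))
    have hw' := sub_pos.2 hw
    simp only [S, Set.mem_inter_iff, Set.mem_prod, Set.mem_Icc, Set.mem_iInter, Set.mem_ofPred_eq,
      h1, h2, h3, h4, true_and]
    rw [eF a' h1 (by linarith), eF b' (by linarith) h2, eW a' h1 (by linarith),
      eW b' (by linarith) h2]
    constructor
    · intro hS
      refine ⟨(F b' - F a') / (W b' - W a'), hlt, hw, (div_mul_cancel₀ _ hw'.ne').symm,
        fun t h5 h6 => ?_⟩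
      have := hS t
      rw [min_eq_right h6, max_eq_right h5, eF t (by linarith) (by linarith),
        eW t (by linarith) (by linarith)] at this
      rw [div_mul_eq_mul_div, le_div_iff₀ hw']
      exact this
    · rintro ⟨l', hl'⟩ t
      set u := max a' (min b' t)
      have h5 : a' ≤ u := le_max_left _ _
      have h6 : u ≤ b' := max_le hlt.le (min_le_left _ _)
      rw [eF u (by linarith) (by linarith), eW u (by linarith) (by linarith), hl'.eq]
      nlinarith [hl'.le u h5 h6]
  obtain ⟨⟨a', b'⟩, hx, hmax⟩ := hS.exists_isMaxOn
    ⟨(a, b), (hmem a b hpq0.1 hpq0.2 le_rfl le_rfl).2 ⟨l, hab⟩⟩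
    (f := fun x : ℝ × ℝ => x.2 - x.1) (by fun_prop)
  obtain ⟨⟨h1, h3⟩, ⟨h4, h2⟩⟩ := hx.1
  simp only at h1 h2 h3 h4
  obtain ⟨l', hl'⟩ := (hmem a' b' h1 h2 h3 h4).1 hx
  have hlt : a' < b' := h3.trans_lt (hab.lt.trans_le h4)
  refine ⟨l', a', b', h3, h4, hsub ⟨h1, by linarith⟩, hsub ⟨by linarith, h2⟩, hl',
    fun l'' a'' b'' ha'' hb'' hlev h5 h6 => ?_⟩
  obtain ⟨h7, h8⟩ := hpq l'' a'' b'' ha'' hb'' (h5.trans h3) (h4.trans h6) hlev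
  have := hmax ((hmem a'' b'' h7 h8 (h5.trans h3) (h4.trans h6)).2 ⟨l'', hlev⟩)
  simp only at this
  change b'' - a'' ≤ b' - a' at this
  constructor <;> linarith

/-- At a maximal level interval the supporting line of `F` is global. -/
theorem isSlopeOn_of_maxLev (h : LevelData E F W) {l a b t : ℝ} (hm : MaxLev F W E l a b)
    (hat : a < t) (htb : t < b) : IsSlopeOn E F W t l a b := by
  refine ⟨hm.left_mem, hm.right_mem, fun r hr hra => ?_, fun s hs hbs => ?_, hm.lev.eq,
    Or.inr ⟨hat, htb, hm⟩⟩
  · rcases hra.eq_or_lt with rfl | hra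
    · simp
    by_contra hcon
    push Not at hcon
    have hw := sub_pos.2 (h.lt_of_lt hr hm.left_mem hm.right_mem hra hm.lev.wlt)
    obtain ⟨l', h1, h2⟩ := exists_between ((div_lt_iff₀ hw).2 hcon)
    rw [div_lt_iff₀ hw] at h1
    have h3 := h.not_both_lt hr hm.right_mem hra hm.lev.lt (h.notInterior_left hm)
      (l := l') (by linarith)
    have := hm.lev.eq
    nlinarith [hm.lev.wlt]
  · rcases hbs.eq_or_lt with rfl | hbs
    · simp
    by_contra hcon
    push Not at hcon
    have hw := sub_nonneg.2 (h.monoW hm.right_mem hs hbs.le)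
    obtain ⟨l', h1, h2⟩ : ∃ l', l < l' ∧ l' * (W s - W b) < F s - F b := by
      rcases hw.eq_or_lt with h0 | h0
      · exact ⟨l + 1, by linarith, by rw [← h0] at hcon ⊢; linarith⟩
      · obtain ⟨l', h1, h2⟩ := exists_between ((lt_div_iff₀ h0).2 hcon)
        exact ⟨l', h1, (lt_div_iff₀ h0).1 h2⟩
    have h3 := h.not_both_lt hm.left_mem hs hm.lev.lt hbs (h.notInterior_right hm)
      (l := l') (by nlinarith [hm.lev.eq, hm.lev.wlt])
    linarith

/-- Where `t` is in the interior of no level interval, the infimum of the slopes of the chords to the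
left is the slope of a supporting line of `F` at `t`. -/
theorem exists_slope_of_notInterior (h : LevelData E F W) {t r₀ s₀ : ℝ} (ht : t ∈ E)
    (hn : NotInterior E F W t) (hr₀ : r₀ ∈ E) (hrt : r₀ < t) (hs₀ : s₀ ∈ E) (hts : W t < W s₀) :
    ∃ m, 0 ≤ m ∧ IsSlopeOn E F W t m t t := by
  set R : Set ℝ := {x | ∃ r ∈ E, r < t ∧ x = (F t - F r) / (W t - W r)}
  have hpos : ∀ r ∈ E, r < t → 0 < W t - W r := fun r hr hrt =>
    sub_pos.2 (h.lt_of_lt hr ht hs₀ hrt hts)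
  have hR0 : ∀ x ∈ R, 0 ≤ x := by
    rintro x ⟨r, hr, hrt, rfl⟩
    exact div_nonneg (sub_nonneg.2 (h.monoF hr ht hrt.le)) (hpos r hr hrt).le
  have hne : R.Nonempty := ⟨_, r₀, hr₀, hrt, rfl⟩
  refine ⟨sInf R, Real.sInf_nonneg hR0, ht, ht, fun r hr hrt => ?_, fun s hs hts' => ?_, by simp,
    Or.inl ⟨rfl, rfl, hn, s₀, hs₀, hts⟩⟩
  · rcases hrt.eq_or_lt with rfl | hrt
    · simp
    · exact (le_div_iff₀ (hpos r hr hrt)).1 (csInf_le ⟨0, hR0⟩ ⟨r, hr, hrt, rfl⟩)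
  · rcases hts'.eq_or_lt with rfl | hts'
    · simp
    have hw : 0 < W s - W t := sub_pos.2 (h.lt_of_lt' ht hs₀ hs hts hts')
    rw [← div_le_iff₀ hw]
    refine le_csInf hne ?_
    rintro x ⟨r, hr, hrt, rfl⟩
    by_contra hcon
    push Not at hcon
    obtain ⟨l, h1, h2⟩ := exists_between hcon
    rw [div_lt_iff₀ (hpos r hr hrt)] at h1
    rw [lt_div_iff₀ hw] at h2
    have := h.not_both_lt hr hs hrt hts' hn (l := l) (by linarith)
    linarith

/-- The slopes of the concave majorant decrease. -/
theorem slope_anti (h : LevelData E F W) {t t' m m' a b a' b' : ℝ} (htt : t < t')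
    (hs : IsSlopeOn E F W t m a b) (hs' : IsSlopeOn E F W t' m' a' b') : m' ≤ m := by
  have hord : b ≤ a' ∨ m = m' := by
    rcases hs.cases with ⟨rfl, rfl, hn, -⟩ | ⟨h1, h2, hm⟩ <;>
    rcases hs'.cases with ⟨h3, h4, hn', -⟩ | ⟨h3, h4, hm'⟩
    · exact Or.inl (h3 ▸ htt.le)
    · refine Or.inl (not_lt.1 fun hlt => ?_)
      exact hn _ _ _ hm'.left_mem hm'.right_mem hm'.lev ⟨hlt, htt.trans h4⟩
    · refine Or.inl (not_lt.1 fun hlt => ?_)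
      rw [h3] at hlt
      exact hn' _ _ _ hm.left_mem hm.right_mem hm.lev ⟨h1.trans htt, hlt⟩
    · rcases h.disjoint hm hm' with h5 | h5 | h5
      · exact Or.inl h5
      · linarith
      · exact Or.inr h5.2.2
  rcases hord with hord | rfl
  swap
  · exact le_rfl
  have hab : a ≤ b := by
    rcases hs.cases with ⟨rfl, rfl, -⟩ | ⟨h1, h2, -⟩
    · exact le_rfl
    · linarith
  obtain ⟨z, hz, hz'⟩ : ∃ s ∈ E, W a' < W s := by
    rcases hs'.cases with ⟨rfl, -, -, hz⟩ | ⟨-, -, hm'⟩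
    · exact hz
    · exact ⟨b', hs'.right_mem, hm'.lev.wlt⟩
  rcases (hab.trans hord).eq_or_lt with heq | hlt
  · have hba : b = a' := le_antisymm hord (heq ▸ hab)
    have h1 : a' < t' := by
      rcases hs.cases with ⟨h1, -⟩ | ⟨h1, h2, -⟩ <;> linarith
    rcases hs'.cases with ⟨h2, -⟩ | ⟨-, -, hm'⟩
    · linarith
    · have h3 := hs.right b' hs'.right_mem (hba ▸ hm'.lev.lt.le)
      have h4 := hs'.eq
      rw [hba, h4] at h3
      exact le_of_mul_le_mul_right h3 (sub_pos.2 hm'.lev.wlt)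
  · have h1 := hs'.left a hs.left_mem hlt.le
    have h2 := hs.right a' hs'.left_mem hord
    have h3 := hs.eq
    have hw := sub_pos.2 (h.lt_of_lt hs.left_mem hs'.left_mem hz hlt hz')
    refine le_of_mul_le_mul_right (h1.trans ?_) hw
    linarith

end LevelData

/-! ### Comparison of integrals along a partition and along superlevel sets -/

section Integrals

variable {α : Type*} [MeasurableSpace α] {μ : Measure α}

theorem lintegral_le_of_partition {ι : Type*} [Countable ι] {J : ι → Set α}
    (hJ : ∀ i, MeasurableSet (J i)) (hd : Pairwise fun i j => Disjoint (J i) (J j))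
    {h₁ h₂ : α → ℝ≥0∞} (hin : ∀ i, ∫⁻ x in J i, h₁ x ∂μ ≤ ∫⁻ x in J i, h₂ x ∂μ)
    (hout : ∀ᵐ x ∂μ, x ∉ ⋃ i, J i → h₁ x ≤ h₂ x) : ∫⁻ x, h₁ x ∂μ ≤ ∫⁻ x, h₂ x ∂μ := by
  have hU : MeasurableSet (⋃ i, J i) := MeasurableSet.iUnion hJ
  rw [← lintegral_add_compl h₁ hU, ← lintegral_add_compl h₂ hU, lintegral_iUnion hJ hd,
    lintegral_iUnion hJ hd]
  refine add_le_add (ENNReal.tsum_le_tsum hin) (lintegral_mono_ae ?_)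
  rw [ae_restrict_iff' hU.compl]
  exact hout

/-- The layer cake formula turns a comparison of two measures on the superlevel sets of `h` into one
of the integrals of `h`. -/
theorem lintegral_le_of_superlevel {ν₁ ν₂ : Measure α} {h : α → ℝ} (h0 : ∀ x, 0 ≤ h x)
    (m₁ : AEMeasurable h ν₁) (m₂ : AEMeasurable h ν₂)
    (hle : ∀ c, 0 < c → ν₁ {x | c < h x} ≤ ν₂ {x | c < h x}) :
    ∫⁻ x, ENNReal.ofReal (h x) ∂ν₁ ≤ ∫⁻ x, ENNReal.ofReal (h x) ∂ν₂ := by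
  rw [lintegral_eq_lintegral_meas_lt ν₁ (ae_of_all _ h0) m₁,
    lintegral_eq_lintegral_meas_lt ν₂ (ae_of_all _ h0) m₂]
  exact setLIntegral_mono' measurableSet_Ioi fun c hc => hle c hc

variable {φ : ℝ → ℝ}

/-- The upper bound of `P` by `Q`: on a level interval `J i` with average `l i` the function
`v = f / l i` turns the integrand into a multiple of `f`, and `f` and `l i * w` have the same
integral there. -/
theorem lintegral_integrand_le_of_level {ι : Type*} [Countable ι]
    {J : ι → Set α} (hJ : ∀ i, MeasurableSet (J i))
    (hd : Pairwise fun i j => Disjoint (J i) (J j)) {l : ι → ℝ} (hl : ∀ i, 0 < l i)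
    {f w v g : α → ℝ≥0∞} (hf : ∀ᵐ x ∂μ, f x ≠ ⊤) (hw : ∀ x, w x ≠ ⊤) (hfm : Measurable f)
    (hJf : ∀ i, ∫⁻ x in J i, f x ∂μ = ENNReal.ofReal (l i) * ∫⁻ x in J i, w x ∂μ)
    (hv : ∀ i, ∀ x ∈ J i, f x ≠ 0 → v x = f x / ENNReal.ofReal (l i))
    (hg : ∀ i, ∀ x ∈ J i, g x = ENNReal.ofReal (l i) * w x)
    (hvout : ∀ᵐ x ∂μ, x ∉ ⋃ i, J i → f x ≠ 0 → v x = w x)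
    (hgout : ∀ᵐ x ∂μ, x ∉ ⋃ i, J i → f x ≠ 0 → g x = f x) :
    ∫⁻ x, integrand φ (f x) (v x) ∂μ ≤ ∫⁻ x, integrand φ (g x) (w x) ∂μ := by
  refine lintegral_le_of_partition hJ hd (fun i => ?_) ?_
  · have hl0 : ENNReal.ofReal (l i) ≠ 0 := by simpa using hl i
    have hlt : ENNReal.ofReal (l i) ≠ ⊤ := ENNReal.ofReal_ne_top
    calc ∫⁻ x in J i, integrand φ (f x) (v x) ∂μ
        ≤ ∫⁻ x in J i, (ENNReal.ofReal (φ (l i)) / ENNReal.ofReal (l i)) * f x ∂μ := by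
          refine lintegral_mono_ae ((ae_restrict_iff' (hJ i)).2 ?_)
          filter_upwards [hf] with x hx hxJ
          by_cases h0 : f x = 0
          · simp [h0]
          · rw [hv i x hxJ h0, integrand_of_ne h0 (ENNReal.div_ne_zero.2 ⟨h0, hlt⟩),
              ENNReal.div_div_cancel h0 hx, extend_ofReal (hl i).le, div_eq_mul_inv,
              div_eq_mul_inv]
            exact (by ring : _ = _).le
      _ = ENNReal.ofReal (φ (l i)) * ∫⁻ x in J i, w x ∂μ := by
          rw [lintegral_const_mul _ hfm, hJf, ← mul_assoc, ENNReal.div_mul_cancel hl0 hlt]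
      _ ≤ ∫⁻ x in J i, ENNReal.ofReal (φ (l i)) * w x ∂μ := lintegral_const_mul_le _ _
      _ ≤ ∫⁻ x in J i, integrand φ (g x) (w x) ∂μ := by
          refine setLIntegral_mono' (hJ i) fun x hxJ => ?_
          by_cases h0 : w x = 0
          · simp [h0]
          · rw [hg i x hxJ, integrand_of_ne (mul_ne_zero hl0 h0) h0,
              ENNReal.mul_div_cancel_right h0 (hw x), extend_ofReal (hl i).le]
  · filter_upwards [hvout, hgout] with x h1 h2 hx
    by_cases h0 : f x = 0
    · simp [h0]
    · rw [h1 hx h0, h2 hx h0]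

/-- The lower bound of `P` by `Q`. Here `y` is the quotient of the level function by the weight.
The supporting lines of `φ` at the values of `y` bound the integrand from below by terms linear in
`f` and `v`; by `hf` and `hv` the bound does not increase if `f` is replaced by `y w` and `v` by
`w`. Truncation of `y` makes the terms that cancel finite. -/
theorem lintegral_le_lintegral_integrand [SFinite μ] (hφ : IsOrlicz φ) {f w v : α → ℝ≥0∞}
    {y : α → ℝ} (hy0 : ∀ x, 0 ≤ y x) (hy : AEMeasurable y μ) (hwm : AEMeasurable w μ)
    (hvm : AEMeasurable v μ) (hvt : ∀ x, v x ≠ ⊤)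
    (hf : ∀ S : ℝ → ℝ≥0∞,
      ∫⁻ x, S (y x) * (ENNReal.ofReal (y x) * w x) ∂μ ≤ ∫⁻ x, S (y x) * f x ∂μ)
    (hv : ∀ U : Set ℝ, IsUpperSet U → ∫⁻ x in y ⁻¹' U, v x ∂μ ≤ ∫⁻ x in y ⁻¹' U, w x ∂μ)
    (hfin : ∀ ε, 0 < ε → ∫⁻ x in {x | ε ≤ y x}, w x ∂μ < ⊤) :
    ∫⁻ x, ENNReal.ofReal (φ (y x)) * w x ∂μ ≤ ∫⁻ x, integrand φ (f x) (v x) ∂μ := by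
  classical
  choose! s hs0 hs using fun (z : ℝ) (hz : 0 < z) => hφ.exists_subgradient hz
  have hψ0 : ∀ z, 0 < z → 0 ≤ z * s z - φ z := fun z hz => by
    have := hs z hz 0 le_rfl
    rw [hφ.zero] at this
    linarith
  have hψ : ∀ z z', 0 < z → z ≤ z' → z * s z - φ z ≤ z' * s z' - φ z' := by
    intro z z' hz hzz
    have h1 := hs z hz z' (hz.le.trans hzz)
    have h2 := hs z' (hz.trans_le hzz) z hz.le
    rcases hzz.eq_or_lt with rfl | hlt
    · rfl
    have h3 : s z ≤ s z' := by
      have : (z' - z) * (s z' - s z) ≥ 0 := by nlinarith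
      nlinarith
    nlinarith
  -- the truncations of `φ` and of its conjugate part
  set ε : ℕ → ℝ := fun n => 1 / ((n : ℝ) + 1)
  have hε : ∀ n, 0 < ε n := fun n => by positivity
  set N : ℕ → ℝ := fun n => (n : ℝ) + 1
  have hN1 : ∀ n, 1 ≤ N n := fun n => by simp [N]
  have hε1 : ∀ n, ε n ≤ 1 := fun n => (div_le_one (by positivity)).2 (hN1 n)
  set φn : ℕ → ℝ → ℝ := fun n u => if ε n ≤ u then φ (min u (N n)) else 0
  set ψn : ℕ → ℝ → ℝ := fun n u =>
    if ε n ≤ u then min u (N n) * s (min u (N n)) - φ (min u (N n)) else 0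
  have hmin : ∀ n u, ε n ≤ u → 0 < min u (N n) := fun n u hu =>
    lt_min ((hε n).trans_le hu) (by positivity)
  have hφn0 : ∀ n u, 0 ≤ φn n u := fun n u => by
    simp only [φn]
    split_ifs with h
    · exact hφ.nonneg (hmin n u h).le
    · exact le_rfl
  have hψn0 : ∀ n u, 0 ≤ ψn n u := fun n u => by
    simp only [ψn]
    split_ifs with h
    · exact hψ0 _ (hmin n u h)
    · exact le_rfl
  have hφn : ∀ n, Monotone (φn n) := fun n u u' huu => by
    by_cases h : ε n ≤ u
    · simp only [φn, if_pos h, if_pos (h.trans huu)]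
      exact hφ.mono (hmin n u h).le (min_le_min_right _ huu)
    · rw [show φn n u = 0 from if_neg h]
      exact hφn0 _ _
  have hψn : ∀ n, Monotone (ψn n) := fun n u u' huu => by
    by_cases h : ε n ≤ u
    · simp only [ψn, if_pos h, if_pos (h.trans huu)]
      exact hψ _ _ (hmin n u h) (min_le_min_right _ huu)
    · rw [show ψn n u = 0 from if_neg h]
      exact hψn0 _ _
  have key : ∀ n, ∫⁻ x, ENNReal.ofReal (φn n (y x)) * w x ∂μ ≤
      ∫⁻ x, integrand φ (f x) (v x) ∂μ := by
    intro n
    have hψm : AEMeasurable (fun x => ENNReal.ofReal (ψn n (y x))) μ :=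
      ((hψn n).measurable.comp_aemeasurable hy).ennreal_ofReal
    have hBm : ∀ u : α → ℝ≥0∞, AEMeasurable u μ →
        AEMeasurable (fun x => ENNReal.ofReal (ψn n (y x)) * u x) μ := fun u hu =>
      hψm.mul hu
    set S : ℝ → ℝ≥0∞ := fun u => if ε n ≤ u then ENNReal.ofReal (s (min u (N n))) else 0
    have hBfin : ∫⁻ x, ENNReal.ofReal (ψn n (y x)) * w x ∂μ ≠ ⊤ := by
      have hset : NullMeasurableSet {x | ε n ≤ y x} μ := nullMeasurableSet_le aemeasurable_const hy
      refine ne_top_of_le_ne_top (ENNReal.mul_ne_top (ENNReal.ofReal_ne_top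
        (r := ψn n (N n))) (hfin _ (hε n)).ne) ?_
      rw [← lintegral_const_mul'' _ hwm.restrict, ← lintegral_indicator₀ hset]
      refine lintegral_mono fun x => ?_
      by_cases h : ε n ≤ y x
      · rw [Set.indicator_of_mem (by simpa using h)]
        gcongr
        simp only [ψn, if_pos h, if_pos ((hε1 n).trans (hN1 n)), min_self]
        exact hψ _ _ (hmin n _ h) (min_le_right _ _)
      · simp [ψn, h]
    have h1 : ∫⁻ x, ENNReal.ofReal (φn n (y x)) * w x ∂μ +
        ∫⁻ x, ENNReal.ofReal (ψn n (y x)) * w x ∂μ ≤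
        ∫⁻ x, S (y x) * (ENNReal.ofReal (y x) * w x) ∂μ := by
      rw [← lintegral_add_right' _ (hBm w hwm)]
      refine lintegral_mono fun x => ?_
      by_cases h : ε n ≤ y x
      · rw [← add_mul, ← ENNReal.ofReal_add (hφn0 _ _) (hψn0 _ _), ← mul_assoc]
        gcongr
        simp only [φn, ψn, S, if_pos h]
        rw [← ENNReal.ofReal_mul (hs0 _ (hmin n _ h))]
        apply ENNReal.ofReal_le_ofReal
        have := mul_le_mul_of_nonneg_left (min_le_left (y x) (N n)) (hs0 _ (hmin n _ h))
        linarith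
      · simp [φn, ψn, h]
    have h2 : ∫⁻ x, S (y x) * f x ∂μ ≤ ∫⁻ x, integrand φ (f x) (v x) ∂μ +
        ∫⁻ x, ENNReal.ofReal (ψn n (y x)) * v x ∂μ := by
      rw [← lintegral_add_right' _ (hBm v hvm)]
      refine lintegral_mono fun x => ?_
      by_cases h : ε n ≤ y x
      · simp only [ψn, S, if_pos h]
        refine tangent_le_integrand hφ (hs0 _ (hmin n _ h)) (hψ0 _ (hmin n _ h))
          (fun u hu => ?_) _ (hvt x)
        have := hs _ (hmin n _ h) u hu
        linarith
      · simp [S, h]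
    have h3 : ∫⁻ x, ENNReal.ofReal (ψn n (y x)) * v x ∂μ ≤
        ∫⁻ x, ENNReal.ofReal (ψn n (y x)) * w x ∂μ := by
      have e : ∀ u : α → ℝ≥0∞, AEMeasurable u μ → ∫⁻ x, ENNReal.ofReal (ψn n (y x)) * u x ∂μ =
          ∫⁻ x, ENNReal.ofReal (ψn n (y x)) ∂(μ.withDensity u) := by
        intro u hu
        rw [lintegral_withDensity_eq_lintegral_mul₀ hu hψm]
        simp [mul_comm]
      rw [e v hvm, e w hwm]
      have hac : ∀ u : α → ℝ≥0∞, AEMeasurable (fun x => ψn n (y x)) (μ.withDensity u) := fun u =>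
        ((hψn n).measurable.comp_aemeasurable hy).mono_ac (withDensity_absolutelyContinuous _ _)
      refine lintegral_le_of_superlevel (fun x => hψn0 _ _) (hac v) (hac w) fun c _ => ?_
      rw [withDensity_apply', withDensity_apply']
      exact hv {u | c < ψn n u} fun u u' huu hu => lt_of_lt_of_le hu (hψn n huu)
    have h4 := h1.trans ((hf S).trans (h2.trans (add_le_add_right h3 _)))
    exact (ENNReal.add_le_add_iff_right hBfin).1 h4
  -- the truncated integrands are eventually constant at every point
  have hlim : Tendsto (fun n => ∫⁻ x, ENNReal.ofReal (φn n (y x)) * w x ∂μ) atTop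
      (nhds (∫⁻ x, ENNReal.ofReal (φ (y x)) * w x ∂μ)) := by
    refine lintegral_tendsto_of_tendsto_of_monotone (fun n =>
      ((hφn n).measurable.comp_aemeasurable hy).ennreal_ofReal.mul hwm)
      (ae_of_all _ fun x n m hnm => ?_) (ae_of_all _ fun x => ?_)
    · dsimp only
      gcongr
      have hnm' : (n : ℝ) ≤ m := by exact_mod_cast hnm
      have h5 : ε m ≤ ε n := one_div_le_one_div_of_le (by positivity) (by linarith)
      by_cases h : ε n ≤ y x
      · simp only [φn, if_pos h, if_pos (h5.trans h)]
        exact hφ.mono (hmin n _ h).le (min_le_min_left _ (by simp only [N]; linarith))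
      · rw [show φn n (y x) = 0 from if_neg h]
        exact hφn0 _ _
    · refine tendsto_const_nhds.congr' ?_
      rcases (hy0 x).eq_or_lt with h | h
      · refine Eventually.of_forall fun n => ?_
        have : ¬ ε n ≤ y x := by rw [← h]; exact not_le.2 (hε n)
        simp only [φn, if_neg this]
        rw [← h, hφ.zero]
      · obtain ⟨n₀, hn₀⟩ := exists_nat_ge (max (y x) (1 / y x))
        filter_upwards [eventually_ge_atTop n₀] with n hn
        have hn' : (n₀ : ℝ) ≤ n := by exact_mod_cast hn
        have h6 := (le_max_left (y x) _).trans hn₀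
        have h7 := (le_max_right (y x) _).trans hn₀
        have h8 : ε n ≤ y x := by
          rw [div_le_iff₀ h] at h7
          simp only [ε]
          rw [div_le_iff₀ (by positivity)]
          nlinarith
        simp only [φn, if_pos h8]
        rw [min_eq_left (by simp only [N]; linarith)]
  exact le_of_tendsto hlim (Eventually.of_forall key)

end Integrals

/-! ### Intervals -/

theorem openInterval_ofReal {a b : ℝ} (ha : 0 ≤ a) :
    openInterval (ENNReal.ofReal a) (ENNReal.ofReal b) = Set.Ioo a b := by
  ext t
  simp only [openInterval, Set.mem_ofPred_eq, Set.mem_Ioo]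
  rw [ENNReal.ofReal_lt_ofReal_iff_of_nonneg ha]
  refine and_congr_right fun h => ?_
  rw [ENNReal.ofReal_lt_ofReal_iff_of_nonneg (ha.trans h.le)]

theorem openInterval_zero_ofReal {b : ℝ} : openInterval 0 (ENNReal.ofReal b) = Set.Ioo 0 b := by
  rw [← ENNReal.ofReal_zero, openInterval_ofReal le_rfl]

theorem openInterval_ofReal_top {a : ℝ} (ha : 0 ≤ a) :
    openInterval (ENNReal.ofReal a) ⊤ = Set.Ioi a := by
  ext t
  simp [openInterval, ENNReal.ofReal_lt_ofReal_iff_of_nonneg ha]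

theorem mem_openInterval_zero {γ : ℝ≥0∞} {t : ℝ} :
    t ∈ openInterval 0 γ ↔ 0 < t ∧ ENNReal.ofReal t < γ := by
  simp [openInterval]

theorem measurableSet_openInterval (a b : ℝ≥0∞) : MeasurableSet (openInterval a b) :=
  (measurableSet_lt measurable_const ENNReal.measurable_ofReal).inter
    (measurableSet_lt ENNReal.measurable_ofReal measurable_const)

theorem openInterval_mono {a b c : ℝ≥0∞} (h : b ≤ c) : openInterval a b ⊆ openInterval a c :=
  fun _ ht => ⟨ht.1, ht.2.trans_le h⟩

theorem mem_openInterval_of_lt {γ : ℝ≥0∞} {s t : ℝ} (hs : 0 < s) (hst : s ≤ t)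
    (ht : ENNReal.ofReal t < γ) : s ∈ openInterval 0 γ :=
  mem_openInterval_zero.2 ⟨hs, (ENNReal.ofReal_le_ofReal hst).trans_lt ht⟩

theorem restrict_I (γ : ℝ≥0∞) :
    (volume : Measure ℝ).restrict (I γ) = (volume : Measure ℝ).restrict (openInterval 0 γ) := by
  refine Measure.restrict_congr_set ?_
  rw [ae_eq_set]
  constructor
  · refine measure_mono_null (t := {0}) (fun t ht => ?_) (by simp)
    by_contra h
    exact ht.2 (mem_openInterval_zero.2 ⟨lt_of_le_of_ne ht.1.1 (Ne.symm h), ht.1.2⟩)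
  · refine measure_mono_null (t := ∅) (fun t ht => ?_) (by simp)
    have := mem_openInterval_zero.1 ht.1
    exact ht.2 ⟨this.1.le, this.2⟩

theorem lintegral_I (γ : ℝ≥0∞) (g : ℝ → ℝ≥0∞) : ∫⁻ t in I γ, g t = intOver g 0 γ := by
  rw [restrict_I, intOver]

theorem measurableSet_I (γ : ℝ≥0∞) : MeasurableSet (I γ) :=
  measurableSet_Ici.inter (measurableSet_lt ENNReal.measurable_ofReal measurable_const)

theorem intOver_mono (g : ℝ → ℝ≥0∞) {a b c : ℝ≥0∞} (h : b ≤ c) : intOver g a b ≤ intOver g a c :=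
  lintegral_mono_set (openInterval_mono h)

/-- The stretching of a half-line or of an interval at `0` by the factor `2`. -/
theorem intOver_comp_half_le (γ : ℝ≥0∞) (h : ℝ → ℝ≥0∞) :
    intOver (fun t => h (2⁻¹ * t)) 0 γ ≤ 2 * intOver h 0 γ := by
  have hU := measurableSet_openInterval 0 γ
  have he : MeasurableEmbedding fun t : ℝ => (2 : ℝ)⁻¹ * t :=
    (Homeomorph.mulLeft₀ (2 : ℝ)⁻¹ (by norm_num)).measurableEmbedding
  have h1 := he.lintegral_map (μ := volume) ((openInterval 0 γ).indicator h)
  rw [Real.map_volume_mul_left (by norm_num), lintegral_smul_measure, lintegral_indicator hU,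
    inv_inv, abs_of_pos two_pos, ENNReal.ofReal_ofNat, smul_eq_mul] at h1
  unfold intOver
  rw [h1, ← lintegral_indicator hU]
  refine lintegral_mono fun t => ?_
  by_cases ht : t ∈ openInterval 0 γ
  · have h2 := mem_openInterval_zero.1 ht
    rw [Set.indicator_of_mem ht, Set.indicator_of_mem
      (mem_openInterval_of_lt (by linarith [h2.1]) (by linarith [h2.1]) h2.2)]
  · simp [Set.indicator_of_notMem ht]

/-! ### Decreasing rearrangements -/

section Rearrangement

variable {γ : ℝ≥0∞}

theorem distribution_anti (f : L0 γ) {c c' : ℝ≥0} (h : c ≤ c') :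
    distribution f c' ≤ distribution f c :=
  measure_mono fun _ ht => lt_of_le_of_lt (NNReal.coe_le_coe.2 h) ht

theorem distribution_mono {f g : L0 γ}
    (h : ∀ᵐ t ∂(volume : Measure ℝ).restrict (I γ), |f t| ≤ |g t|) (c : ℝ≥0) :
    distribution f c ≤ distribution g c :=
  measure_mono_ae (by filter_upwards [h] with t ht h1 using lt_of_lt_of_le h1 ht)

theorem rearrangement_antitone (f : L0 γ) : Antitone (rearrangement f) := fun _ _ hst =>
  iInf_mono fun _ => iInf_mono fun _ => iInf_mono' fun h =>
    ⟨h.trans (ENNReal.ofReal_le_ofReal hst), le_rfl⟩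

theorem measurable_rearrangement (f : L0 γ) : Measurable (rearrangement f) :=
  (rearrangement_antitone f).measurable

theorem rearrangement_le {f : L0 γ} {t : ℝ} {c : ℝ≥0} (hc : 0 < c)
    (h : distribution f c ≤ ENNReal.ofReal t) : rearrangement f t ≤ c :=
  iInf_le_of_le c (iInf_le_of_le hc (iInf_le_of_le h le_rfl))

theorem le_rearrangement {f : L0 γ} {t : ℝ} {c : ℝ≥0} (h : ENNReal.ofReal t < distribution f c) :
    (c : ℝ≥0∞) ≤ rearrangement f t := by
  refine le_iInf fun c' => le_iInf fun _ => le_iInf fun h' => ?_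
  by_contra hcon
  push Not at hcon
  exact (h.trans_le ((distribution_anti f (ENNReal.coe_lt_coe.1 hcon).le).trans h')).false

theorem exists_of_rearrangement_lt {f : L0 γ} {t : ℝ} {x : ℝ≥0∞} (h : rearrangement f t < x) :
    ∃ c : ℝ≥0, 0 < c ∧ distribution f c ≤ ENNReal.ofReal t ∧ (c : ℝ≥0∞) < x := by
  simp only [rearrangement, iInf_lt_iff] at h
  obtain ⟨c, h1, h2, h3⟩ := h
  exact ⟨c, h1, h2, h3⟩

theorem rearrangement_mono {f g : L0 γ}
    (h : ∀ᵐ t ∂(volume : Measure ℝ).restrict (I γ), |f t| ≤ |g t|) (t : ℝ) :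
    rearrangement f t ≤ rearrangement g t :=
  iInf_mono fun c => iInf_mono fun _ => iInf_mono' fun h' =>
    ⟨(distribution_mono h c).trans h', le_rfl⟩

theorem distribution_smul (f : L0 γ) {k : ℝ≥0} (hk : 0 < k) (c : ℝ≥0) :
    distribution ((k : ℝ) • f) (k * c) = distribution f c := by
  refine measure_congr ?_
  filter_upwards [AEEqFun.coeFn_smul (k : ℝ) f] with t ht
  have hk' : (0 : ℝ) < k := hk
  refine propext ?_
  change ((k * c : ℝ≥0) : ℝ) < |((k : ℝ) • f : L0 γ) t| ↔ (c : ℝ) < |f t|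
  rw [ht]
  simp [abs_mul, hk']

theorem rearrangement_smul_le (f : L0 γ) {k : ℝ} (hk : 0 < k) (t : ℝ) :
    rearrangement (k • f) t ≤ ENNReal.ofReal k * rearrangement f t := by
  lift k to ℝ≥0 using hk.le
  have hk' : 0 < k := hk
  rw [ENNReal.ofReal_coe_nnreal]
  refine le_of_forall_gt fun x hx => ?_
  rw [mul_comm, ← ENNReal.lt_div_iff_mul_lt (Or.inl (by simpa using hk'.ne')) (by simp)] at hx
  obtain ⟨c, h1, h2, h3⟩ := exists_of_rearrangement_lt hx
  rw [ENNReal.lt_div_iff_mul_lt (Or.inl (by simpa using hk'.ne')) (by simp)] at h3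
  refine lt_of_le_of_lt (rearrangement_le (c := k * c) (mul_pos hk' h1) ?_) ?_
  · rwa [distribution_smul f hk']
  · rwa [ENNReal.coe_mul, mul_comm]

theorem rearrangement_smul (f : L0 γ) {k : ℝ} (hk : 0 < k) (t : ℝ) :
    rearrangement (k • f) t = ENNReal.ofReal k * rearrangement f t := by
  refine le_antisymm (rearrangement_smul_le f hk t) ?_
  have h := rearrangement_smul_le (k • f) (inv_pos.2 hk) t
  rw [inv_smul_smul₀ hk.ne', ENNReal.ofReal_inv_of_pos hk] at h
  have hk0 : ENNReal.ofReal k ≠ 0 := by simpa using hk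
  calc _ ≤ ENNReal.ofReal k * ((ENNReal.ofReal k)⁻¹ * rearrangement (k • f) t) := by gcongr
    _ = rearrangement (k • f) t := by
      rw [← mul_assoc, ENNReal.mul_inv_cancel hk0 ENNReal.ofReal_ne_top, one_mul]

theorem rearrangement_add_le (f g : L0 γ) {s t : ℝ} (hs : 0 ≤ s) (ht : 0 ≤ t) :
    rearrangement (f + g) (s + t) ≤ rearrangement f s + rearrangement g t := by
  refine ENNReal.le_of_forall_pos_le_add fun ε hε hlt => ?_
  have hε' : (ε : ℝ≥0∞) / 2 ≠ 0 := by simpa using hε.ne'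
  obtain ⟨hf, hg⟩ := ENNReal.add_lt_top.1 hlt
  obtain ⟨c, hc, hc1, hc2⟩ := exists_of_rearrangement_lt (ENNReal.lt_add_right hf.ne hε')
  obtain ⟨d, hd, hd1, hd2⟩ := exists_of_rearrangement_lt (ENNReal.lt_add_right hg.ne hε')
  refine (rearrangement_le (c := c + d) (by positivity) ?_).trans ?_
  · rw [ENNReal.ofReal_add hs ht]
    refine le_trans ?_ (add_le_add hc1 hd1)
    refine le_trans (measure_mono_ae ?_) (measure_union_le _ _)
    filter_upwards [AEEqFun.coeFn_add f g] with u hu h1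
    have h1' : ((c + d : ℝ≥0) : ℝ) < |(f + g : L0 γ) u| := h1
    rw [hu, NNReal.coe_add] at h1'
    have h2 : |(⇑f + ⇑g) u| ≤ |f u| + |g u| := abs_add_le _ _
    by_contra hcon
    have h3 : ¬ ((c : ℝ) < |f u| ∨ (d : ℝ) < |g u|) := hcon
    push Not at h3
    linarith
  · rw [ENNReal.coe_add]
    calc (c : ℝ≥0∞) + d ≤ (rearrangement f s + ε / 2) + (rearrangement g t + ε / 2) := by
          gcongr
      _ = rearrangement f s + rearrangement g t + (ε / 2 + ε / 2) := by ring
      _ = _ := by rw [ENNReal.add_halves]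

theorem rearrangement_half_add_le (f g : L0 γ) {t : ℝ} (ht : 0 ≤ t) :
    rearrangement (f + g) t ≤ rearrangement f (2⁻¹ * t) + rearrangement g (2⁻¹ * t) := by
  have := rearrangement_add_le f g (s := 2⁻¹ * t) (t := 2⁻¹ * t) (by positivity) (by positivity)
  rwa [show 2⁻¹ * t + 2⁻¹ * t = t by ring] at this

theorem rearrangement_sub_comm (f g : L0 γ) (t : ℝ) :
    rearrangement (f - g) t = rearrangement (g - f) t := by
  have h : ∀ f g : L0 γ, ∀ᵐ t ∂(volume : Measure ℝ).restrict (I γ), |(f - g : L0 γ) t| ≤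
      |(g - f : L0 γ) t| := fun f g => by
    filter_upwards [AEEqFun.coeFn_sub f g, AEEqFun.coeFn_sub g f] with t h1 h2
    rw [h1, h2, Pi.sub_apply, Pi.sub_apply, abs_sub_comm]
  exact le_antisymm (rearrangement_mono (h f g) t) (rearrangement_mono (h g f) t)

/-- The integral of `|f|` over a set is at most that of the rearrangement over an interval of the
same length. -/
theorem lintegral_le_intOver_rearrangement (f : L0 γ) {A : Set ℝ} {b : ℝ}
    (hA' : (volume : Measure ℝ).restrict (I γ) A ≤ ENNReal.ofReal b) :
    ∫⁻ t in A, ENNReal.ofReal |f t| ∂(volume : Measure ℝ).restrict (I γ) ≤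
      intOver (rearrangement f) 0 (ENNReal.ofReal b) := by
  by_cases htop : ∃ t ∈ Set.Ioo 0 b, rearrangement f t = ⊤
  · obtain ⟨t, ht, htt⟩ := htop
    refine le_top.trans (top_le_iff.2 ?_).ge
    rw [eq_top_iff]
    calc (⊤ : ℝ≥0∞) = ∫⁻ _ in Set.Ioo 0 t, ⊤ := by
          simp [ht.1]
      _ ≤ ∫⁻ s in Set.Ioo 0 t, rearrangement f s := by
          refine setLIntegral_mono' measurableSet_Ioo fun s hs => ?_
          exact htt.ge.trans (rearrangement_antitone f hs.2.le)
      _ ≤ _ := by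
          rw [intOver, openInterval_zero_ofReal]
          exact lintegral_mono_set (Set.Ioo_subset_Ioo_right ht.2.le)
  push Not at htop
  have h1 : intOver (rearrangement f) 0 (ENNReal.ofReal b) =
      ∫⁻ t in Set.Ioo 0 b, ENNReal.ofReal (rearrangement f t).toReal := by
    rw [intOver, openInterval_zero_ofReal]
    exact setLIntegral_congr_fun measurableSet_Ioo fun t ht =>
      (ENNReal.ofReal_toReal (htop t ht)).symm
  rw [h1, lintegral_eq_lintegral_meas_lt _ (ae_of_all _ fun _ => abs_nonneg _)
    (by fun_prop), lintegral_eq_lintegral_meas_le _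
    (ae_of_all _ fun _ => ENNReal.toReal_nonneg)
    (measurable_rearrangement f).ennreal_toReal.aemeasurable]
  refine setLIntegral_mono' measurableSet_Ioi fun c hc => ?_
  lift c to ℝ≥0 using (le_of_lt hc)
  set μ := (volume : Measure ℝ).restrict (I γ)
  have hle1 : (μ.restrict A) {t | (c : ℝ) < |f t|} ≤ distribution f c :=
    Measure.restrict_apply_le _ _
  have hle2 : (μ.restrict A) {t | (c : ℝ) < |f t|} ≤ ENNReal.ofReal b :=
    (measure_mono (Set.subset_univ _)).trans (by rwa [Measure.restrict_apply_univ])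
  set d := (μ.restrict A) {t | (c : ℝ) < |f t|}
  have hd : d ≠ ⊤ := ne_top_of_le_ne_top ENNReal.ofReal_ne_top hle2
  have hdb : d.toReal ≤ max b 0 := by
    have := ENNReal.toReal_mono ENNReal.ofReal_ne_top hle2
    rwa [ENNReal.toReal_ofReal'] at this
  calc d = ENNReal.ofReal d.toReal := (ENNReal.ofReal_toReal hd).symm
    _ = volume (Set.Ioo 0 d.toReal) := by simp
    _ ≤ (volume.restrict (Set.Ioo 0 b)) (Set.Ioo 0 d.toReal) := by
        rw [Measure.restrict_apply measurableSet_Ioo]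
        refine measure_mono fun t ht => ⟨ht, ht.1, ?_⟩
        rcases le_max_iff.1 hdb with h | h
        · exact ht.2.trans_le h
        · linarith [ht.1, ht.2]
    _ ≤ _ := by
        rw [Measure.restrict_apply measurableSet_Ioo]
        refine le_trans (measure_mono fun t ht => ?_) (Measure.le_restrict_apply _ _)
        refine ⟨?_, ht.2⟩
        have hlt : ENNReal.ofReal t < distribution f c := by
          refine lt_of_lt_of_le ?_ hle1
          rw [ENNReal.ofReal_lt_iff_lt_toReal ht.1.1.le hd]
          exact ht.1.2
        have := ENNReal.toReal_mono (htop t ht.2) (le_rearrangement hlt)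
        simpa using this

end Rearrangement

/-! ### The modular `P` and its norm -/

section Modular

variable {γ : ℝ≥0∞} {φ w : ℝ → ℝ}

theorem modularP_eq (f : L0 γ) : modularP φ w f = ⨅ (v : ℝ → ℝ) (_ : Submajorized γ w v),
    intOver (fun t => integrand φ (rearrangement f t) (ENNReal.ofReal (v t))) 0 γ := by
  simp only [modularP, lintegral_I]

theorem modularP_le (f : L0 γ) {v : ℝ → ℝ} (hv : Submajorized γ w v) : modularP φ w f ≤
    intOver (fun t => integrand φ (rearrangement f t) (ENNReal.ofReal (v t))) 0 γ := by
  rw [modularP_eq]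
  exact iInf₂_le v hv

theorem exists_of_modularP_lt {f : L0 γ} {x : ℝ≥0∞} (h : modularP φ w f < x) :
    ∃ v, Submajorized γ w v ∧
      intOver (fun t => integrand φ (rearrangement f t) (ENNReal.ofReal (v t))) 0 γ < x := by
  rw [modularP_eq] at h
  simp only [iInf_lt_iff] at h
  obtain ⟨v, hv, h⟩ := h
  exact ⟨v, hv, h⟩

theorem le_modularP {f : L0 γ} {x : ℝ≥0∞} (h : ∀ v, Submajorized γ w v →
      x ≤ intOver (fun t => integrand φ (rearrangement f t) (ENNReal.ofReal (v t))) 0 γ) :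
    x ≤ modularP φ w f := by
  rw [modularP_eq]
  exact le_iInf₂ h

theorem modularP_mono_rearrangement (hφ : IsOrlicz φ) {f g : L0 γ}
    (h : ∀ t ∈ openInterval 0 γ, rearrangement f t ≤ rearrangement g t) :
    modularP φ w f ≤ modularP φ w g :=
  le_modularP fun _ hv => (modularP_le f hv).trans
    (setLIntegral_mono' (measurableSet_openInterval _ _) fun t ht => integrand_mono hφ (h t ht) _)

theorem modularP_mono (hφ : IsOrlicz φ) {f g : L0 γ}
    (h : ∀ᵐ t ∂(volume : Measure ℝ).restrict (I γ), |f t| ≤ |g t|) :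
    modularP φ w f ≤ modularP φ w g :=
  modularP_mono_rearrangement hφ fun t _ => rearrangement_mono h t

theorem modularP_smul_mono (hφ : IsOrlicz φ) (f : L0 γ) {a b : ℝ} (ha : 0 < a) (hab : a ≤ b) :
    modularP φ w (a • f) ≤ modularP φ w (b • f) :=
  modularP_mono_rearrangement hφ fun t _ => by
    rw [rearrangement_smul f ha, rearrangement_smul f (ha.trans_le hab)]
    gcongr

theorem modularP_smul (f : L0 γ) {a : ℝ} (ha : 0 < a) :
    modularP φ w (a • f) = modularP (fun u => φ (a * u)) w f := by
  simp only [modularP, rearrangement_smul f ha, integrand_scale ha]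

theorem Submajorized.aemeasurable {v : ℝ → ℝ} (hv : Submajorized γ w v) :
    AEMeasurable (fun t => ENNReal.ofReal (v t)) (volume.restrict (openInterval 0 γ)) :=
  (aemeasurable_restrict_of_antitoneOn (measurableSet_openInterval 0 γ) hv.2.1).ennreal_ofReal

theorem IsWeight.submajorized (hw : IsWeight γ w) : Submajorized γ w w :=
  ⟨hw.nonneg, hw.antitone, fun _ _ => le_rfl⟩

theorem aemeasurable_integrand (hφ : IsOrlicz φ) {f : ℝ → ℝ≥0∞} (hf : Measurable f) {v : ℝ → ℝ}
    (hv : Submajorized γ w v) : AEMeasurable (fun t => integrand φ (f t) (ENNReal.ofReal (v t)))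
      (volume.restrict (openInterval 0 γ)) :=
  (measurable_integrand hφ).comp_aemeasurable (hf.aemeasurable.prodMk hv.aemeasurable)

theorem intOver_zero_top_le {g : ℝ → ℝ≥0∞} {C : ℝ≥0∞} {b : ℝ≥0∞} (hb : 0 < b)
    (h : ∀ t < b, intOver g 0 t ≤ C) : intOver g 0 b ≤ C := by
  obtain ⟨q, hq, hqb, hlim⟩ := exists_seq_strictMono_tendsto' hb
  have : openInterval 0 b = ⋃ n, openInterval 0 (q n) := by
    ext t
    simp only [Set.mem_iUnion, mem_openInterval_zero]
    constructor
    · rintro ⟨h1, h2⟩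
      obtain ⟨n, hn⟩ := (hlim.eventually (lt_mem_nhds h2)).exists
      exact ⟨n, h1, hn⟩
    · rintro ⟨n, h1, h2⟩
      exact ⟨h1, h2.trans (hqb n).2⟩
  unfold intOver
  rw [this, setLIntegral_iUnion_of_directed _
    (directed_of_isDirected_le fun m n hmn => openInterval_mono (hq.monotone hmn))]
  exact iSup_le fun n => h _ (hqb n).2

theorem Submajorized.le {v : ℝ → ℝ} (hv : Submajorized γ w v) (hγ : 0 < γ) {t : ℝ≥0∞}
    (ht : t ≤ γ) : intOver (fun s => ENNReal.ofReal (v s)) 0 t ≤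
      intOver (fun s => ENNReal.ofReal (w s)) 0 t := by
  rcases ht.lt_or_eq with h | rfl
  · exact hv.2.2 t h
  · exact intOver_zero_top_le hγ fun s hs => (hv.2.2 s hs).trans (intOver_mono _ hs.le)

/-- The joint subadditivity of the integrand and the boundedness of dilations make `P` almost
subadditive. -/
theorem modularP_add_le (hφ : IsOrlicz φ) (f g : L0 γ) : modularP φ w (f + g) ≤
    2⁻¹ * (modularP φ w ((4 : ℝ) • f) + modularP φ w ((4 : ℝ) • g)) := by
  have key : ∀ v₁, Submajorized γ w v₁ → ∀ v₂, Submajorized γ w v₂ → modularP φ w (f + g) ≤ 2⁻¹ *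
      (intOver (fun t => integrand φ (rearrangement ((4 : ℝ) • f) t) (ENNReal.ofReal (v₁ t))) 0 γ +
      intOver (fun t => integrand φ (rearrangement ((4 : ℝ) • g) t) (ENNReal.ofReal (v₂ t))) 0 γ) := by
    intro v₁ h₁ v₂ h₂
    have hhalf : ∀ {b : ℝ≥0∞} {t}, t ∈ openInterval 0 b → 2⁻¹ * t ∈ openInterval 0 b :=
      fun {b t} ht => by
        have := mem_openInterval_zero.1 ht
        exact mem_openInterval_of_lt (by linarith [this.1]) (by linarith [this.1]) this.2
    have h4 : ENNReal.ofReal 4 = 4 := by norm_num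
    have h44 : (4 : ℝ≥0∞)⁻¹ * 4 = 1 := ENNReal.inv_mul_cancel (by norm_num) (by norm_num)
    have h24 : (4 : ℝ≥0∞)⁻¹ * 2 = 2⁻¹ := by
      rw [show (4 : ℝ≥0∞) = 2 * 2 by norm_num, ENNReal.mul_inv (by simp) (by simp), mul_assoc,
        ENNReal.inv_mul_cancel (by simp) (by simp), mul_one]
    have hv : Submajorized γ w fun t => (v₁ (2⁻¹ * t) + v₂ (2⁻¹ * t)) / 4 := by
      refine ⟨fun t ht => ?_, fun s hs t ht hst => ?_, fun t ht => ?_⟩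
      · have := h₁.1 _ (hhalf ht)
        have := h₂.1 _ (hhalf ht)
        positivity
      · have := h₁.2.1 (hhalf hs) (hhalf ht) (by linarith)
        have := h₂.2.1 (hhalf hs) (hhalf ht) (by linarith)
        simp only
        linarith
      · have hsub := openInterval_mono (a := 0) ht.le
        calc intOver (fun t => ENNReal.ofReal ((v₁ (2⁻¹ * t) + v₂ (2⁻¹ * t)) / 4)) 0 t
            = intOver (fun t => (fun s => 4⁻¹ * (ENNReal.ofReal (v₁ s) + ENNReal.ofReal (v₂ s)))
              (2⁻¹ * t)) 0 t := by
              refine setLIntegral_congr_fun (measurableSet_openInterval _ _) fun s hs => ?_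
              have e1 := h₁.1 _ (hsub (hhalf hs))
              have e2 := h₂.1 _ (hsub (hhalf hs))
              simp only
              rw [← ENNReal.ofReal_add e1 e2, div_eq_inv_mul, ENNReal.ofReal_mul (by norm_num),
                ENNReal.ofReal_inv_of_pos (by norm_num), h4]
          _ ≤ 2 * intOver (fun s => 4⁻¹ * (ENNReal.ofReal (v₁ s) + ENNReal.ofReal (v₂ s))) 0 t :=
              intOver_comp_half_le _ _
          _ = 2⁻¹ * (intOver (fun s => ENNReal.ofReal (v₁ s)) 0 t +
              intOver (fun s => ENNReal.ofReal (v₂ s)) 0 t) := by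
              unfold intOver
              rw [lintegral_const_mul' _ _ (by simp), lintegral_add_left'
                (h₁.aemeasurable.mono_measure (Measure.restrict_mono_set _ hsub)), ← mul_assoc,
                mul_comm 2, h24]
          _ ≤ 2⁻¹ * (intOver (fun s => ENNReal.ofReal (w s)) 0 t +
              intOver (fun s => ENNReal.ofReal (w s)) 0 t) := by
              gcongr
              · exact h₁.2.2 t ht
              · exact h₂.2.2 t ht
          _ = _ := by
              rw [← two_mul, ← mul_assoc, ENNReal.inv_mul_cancel (by simp) (by simp), one_mul]
    refine (modularP_le _ hv).trans ?_
    set k₁ : ℝ → ℝ≥0∞ := fun t =>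
      integrand φ (rearrangement ((4 : ℝ) • f) t) (ENNReal.ofReal (v₁ t))
    set k₂ : ℝ → ℝ≥0∞ := fun t =>
      integrand φ (rearrangement ((4 : ℝ) • g) t) (ENNReal.ofReal (v₂ t))
    calc intOver (fun t => integrand φ (rearrangement (f + g) t)
          (ENNReal.ofReal ((v₁ (2⁻¹ * t) + v₂ (2⁻¹ * t)) / 4))) 0 γ
        ≤ intOver (fun t => (fun s => 4⁻¹ * (k₁ s + k₂ s)) (2⁻¹ * t)) 0 γ := by
          refine setLIntegral_mono' (measurableSet_openInterval _ _) fun t ht => ?_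
          have e1 := h₁.1 _ (hhalf ht)
          have e2 := h₂.1 _ (hhalf ht)
          have ht0 := (mem_openInterval_zero.1 ht).1.le
          have e3 : ENNReal.ofReal ((v₁ (2⁻¹ * t) + v₂ (2⁻¹ * t)) / 4) =
              4⁻¹ * (ENNReal.ofReal (v₁ (2⁻¹ * t)) + ENNReal.ofReal (v₂ (2⁻¹ * t))) := by
            rw [← ENNReal.ofReal_add e1 e2, div_eq_inv_mul, ENNReal.ofReal_mul (by norm_num),
              ENNReal.ofReal_inv_of_pos (by norm_num), h4]
          have e4 : rearrangement (f + g) t ≤ 4⁻¹ * (rearrangement ((4 : ℝ) • f) (2⁻¹ * t) +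
              rearrangement ((4 : ℝ) • g) (2⁻¹ * t)) := by
            refine (rearrangement_half_add_le f g ht0).trans_eq ?_
            rw [rearrangement_smul f four_pos, rearrangement_smul g four_pos, h4, ← mul_add,
              ← mul_assoc, h44, one_mul]
          refine (integrand_mono hφ e4 _).trans ?_
          rw [e3, integrand_mul_right _ _ _ (by simp) (by simp)]
          refine mul_le_mul_right ?_ _
          exact integrand_add_le hφ _ _ ENNReal.ofReal_ne_top ENNReal.ofReal_ne_top
      _ ≤ 2 * intOver (fun s => 4⁻¹ * (k₁ s + k₂ s)) 0 γ := intOver_comp_half_le _ _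
      _ = _ := by
          unfold intOver
          rw [lintegral_const_mul' _ _ (by simp), lintegral_add_left'
            (aemeasurable_integrand hφ (measurable_rearrangement _) h₁), ← mul_assoc,
            mul_comm 2, h24]
  rw [← ENNReal.mul_le_iff_le_inv (by simp) (by simp)]
  conv_rhs => rw [modularP_eq, modularP_eq]
  simp only [ENNReal.iInf_add, ENNReal.add_iInf]
  refine le_iInf₂ fun v₂ h₂ => le_iInf₂ fun v₁ h₁ => ?_
  rw [ENNReal.mul_le_iff_le_inv (by simp) (by simp)]
  exact key v₁ h₁ v₂ h₂

theorem modularP_inv_smul_le_one (hφ : IsOrlicz φ) {f : L0 γ} {ε : ℝ} (hε : 0 < ε)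
    (h : normM φ w f < ENNReal.ofReal ε) : modularP φ w (ε⁻¹ • f) ≤ 1 := by
  simp only [normM, iInf_lt_iff] at h
  obtain ⟨δ, hδ, h1, h2⟩ := h
  refine (modularP_smul_mono hφ f (inv_pos.2 hε) ?_).trans h1
  exact inv_anti₀ hδ ((ENNReal.ofReal_lt_ofReal_iff hε).1 h2).le

theorem normM_le {f : L0 γ} {ε : ℝ} (hε : 0 < ε) (h : modularP φ w (ε⁻¹ • f) ≤ 1) :
    normM φ w f ≤ ENNReal.ofReal ε :=
  iInf_le_of_le ε (iInf_le_of_le hε (iInf_le_of_le h le_rfl))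

/-- A triangle inequality up to the factor `4`, which is enough for questions of separability. -/
theorem normM_add_le (hφ : IsOrlicz φ) {f g : L0 γ} {ε : ℝ} (hε : 0 < ε)
    (hf : normM φ w f < ENNReal.ofReal ε) (hg : normM φ w g < ENNReal.ofReal ε) :
    normM φ w (f + g) ≤ ENNReal.ofReal (4 * ε) := by
  have e : ∀ h : L0 γ, (4 : ℝ) • ((4 * ε)⁻¹ • h) = ε⁻¹ • h := fun h => by
    rw [smul_smul]
    congr 1
    field_simp
  refine normM_le (by positivity) ?_
  rw [smul_add]
  refine (modularP_add_le hφ _ _).trans ?_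
  rw [e, e, ENNReal.inv_mul_le_iff (by simp) (by simp), mul_one, ← one_add_one_eq_two]
  exact add_le_add (modularP_inv_smul_le_one hφ hε hf) (modularP_inv_smul_le_one hφ hε hg)

theorem normM_sub_comm (f g : L0 γ) : normM φ w (f - g) = normM φ w (g - f) := by
  have h : ∀ (ε : ℝ) (_ : 0 < ε), modularP φ w (ε⁻¹ • (f - g)) = modularP φ w (ε⁻¹ • (g - f)) := by
    intro ε hε
    simp only [modularP, rearrangement_smul _ (inv_pos.2 hε), rearrangement_sub_comm f g]
  simp only [normM]
  refine iInf_congr fun ε => iInf_congr fun hε => ?_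
  rw [h ε hε]

/-- The integral of the rearrangement is controlled by `P`: the tangent bound with the chord of
`φ` over `[0, u]`. -/
theorem intOver_rearrangement_le (hφ : IsOrlicz φ) (hγ : 0 < γ) {f : ℝ → ℝ≥0∞} {v : ℝ → ℝ}
    (hv : Submajorized γ w v) {u : ℝ} (hu : 0 < u) {t : ℝ≥0∞} (ht : t ≤ γ) :
    ENNReal.ofReal (φ u / u) * intOver f 0 t ≤
      intOver (fun t => integrand φ (f t) (ENNReal.ofReal (v t))) 0 γ +
      ENNReal.ofReal (φ u) * intOver (fun s => ENNReal.ofReal (w s)) 0 t := by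
  have hsub := openInterval_mono (a := 0) ht
  have hφu := hφ.pos u hu
  have key : ∀ x, 0 ≤ x → φ u / u * x ≤ φ x + φ u := by
    intro x hx
    rcases le_total x u with h | h
    · have h1 : φ u / u * x ≤ φ u / u * u := by gcongr
      rw [div_mul_cancel₀ _ hu.ne'] at h1
      linarith [hφ.nonneg hx]
    · have h1 := hφ.mul_le_map ((one_le_div hu).2 h) hu.le
      rw [div_mul_cancel₀ _ hu.ne'] at h1
      have : φ u / u * x = x / u * φ u := by ring
      linarith
  calc ENNReal.ofReal (φ u / u) * intOver f 0 t
      ≤ ∫⁻ s in openInterval 0 t, ENNReal.ofReal (φ u / u) * f s := lintegral_const_mul_le _ _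
    _ ≤ ∫⁻ s in openInterval 0 t, (integrand φ (f s) (ENNReal.ofReal (v s)) +
          ENNReal.ofReal (φ u) * ENNReal.ofReal (v s)) :=
        lintegral_mono fun s => tangent_le_integrand hφ (by positivity) hφu.le key _
          ENNReal.ofReal_ne_top
    _ = (∫⁻ s in openInterval 0 t, integrand φ (f s) (ENNReal.ofReal (v s))) +
          ENNReal.ofReal (φ u) * intOver (fun s => ENNReal.ofReal (v s)) 0 t := by
        rw [lintegral_add_right' _ ((hv.aemeasurable.mono_measure
          (Measure.restrict_mono_set _ hsub)).const_mul _), lintegral_const_mul' _ _ (by simp),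
          intOver]
    _ ≤ _ := by
        gcongr
        · exact lintegral_mono_set hsub
        · exact hv.le hγ ht

end Modular

/-! ### Dominated convergence for the modular `P` -/

section Dominated

variable {γ : ℝ≥0∞} {φ w : ℝ → ℝ}

theorem tendsto_integrand (hφ : IsOrlicz φ) {x : ℕ → ℝ≥0∞} (hx : Tendsto x atTop (nhds 0)) {v : ℝ}
    (hv : 0 < v) : Tendsto (fun n => integrand φ (x n) (ENNReal.ofReal v)) atTop (nhds 0) := by
  rw [ENNReal.tendsto_nhds_zero]
  intro ε hε
  by_cases hεt : ε = ⊤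
  · simp [hεt]
  obtain ⟨u₀, h0, h1⟩ := hφ.exists_small (div_pos (ENNReal.toReal_pos hε.ne' hεt) hv)
  filter_upwards [ENNReal.tendsto_nhds_zero.1 hx (ENNReal.ofReal (u₀ * v))
    (by simpa using mul_pos h0 hv)] with n hn
  refine (integrand_mono hφ hn _).trans ?_
  rw [integrand_ofReal hφ (by positivity) hv, mul_div_cancel_right₀ _ hv.ne']
  refine (ENNReal.ofReal_le_ofReal ((le_div_iff₀ hv).1 (h1 u₀ h0.le le_rfl))).trans ?_
  rw [ENNReal.ofReal_toReal hεt]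

/-- Dominated convergence, applied to the integrand with a fixed `v` for which the bound for `f` is
finite. -/
theorem tendsto_modularP (hφ : IsOrlicz φ) {f : L0 γ} (hf : modularP φ w f < ⊤) {u : ℕ → L0 γ}
    (hle : ∀ n, ∀ t ∈ openInterval 0 γ, rearrangement (u n) t ≤ rearrangement f t)
    (hlim : ∀ t ∈ openInterval 0 γ, Tendsto (fun n => rearrangement (u n) t) atTop (nhds 0)) :
    Tendsto (fun n => modularP φ w (u n)) atTop (nhds 0) := by
  obtain ⟨v, hv, hfin⟩ := exists_of_modularP_lt hf
  have hU := measurableSet_openInterval 0 γ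
  have h := tendsto_lintegral_of_dominated_convergence'
    (μ := (volume : Measure ℝ).restrict (openInterval 0 γ)) (f := fun _ => 0)
    (F := fun n t => integrand φ (rearrangement (u n) t) (ENNReal.ofReal (v t)))
    (fun t => integrand φ (rearrangement f t) (ENNReal.ofReal (v t)))
    (fun n => aemeasurable_integrand hφ (measurable_rearrangement _) hv)
    (fun n => (ae_restrict_iff' hU).2 (ae_of_all _ fun t ht => integrand_mono hφ (hle n t ht) _))
    hfin.ne ?_
  · rw [lintegral_zero] at h
    exact tendsto_of_tendsto_of_tendsto_of_le_of_le tendsto_const_nhds h (fun _ => zero_le)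
      fun n => modularP_le _ hv
  · filter_upwards [ae_lt_top' (aemeasurable_integrand hφ (measurable_rearrangement _) hv) hfin.ne,
      (ae_restrict_iff' hU).2 (ae_of_all _ fun t ht => ht)] with t ht htU
    rcases (hv.1 t htU).eq_or_lt with h0 | h0
    · have hf0 : rearrangement f t = 0 := by
        by_contra hne
        simp [integrand, hne, ← h0] at ht
      have : ∀ n, rearrangement (u n) t = 0 := fun n => le_zero_iff.1 (hf0 ▸ hle n t htU)
      simp [this]
    · exact tendsto_integrand hφ (hlim t htU) h0

/-- The norm is order continuous on the functions all of whose multiples have finite modular: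
functions dominated by such a function that converge to `0` in measure are small in norm. -/
theorem eventually_normM_le (hφ : IsOrlicz φ) {f : L0 γ} (hf : f ∈ finiteP γ φ w) {u : ℕ → L0 γ}
    (hle : ∀ n, ∀ᵐ t ∂(volume : Measure ℝ).restrict (I γ), |u n t| ≤ |f t|)
    (hlim : ∀ c : ℝ≥0, 0 < c → Tendsto (fun n => distribution (u n) c) atTop (nhds 0)) {ε : ℝ}
    (hε : 0 < ε) : ∀ᶠ n in atTop, normM φ w (u n) ≤ ENNReal.ofReal ε := by
  have h := tendsto_modularP hφ (hf ε⁻¹ (inv_pos.2 hε)) (u := fun n => ε⁻¹ • u n)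
    (fun n t _ => by
      rw [rearrangement_smul _ (inv_pos.2 hε), rearrangement_smul _ (inv_pos.2 hε)]
      gcongr
      exact rearrangement_mono (hle n) t)
    (fun t ht => by
      simp only [rearrangement_smul _ (inv_pos.2 hε)]
      rw [← mul_zero (ENNReal.ofReal ε⁻¹)]
      refine ENNReal.Tendsto.const_mul ?_ (Or.inr ENNReal.ofReal_ne_top)
      rw [ENNReal.tendsto_nhds_zero]
      intro δ hδ
      obtain ⟨c, hc0, hcδ⟩ := ENNReal.lt_iff_exists_nnreal_btwn.1 hδ
      have hc : 0 < c := by simpa using hc0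
      filter_upwards [ENNReal.tendsto_nhds_zero.1 (hlim c hc) (ENNReal.ofReal t)
        (by simpa using (mem_openInterval_zero.1 ht).1)] with n hn
      exact (rearrangement_le hc hn).trans hcδ.le)
  filter_upwards [h.eventually_lt_const one_pos] with n hn
  exact normM_le hε hn.le

end Dominated

/-! ### Weights and the spaces they define -/

section Weight

variable {γ : ℝ≥0∞} {φ w : ℝ → ℝ}

theorem IsWeight.exists_pos (hw : IsWeight γ w) : ∃ s ∈ openInterval 0 γ, 0 < w s := by
  by_contra h
  push Not at h
  have : intOver (fun s => ENNReal.ofReal (w s)) 0 γ = 0 := by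
    unfold intOver
    rw [setLIntegral_congr_fun (measurableSet_openInterval _ _)
      (fun s hs => ENNReal.ofReal_of_nonpos (h s hs))]
    simp
  exact hw.nontrivial.ne' this

/-- A bounded decreasing function is integrable over a bounded interval if it is so near the
left end point. -/
theorem intOver_lt_top {g : ℝ → ℝ≥0∞} {b : ℝ} {s : ℝ} (hs : 0 < s)
    (hg : AntitoneOn g (Set.Ioo 0 b)) (hsb : s < b) (h : intOver g 0 (ENNReal.ofReal s) < ⊤)
    (hgs : g s < ⊤) : intOver g 0 (ENNReal.ofReal b) < ⊤ := by
  unfold intOver at h ⊢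
  rw [openInterval_zero_ofReal] at h ⊢
  have : Set.Ioo 0 b = Set.Ioo 0 s ∪ Set.Ico s b := (Set.Ioo_union_Ico_eq_Ioo hs hsb.le).symm
  rw [this]
  refine (lintegral_union_le _ _ _).trans_lt (ENNReal.add_lt_top.2 ⟨h, ?_⟩)
  calc ∫⁻ t in Set.Ico s b, g t ≤ ∫⁻ _ in Set.Ico s b, g s :=
        setLIntegral_mono' measurableSet_Ico fun t ht =>
          hg ⟨hs, hsb⟩ ⟨hs.trans_le ht.1, ht.2⟩ ht.1
    _ < ⊤ := by
        rw [setLIntegral_const, Real.volume_Ico]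
        exact ENNReal.mul_lt_top hgs ENNReal.ofReal_lt_top

theorem IsWeight.intOver_lt_top (hw : IsWeight γ w) {t : ℝ≥0∞} (ht : t ≤ γ) (ht' : t < ⊤) :
    intOver (fun s => ENNReal.ofReal (w s)) 0 t < ⊤ := by
  rcases ht.lt_or_eq with h | rfl
  · exact hw.locallyIntegrable t h
  · obtain ⟨s, hs, -⟩ := hw.exists_pos
    have hs' := mem_openInterval_zero.1 hs
    lift t to ℝ≥0 using ht'.ne
    rw [← ENNReal.ofReal_coe_nnreal] at hs' ⊢
    refine OrliczLorentz.intOver_lt_top hs'.1 (fun x hx y hy hxy => ?_)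
      ((ENNReal.ofReal_lt_ofReal_iff_of_nonneg hs'.1.le).1 hs'.2)
      (hw.locallyIntegrable _ (by simpa using hs'.2)) ENNReal.ofReal_lt_top
    have e : openInterval 0 (t : ℝ≥0∞) = Set.Ioo 0 (t : ℝ) := by
      rw [← ENNReal.ofReal_coe_nnreal, openInterval_zero_ofReal]
    exact ENNReal.ofReal_le_ofReal (hw.antitone (e ▸ hx) (e ▸ hy) hxy)

theorem IsWeight.mul_le_intOver (hw : IsWeight γ w) {s : ℝ} (hs : s ∈ openInterval 0 γ) (t : ℝ) :
    ENNReal.ofReal (w s * min t s) ≤ intOver (fun s => ENNReal.ofReal (w s)) 0 (ENNReal.ofReal t) := by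
  have hs' := mem_openInterval_zero.1 hs
  have h0 := hw.nonneg s hs
  calc ENNReal.ofReal (w s * min t s) = ∫⁻ _ in Set.Ioo 0 (min t s), ENNReal.ofReal (w s) := by
        rw [setLIntegral_const, Real.volume_Ioo, sub_zero, ENNReal.ofReal_mul h0]
    _ ≤ ∫⁻ x in Set.Ioo 0 (min t s), ENNReal.ofReal (w x) := by
        refine setLIntegral_mono' measurableSet_Ioo fun x hx => ENNReal.ofReal_le_ofReal ?_
        have hxs : x ≤ s := (hx.2.trans_le (min_le_right _ _)).le
        exact hw.antitone (mem_openInterval_of_lt hx.1 hxs hs'.2) hs hxs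
    _ ≤ _ := by
        rw [intOver, openInterval_zero_ofReal]
        exact lintegral_mono_set (Set.Ioo_subset_Ioo_right (min_le_left _ _))

theorem IsWeight.intOver_le_mul (hw : IsWeight ⊤ w) {t : ℝ} (ht : 1 ≤ t) :
    intOver (fun s => ENNReal.ofReal (w s)) 0 (ENNReal.ofReal t) ≤
      ENNReal.ofReal t * intOver (fun s => ENNReal.ofReal (w s)) 0 (ENNReal.ofReal 1) := by
  have h1 : (1 : ℝ) ∈ openInterval 0 ⊤ := mem_openInterval_zero.2 (by simp)
  have h2 := hw.mul_le_intOver h1 1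
  rw [min_self, mul_one] at h2
  set W₁ := intOver (fun s => ENNReal.ofReal (w s)) 0 (ENNReal.ofReal 1) with hW
  have : Set.Ioo 0 t = Set.Ioo 0 1 ∪ Set.Ico 1 t := (Set.Ioo_union_Ico_eq_Ioo one_pos ht).symm
  rw [intOver, openInterval_zero_ofReal, this]
  refine (lintegral_union_le _ _ _).trans ?_
  calc _ ≤ W₁ + ∫⁻ _ in Set.Ico 1 t, ENNReal.ofReal (w 1) := by
        refine add_le_add ?_ (setLIntegral_mono' measurableSet_Ico fun x hx => ?_)
        · rw [hW, intOver, openInterval_zero_ofReal]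
        · refine ENNReal.ofReal_le_ofReal (hw.antitone h1 (mem_openInterval_zero.2 ?_) hx.1)
          exact ⟨one_pos.trans_le hx.1, by simp⟩
    _ ≤ W₁ + W₁ * ENNReal.ofReal (t - 1) := by
        rw [setLIntegral_const, Real.volume_Ico]
        gcongr
    _ = ENNReal.ofReal t * W₁ := by
        nth_rewrite 1 [← mul_one W₁]
        rw [← mul_add, ← ENNReal.ofReal_one, ← ENNReal.ofReal_add zero_le_one (by linarith),
          mul_comm]
        congr 2
        ring

theorem volume_I (γ : ℝ≥0∞) : (volume : Measure ℝ) (I γ) ≤ γ := by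
  by_cases h : γ = ⊤
  · simp [h]
  · lift γ to ℝ≥0 using h
    calc _ ≤ (volume : Measure ℝ) (Set.Icc 0 (γ : ℝ)) := by
          refine measure_mono fun t ht => ⟨ht.1, ?_⟩
          have := ht.2
          rw [← ENNReal.ofReal_coe_nnreal] at this
          exact ((ENNReal.ofReal_lt_ofReal_iff_of_nonneg ht.1).1 this).le
      _ = γ := by simp

/-- A function with finite modular exceeds a given level on a set of finite measure only. -/
theorem distribution_lt_top (hφ : IsOrlicz φ) (hw : IsWeight γ w) {f : L0 γ}
    (hf : modularP φ w f < ⊤) {c : ℝ≥0} (hc : 0 < c) : distribution f c < ⊤ := by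
  rcases lt_or_eq_of_le (le_top (a := γ)) with hγ | rfl
  · refine lt_of_le_of_lt (measure_mono (Set.subset_univ _)) ?_
    rw [Measure.restrict_apply_univ]
    exact (volume_I γ).trans_lt hγ
  by_contra htop
  rw [not_lt, top_le_iff] at htop
  obtain ⟨v, hv, hfin⟩ := exists_of_modularP_lt hf
  have hc' : (0 : ℝ) < c := hc
  set i := intOver (fun t => integrand φ (rearrangement f t) (ENNReal.ofReal (v t))) 0 ⊤
  have hW := hw.locallyIntegrable (ENNReal.ofReal 1) ENNReal.ofReal_lt_top
  set W₁ := (intOver (fun s => ENNReal.ofReal (w s)) 0 (ENNReal.ofReal 1)).toReal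
  have hW0 : 0 ≤ W₁ := ENNReal.toReal_nonneg
  set u := c / (2 * (W₁ + 1))
  have hu : 0 < u := by positivity
  have hφu := hφ.pos u hu
  have key : ∀ t : ℝ, 1 ≤ t → φ u * t ≤ i.toReal := by
    intro t ht
    have h1 := intOver_rearrangement_le hφ ENNReal.zero_lt_top hv (f := rearrangement f) hu
      (le_top (a := ENNReal.ofReal t))
    have h2 : ENNReal.ofReal (c * t) ≤ intOver (rearrangement f) 0 (ENNReal.ofReal t) := by
      rw [intOver, openInterval_zero_ofReal]
      calc ENNReal.ofReal (c * t) = ∫⁻ _ in Set.Ioo 0 t, (c : ℝ≥0∞) := by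
            rw [setLIntegral_const, Real.volume_Ioo, sub_zero, ENNReal.ofReal_mul hc'.le,
              ENNReal.ofReal_coe_nnreal]
        _ ≤ _ := setLIntegral_mono' measurableSet_Ioo fun s _ =>
            le_rearrangement (by rw [htop]; exact ENNReal.ofReal_lt_top)
    have h3 : intOver (fun s => ENNReal.ofReal (w s)) 0 (ENNReal.ofReal t) ≤
        ENNReal.ofReal (t * W₁) := by
      refine (hw.intOver_le_mul ht).trans_eq ?_
      rw [ENNReal.ofReal_mul (by linarith), ENNReal.ofReal_toReal hW.ne]
    have h4 : ENNReal.ofReal (φ u / u * (c * t)) ≤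
        ENNReal.ofReal (i.toReal + φ u * (t * W₁)) := by
      rw [ENNReal.ofReal_mul (by positivity), ENNReal.ofReal_add ENNReal.toReal_nonneg
        (by positivity), ENNReal.ofReal_mul hφu.le, ENNReal.ofReal_toReal hfin.ne]
      exact (by gcongr : _ ≤ _).trans (h1.trans (by gcongr))
    rw [ENNReal.ofReal_le_ofReal_iff (by positivity)] at h4
    have h5 : φ u / u * (c * t) = φ u * t * (2 * (W₁ + 1)) := by
      simp only [u]
      field_simp
    rw [h5] at h4
    nlinarith [mul_pos hφu (by linarith : 0 < t), mul_nonneg (mul_pos hφu (by linarith : 0 < t)).le hW0]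
  have h6 := key (i.toReal / φ u + 1) (by have : 0 ≤ i.toReal := ENNReal.toReal_nonneg
                                          linarith [div_nonneg this hφu.le])
  rw [mul_add, mul_div_cancel₀ _ hφu.ne'] at h6
  linarith

/-! ### Growth conditions and finiteness of the modular -/

/-- The appropriate growth condition as a bound on all of `[0, ∞)`. The additive constant covers the
small arguments; it is integrated against `v`, and so has to vanish if `γ = ∞`. -/
theorem AppropriateDeltaTwo.exists_bound (hφ : IsOrlicz φ) (h : AppropriateDeltaTwo γ φ) :
    ∃ K C : ℝ, 0 < K ∧ 0 ≤ C ∧ (γ = ⊤ → C = 0) ∧ ∀ u, 0 ≤ u → φ (2 * u) ≤ K * φ u + C := by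
  rcases lt_or_eq_of_le (le_top (a := γ)) with hγ | rfl
  · obtain ⟨K, u₀, hK, hu₀, h1⟩ := h.1 hγ
    refine ⟨K, φ (2 * u₀), by linarith, hφ.nonneg (by linarith), fun h => absurd h hγ.ne,
      fun u hu => ?_⟩
    rcases le_total u₀ u with h2 | h2
    · linarith [h1 u h2, hφ.nonneg (u := 2 * u₀) (by linarith)]
    · have := hφ.mono (u := 2 * u) (v := 2 * u₀) (by linarith) (by linarith)
      have := mul_nonneg (by linarith : 0 ≤ K) (hφ.nonneg hu)
      linarith
  · obtain ⟨⟨K, u₀, hK, hu₀, h1⟩, ⟨K', u₁, hK', hu₁, h2⟩⟩ := h.2 rfl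
    have h0 := hφ.pos u₀ hu₀
    have h3 : 0 ≤ φ (2 * u₁) := hφ.nonneg (by linarith)
    have h3' : 0 ≤ φ (2 * u₁) / φ u₀ := by positivity
    refine ⟨K + K' + φ (2 * u₁) / φ u₀, 0, by linarith, le_rfl, fun _ => rfl, fun u hu => ?_⟩
    have h4 := hφ.nonneg hu
    have e1 : 0 ≤ K * φ u := mul_nonneg (by linarith) h4
    have e2 : 0 ≤ K' * φ u := mul_nonneg (by linarith) h4
    have e3 : 0 ≤ φ (2 * u₁) / φ u₀ * φ u := mul_nonneg h3' h4
    rw [add_zero, add_mul, add_mul]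
    rcases le_total u u₀ with h5 | h5
    · linarith [h1 u hu h5]
    rcases le_total u₁ u with h6 | h6
    · linarith [h2 u h6]
    have h7 := hφ.mono (u := 2 * u) (v := 2 * u₁) (by linarith) (by linarith)
    have h8 : φ (2 * u₁) / φ u₀ * φ u₀ ≤ φ (2 * u₁) / φ u₀ * φ u := by
      gcongr
      exact hφ.mono hu₀.le h5
    rw [div_mul_cancel₀ _ h0.ne'] at h8
    linarith

theorem modularP_two_smul_lt_top (hφ : IsOrlicz φ) (hγ : 0 < γ) (hw : IsWeight γ w)
    (h : AppropriateDeltaTwo γ φ) {f : L0 γ} (hf : modularP φ w f < ⊤) :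
    modularP φ w ((2 : ℝ) • f) < ⊤ := by
  obtain ⟨K, C, hK, hC, hCγ, hKC⟩ := h.exists_bound hφ
  obtain ⟨v, hv, hfin⟩ := exists_of_modularP_lt hf
  have hK1 : ENNReal.ofReal K ≠ 0 := by simpa using hK
  refine (modularP_le _ hv).trans_lt ?_
  calc intOver (fun t => integrand φ (rearrangement ((2 : ℝ) • f) t) (ENNReal.ofReal (v t))) 0 γ
      ≤ intOver (fun t => ENNReal.ofReal K * integrand φ (rearrangement f t) (ENNReal.ofReal (v t)) +
          ENNReal.ofReal C * ENNReal.ofReal (v t)) 0 γ := by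
        refine lintegral_mono fun t => ?_
        simp only
        rw [rearrangement_smul f two_pos]
        by_cases h0 : rearrangement f t = 0
        · simp [h0]
        by_cases hv0 : ENNReal.ofReal (v t) = 0
        · simp [integrand, h0, hv0, ENNReal.mul_top hK1]
        rw [integrand_scale two_pos, integrand_of_ne h0 hv0, integrand_of_ne h0 hv0, ← mul_assoc,
          ← add_mul]
        gcongr
        unfold extend
        by_cases h1 : rearrangement f t / ENNReal.ofReal (v t) = ⊤
        · simp [h1, ENNReal.mul_top hK1]
        · rw [if_neg h1, if_neg h1, ← ENNReal.ofReal_mul hK.le, ← ENNReal.ofReal_add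
            (mul_nonneg hK.le (hφ.nonneg ENNReal.toReal_nonneg)) hC]
          exact ENNReal.ofReal_le_ofReal (hKC _ ENNReal.toReal_nonneg)
    _ = ENNReal.ofReal K * intOver (fun t => integrand φ (rearrangement f t)
          (ENNReal.ofReal (v t))) 0 γ +
          ENNReal.ofReal C * intOver (fun t => ENNReal.ofReal (v t)) 0 γ := by
        unfold intOver
        rw [lintegral_add_right' _ (hv.aemeasurable.const_mul _), lintegral_const_mul' _ _ (by simp),
          lintegral_const_mul' _ _ (by simp)]
    _ < ⊤ := by
        refine ENNReal.add_lt_top.2 ⟨ENNReal.mul_lt_top (by simp) hfin, ?_⟩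
        rcases lt_or_eq_of_le (le_top (a := γ)) with hγ' | h1
        · exact ENNReal.mul_lt_top (by simp) ((hv.le hγ le_rfl).trans_lt
            (hw.intOver_lt_top le_rfl hγ'))
        · simp [hCγ h1]

/-- If the finiteness of `P` is stable under doubling, it is so under all multiples. -/
theorem spaceM_eq_finiteP_of_forall_two (hφ : IsOrlicz φ)
    (h : ∀ g : L0 γ, modularP φ w g < ⊤ → modularP φ w ((2 : ℝ) • g) < ⊤) :
    spaceM γ φ w = finiteP γ φ w := by
  refine Set.Subset.antisymm ?_ fun f hf => ⟨1, one_pos, hf 1 one_pos⟩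
  rintro f ⟨k, hk, hf⟩ l hl
  have h1 : ∀ n : ℕ, modularP φ w (((2 : ℝ) ^ n * k) • f) < ⊤ := by
    intro n
    induction n with
    | zero => simpa using hf
    | succ n ih =>
      have := h _ ih
      rwa [smul_smul, ← mul_assoc, ← pow_succ'] at this
  obtain ⟨n, hn⟩ := pow_unbounded_of_one_lt (l / k) (one_lt_two (α := ℝ))
  exact (modularP_smul_mono hφ f hl ((div_lt_iff₀ hk).1 hn).le).trans_lt (h1 n)

end Weight

/-! ### Separability under a growth condition -/

section Separable

variable {γ : ℝ≥0∞} {φ w : ℝ → ℝ}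

/-- The truncation of `f` to the interval `[0, n]` and to values between `-n` and `n`. -/
noncomputable def truncate (n : ℕ) (f : L0 γ) : L0 γ :=
  AEEqFun.mk ((Set.Icc (0 : ℝ) n).indicator fun t => max (-(n : ℝ)) (min n (f t)))
    (((continuous_const.max (continuous_const.min continuous_id)).comp_aestronglyMeasurable
      f.aestronglyMeasurable).indicator measurableSet_Icc)

theorem coeFn_truncate (n : ℕ) (f : L0 γ) : truncate n f =ᵐ[(volume : Measure ℝ).restrict (I γ)]
    (Set.Icc (0 : ℝ) n).indicator fun t => max (-(n : ℝ)) (min n (f t)) := AEEqFun.coeFn_mk _ _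

/-- The function that is `c` on `[0, n]` and `0` elsewhere. -/
noncomputable def constOn (γ : ℝ≥0∞) (n : ℕ) (c : ℝ) : L0 γ :=
  AEEqFun.mk ((Set.Icc (0 : ℝ) n).indicator fun _ => c)
    (aestronglyMeasurable_const.indicator measurableSet_Icc)

theorem coeFn_constOn (n : ℕ) (c : ℝ) : constOn γ n c =ᵐ[(volume : Measure ℝ).restrict (I γ)]
    (Set.Icc (0 : ℝ) n).indicator fun _ => c := AEEqFun.coeFn_mk _ _

/-- A suitable small constant on `[0, n]` is submajorized by the weight and serves as `v`. -/
theorem modularP_constOn_lt_top (hφ : IsOrlicz φ) (hw : IsWeight γ w) (n : ℕ) (c : ℝ) :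
    modularP φ w (constOn γ n c) < ⊤ := by
  obtain ⟨s, hs, hws⟩ := hw.exists_pos
  have hs0 := (mem_openInterval_zero.1 hs).1
  set k : ℝ := w s * min s (n + 1) / (n + 1)
  have hk : 0 < k := by positivity
  have hn0 : (0 : ℝ) ≤ n := Nat.cast_nonneg n
  have hv : Submajorized γ w fun t => if t ≤ n then k else 0 := by
    refine ⟨fun t _ => ?_, fun x _ y _ hxy => ?_, fun t ht => ?_⟩
    · dsimp only
      split_ifs <;> positivity
    · dsimp only
      split_ifs with h1 h2
      · exact le_rfl
      · linarith
      · exact hk.le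
      · exact le_rfl
    · obtain ⟨t, ht0, rfl⟩ : ∃ r : ℝ, 0 ≤ r ∧ t = ENNReal.ofReal r :=
        ⟨t.toReal, ENNReal.toReal_nonneg, (ENNReal.ofReal_toReal ht.ne_top).symm⟩
      refine le_trans ?_ (hw.mul_le_intOver hs t)
      rw [intOver, openInterval_zero_ofReal]
      calc ∫⁻ x in Set.Ioo 0 t, ENNReal.ofReal (if x ≤ n then k else 0)
          ≤ ∫⁻ x, (Set.Ioc (0 : ℝ) (min t n)).indicator (fun _ => ENNReal.ofReal k) x := by
            rw [← lintegral_indicator measurableSet_Ioo]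
            refine lintegral_mono fun x => ?_
            by_cases h1 : x ∈ Set.Ioo 0 t
            · rw [Set.indicator_of_mem h1]
              split_ifs with h2
              · rw [Set.indicator_of_mem (Set.mem_Ioc.2 ⟨h1.1, le_min h1.2.le h2⟩)]
              · simp
            · simp [Set.indicator_of_notMem h1]
        _ = ENNReal.ofReal (k * min t n) := by
            rw [lintegral_indicator measurableSet_Ioc, setLIntegral_const, Real.volume_Ioc,
              sub_zero, ENNReal.ofReal_mul hk.le]
        _ ≤ _ := by
            refine ENNReal.ofReal_le_ofReal ?_
            have : min s (n + 1) / (n + 1) * min (t : ℝ) n ≤ min t s := by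
              refine le_min ?_ ?_
              · refine (mul_le_of_le_one_left (le_min ht0 hn0) ?_).trans (min_le_left _ _)
                exact (div_le_one (by positivity)).2 (min_le_right _ _)
              · rw [div_mul_eq_mul_div, div_le_iff₀ (by positivity)]
                have e1 : min (t : ℝ) n ≤ n + 1 := (min_le_right _ _).trans (by linarith)
                have e2 : min s ((n : ℝ) + 1) ≤ s := min_le_left _ _
                have e3 : 0 ≤ min (t : ℝ) n := le_min ht0 hn0
                exact mul_le_mul e2 e1 e3 hs0.le
            calc k * min t n = w s * (min s (n + 1) / (n + 1) * min (t : ℝ) n) := by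
                  simp only [k]; ring
              _ ≤ _ := by gcongr
  have hdist : ∀ d : ℝ≥0, distribution (constOn γ n c) d ≤ ENNReal.ofReal n := by
    intro d
    calc distribution (constOn γ n c) d ≤ (volume : Measure ℝ).restrict (I γ) (Set.Icc 0 (n : ℝ)) := by
          refine measure_mono_ae ?_
          filter_upwards [coeFn_constOn n c] with t ht h1
          by_contra h2
          have h1' : (d : ℝ) < |constOn γ n c t| := h1
          have h2' : t ∉ Set.Icc 0 (n : ℝ) := h2
          rw [ht, Set.indicator_of_notMem h2', abs_zero] at h1'
          exact h1'.not_ge d.2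
      _ ≤ _ := (Measure.restrict_apply_le _ _).trans_eq (by simp)
  have hle : ∀ t, rearrangement (constOn γ n c) t ≤ ENNReal.ofReal (|c| + 1) := by
    intro t
    have hd : distribution (constOn γ n c) (Real.toNNReal (|c| + 1)) ≤ ENNReal.ofReal t := by
      refine le_trans (le_of_eq ?_) zero_le
      refine measure_mono_null_ae (t := ∅) ?_ (by simp)
      filter_upwards [coeFn_constOn n c] with t ht h1
      have h1' : ((Real.toNNReal (|c| + 1) : ℝ≥0) : ℝ) < |constOn γ n c t| := h1
      rw [ht, Real.coe_toNNReal _ (by positivity)] at h1'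
      have : |(Set.Icc (0 : ℝ) n).indicator (fun _ => c) t| ≤ |c| := by
        by_cases h : t ∈ Set.Icc (0 : ℝ) n
        · rw [Set.indicator_of_mem h]
        · rw [Set.indicator_of_notMem h]
          simp
      linarith
    exact rearrangement_le (Real.toNNReal_pos.2 (by positivity)) hd
  have hzero : ∀ t : ℝ, n ≤ t → rearrangement (constOn γ n c) t = 0 := by
    intro t ht
    refine le_zero_iff.1 (ENNReal.le_of_forall_pos_le_add fun ε hε _ => ?_)
    rw [zero_add]
    exact rearrangement_le hε ((hdist ε).trans (ENNReal.ofReal_le_ofReal ht))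
  refine (modularP_le _ hv).trans_lt ?_
  calc intOver (fun t => integrand φ (rearrangement (constOn γ n c) t)
        (ENNReal.ofReal (if t ≤ n then k else 0))) 0 γ
      ≤ ∫⁻ t in openInterval 0 γ, (Set.Icc (0 : ℝ) n).indicator
          (fun _ => integrand φ (ENNReal.ofReal (|c| + 1)) (ENNReal.ofReal k)) t := by
        refine setLIntegral_mono' (measurableSet_openInterval _ _) fun t ht => ?_
        by_cases h : t ≤ n
        · rw [if_pos h, Set.indicator_of_mem (Set.mem_Icc.2 ⟨(mem_openInterval_zero.1 ht).1.le, h⟩)]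
          exact integrand_mono hφ (hle t) _
        · rw [hzero t (not_le.1 h).le]
          simp
    _ ≤ ∫⁻ t, (Set.Icc (0 : ℝ) n).indicator
          (fun _ => integrand φ (ENNReal.ofReal (|c| + 1)) (ENNReal.ofReal k)) t :=
        setLIntegral_le_lintegral _ _
    _ < ⊤ := by
        rw [lintegral_indicator measurableSet_Icc, setLIntegral_const,
          integrand_ofReal hφ (by positivity) hk, Real.volume_Icc]
        exact ENNReal.mul_lt_top ENNReal.ofReal_lt_top ENNReal.ofReal_lt_top

theorem constOn_mem_finiteP (hφ : IsOrlicz φ) (hw : IsWeight γ w) (n : ℕ) (c : ℝ) :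
    constOn γ n c ∈ finiteP γ φ w := fun k hk => by
  refine lt_of_le_of_lt (modularP_mono hφ ?_) (modularP_constOn_lt_top hφ hw n (k * c))
  filter_upwards [coeFn_constOn n c, coeFn_constOn n (k * c),
    AEEqFun.coeFn_smul k (constOn γ n c)] with t h1 h2 h3
  rw [h2, h3, Pi.smul_apply, h1]
  by_cases h : t ∈ Set.Icc (0 : ℝ) n <;> simp [h]

theorem abs_truncate_le (n : ℕ) (f : L0 γ) :
    ∀ᵐ t ∂(volume : Measure ℝ).restrict (I γ), |truncate n f t| ≤ |constOn γ n n t| := by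
  filter_upwards [coeFn_truncate n f, coeFn_constOn n n] with t h1 h2
  rw [h1, h2]
  have hn : (0 : ℝ) ≤ n := Nat.cast_nonneg n
  by_cases h : t ∈ Set.Icc (0 : ℝ) n
  · rw [Set.indicator_of_mem h, Set.indicator_of_mem h, abs_of_nonneg hn]
    exact abs_le.2 ⟨le_max_left _ _, max_le (by linarith) (min_le_left _ _)⟩
  · simp [h]

theorem truncate_mem (hφ : IsOrlicz φ) (hw : IsWeight γ w) (n : ℕ) (f : L0 γ) :
    truncate n f ∈ spaceM γ φ w := by
  refine ⟨1, one_pos, ?_⟩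
  rw [one_smul]
  exact (modularP_mono hφ (abs_truncate_le n f)).trans_lt (modularP_constOn_lt_top hφ hw n n)

theorem abs_sub_truncate_le (n : ℕ) (f : L0 γ) :
    ∀ᵐ t ∂(volume : Measure ℝ).restrict (I γ), |(f - truncate n f : L0 γ) t| ≤ |f t| := by
  filter_upwards [coeFn_truncate n f, AEEqFun.coeFn_sub f (truncate n f)] with t h1 h2
  rw [h2, Pi.sub_apply, h1]
  have hn : (0 : ℝ) ≤ n := Nat.cast_nonneg n
  by_cases h : t ∈ Set.Icc (0 : ℝ) n
  · rw [Set.indicator_of_mem h]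
    rcases max_cases (-(n : ℝ)) (min n (f t)) with ⟨h3, h4⟩ | ⟨h3, h4⟩ <;>
    rcases min_cases (n : ℝ) (f t) with ⟨h5, h6⟩ | ⟨h5, h6⟩ <;> rw [h3] <;>
    rcases abs_cases (f t) with ⟨h7, h8⟩ | ⟨h7, h8⟩ <;> rw [h7] <;>
    exact abs_le.2 ⟨by linarith, by linarith⟩
  · simp [h]

theorem tendsto_distribution_sub_truncate (hφ : IsOrlicz φ) (hw : IsWeight γ w) {f : L0 γ}
    (hf : modularP φ w f < ⊤) {c : ℝ≥0} (hc : 0 < c) :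
    Tendsto (fun n => distribution (f - truncate n f) c) atTop (nhds 0) := by
  set μ := (volume : Measure ℝ).restrict (I γ)
  set A : ℕ → Set ℝ := fun n => {t | (c : ℝ) < |f t|} ∩ ({t | (n : ℝ) < |f t|} ∪ (Set.Icc 0 (n : ℝ))ᶜ)
  have hfm : AEMeasurable (fun t => |f t|) μ := by fun_prop
  have hA : Tendsto (μ ∘ A) atTop (nhds (μ (⋂ n, A n))) := by
    refine tendsto_measure_iInter_atTop (fun n => ?_) (fun n m hnm t ht => ?_)
      ⟨0, (lt_of_le_of_lt (measure_mono Set.inter_subset_left) (distribution_lt_top hφ hw hf hc)).ne⟩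
    · exact (nullMeasurableSet_lt aemeasurable_const hfm).inter
        ((nullMeasurableSet_lt aemeasurable_const hfm).union
          measurableSet_Icc.compl.nullMeasurableSet)
    · have hnm' : (n : ℝ) ≤ m := by exact_mod_cast hnm
      refine ⟨ht.1, ht.2.imp (fun h => lt_of_le_of_lt hnm' h) fun h h' => h ?_⟩
      exact ⟨h'.1, h'.2.trans hnm'⟩
  have h0 : μ (⋂ n, A n) = 0 := by
    refine measure_mono_null (t := (I γ)ᶜ) (fun t ht hI => ?_) ?_
    · obtain ⟨n, hn⟩ := exists_nat_ge (max |f t| t)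
      have := Set.mem_iInter.1 ht n
      rcases this.2 with h | h
      · exact not_le.2 h ((le_max_left _ _).trans hn)
      · exact h ⟨hI.1, (le_max_right _ _).trans hn⟩
    · rw [Measure.restrict_apply (measurableSet_I γ).compl]
      simp
  rw [h0] at hA
  refine tendsto_of_tendsto_of_tendsto_of_le_of_le tendsto_const_nhds hA (fun _ => zero_le)
    fun n => measure_mono_ae ?_
  filter_upwards [coeFn_truncate n f, AEEqFun.coeFn_sub f (truncate n f), abs_sub_truncate_le n f]
    with t h1 h2 h3 h4
  have h4' : (c : ℝ) < |(f - truncate n f : L0 γ) t| := h4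
  refine ⟨h4'.trans_le h3, ?_⟩
  by_contra hcon
  have hcon' : ¬ ((n : ℝ) < |f t| ∨ ¬ t ∈ Set.Icc 0 (n : ℝ)) := hcon
  push Not at hcon'
  have h5 := abs_le.1 hcon'.1
  rw [h2, Pi.sub_apply, h1, Set.indicator_of_mem hcon'.2, min_eq_right h5.2, max_eq_right h5.1,
    sub_self, abs_zero] at h4'
  exact h4'.not_ge c.2

theorem abs_truncate_sub_truncate_le (n : ℕ) (f g : L0 γ) :
    ∀ᵐ t ∂(volume : Measure ℝ).restrict (I γ), |(truncate n f - truncate n g : L0 γ) t| ≤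
      |truncate n f t - g t| := by
  filter_upwards [coeFn_truncate n f, coeFn_truncate n g,
    AEEqFun.coeFn_sub (truncate n f) (truncate n g)] with t h1 h2 h3
  rw [h3, Pi.sub_apply, h1, h2]
  by_cases h : t ∈ Set.Icc (0 : ℝ) n
  · have hn : (0 : ℝ) ≤ n := Nat.cast_nonneg n
    rw [Set.indicator_of_mem h, Set.indicator_of_mem h]
    set x := max (-(n : ℝ)) (min n (f t))
    have hx : max (-(n : ℝ)) (min n x) = x := by
      rw [min_eq_right (max_le (by linarith) (min_le_left _ _)), max_eq_right (le_max_left _ _)]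
    calc |x - max (-(n : ℝ)) (min n (g t))|
        = |max (-(n : ℝ)) (min n x) - max (-(n : ℝ)) (min n (g t))| := by rw [hx]
      _ ≤ |min (n : ℝ) x - min (n : ℝ) (g t)| := by
          simpa using abs_max_sub_max_le_max (-(n : ℝ)) (min (n : ℝ) x) (-(n : ℝ)) (min (n : ℝ) (g t))
      _ ≤ |x - g t| := by simpa using abs_min_sub_min_le_max (n : ℝ) x n (g t)
  · simp [h]

/-- The truncations of a dense sequence in `L¹` are dense: a truncation of `f` approximates `f` in
norm, and, bounds being uniform, an approximation of the truncation in `L¹` is one in norm as well. -/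
theorem separableFor_of_eq (hφ : IsOrlicz φ) (hw : IsWeight γ w)
    (h : spaceM γ φ w = finiteP γ φ w) : SeparableFor (normM φ w) (spaceM γ φ w) := by
  set μ := (volume : Measure ℝ).restrict (I γ)
  have : Fact ((1 : ℝ≥0∞) ≠ ⊤) := ⟨by simp⟩
  let g : ℕ → Lp ℝ 1 μ := TopologicalSpace.denseSeq (Lp ℝ 1 μ)
  refine ⟨Set.range fun p : ℕ × ℕ => truncate p.1 (g p.2 : L0 γ), ?_, Set.countable_range _, ?_⟩
  · rintro _ ⟨p, rfl⟩
    exact truncate_mem hφ hw _ _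
  intro f hf ε hε
  rw [h] at hf
  obtain ⟨δ, hδ, hδε⟩ : ∃ δ : ℝ, 0 < δ ∧ ENNReal.ofReal (4 * (2 * δ)) < ε := by
    obtain ⟨c, hc0, hc⟩ := ENNReal.lt_iff_exists_nnreal_btwn.1 hε
    have : (0 : ℝ) < c := by simpa using hc0
    refine ⟨c / 8, by positivity, ?_⟩
    rwa [show 4 * (2 * ((c : ℝ) / 8)) = c by ring, ENNReal.ofReal_coe_nnreal]
  have hlt : ENNReal.ofReal δ < ENNReal.ofReal (2 * δ) :=
    (ENNReal.ofReal_lt_ofReal_iff (by positivity)).2 (by linarith)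
  have hf1 : modularP φ w f < ⊤ := by simpa using hf 1 one_pos
  obtain ⟨n, hn⟩ := (eventually_normM_le hφ hf (fun n => abs_sub_truncate_le n f)
    (fun c hc => tendsto_distribution_sub_truncate hφ hw hf1 hc) hδ).exists
  -- the truncation is integrable
  have hmem : truncate n f ∈ Lp ℝ 1 μ := by
    rw [Lp.mem_Lp_iff_memLp]
    have h1 : MemLp (constOn γ n n : ℝ → ℝ) 1 μ := by
      refine (memLp_congr_ae (coeFn_constOn n n)).2 ?_
      refine memLp_indicator_const 1 measurableSet_Icc _ (Or.inr ?_)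
      exact ((Measure.restrict_apply_le _ _).trans_lt (by simp)).ne
    exact h1.mono (AEEqFun.aestronglyMeasurable _) (abs_truncate_le n f)
  obtain ⟨m, hlim⟩ : ∃ m : ℕ → ℕ, Tendsto (fun j => g (m j)) atTop
      (nhds (⟨truncate n f, hmem⟩ : Lp ℝ 1 μ)) := by
    have hcl := (TopologicalSpace.denseRange_denseSeq (Lp ℝ 1 μ))
      (⟨truncate n f, hmem⟩ : Lp ℝ 1 μ)
    obtain ⟨x, hx, hx'⟩ := mem_closure_iff_seq_limit.1 hcl
    choose m hm using hx
    exact ⟨m, by simpa only [g, hm] using hx'⟩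
  have hmeas := tendstoInMeasure_of_tendsto_Lp hlim
  obtain ⟨j, hj⟩ := (eventually_normM_le hφ (constOn_mem_finiteP hφ hw n (2 * n))
    (u := fun j => truncate n f - truncate n (g (m j) : L0 γ)) (fun j => by
      filter_upwards [abs_truncate_le n f, abs_truncate_le n (g (m j) : L0 γ),
        coeFn_constOn n n, coeFn_constOn n (2 * n),
        AEEqFun.coeFn_sub (truncate n f) (truncate n (g (m j) : L0 γ))] with t h1 h2 h3 h4 h5
      rw [h5, h4, Pi.sub_apply]
      rw [h3] at h1 h2
      refine (abs_sub _ _).trans ((add_le_add h1 h2).trans_eq ?_)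
      by_cases h : t ∈ Set.Icc (0 : ℝ) n
      · simp only [Set.indicator_of_mem h, abs_mul, abs_two]
        ring
      · simp [h])
    (fun c hc => by
      have h1 := hmeas c (by simpa using hc)
      refine tendsto_of_tendsto_of_tendsto_of_le_of_le tendsto_const_nhds h1 (fun _ => zero_le)
        fun j => measure_mono_ae ?_
      filter_upwards [abs_truncate_sub_truncate_le n f (g (m j) : L0 γ)] with t ht h2
      have h2' : (c : ℝ) < |(truncate n f - truncate n (g (m j) : L0 γ) : L0 γ) t| := h2
      change (c : ℝ≥0∞) ≤ edist ((g (m j) : L0 γ) t) (truncate n f t)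
      rw [edist_dist, Real.dist_eq, abs_sub_comm, ENNReal.le_ofReal_iff_toReal_le (by simp)
        (abs_nonneg _)]
      exact (h2'.trans_le ht).le) hδ).exists
  refine ⟨_, ⟨(n, m j), rfl⟩, lt_of_le_of_lt ?_ hδε⟩
  have := normM_add_le hφ (by positivity) (hn.trans_lt hlt) (hj.trans_lt hlt)
  rwa [sub_add_sub_cancel] at this

end Separable

/-! ### Copies of `ℓ_∞` in the absence of a growth condition -/

/-- Data for a function `L w`, with `L` a decreasing step function with values `l n`, that has
modular at most `1`, while each of its pieces over the disjoint intervals `[a n, b n)` has norm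
bounded from below. -/
structure BumpData (γ : ℝ≥0∞) (φ w : ℝ → ℝ) (l a b : ℕ → ℝ) (L : ℝ → ℝ) : Prop where
  pos : ∀ n, 0 < l n
  left_nonneg : ∀ n, 0 ≤ a n
  lt : ∀ n, a n < b n
  right_lt : ∀ n, ENNReal.ofReal (b n) < γ
  disjoint : Pairwise fun n m => Disjoint (Set.Ico (a n) (b n)) (Set.Ico (a m) (b m))
  eq : ∀ t ∈ openInterval 0 γ, (∃ n, t < b n ∧ L t = l n) ∨ L t = 0
  ge : ∀ n, ∀ t ∈ openInterval 0 γ, t < b n → l n ≤ L t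
  sum_le : ∑' n, ENNReal.ofReal (φ (l n)) *
    intOver (fun s => ENNReal.ofReal (w s)) 0 (ENNReal.ofReal (b n)) ≤ 1
  one_lt : ∀ n, 1 < ENNReal.ofReal (φ (2 * l n)) *
    intOver (fun s => ENNReal.ofReal (w s)) 0 (ENNReal.ofReal (b n))
  half : ∀ n, 2 * intOver (fun s => ENNReal.ofReal (w s)) 0 (ENNReal.ofReal (a n)) ≤
    intOver (fun s => ENNReal.ofReal (w s)) 0 (ENNReal.ofReal (b n))

/-- The part of `L w` over the intervals with index in `S`. -/
noncomputable def bump (w : ℝ → ℝ) (a b : ℕ → ℝ) (L : ℝ → ℝ) (S : Set ℕ) : ℝ → ℝ :=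
  (⋃ n ∈ S, Set.Ico (a n) (b n)).indicator fun t => L t * w t

/-- The argument for non-separability: a family indexed by the sets of natural numbers no two
members of which are close to the same element. -/
theorem not_separableFor {X : Type*} [AddGroup X] {N : X → ℝ≥0∞} {M : Set X} {f : Set ℕ → X}
    (hf : ∀ S, f S ∈ M) {ε : ℝ≥0∞} (hε : 0 < ε)
    (h : ∀ S T g, N (f S - g) < ε → N (f T - g) < ε → S = T) : ¬ SeparableFor N M := by
  rintro ⟨D, -, hD, hdense⟩
  choose g hgD hg using fun S => hdense (f S) (hf S) ε hε
  have hinj : Function.Injective fun S : Set ℕ => (⟨g S, hgD S⟩ : D) := fun S T hST =>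
    h S T (g S) (hg S) (by have := congrArg Subtype.val hST; simp only at this; rw [this]; exact hg T)
  have := hD.to_subtype
  have : Countable (Set ℕ) := hinj.countable
  obtain ⟨e, he⟩ := exists_injective_nat (Set ℕ)
  exact Function.cantor_injective e he

section Bump

variable {γ : ℝ≥0∞} {φ w : ℝ → ℝ}

theorem ae_mem_openInterval (γ : ℝ≥0∞) :
    ∀ᵐ t ∂(volume : Measure ℝ).restrict (I γ), t ∈ openInterval 0 γ := by
  rw [restrict_I]
  exact ae_restrict_mem (measurableSet_openInterval 0 γ)

theorem rearrangement_le_of_antitoneOn {f : L0 γ} {g : ℝ → ℝ}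
    (hf : f =ᵐ[(volume : Measure ℝ).restrict (I γ)] g) (hg0 : ∀ t ∈ openInterval 0 γ, 0 ≤ g t)
    (hg : AntitoneOn g (openInterval 0 γ)) {t : ℝ} (ht : t ∈ openInterval 0 γ) :
    rearrangement f t ≤ ENNReal.ofReal (g t) := by
  refine ENNReal.le_of_forall_pos_le_add fun ε hε _ => ?_
  have h0 := hg0 t ht
  have : ENNReal.ofReal (g t) + ε = (((g t).toNNReal + ε : ℝ≥0) : ℝ≥0∞) := by
    rw [ENNReal.coe_add]
    rfl
  rw [this]
  refine rearrangement_le (by positivity) ?_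
  have hε' : (0 : ℝ) < ε := hε
  calc distribution f ((g t).toNNReal + ε) ≤ (volume : Measure ℝ) (Set.Icc 0 t) := by
        refine (measure_mono_ae ?_).trans (Measure.restrict_apply_le _ _)
        filter_upwards [hf, ae_mem_openInterval γ] with s hs hsU h
        have h' : (((g t).toNNReal + ε : ℝ≥0) : ℝ) < |f s| := h
        rw [hs, abs_of_nonneg (hg0 s hsU), NNReal.coe_add, Real.coe_toNNReal _ h0] at h'
        refine ⟨(mem_openInterval_zero.1 hsU).1.le, ?_⟩
        by_contra hts
        have := hg ht hsU (not_le.1 hts).le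
        linarith
    _ = ENNReal.ofReal t := by simp

namespace BumpData

variable {l a b : ℕ → ℝ} {L : ℝ → ℝ}

theorem nonneg (h : BumpData γ φ w l a b L) {t : ℝ} (ht : t ∈ openInterval 0 γ) : 0 ≤ L t := by
  rcases h.eq t ht with ⟨n, -, hn⟩ | h0
  · exact hn ▸ (h.pos n).le
  · exact h0.ge

theorem antitoneOn (h : BumpData γ φ w l a b L) : AntitoneOn L (openInterval 0 γ) := by
  intro s hs t ht hst
  rcases h.eq t ht with ⟨n, hn, hLn⟩ | h0
  · exact hLn ▸ h.ge n s hs (hst.trans_lt hn)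
  · exact h0 ▸ h.nonneg hs

theorem antitoneOn_mul (h : BumpData γ φ w l a b L) (hw : IsWeight γ w) :
    AntitoneOn (fun t => L t * w t) (openInterval 0 γ) := fun _ hs t ht hst =>
  mul_le_mul (h.antitoneOn hs ht hst) (hw.antitone hs ht hst) (hw.nonneg t ht) (h.nonneg hs)

theorem aestronglyMeasurable (h : BumpData γ φ w l a b L) (hw : IsWeight γ w) (S : Set ℕ) :
    AEStronglyMeasurable (bump w a b L S) ((volume : Measure ℝ).restrict (I γ)) := by
  rw [restrict_I]
  exact (aemeasurable_restrict_of_antitoneOn (measurableSet_openInterval 0 γ)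
    (h.antitoneOn_mul hw)).aestronglyMeasurable.indicator
    (MeasurableSet.biUnion S.to_countable fun _ _ => measurableSet_Ico)

/-- The weight itself serves as `v`. -/
theorem modularP_le_one (h : BumpData γ φ w l a b L) (hφ : IsOrlicz φ) (hw : IsWeight γ w)
    {f : L0 γ} {S : Set ℕ} (hf : f =ᵐ[(volume : Measure ℝ).restrict (I γ)] bump w a b L S) :
    modularP φ w f ≤ 1 := by
  have hU := measurableSet_openInterval 0 γ
  have hLm : AEStronglyMeasurable (fun t => L t * w t) ((volume : Measure ℝ).restrict (I γ)) := by
    rw [restrict_I]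
    exact (aemeasurable_restrict_of_antitoneOn hU (h.antitoneOn_mul hw)).aestronglyMeasurable
  have h1 : modularP φ w f ≤ modularP φ w (AEEqFun.mk _ hLm) := by
    refine modularP_mono hφ ?_
    filter_upwards [hf, AEEqFun.coeFn_mk _ hLm] with t h1 h2
    rw [h1, h2, bump]
    by_cases ht : t ∈ ⋃ n ∈ S, Set.Ico (a n) (b n)
    · rw [Set.indicator_of_mem ht]
    · rw [Set.indicator_of_notMem ht, abs_zero]
      exact abs_nonneg _
  refine h1.trans ((modularP_le _ hw.submajorized).trans (le_trans ?_ h.sum_le))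
  have hwm := hw.submajorized.aemeasurable
  calc intOver (fun t => integrand φ (rearrangement (AEEqFun.mk _ hLm : L0 γ) t)
        (ENNReal.ofReal (w t))) 0 γ
      ≤ ∫⁻ t in openInterval 0 γ, ∑' n, (Set.Iio (b n)).indicator
          (fun t => ENNReal.ofReal (φ (l n)) * ENNReal.ofReal (w t)) t := by
        refine setLIntegral_mono' hU fun t ht => ?_
        refine (integrand_mono hφ (rearrangement_le_of_antitoneOn (AEEqFun.coeFn_mk _ hLm)
          (fun s hs => mul_nonneg (h.nonneg hs) (hw.nonneg s hs)) (h.antitoneOn_mul hw) ht) _).trans ?_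
        rcases (hw.nonneg t ht).eq_or_lt with h0 | h0
        · simp [← h0]
        rcases h.eq t ht with ⟨n, hn, hLn⟩ | hL0
        · refine le_trans ?_ (ENNReal.le_tsum n)
          rw [integrand_ofReal hφ (mul_nonneg (h.nonneg ht) h0.le) h0,
            mul_div_cancel_right₀ _ h0.ne', hLn, ENNReal.ofReal_mul (hφ.nonneg (h.pos n).le),
            Set.indicator_of_mem (Set.mem_Iio.2 hn)]
        · simp [hL0]
    _ = ∑' n, ∫⁻ t in openInterval 0 γ, (Set.Iio (b n)).indicator
          (fun t => ENNReal.ofReal (φ (l n)) * ENNReal.ofReal (w t)) t :=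
        lintegral_tsum fun n => (hwm.const_mul _).indicator measurableSet_Iio
    _ ≤ _ := by
        refine ENNReal.tsum_le_tsum fun n => ?_
        rw [lintegral_indicator measurableSet_Iio, Measure.restrict_restrict measurableSet_Iio,
          lintegral_const_mul' _ _ (by simp), intOver]
        gcongr
        rw [openInterval_zero_ofReal]
        exact fun t ht => ⟨(mem_openInterval_zero.1 ht.2).1, ht.1⟩

/-- The part of `L w` over a single interval has a large modular after multiplication by `8`. -/
theorem one_lt_modularP (h : BumpData γ φ w l a b L) (hφ : IsOrlicz φ) (hw : IsWeight γ w)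
    {g : L0 γ} (n : ℕ) (hg : ∀ᵐ t ∂(volume : Measure ℝ).restrict (I γ),
      |(Set.Ico (a n) (b n)).indicator (fun t => L t * w t) t| ≤ |g t|) :
    1 < modularP φ w ((8 : ℝ) • g) := by
  refine lt_of_lt_of_le (h.one_lt n) (le_modularP fun v hv => ?_)
  have hγ : 0 < γ := zero_le.trans_lt (h.right_lt n)
  have hln := h.pos n
  have hbn : 0 < b n := (h.left_nonneg n).trans_lt (h.lt n)
  have hbγ := (h.right_lt n).le
  have h1 := intOver_rearrangement_le hφ hγ hv (f := rearrangement ((8 : ℝ) • g))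
    (u := 2 * l n) (by positivity) hbγ
  set W := intOver (fun s => ENNReal.ofReal (w s)) 0 (ENNReal.ofReal (b n)) with hW
  have hWfin : W < ⊤ := hw.intOver_lt_top hbγ ENNReal.ofReal_lt_top
  set i := intOver (fun t => integrand φ (rearrangement ((8 : ℝ) • g) t) (ENNReal.ofReal (v t))) 0 γ
  set V := ∫⁻ t in Set.Ico (a n) (b n), ENNReal.ofReal (w t) with hV
  have h2 : W ≤ 2 * V := by
    have h3 : W ≤ intOver (fun s => ENNReal.ofReal (w s)) 0 (ENNReal.ofReal (a n)) + V := by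
      rw [hW, intOver, intOver, openInterval_zero_ofReal, openInterval_zero_ofReal]
      refine le_trans (lintegral_mono_set fun t ht => ?_) (lintegral_union_le _ _ _)
      rcases lt_or_ge t (a n) with h4 | h4
      · exact Or.inl ⟨ht.1, h4⟩
      · exact Or.inr ⟨h4, ht.2⟩
    have h4 : W + W ≤ W + 2 * V := by
      rw [← two_mul]
      calc 2 * W ≤ 2 * (intOver (fun s => ENNReal.ofReal (w s)) 0 (ENNReal.ofReal (a n)) + V) := by
            gcongr
        _ ≤ W + 2 * V := by
            rw [mul_add]
            gcongr
            exact h.half n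
    exact (ENNReal.add_le_add_iff_left hWfin.ne).1 h4
  -- the integral of the rearrangement of `8 g` over `(0, b n)`
  have h3 : ENNReal.ofReal (4 * l n) * W ≤
      intOver (rearrangement ((8 : ℝ) • g)) 0 (ENNReal.ofReal (b n)) := by
    refine le_trans ?_ (lintegral_le_intOver_rearrangement ((8 : ℝ) • g)
      (A := Set.Ico (a n) (b n)) ((Measure.restrict_apply_le _ _).trans ?_))
    · calc ENNReal.ofReal (4 * l n) * W ≤ ENNReal.ofReal (4 * l n) * (2 * V) := by gcongr
        _ = ∫⁻ t in Set.Ico (a n) (b n), ENNReal.ofReal (8 * l n) * ENNReal.ofReal (w t) := by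
            rw [lintegral_const_mul' _ _ ENNReal.ofReal_ne_top, ← hV, ← mul_assoc]
            congr 1
            rw [show (2 : ℝ≥0∞) = ENNReal.ofReal 2 by simp, ← ENNReal.ofReal_mul (by positivity)]
            congr 1
            ring
        _ = ∫⁻ t in Set.Ico (a n) (b n), ENNReal.ofReal (8 * l n) * ENNReal.ofReal (w t)
              ∂(volume : Measure ℝ).restrict (I γ) := by
            rw [Measure.restrict_restrict measurableSet_Ico, Set.inter_eq_left.2]
            exact fun t ht => ⟨(h.left_nonneg n).trans ht.1, lt_of_le_of_lt
              (ENNReal.ofReal_le_ofReal ht.2.le) (h.right_lt n)⟩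
        _ ≤ _ := by
            refine lintegral_mono_ae ((ae_restrict_iff' measurableSet_Ico).2 ?_)
            filter_upwards [hg, ae_mem_openInterval γ, AEEqFun.coeFn_smul (8 : ℝ) g]
              with t h4 h5 h6 h7
            rw [Set.indicator_of_mem h7] at h4
            rw [h6, Pi.smul_apply, smul_eq_mul, ← ENNReal.ofReal_mul (by positivity), abs_mul,
              abs_of_pos (by norm_num : (0 : ℝ) < 8)]
            refine ENNReal.ofReal_le_ofReal ?_
            have h8 := h.ge n t h5 h7.2
            have h9 := hw.nonneg t h5
            have h10 : l n * w t ≤ L t * w t := by gcongr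
            have h11 := h10.trans ((le_abs_self _).trans h4)
            linarith
    · rw [Real.volume_Ico]
      exact ENNReal.ofReal_le_ofReal (by linarith [h.left_nonneg n])
  have hφn := hφ.nonneg (u := 2 * l n) (by positivity)
  have h4 : ENNReal.ofReal (φ (2 * l n)) * W + ENNReal.ofReal (φ (2 * l n)) * W ≤
      i + ENNReal.ofReal (φ (2 * l n)) * W := by
    refine le_trans ?_ h1
    calc _ = ENNReal.ofReal (φ (2 * l n) / (2 * l n)) * (ENNReal.ofReal (4 * l n) * W) := by
          rw [← add_mul, ← mul_assoc, ← ENNReal.ofReal_add hφn hφn,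
            ← ENNReal.ofReal_mul (by positivity)]
          congr 2
          field_simp
          ring
      _ ≤ _ := by gcongr
  exact (ENNReal.add_le_add_iff_right (ENNReal.mul_ne_top ENNReal.ofReal_ne_top hWfin.ne)).1 h4

open Classical in
theorem bump_of_mem (h : BumpData γ φ w l a b L) {S : Set ℕ} {n : ℕ} {t : ℝ}
    (ht : t ∈ Set.Ico (a n) (b n)) : bump w a b L S t = if n ∈ S then L t * w t else 0 := by
  unfold bump
  split_ifs with hn
  · exact Set.indicator_of_mem (Set.mem_biUnion hn ht) _
  · refine Set.indicator_of_notMem (fun hmem => ?_) _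
    obtain ⟨m, hm, htm⟩ := Set.mem_iUnion₂.1 hmem
    rcases eq_or_ne m n with rfl | hmn
    · exact hn hm
    · exact Set.disjoint_left.1 (h.disjoint hmn) htm ht

theorem one_lt_modularP_sub (h : BumpData γ φ w l a b L) (hφ : IsOrlicz φ) (hw : IsWeight γ w)
    {f g : L0 γ} {S T : Set ℕ} (hST : S ≠ T)
    (hf : f =ᵐ[(volume : Measure ℝ).restrict (I γ)] bump w a b L S)
    (hg : g =ᵐ[(volume : Measure ℝ).restrict (I γ)] bump w a b L T) :
    1 < modularP φ w ((8 : ℝ) • (f - g)) := by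
  obtain ⟨n, hn⟩ : ∃ n, ¬ (n ∈ S ↔ n ∈ T) := by
    by_contra hcon
    push Not at hcon
    exact hST (Set.ext hcon)
  refine h.one_lt_modularP hφ hw n ?_
  filter_upwards [hf, hg, AEEqFun.coeFn_sub f g] with t h1 h2 h3
  by_cases ht : t ∈ Set.Ico (a n) (b n)
  · rw [h3, Pi.sub_apply, h1, h2, h.bump_of_mem ht, h.bump_of_mem ht, Set.indicator_of_mem ht]
    by_cases hS : n ∈ S <;> by_cases hT : n ∈ T <;> simp_all
  · rw [Set.indicator_of_notMem ht, abs_zero]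
    exact abs_nonneg _

/-- If both norms are less than `1 / 64`, that of `f - g` is at most `4 / 64 < 1 / 8`, while
`8 (f - g)` has modular larger than `1` if the index sets differ. -/
theorem eq_of_normM_lt (h : BumpData γ φ w l a b L) (hφ : IsOrlicz φ) (hw : IsWeight γ w)
    {f g d : L0 γ} {S T : Set ℕ}
    (hf : f =ᵐ[(volume : Measure ℝ).restrict (I γ)] bump w a b L S)
    (hg : g =ᵐ[(volume : Measure ℝ).restrict (I γ)] bump w a b L T)
    (h1 : normM φ w (f - d) < ENNReal.ofReal (1 / 64))
    (h2 : normM φ w (g - d) < ENNReal.ofReal (1 / 64)) : S = T := by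
  by_contra hST
  have h3 := h.one_lt_modularP_sub hφ hw hST hf hg
  rw [normM_sub_comm] at h2
  have h4 := normM_add_le hφ (by norm_num) h1 h2
  rw [sub_add_sub_cancel] at h4
  have h5 := modularP_inv_smul_le_one hφ (ε := 1 / 8) (by norm_num)
    (h4.trans_lt ((ENNReal.ofReal_lt_ofReal_iff (by norm_num)).2 (by norm_num)))
  rw [one_div, inv_inv] at h5
  exact h5.not_gt h3

/-- The pieces of the function converge to `0` in measure, but not in norm. -/
theorem notMem_finiteP (h : BumpData γ φ w l a b L) (hφ : IsOrlicz φ) (hw : IsWeight γ w)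
    {f : L0 γ} (hf : f =ᵐ[(volume : Measure ℝ).restrict (I γ)] bump w a b L Set.univ) :
    f ∉ finiteP γ φ w := by
  intro hfin
  set μ := (volume : Measure ℝ).restrict (I γ)
  have hm : ∀ n, AEStronglyMeasurable ((Set.Ico (a n) (b n)).indicator f) μ := fun n =>
    f.aestronglyMeasurable.indicator measurableSet_Ico
  set u : ℕ → L0 γ := fun n => AEEqFun.mk _ (hm n)
  have hu : ∀ n, u n =ᵐ[μ] (Set.Ico (a n) (b n)).indicator f := fun n => AEEqFun.coeFn_mk _ _
  have hf1 : modularP φ w f < ⊤ := by simpa using hfin 1 one_pos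
  obtain ⟨n, hn⟩ := (eventually_normM_le hφ hfin (u := u) (fun n => by
      filter_upwards [hu n] with t ht
      rw [ht]
      by_cases h1 : t ∈ Set.Ico (a n) (b n) <;> simp [h1])
    (fun c hc => by
      set A := {t | (c : ℝ) < |f t|}
      have hA : NullMeasurableSet A μ := nullMeasurableSet_lt aemeasurable_const (by fun_prop)
      have h1 : ∑' n, μ (A ∩ Set.Ico (a n) (b n)) ≠ ⊤ := by
        rw [← measure_iUnion₀]
        · exact (lt_of_le_of_lt (measure_mono (Set.iUnion_subset fun n => Set.inter_subset_left))
            (distribution_lt_top hφ hw hf1 hc)).ne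
        · exact fun n m hnm => ((h.disjoint hnm).mono Set.inter_subset_right
            Set.inter_subset_right).aedisjoint
        · exact fun n => hA.inter measurableSet_Ico.nullMeasurableSet
      refine tendsto_of_tendsto_of_tendsto_of_le_of_le tendsto_const_nhds
        (ENNReal.tendsto_atTop_zero_of_tsum_ne_top h1) (fun _ => zero_le)
        fun n => measure_mono_ae ?_
      filter_upwards [hu n] with t ht h2
      have h2' : (c : ℝ) < |u n t| := h2
      rw [ht] at h2'
      by_cases h3 : t ∈ Set.Ico (a n) (b n)
      · rw [Set.indicator_of_mem h3] at h2'
        exact ⟨h2', h3⟩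
      · rw [Set.indicator_of_notMem h3, abs_zero] at h2'
        exact absurd h2' (not_lt.2 c.2))
    (ε := 1 / 16) (by norm_num)).exists
  have h5 := modularP_inv_smul_le_one hφ (ε := 1 / 8) (by norm_num)
    (hn.trans_lt ((ENNReal.ofReal_lt_ofReal_iff (by norm_num)).2 (by norm_num)))
  rw [one_div, inv_inv] at h5
  refine h5.not_gt (h.one_lt_modularP hφ hw n ?_)
  filter_upwards [hu n, hf] with t h1 h2
  rw [h1]
  by_cases h3 : t ∈ Set.Ico (a n) (b n)
  · rw [Set.indicator_of_mem h3, Set.indicator_of_mem h3, h2, h.bump_of_mem h3,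
      if_pos (Set.mem_univ n)]
  · simp [h3]

theorem not_separableFor_and_ne (h : BumpData γ φ w l a b L) (hφ : IsOrlicz φ)
    (hw : IsWeight γ w) : ¬ SeparableFor (normM φ w) (spaceM γ φ w) ∧
      spaceM γ φ w ≠ finiteP γ φ w := by
  set f : Set ℕ → L0 γ := fun S => AEEqFun.mk _ (h.aestronglyMeasurable hw S)
  have hf : ∀ S, f S =ᵐ[(volume : Measure ℝ).restrict (I γ)] bump w a b L S :=
    fun S => AEEqFun.coeFn_mk _ _
  have hM : ∀ S, f S ∈ spaceM γ φ w := fun S => ⟨1, one_pos, by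
    rw [one_smul]
    exact (h.modularP_le_one hφ hw (hf S)).trans_lt ENNReal.one_lt_top⟩
  refine ⟨not_separableFor hM (ε := ENNReal.ofReal (1 / 64)) (by simp)
    fun S T d h1 h2 => h.eq_of_normM_lt hφ hw (hf S) (hf T) h1 h2, fun he => ?_⟩
  exact h.notMem_finiteP hφ hw (hf Set.univ) (he ▸ hM Set.univ)

end BumpData

end Bump

/-! ### Existence of the bumps -/

section Existence

variable {γ : ℝ≥0∞} {φ w : ℝ → ℝ}

theorem exists_of_not_deltaTwoInfty (h : ¬ DeltaTwoInfty φ) (n : ℕ) (u₀ : ℝ) :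
    ∃ u, 0 < u ∧ u₀ ≤ u ∧ 2 ^ (n + 2) * φ u < φ (2 * u) := by
  unfold DeltaTwoInfty at h
  push Not at h
  have h2 : (2 : ℝ) < 2 ^ (n + 2) := by
    have : (1 : ℝ) ≤ 2 ^ n := one_le_pow₀ one_le_two
    rw [pow_add]
    linarith
  obtain ⟨u, hu, h1⟩ := h (2 ^ (n + 2)) (max u₀ 1) h2 (by positivity)
  exact ⟨u, one_pos.trans_le ((le_max_right _ _).trans hu), (le_max_left _ _).trans hu, h1⟩

theorem exists_of_not_deltaTwoZero (hφ : IsOrlicz φ) (h : ¬ DeltaTwoZero φ) (n : ℕ) {u₀ : ℝ}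
    (hu₀ : 0 < u₀) : ∃ u, 0 < u ∧ u ≤ u₀ ∧ 2 ^ (n + 2) * φ u < φ (2 * u) := by
  unfold DeltaTwoZero at h
  push Not at h
  have h2 : (2 : ℝ) < 2 ^ (n + 2) := by
    have : (1 : ℝ) ≤ 2 ^ n := one_le_pow₀ one_le_two
    rw [pow_add]
    linarith
  obtain ⟨u, hu0, hu, h1⟩ := h (2 ^ (n + 2)) u₀ h2 hu₀
  refine ⟨u, hu0.lt_of_ne ?_, hu, h1⟩
  rintro rfl
  simp [hφ.zero] at h1

/-- The primitive of the weight takes all small values. -/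
theorem IsWeight.exists_intOver_eq (hw : IsWeight γ w) {s : ℝ} (hs : s ∈ openInterval 0 γ) {x : ℝ}
    (hx : 0 < x)
    (hxs : ENNReal.ofReal x ≤ intOver (fun s => ENNReal.ofReal (w s)) 0 (ENNReal.ofReal s)) :
    ∃ b, 0 < b ∧ b ≤ s ∧
      intOver (fun s => ENNReal.ofReal (w s)) 0 (ENNReal.ofReal b) = ENNReal.ofReal x := by
  have hs' := mem_openInterval_zero.1 hs
  have hfin := hw.locallyIntegrable _ hs'.2
  have hint : IntegrableOn w (Set.Ioo 0 s) := by
    refine ⟨?_, ?_⟩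
    · exact (aemeasurable_restrict_of_antitoneOn measurableSet_Ioo (hw.antitone.mono fun t ht =>
        mem_openInterval_of_lt ht.1 ht.2.le hs'.2)).aestronglyMeasurable
    · rw [hasFiniteIntegral_iff_enorm]
      refine lt_of_eq_of_lt ?_ hfin
      rw [intOver, openInterval_zero_ofReal]
      refine setLIntegral_congr_fun measurableSet_Ioo fun t ht => ?_
      exact Real.enorm_of_nonneg (hw.nonneg t (mem_openInterval_of_lt ht.1 ht.2.le hs'.2))
  have heq : ∀ b, 0 ≤ b → b ≤ s → intOver (fun s => ENNReal.ofReal (w s)) 0 (ENNReal.ofReal b) =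
      ENNReal.ofReal (∫ t in 0..b, w t) := by
    intro b hb hbs
    rw [intervalIntegral.integral_of_le hb, integral_Ioc_eq_integral_Ioo,
      ofReal_integral_eq_lintegral_ofReal (hint.mono_set (Set.Ioo_subset_Ioo_right hbs)),
      intOver, openInterval_zero_ofReal]
    exact (ae_restrict_iff' measurableSet_Ioo).2 (ae_of_all _ fun t ht =>
      hw.nonneg t (mem_openInterval_of_lt ht.1 (ht.2.le.trans hbs) hs'.2))
  have hcont : ContinuousOn (fun b => ∫ t in 0..b, w t) (Set.Icc 0 s) := by
    have h1 : IntegrableOn w (Set.uIcc 0 s) := by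
      rw [Set.uIcc_of_le hs'.1.le, integrableOn_Icc_iff_integrableOn_Ioo]
      exact hint
    have := intervalIntegral.continuousOn_primitive_interval h1
    rwa [Set.uIcc_of_le hs'.1.le] at this
  rw [heq s hs'.1.le le_rfl] at hxs
  have hxs' : x ≤ ∫ t in 0..s, w t := by
    by_contra hcon
    push Not at hcon
    exact (lt_of_lt_of_le ((ENNReal.ofReal_lt_ofReal_iff hx).2 hcon) hxs).false
  obtain ⟨b, hb, hbx⟩ := intermediate_value_Icc hs'.1.le hcont
    (show x ∈ Set.Icc _ _ from ⟨by simpa using hx.le, hxs'⟩)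
  refine ⟨b, hb.1.lt_of_ne ?_, hb.2, ?_⟩
  · rintro rfl
    simp at hbx
    linarith
  · rw [heq b hb.1 hb.2]
    exact congrArg _ hbx

theorem tsum_half_pow_succ : ∑' n : ℕ, ENNReal.ofReal ((1 / 2) ^ (n + 1)) = 1 := by
  have : ∀ n : ℕ, ENNReal.ofReal ((1 / 2) ^ (n + 1)) = 2⁻¹ ^ (n + 1) := fun n => by
    rw [ENNReal.ofReal_pow (by norm_num), one_div, ENNReal.ofReal_inv_of_pos two_pos]
    simp
  simp_rw [this]
  rw [ENNReal.tsum_geometric_add_one, ENNReal.one_sub_inv_two, inv_inv]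
  exact ENNReal.inv_mul_cancel (by simp) (by simp)

/-- If `Δ₂` fails at infinity, there are bumps that accumulate at `0`. -/
theorem exists_bumpData_of_not_deltaTwoInfty (hφ : IsOrlicz φ) (hw : IsWeight γ w)
    (h : ¬ DeltaTwoInfty φ) : ∃ l a b L, BumpData γ φ w l a b L := by
  obtain ⟨s, hs, hws⟩ := hw.exists_pos
  have hs' := mem_openInterval_zero.1 hs
  set W : ℝ → ℝ≥0∞ := fun t => intOver (fun s => ENNReal.ofReal (w s)) 0 (ENNReal.ofReal t)
  have hWmono : Monotone W := fun x y hxy => intOver_mono _ (ENNReal.ofReal_le_ofReal hxy)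
  have hWpos : ∀ t, 0 < t → 0 < W t := fun t ht =>
    lt_of_lt_of_le (by simpa using mul_pos hws (lt_min ht hs'.1)) (hw.mul_le_intOver hs t)
  have hWs : ENNReal.ofReal (w s * s) ≤ W s := by
    have := hw.mul_le_intOver hs s
    rwa [min_self] at this
  obtain ⟨u₀, hu₀, hu₀'⟩ := hφ.exists_large (1 / (w s * s))
  choose g hg0 hg1 hg2 using exists_of_not_deltaTwoInfty h
  -- the heights `l n` increase, and the numbers `W (b n)` at least halve at each step
  let l : ℕ → ℝ := fun n => Nat.rec (g 0 u₀) (fun n x => g (n + 1) x) n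
  have hl0 : ∀ n, 0 < l n := fun n => by cases n <;> exact hg0 _ _
  have hl : Monotone l := monotone_nat_of_le_succ fun n => hg1 (n + 1) (l n)
  have hl2 : ∀ n, 2 ^ (n + 2) * φ (l n) < φ (2 * l n) := fun n => by cases n <;> exact hg2 _ _
  have hφl : ∀ n, 0 < φ (l n) := fun n => hφ.pos _ (hl0 n)
  have hws' : 0 < w s * s := mul_pos hws hs'.1
  have hlarge : ∀ n, 1 / (w s * s) ≤ φ (l n) := fun n =>
    hu₀' _ ((hg1 0 u₀).trans (hl (Nat.zero_le n)))
  have hx : ∀ n : ℕ, ((1 : ℝ) / 2) ^ (n + 1) / φ (l n) ≤ w s * s := fun n => by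
    rw [div_le_iff₀ (hφl n)]
    have h1 := (div_le_iff₀ hws').1 (hlarge n)
    have h2 : ((1 : ℝ) / 2) ^ (n + 1) ≤ 1 := pow_le_one₀ (by norm_num) (by norm_num)
    linarith
  choose b hb0 hbs hb using fun n : ℕ => hw.exists_intOver_eq hs
    (x := (1 / 2) ^ (n + 1) / φ (l n)) (div_pos (by positivity) (hφl n))
    ((ENNReal.ofReal_le_ofReal (hx n)).trans hWs)
  have hhalf : ∀ n, 2 * W (b (n + 1)) ≤ W (b n) := fun n => by
    change 2 * intOver _ _ _ ≤ intOver _ _ _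
    rw [hb, hb, show (2 : ℝ≥0∞) = ENNReal.ofReal 2 by simp, ← ENNReal.ofReal_mul two_pos.le]
    refine ENNReal.ofReal_le_ofReal ?_
    have h1 := hφ.mono (hl0 n).le (hl (Nat.le_succ n))
    have h2 := hφl n
    rw [pow_succ _ (n + 1), mul_div_assoc', show (2 : ℝ) * ((1 / 2) ^ (n + 1) * (1 / 2)) =
      (1 / 2) ^ (n + 1) by ring]
    gcongr
  have hWfin : ∀ n, W (b n) ≠ ⊤ := fun n => by
    change intOver _ _ _ ≠ ⊤
    rw [hb]
    exact ENNReal.ofReal_ne_top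
  have hblt : ∀ n, b (n + 1) < b n := fun n => by
    by_contra hcon
    have h1 := hWmono (not_lt.1 hcon)
    have h2 := (hhalf n).trans h1
    have h3 := hWpos _ (hb0 (n + 1))
    rw [two_mul] at h2
    exact h2.not_gt (ENNReal.lt_add_right (hWfin _) h3.ne')
  have hbanti : Antitone b := antitone_nat_of_succ_le fun n => (hblt n).le
  have hex : ∀ t, 0 < t → ∃ n, b n ≤ t := by
    intro t ht
    by_contra hcon
    push Not at hcon
    have h1 : ∀ n : ℕ, W t ≤ ENNReal.ofReal ((1 / 2) ^ (n + 1) / φ (l 0)) := fun n => by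
      refine (hWmono (hcon n).le).trans ((hb n).le.trans (ENNReal.ofReal_le_ofReal ?_))
      have := hφ.mono (hl0 0).le (hl (Nat.zero_le n))
      have := hφl 0
      gcongr
    have h2 : Tendsto (fun n : ℕ => ENNReal.ofReal (((1 : ℝ) / 2) ^ (n + 1) / φ (l 0))) atTop
        (nhds 0) := by
      rw [← ENNReal.ofReal_zero]
      refine ENNReal.tendsto_ofReal ?_
      have := (tendsto_add_atTop_iff_nat 1).2 (tendsto_pow_atTop_nhds_zero_of_lt_one
        (r := (1 : ℝ) / 2) (by norm_num) (by norm_num))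
      simpa using this.div_const (φ (l 0))
    exact (hWpos t ht).not_ge (ge_of_tendsto' h2 h1)
  classical
  set L : ℝ → ℝ := fun t => if ht : ∃ n, b n ≤ t then
    (match Nat.find ht with
      | 0 => 0
      | n + 1 => l n) else 0
  have hL : ∀ t, 0 < t → (b 0 ≤ t ∧ L t = 0) ∨ ∃ n, b (n + 1) ≤ t ∧ t < b n ∧ L t = l n := by
    intro t ht
    have h1 := hex t ht
    rcases hN : Nat.find h1 with _ | n
    · left
      refine ⟨(Nat.find_eq_zero h1).1 hN, ?_⟩
      simp only [L, dif_pos h1, hN]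
    · right
      have h2 := Nat.find_spec h1
      have h3 := Nat.find_min h1 (m := n) (by omega)
      rw [hN] at h2
      refine ⟨n, h2, not_le.1 h3, ?_⟩
      simp only [L, dif_pos h1, hN]
  refine ⟨l, fun n => b (n + 1), b, L, hl0, fun n => (hb0 _).le, hblt, fun n => ?_, ?_, ?_, ?_, ?_,
    fun n => ?_, hhalf⟩
  · exact (ENNReal.ofReal_le_ofReal (hbs n)).trans_lt hs'.2
  · have hdis : ∀ n m, n < m → Disjoint (Set.Ico (b (n + 1)) (b n)) (Set.Ico (b (m + 1)) (b m)) := by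
      intro n m hnm
      rw [Set.disjoint_left]
      intro t h1 h2
      have := hbanti (Nat.succ_le_of_lt hnm)
      exact absurd (h2.2.trans_le this) (not_lt.2 h1.1)
    intro n m hnm
    rcases hnm.lt_or_gt with h1 | h1
    · exact hdis n m h1
    · exact (hdis m n h1).symm
  · intro t ht
    rcases hL t (mem_openInterval_zero.1 ht).1 with ⟨-, h1⟩ | ⟨n, -, h1, h2⟩
    · exact Or.inr h1
    · exact Or.inl ⟨n, h1, h2⟩
  · intro n t ht htn
    rcases hL t (mem_openInterval_zero.1 ht).1 with ⟨h1, -⟩ | ⟨m, h1, -, h2⟩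
    · exact absurd (h1.trans_lt htn) (not_lt.2 (hbanti (Nat.zero_le n)))
    · rw [h2]
      refine hl ?_
      by_contra hcon
      exact absurd (h1.trans_lt htn) (not_lt.2 (hbanti (by omega)))
  · rw [← tsum_half_pow_succ]
    refine ENNReal.tsum_le_tsum fun n => ?_
    rw [hb, ← ENNReal.ofReal_mul (hφl n).le, mul_div_cancel₀ _ (hφl n).ne']
  · rw [hb, ← ENNReal.ofReal_mul (hφ.nonneg (by linarith [hl0 n])), ENNReal.one_lt_ofReal,
      mul_div_assoc', one_lt_div (hφl n)]
    have h1 := hl2 n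
    have h2 : ((1 : ℝ) / 2) ^ (n + 1) * 2 ^ (n + 2) = 2 := by
      rw [one_div, inv_pow, pow_succ (2 : ℝ) (n + 1), ← mul_assoc,
        inv_mul_cancel₀ (by positivity), one_mul]
    have h3 : (0 : ℝ) < (1 / 2) ^ (n + 1) := by positivity
    have := hφl n
    nlinarith [mul_lt_mul_of_pos_left h1 h3]

theorem IsWeight.tendsto_intOver (hw : IsWeight ⊤ w) :
    Tendsto (fun n : ℕ => intOver (fun s => ENNReal.ofReal (w s)) 0 (ENNReal.ofReal n)) atTop
      (nhds ⊤) := by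
  have hmono : Monotone fun n : ℕ => openInterval 0 (ENNReal.ofReal n) := fun n m hnm =>
    openInterval_mono (ENNReal.ofReal_le_ofReal (Nat.cast_le.2 hnm))
  have hU : ⋃ n : ℕ, openInterval 0 (ENNReal.ofReal n) = openInterval 0 ⊤ := by
    refine Set.Subset.antisymm (Set.iUnion_subset fun n => openInterval_mono le_top) fun t ht => ?_
    obtain ⟨n, hn⟩ := exists_nat_gt t
    refine Set.mem_iUnion.2 ⟨n, mem_openInterval_of_lt (mem_openInterval_zero.1 ht).1 le_rfl ?_⟩
    exact (ENNReal.ofReal_lt_ofReal_iff ((mem_openInterval_zero.1 ht).1.trans hn)).2 hn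
  have h1 := hw.infinite rfl
  rw [intOver, ← hU, setLIntegral_iUnion_of_directed _ (directed_of_isDirected_le hmono)] at h1
  rw [← h1]
  exact tendsto_atTop_iSup fun n m hnm => lintegral_mono_set (hmono hnm)

/-- Since the weight decreases, its primitive at most doubles from one integer to the next. -/
theorem IsWeight.intOver_succ_le (hw : IsWeight ⊤ w) {n : ℕ} (hn : 1 ≤ n) :
    intOver (fun s => ENNReal.ofReal (w s)) 0 (ENNReal.ofReal (n + 1 : ℕ)) ≤
      2 * intOver (fun s => ENNReal.ofReal (w s)) 0 (ENNReal.ofReal n) := by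
  have hn0 : (0 : ℝ) < n := by exact_mod_cast hn
  have h1 : (n : ℝ) ∈ openInterval 0 ⊤ := mem_openInterval_zero.2 ⟨hn0, ENNReal.ofReal_lt_top⟩
  have h2 := hw.mul_le_intOver h1 n
  rw [min_self] at h2
  rw [two_mul]
  calc _ ≤ ∫⁻ s in Set.Ioo 0 (n : ℝ) ∪ Set.Ico (n : ℝ) (n + 1), ENNReal.ofReal (w s) := by
        rw [intOver, openInterval_zero_ofReal]
        refine lintegral_mono_set fun t ht => ?_
        push_cast at ht
        rcases lt_or_ge t n with h | h
        · exact Or.inl ⟨ht.1, h⟩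
        · exact Or.inr ⟨h, ht.2⟩
    _ ≤ _ := lintegral_union_le _ _ _
    _ ≤ _ := by
        refine add_le_add (by rw [intOver, openInterval_zero_ofReal]) (le_trans ?_ h2)
        calc _ ≤ ∫⁻ _ in Set.Ico (n : ℝ) (n + 1), ENNReal.ofReal (w n) :=
              setLIntegral_mono' measurableSet_Ico fun t ht =>
                ENNReal.ofReal_le_ofReal (hw.antitone h1
                  (mem_openInterval_zero.2 ⟨hn0.trans_le ht.1, ENNReal.ofReal_lt_top⟩) ht.1)
          _ ≤ _ := by
              rw [setLIntegral_const, Real.volume_Ico, add_sub_cancel_left]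
              simp only [ENNReal.ofReal_one, mul_one]
              refine ENNReal.ofReal_le_ofReal ?_
              have : (1 : ℝ) ≤ n := by exact_mod_cast hn
              nlinarith [hw.nonneg _ h1]

/-- If `Δ₂` fails at zero and `γ = ∞`, there are bumps that move off to infinity. Their end points
may be taken to be integers. -/
theorem exists_bumpData_of_not_deltaTwoZero (hφ : IsOrlicz φ) (hw : IsWeight ⊤ w)
    (h : ¬ DeltaTwoZero φ) : ∃ (l : ℕ → ℝ) (a b : ℕ → ℕ) (L : ℕ → ℝ),
      BumpData ⊤ φ w l (fun n => a n) (fun n => b n) fun t => L ⌊t⌋₊ := by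
  classical
  set W : ℕ → ℝ≥0∞ := fun n => intOver (fun s => ENNReal.ofReal (w s)) 0 (ENNReal.ofReal n)
    with hWdef
  have hWmono : Monotone W := fun x y hxy =>
    intOver_mono _ (ENNReal.ofReal_le_ofReal (Nat.cast_le.2 hxy))
  have hWfin : ∀ n, W n < ⊤ := fun n => hw.locallyIntegrable _ ENNReal.ofReal_lt_top
  have hW0 : W 0 = 0 := by
    have : openInterval 0 0 = ∅ := by ext t; simp [openInterval]
    simp [W, intOver, this]
  have hW1 : W 1 < ⊤ := hWfin 1
  set c : ℝ := (W 1).toReal + 1 with hc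
  have hc0 : 0 < c := by positivity
  have hc1 : W 1 ≤ ENNReal.ofReal c := by
    rw [← ENNReal.ofReal_toReal hW1.ne]
    exact ENNReal.ofReal_le_ofReal (by linarith)
  -- the heights `l n` decrease so fast that `W (b n)` at least doubles at each step
  have hg : ∀ (n : ℕ) (x : ℝ), ∃ u, 0 < x → 0 < u ∧ u ≤ x ∧ φ u ≤ φ x / 8 ∧
      φ u ≤ (1 / 2) ^ (n + 1) / c ∧ 2 ^ (n + 2) * φ u < φ (2 * u) := by
    intro n x
    by_cases hx : 0 < x
    · obtain ⟨u₁, h1, h1'⟩ := hφ.exists_small (ε := φ x / 8) (by have := hφ.pos x hx; positivity)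
      obtain ⟨u₂, h2, h2'⟩ := hφ.exists_small (ε := (1 / 2) ^ (n + 1) / c) (by positivity)
      obtain ⟨u, h3, h4, h5⟩ := exists_of_not_deltaTwoZero hφ h n (u₀ := min x (min u₁ u₂))
        (by positivity)
      exact ⟨u, fun _ => ⟨h3, h4.trans (min_le_left _ _),
        h1' u h3.le (h4.trans ((min_le_right _ _).trans (min_le_left _ _))),
        h2' u h3.le (h4.trans ((min_le_right _ _).trans (min_le_right _ _))), h5⟩⟩
    · exact ⟨0, fun h => absurd h hx⟩
  choose g hg using hg
  let l : ℕ → ℝ := fun n => Nat.rec (g 0 1) (fun n x => g (n + 1) x) n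
  have hl0 : ∀ n, 0 < l n := fun n => by
    induction n with
    | zero => exact (hg 0 1 one_pos).1
    | succ n ih => exact (hg (n + 1) (l n) ih).1
  have hl : Antitone l := antitone_nat_of_succ_le fun n => (hg (n + 1) (l n) (hl0 n)).2.1
  have hl8 : ∀ n, φ (l (n + 1)) ≤ φ (l n) / 8 := fun n => (hg (n + 1) (l n) (hl0 n)).2.2.1
  have hlc : ∀ n, φ (l n) ≤ (1 / 2) ^ (n + 1) / c ∧ 2 ^ (n + 2) * φ (l n) < φ (2 * l n) :=
    fun n => by
      cases n with
      | zero => exact (hg 0 1 one_pos).2.2.2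
      | succ n => exact (hg (n + 1) (l n) (hl0 n)).2.2.2
  have hφl : ∀ n, 0 < φ (l n) := fun n => hφ.pos _ (hl0 n)
  set X : ℕ → ℝ := fun n => (1 / 2) ^ (n + 1) / φ (l n) with hX
  have hXc : ∀ n, c ≤ X n := fun n => by
    rw [le_div_iff₀ (hφl n)]
    have := (le_div_iff₀ hc0).1 (hlc n).1
    linarith
  have hX4 : ∀ n, 4 * X n ≤ X (n + 1) := fun n => by
    have h1 := hφl n
    have h2 := hφl (n + 1)
    have h3 := hl8 n
    simp only [hX]
    rw [mul_div_assoc', div_le_div_iff₀ h1 h2, pow_succ _ (n + 1)]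
    have : (0 : ℝ) < (1 / 2) ^ (n + 1) := by positivity
    nlinarith [mul_le_mul_of_nonneg_left h3 this.le]
  -- `b n` is the last integer with `W (b n) ≤ X n`
  have hex : ∀ n, ∃ m, ENNReal.ofReal (X n) < W (m + 1) := fun n => by
    have := hw.tendsto_intOver.eventually (lt_mem_nhds (ENNReal.ofReal_lt_top (r := X n)))
    obtain ⟨m, hm⟩ := this.exists
    exact ⟨m, hm.trans_le (hWmono (Nat.le_succ m))⟩
  set b : ℕ → ℕ := fun n => Nat.find (hex n) with hb
  have hb2 : ∀ n, ENNReal.ofReal (X n) < W (b n + 1) := fun n => Nat.find_spec (hex n)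
  have hb1 : ∀ n, W (b n) ≤ ENNReal.ofReal (X n) := fun n => by
    rcases hbn : b n with _ | m
    · rw [hW0]
      exact zero_le
    · exact not_lt.1 (Nat.find_min (hex n) (m := m) (by change m < b n; omega))
  have hb0 : ∀ n, 1 ≤ b n := fun n => by
    by_contra hcon
    have h1 := hb2 n
    rw [show b n + 1 = 1 by omega] at h1
    exact (h1.trans_le (hc1.trans (ENNReal.ofReal_le_ofReal (hXc n)))).false
  have hbX : ∀ n, ENNReal.ofReal (X n / 2) < W (b n) := fun n => by
    have h1 := (hb2 n).trans_le (hw.intOver_succ_le (hb0 n))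
    by_contra hcon
    refine (h1.trans_le (mul_le_mul_right (not_lt.1 hcon) 2)).ne ?_
    rw [show (2 : ℝ≥0∞) = ENNReal.ofReal 2 by simp, ← ENNReal.ofReal_mul two_pos.le,
      mul_div_cancel₀ _ two_ne_zero]
  have hhalf : ∀ n, 2 * W (b n) ≤ W (b (n + 1)) := fun n => by
    refine (mul_le_mul_right (hb1 n) 2).trans (le_trans ?_ (hbX (n + 1)).le)
    rw [show (2 : ℝ≥0∞) = ENNReal.ofReal 2 by simp, ← ENNReal.ofReal_mul two_pos.le]
    exact ENNReal.ofReal_le_ofReal (by linarith [hX4 n])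
  have hWb : ∀ n, 0 < W (b n) := fun n => zero_le.trans_lt (hbX n)
  have hblt : ∀ n, b n < b (n + 1) := fun n => by
    by_contra hcon
    have h2 := (hhalf n).trans (hWmono (not_lt.1 hcon))
    rw [two_mul] at h2
    exact h2.not_gt (ENNReal.lt_add_right (hWfin _).ne (hWb n).ne')
  have hbmono : StrictMono b := strictMono_nat_of_lt_succ hblt
  have hexb : ∀ i, ∃ n, i < b n := fun i => ⟨i + 1, (Nat.lt_succ_self i).trans_le (hbmono.id_le _)⟩
  have hfl : ∀ t ∈ openInterval 0 ⊤, ∀ n, t < (b n : ℝ) ↔ ⌊t⌋₊ < b n := fun t ht n =>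
    (Nat.floor_lt (mem_openInterval_zero.1 ht).1.le).symm
  set a : ℕ → ℕ := fun n => Nat.casesOn n 0 b with ha
  have halt : ∀ n, a n < b n := fun n => by
    cases n with
    | zero => exact hb0 0
    | succ n => exact hblt n
  refine ⟨l, a, b, fun i => l (Nat.find (hexb i)), hl0, fun n => Nat.cast_nonneg _,
    fun n => Nat.cast_lt.2 (halt n), fun n => ENNReal.ofReal_lt_top, ?_, ?_, ?_, ?_, ?_,
    fun n => ?_⟩
  · have hdis : ∀ n m, n < m →
        Disjoint (Set.Ico (a n : ℝ) (b n)) (Set.Ico (a m : ℝ) (b m)) := by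
      intro n m hnm
      rw [Set.disjoint_left]
      intro t h1 h2
      obtain ⟨k, rfl⟩ : ∃ k, m = k + 1 := ⟨m - 1, by omega⟩
      have h3 : b n ≤ b k := hbmono.monotone (Nat.lt_succ_iff.1 hnm)
      have h4 : (b k : ℝ) ≤ t := h2.1
      exact absurd (h1.2.trans_le (Nat.cast_le.2 h3)) (not_lt.2 h4)
    intro n m hnm
    rcases hnm.lt_or_gt with h1 | h1
    · exact hdis n m h1
    · exact (hdis m n h1).symm
  · intro t ht
    exact Or.inl ⟨_, (hfl t ht _).2 (Nat.find_spec (hexb _)), rfl⟩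
  · intro n t ht htn
    exact hl (Nat.find_min' _ ((hfl t ht n).1 htn))
  · rw [← tsum_half_pow_succ]
    refine ENNReal.tsum_le_tsum fun n => ?_
    refine (mul_le_mul_right (hb1 n) _).trans ?_
    rw [← ENNReal.ofReal_mul (hφl n).le, mul_div_cancel₀ _ (hφl n).ne']
  · intro n
    have h0 : 0 < φ (2 * l n) := hφ.pos _ (by linarith [hl0 n])
    have h1 : 1 ≤ ENNReal.ofReal (φ (2 * l n)) * ENNReal.ofReal (X n / 2) := by
      rw [← ENNReal.ofReal_mul h0.le, ENNReal.one_le_ofReal]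
      simp only [hX]
      rw [div_div, mul_div_assoc', one_le_div (by have := hφl n; positivity)]
      have h1 := (hlc n).2
      have h2 : ((1 : ℝ) / 2) ^ (n + 1) * 2 ^ (n + 2) = 2 := by
        rw [one_div, inv_pow, pow_succ (2 : ℝ) (n + 1), ← mul_assoc,
          inv_mul_cancel₀ (by positivity), one_mul]
      have h3 : (0 : ℝ) < (1 / 2) ^ (n + 1) := by positivity
      have := hφl n
      nlinarith [mul_lt_mul_of_pos_left h1 h3]
    refine h1.trans_lt ?_
    exact (ENNReal.mul_lt_mul_iff_right (by simpa using h0) ENNReal.ofReal_ne_top).2 (hbX n)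
  · cases n with
    | zero =>
      change 2 * W 0 ≤ W (b 0)
      rw [hW0, mul_zero]
      exact zero_le
    | succ n => exact hhalf n

end Existence

/-! ### Primitives over `[0, γ]` -/

/-- The real points of the closed interval `[0, γ]`. -/
def closedI (γ : ℝ≥0∞) : Set ℝ := {t | 0 ≤ t ∧ ENNReal.ofReal t ≤ γ}

/-- The primitive of `h` that vanishes at `0`. -/
noncomputable def prim (h : ℝ → ℝ≥0∞) (t : ℝ) : ℝ := (intOver h 0 (ENNReal.ofReal t)).toReal

section Prim

variable {γ : ℝ≥0∞} {h : ℝ → ℝ≥0∞}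

theorem openInterval_subset_closedI : openInterval 0 γ ⊆ closedI γ := fun _ ht =>
  ⟨(mem_openInterval_zero.1 ht).1.le, ht.2.le⟩

theorem mem_openInterval_of_closedI {s t : ℝ} (hs : 0 < s) (hst : s < t) (ht : t ∈ closedI γ) :
    s ∈ openInterval 0 γ :=
  mem_openInterval_zero.2
    ⟨hs, ((ENNReal.ofReal_lt_ofReal_iff (hs.trans hst)).2 hst).trans_le ht.2⟩

theorem zero_mem_closedI : (0 : ℝ) ∈ closedI γ := ⟨le_rfl, by simp⟩

theorem mem_closedI_of_le {s t : ℝ} (hs : 0 ≤ s) (hst : s ≤ t) (ht : t ∈ closedI γ) :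
    s ∈ closedI γ := ⟨hs, (ENNReal.ofReal_le_ofReal hst).trans ht.2⟩

theorem ordConnected_closedI : (closedI γ).OrdConnected :=
  ⟨fun _ hx _ hy _ hz => mem_closedI_of_le (hx.1.trans hz.1) hz.2 hy⟩

theorem intOver_split (h : ℝ → ℝ≥0∞) {a b : ℝ} (ha : 0 ≤ a) (hab : a ≤ b) :
    intOver h 0 (ENNReal.ofReal b) =
      intOver h 0 (ENNReal.ofReal a) + intOver h (ENNReal.ofReal a) (ENNReal.ofReal b) := by
  simp only [intOver, openInterval_zero_ofReal, openInterval_ofReal ha]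
  rw [setLIntegral_congr Ioo_ae_eq_Ioc, setLIntegral_congr (Ioo_ae_eq_Ioc (a := (0 : ℝ)) (b := a)),
    setLIntegral_congr (Ioo_ae_eq_Ioc (a := a) (b := b)), ← Set.Ioc_union_Ioc_eq_Ioc ha hab]
  exact lintegral_union measurableSet_Ioc (Set.Ioc_disjoint_Ioc_of_le le_rfl)

theorem prim_zero : prim h 0 = 0 := by
  have : openInterval 0 0 = ∅ := by ext t; simp [openInterval]
  simp [prim, intOver, this]

variable (hfin : ∀ t ∈ closedI γ, intOver h 0 (ENNReal.ofReal t) ≠ ⊤)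
include hfin

theorem ofReal_prim {t : ℝ} (ht : t ∈ closedI γ) :
    ENNReal.ofReal (prim h t) = intOver h 0 (ENNReal.ofReal t) := ENNReal.ofReal_toReal (hfin t ht)

theorem prim_mono : MonotoneOn (prim h) (closedI γ) := fun _ _ b hb hab =>
  ENNReal.toReal_mono (hfin b hb) (intOver_mono h (ENNReal.ofReal_le_ofReal hab))

theorem intOver_eq_ofReal {a b : ℝ} (ha : 0 ≤ a) (hab : a ≤ b) (hb : b ∈ closedI γ) :
    intOver h (ENNReal.ofReal a) (ENNReal.ofReal b) = ENNReal.ofReal (prim h b - prim h a) := by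
  have ha' := mem_closedI_of_le ha hab hb
  have h1 := intOver_split h ha hab
  rw [← ofReal_prim hfin hb, ← ofReal_prim hfin ha'] at h1
  rw [ENNReal.ofReal_sub _ (show 0 ≤ prim h a from ENNReal.toReal_nonneg), h1,
    ENNReal.add_sub_cancel_left ENNReal.ofReal_ne_top]

theorem prim_sub_eq {a b : ℝ} (ha : 0 ≤ a) (hab : a ≤ b) (hb : b ∈ closedI γ) :
    ENNReal.ofReal (prim h b - prim h a) = ∫⁻ t in Set.Ioo a b, h t := by
  rw [← intOver_eq_ofReal hfin ha hab hb, intOver, openInterval_ofReal ha]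

theorem prim_sub_le {a b c : ℝ} (ha : 0 ≤ a) (hab : a ≤ b) (hb : b ∈ closedI γ) (hc0 : 0 ≤ c)
    (hc : ∀ t ∈ Set.Ioo a b, h t ≤ ENNReal.ofReal c) : prim h b - prim h a ≤ c * (b - a) := by
  have h1 : ENNReal.ofReal (prim h b - prim h a) ≤ ENNReal.ofReal (c * (b - a)) := by
    rw [prim_sub_eq hfin ha hab hb, ENNReal.ofReal_mul hc0, ← Real.volume_Ioo, ← setLIntegral_const]
    exact setLIntegral_mono' measurableSet_Ioo hc
  exact (ENNReal.ofReal_le_ofReal_iff (mul_nonneg hc0 (sub_nonneg.2 hab))).1 h1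

theorem le_prim_sub {a b c : ℝ} (ha : 0 ≤ a) (hab : a ≤ b) (hb : b ∈ closedI γ) (hc0 : 0 ≤ c)
    (hc : ∀ t ∈ Set.Ioo a b, ENNReal.ofReal c ≤ h t) : c * (b - a) ≤ prim h b - prim h a := by
  have h1 : ENNReal.ofReal (c * (b - a)) ≤ ENNReal.ofReal (prim h b - prim h a) := by
    rw [prim_sub_eq hfin ha hab hb, ENNReal.ofReal_mul hc0, ← Real.volume_Ioo, ← setLIntegral_const]
    exact setLIntegral_mono' measurableSet_Ioo hc
  exact (ENNReal.ofReal_le_ofReal_iff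
    (sub_nonneg.2 (prim_mono hfin (mem_closedI_of_le ha hab hb) hb hab))).1 h1

theorem continuousOn_prim : ContinuousOn (prim h) (closedI γ) := by
  have key : ∀ b ∈ closedI γ, ContinuousOn (prim h) (Set.Icc 0 b) := by
    intro b hb
    rw [Metric.continuousOn_iff]
    have hb' : ∫⁻ t in Set.Ioo 0 b, h t ≠ ⊤ := by
      have := hfin b hb
      rwa [intOver, openInterval_zero_ofReal] at this
    have main : ∀ ε > 0, ∃ δ > 0, ∀ x y, 0 ≤ x → x ≤ y → y ≤ b → y - x < δ →
        prim h y - prim h x < ε := by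
      intro ε hε
      obtain ⟨δ, hδ, h1⟩ := exists_pos_setLIntegral_lt_of_measure_lt hb'
        (ε := ENNReal.ofReal ε) (by simpa using hε)
      obtain ⟨δ', hδ', hδδ⟩ : ∃ δ' : ℝ, 0 < δ' ∧ ENNReal.ofReal δ' ≤ δ := by
        rcases eq_or_ne δ ⊤ with rfl | hne
        · exact ⟨1, one_pos, le_top⟩
        · exact ⟨δ.toReal, ENNReal.toReal_pos hδ.ne' hne, (ENNReal.ofReal_toReal hne).le⟩
      refine ⟨δ', hδ', fun x y hx hxy hy hlt => ?_⟩
      have h2 := h1 (Set.Ioo x y) (by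
        refine lt_of_le_of_lt (Measure.restrict_apply_le _ _) ?_
        rw [Real.volume_Ioo]
        exact ((ENNReal.ofReal_lt_ofReal_iff hδ').2 hlt).trans_le hδδ)
      rw [Measure.restrict_restrict measurableSet_Ioo,
        Set.inter_eq_left.2 (Set.Ioo_subset_Ioo hx hy), ← prim_sub_eq hfin hx hxy
          (mem_closedI_of_le (hx.trans hxy) hy hb)] at h2
      exact (ENNReal.ofReal_lt_ofReal_iff hε).1 h2
    intro x hx ε hε
    obtain ⟨δ, hδ, h1⟩ := main ε hε
    refine ⟨δ, hδ, fun y hy hd => ?_⟩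
    rw [Real.dist_eq, abs_lt] at hd ⊢
    have hx' := mem_closedI_of_le hx.1 hx.2 hb
    have hy' := mem_closedI_of_le hy.1 hy.2 hb
    rcases le_total x y with hxy | hxy
    · have h2 := h1 x y hx.1 hxy hy.2 (by linarith)
      have h3 := prim_mono hfin hx' hy' hxy
      constructor <;> linarith
    · have h2 := h1 y x hy.1 hxy hx.2 (by linarith)
      have h3 := prim_mono hfin hy' hx' hxy
      constructor <;> linarith
  intro x hx
  by_cases hmax : ∃ b ∈ closedI γ, x < b
  · obtain ⟨b, hb, hxb⟩ := hmax
    refine (key b hb x ⟨hx.1, hxb.le⟩).mono_of_mem_nhdsWithin ?_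
    filter_upwards [self_mem_nhdsWithin, mem_nhdsWithin_of_mem_nhds (Iio_mem_nhds hxb)] with y h1 h2
    exact ⟨h1.1, h2.le⟩
  · push Not at hmax
    exact (key x hx x ⟨hx.1, le_rfl⟩).mono fun y hy => ⟨hy.1, hmax y hy⟩

theorem eq_zero_of_prim_eq (hanti : AntitoneOn h (openInterval 0 γ)) {c b t : ℝ}
    (hc : 0 ≤ c) (hb : b ∈ closedI γ) (heq : prim h c = prim h b) (hct : c < t) (htb : t < b) :
    h t = 0 := by
  have ht : t ∈ openInterval 0 γ := mem_openInterval_of_closedI (hc.trans_lt hct) htb hb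
  have h1 := prim_sub_eq hfin hc hct.le (openInterval_subset_closedI ht)
  have h2 : prim h t - prim h c ≤ 0 := by
    have := prim_mono hfin (openInterval_subset_closedI ht) hb htb.le
    linarith
  rw [ENNReal.ofReal_eq_zero.2 h2] at h1
  have h3 : h t * ENNReal.ofReal (t - c) ≤ 0 := by
    rw [h1, ← Real.volume_Ioo, ← setLIntegral_const]
    exact setLIntegral_mono' measurableSet_Ioo fun s hs =>
      hanti (mem_openInterval_of_closedI (hc.trans_lt hs.1) hs.2 (openInterval_subset_closedI ht)) ht
        hs.2.le
  rcases mul_eq_zero.1 (le_antisymm h3 zero_le) with h4 | h4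
  · exact h4
  · rw [ENNReal.ofReal_eq_zero] at h4
    linarith

/-- A decreasing function whose integral over `(c, b)` vanishes is `0` from `c` on. -/
theorem prim_flat (hanti : AntitoneOn h (openInterval 0 γ)) {c b d : ℝ}
    (hc : 0 ≤ c) (hb : b ∈ closedI γ) (hd : d ∈ closedI γ) (hcb : c < b)
    (heq : prim h c = prim h b) (hcd : c ≤ d) : prim h d = prim h c := by
  have hc' := mem_closedI_of_le hc hcd hd
  rcases le_total d b with hdb | hbd
  · exact le_antisymm (heq ▸ prim_mono hfin hd hb hdb) (prim_mono hfin hc' hd hcd)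
  · obtain ⟨m, hcm, hmb⟩ := exists_between hcb
    have hm : m ∈ openInterval 0 γ := mem_openInterval_of_closedI (hc.trans_lt hcm) hmb hb
    have h0 := eq_zero_of_prim_eq hfin hanti hc hb heq hcm hmb
    have h1 := prim_sub_le hfin (c := 0) (hc.trans hcm.le) (hmb.le.trans hbd) hd le_rfl
      fun t ht => by
        have := hanti hm (mem_openInterval_of_closedI ((hc.trans_lt hcm).trans ht.1) ht.2 hd) ht.1.le
        rw [h0] at this
        simpa using this
    have h2 := prim_mono hfin (openInterval_subset_closedI hm) hb hmb.le
    have h3 := prim_mono hfin hc' hd hcd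
    linarith

end Prim

/-- A decreasing function with finite primitive and a weight, the objects of which level intervals
are considered. -/
structure LevelPair (γ : ℝ≥0∞) (w : ℝ → ℝ) (g : ℝ → ℝ≥0∞) : Prop where
  weight : IsWeight γ w
  anti : Antitone g
  fin : ∀ t ∈ closedI γ, intOver g 0 (ENNReal.ofReal t) ≠ ⊤

theorem IsWeight.pos (hw : IsWeight γ w) : 0 < γ := by
  obtain ⟨s, hs, -⟩ := hw.exists_pos
  exact zero_le.trans_lt hs.2

/-- The primitive of the weight. -/
noncomputable abbrev wprim (w : ℝ → ℝ) : ℝ → ℝ := prim fun s => ENNReal.ofReal (w s)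

theorem IsWeight.fin {γ : ℝ≥0∞} {w : ℝ → ℝ} (hw : IsWeight γ w) : ∀ t ∈ closedI γ,
    intOver (fun s => ENNReal.ofReal (w s)) 0 (ENNReal.ofReal t) ≠ ⊤ := fun _ ht =>
  (hw.intOver_lt_top ht.2 ENNReal.ofReal_lt_top).ne

theorem IsWeight.antitoneOn_ofReal {γ : ℝ≥0∞} {w : ℝ → ℝ} (hw : IsWeight γ w) :
    AntitoneOn (fun s => ENNReal.ofReal (w s)) (openInterval 0 γ) := fun _ hx _ hy hxy =>
  ENNReal.ofReal_le_ofReal (hw.antitone hx hy hxy)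

theorem IsWeight.wprim_pos {γ : ℝ≥0∞} {w : ℝ → ℝ} (hw : IsWeight γ w) {t : ℝ} (ht0 : 0 < t)
    (ht : t ∈ closedI γ) : 0 < wprim w t := by
  obtain ⟨s, hs, hws⟩ := hw.exists_pos
  have h1 := hw.mul_le_intOver hs t
  rw [← ofReal_prim hw.fin ht] at h1
  exact ENNReal.ofReal_pos.1 (lt_of_lt_of_le (ENNReal.ofReal_pos.2
    (mul_pos hws (lt_min ht0 (mem_openInterval_zero.1 hs).1))) h1)

namespace LevelPair

variable {γ : ℝ≥0∞} {w : ℝ → ℝ} {g : ℝ → ℝ≥0∞}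

theorem levelData (h : LevelPair γ w g) : LevelData (closedI γ) (prim g) (wprim w) where
  ordConnected := ordConnected_closedI
  contF := continuousOn_prim h.fin
  contW := continuousOn_prim h.weight.fin
  monoF := prim_mono h.fin
  monoW := prim_mono h.weight.fin
  flat _ _ _ hc hb hd hcb heq hcd :=
    prim_flat h.weight.fin h.weight.antitoneOn_ofReal hc.1 hb hd hcb heq hcd

theorem ne_top (h : LevelPair γ w g) {t : ℝ} (ht : t ∈ openInterval 0 γ) : g t ≠ ⊤ := by
  intro htop
  have ht' := mem_openInterval_zero.1 ht
  refine h.fin t (openInterval_subset_closedI ht) (top_le_iff.1 ?_)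
  calc (⊤ : ℝ≥0∞) = ∫⁻ _ in Set.Ioo 0 t, ⊤ := by
        rw [setLIntegral_const, Real.volume_Ioo, ENNReal.top_mul]
        simpa using ht'.1
    _ ≤ _ := by
        rw [intOver, openInterval_zero_ofReal]
        exact setLIntegral_mono' measurableSet_Ioo fun s hs => htop ▸ h.anti hs.2.le

theorem average_eq (h : LevelPair γ w g) {a b : ℝ} (ha : 0 ≤ a) (hab : a ≤ b)
    (hb : b ∈ closedI γ) : average w g (ENNReal.ofReal a) (ENNReal.ofReal b) =
      ENNReal.ofReal (prim g b - prim g a) / ENNReal.ofReal (wprim w b - wprim w a) := by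
  rw [average, if_neg ENNReal.ofReal_ne_top, intOver_eq_ofReal h.fin ha hab hb,
    intOver_eq_ofReal h.weight.fin ha hab hb]

theorem average_eq_ofReal (h : LevelPair γ w g) {a b : ℝ} (ha : 0 ≤ a) (hab : a ≤ b)
    (hb : b ∈ closedI γ) (hw : wprim w a < wprim w b) :
    average w g (ENNReal.ofReal a) (ENNReal.ofReal b) =
      ENNReal.ofReal ((prim g b - prim g a) / (wprim w b - wprim w a)) := by
  rw [h.average_eq ha hab hb, ENNReal.ofReal_div_of_pos (sub_pos.2 hw)]

/-- Level intervals with finite end points, in terms of the primitives. Intervals on which the weight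
vanishes are excluded here. -/
theorem isLevelInterval_iff (h : LevelPair γ w g) {a b : ℝ} (ha : 0 ≤ a) (hab : a < b) (hb : b ∈ closedI γ)
    (hw : wprim w a < wprim w b) :
    IsLevelInterval γ w g (ENNReal.ofReal a) (ENNReal.ofReal b) ↔
      Lev (prim g) (wprim w) ((prim g b - prim g a) / (wprim w b - wprim w a)) a b := by
  have hpos := sub_pos.2 hw
  have hmem : ∀ t, a < t → t ≤ b → t ∈ closedI γ := fun t h1 h2 =>
    mem_closedI_of_le (ha.trans h1.le) h2 hb
  have hWt : ∀ t, a < t → t ≤ b → wprim w a < wprim w t := fun t h1 h2 =>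
    h.levelData.lt_of_lt' (mem_closedI_of_le ha hab.le hb) hb (hmem t h1 h2) hw h1
  have hFab : 0 ≤ prim g b - prim g a :=
    sub_nonneg.2 (prim_mono h.fin (mem_closedI_of_le ha hab.le hb) hb hab.le)
  have key : ∀ t, a < t → t ≤ b →
      (average w g (ENNReal.ofReal a) (ENNReal.ofReal t) ≤
        average w g (ENNReal.ofReal a) (ENNReal.ofReal b) ↔
      prim g t - prim g a ≤
        (prim g b - prim g a) / (wprim w b - wprim w a) * (wprim w t - wprim w a)) := by
    intro t h1 h2
    rw [h.average_eq_ofReal ha h1.le (hmem t h1 h2) (hWt t h1 h2),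
      h.average_eq_ofReal ha hab.le hb hw, ENNReal.ofReal_le_ofReal_iff
        (div_nonneg hFab hpos.le), div_le_iff₀ (sub_pos.2 (hWt t h1 h2))]
  constructor
  · rintro ⟨-, -, hlev⟩
    refine ⟨hab, hw, (div_mul_cancel₀ _ hpos.ne').symm, fun t h1 h2 => ?_⟩
    rcases h1.eq_or_lt with rfl | h1
    · simp
    · exact (key t h1 h2).1 (hlev _ ((ENNReal.ofReal_lt_ofReal_iff (ha.trans_lt h1)).2 h1)
        (ENNReal.ofReal_le_ofReal h2))
  · intro hlev
    refine ⟨(ENNReal.ofReal_lt_ofReal_iff (ha.trans_lt hab)).2 hab, hb.2, fun t h1 h2 => ?_⟩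
    have htop : t ≠ ⊤ := (h2.trans_lt ENNReal.ofReal_lt_top).ne
    rw [← ENNReal.ofReal_toReal htop] at h1 h2 ⊢
    have h1' := (ENNReal.ofReal_lt_ofReal_iff_of_nonneg ha).1 h1
    have h2' := (ENNReal.ofReal_le_ofReal_iff (ha.trans hab.le)).1 h2
    exact (key _ h1' h2').2 (hlev.le _ h1'.le h2')

theorem isLevelInterval_of_lev (h : LevelPair γ w g) {l a b : ℝ} (ha : 0 ≤ a) (hb : b ∈ closedI γ)
    (hlev : Lev (prim g) (wprim w) l a b) :
    IsLevelInterval γ w g (ENNReal.ofReal a) (ENNReal.ofReal b) := by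
  rw [h.isLevelInterval_iff ha hlev.lt hb hlev.wlt, hlev.eq,
    mul_div_cancel_right₀ _ (sub_pos.2 hlev.wlt).ne']
  exact hlev

/-- A maximal level interval with finite end points that carries mass of the weight. -/
theorem maxLev_of_isMaximal (h : LevelPair γ w g) {a b : ℝ} (ha : 0 ≤ a) (hb : b ∈ closedI γ)
    (hw : wprim w a < wprim w b)
    (hmax : IsMaximalLevelInterval γ w g (ENNReal.ofReal a) (ENNReal.ofReal b)) :
    MaxLev (prim g) (wprim w) (closedI γ)
      ((prim g b - prim g a) / (wprim w b - wprim w a)) a b := by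
  have hlev := (h.isLevelInterval_iff ha
    ((ENNReal.ofReal_lt_ofReal_iff_of_nonneg ha).1 hmax.1.1) hb hw).1 hmax.1
  refine ⟨mem_closedI_of_le ha hlev.lt.le hb, hb, hlev, fun l' a' b' ha' hb' hlev' h1 h2 => ?_⟩
  obtain ⟨h3, h4⟩ := hmax.2 _ _ (h.isLevelInterval_of_lev ha'.1 hb' hlev')
    (ENNReal.ofReal_le_ofReal h1) (ENNReal.ofReal_le_ofReal h2)
  exact ⟨(ENNReal.ofReal_eq_ofReal_iff ha'.1 ha).1 h3,
    (ENNReal.ofReal_eq_ofReal_iff hb'.1 hb.1).1 h4⟩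

theorem eq_zero_of_prim_eq (h : LevelPair γ w g) {c b t : ℝ} (hc : 0 ≤ c) (hb : b ∈ closedI γ)
    (heq : prim g c = prim g b) (hct : c < t) (htb : t < b) : g t = 0 :=
  OrliczLorentz.eq_zero_of_prim_eq h.fin (h.anti.antitoneOn _) hc hb heq hct htb

theorem prim_lt (h : LevelPair γ w g) {a t b : ℝ} (ha : 0 ≤ a) (hat : a < t) (hb : b ∈ closedI γ)
    (htb : t ≤ b) (hg : g t ≠ 0) : prim g a < prim g b := by
  have ht := mem_closedI_of_le (ha.trans hat.le) htb hb
  refine lt_of_lt_of_le ?_ (prim_mono h.fin ht hb htb)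
  refine (prim_mono h.fin (mem_closedI_of_le ha hat.le ht) ht hat.le).lt_of_ne fun heq => hg ?_
  obtain ⟨m, h1, h2⟩ := exists_between hat
  have h0 := h.eq_zero_of_prim_eq ha ht heq h1 h2
  exact le_antisymm (h0 ▸ h.anti h2.le) zero_le

/-- On a level interval the function is at most the multiple of the weight to its left, and at
least the multiple of the weight to its right. -/
theorem le_mul_of_lev (h : LevelPair γ w g) {l a b t s : ℝ} (hl : 0 ≤ l) (ha : a ∈ closedI γ)
    (hb : b ∈ closedI γ) (hlev : Lev (prim g) (wprim w) l a b) (hat : a < t) (htb : t < b)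
    (hs : s ∈ openInterval 0 γ) (hsa : s ≤ a) : g t ≤ ENNReal.ofReal (l * w s) := by
  have ht : t ∈ openInterval 0 γ := mem_openInterval_of_closedI (ha.1.trans_lt hat) htb hb
  have ht' := openInterval_subset_closedI ht
  have hg := h.ne_top ht
  have h1 : (g t).toReal * (t - a) ≤ prim g t - prim g a :=
    le_prim_sub h.fin ha.1 hat.le ht' ENNReal.toReal_nonneg fun x hx => by
      rw [ENNReal.ofReal_toReal hg]
      exact h.anti hx.2.le
  have h2 : wprim w t - wprim w a ≤ w s * (t - a) :=
    prim_sub_le h.weight.fin ha.1 hat.le ht' (h.weight.nonneg s hs) fun x hx =>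
      h.weight.antitoneOn_ofReal hs
        (mem_openInterval_of_closedI (ha.1.trans_lt hx.1) hx.2 ht') (hsa.trans hx.1.le)
  have h3 := hlev.le t hat.le htb.le
  rw [← ENNReal.ofReal_toReal hg]
  refine ENNReal.ofReal_le_ofReal (le_of_mul_le_mul_right ?_ (sub_pos.2 hat))
  nlinarith [mul_le_mul_of_nonneg_left h2 hl]

theorem mul_le_of_lev (h : LevelPair γ w g) {l a b t s : ℝ} (hl : 0 ≤ l) (ha : a ∈ closedI γ)
    (hb : b ∈ closedI γ) (hlev : Lev (prim g) (wprim w) l a b) (hat : a < t) (htb : t < b)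
    (hs : s ∈ openInterval 0 γ) (hbs : b ≤ s) : ENNReal.ofReal (l * w s) ≤ g t := by
  have ht : t ∈ openInterval 0 γ := mem_openInterval_of_closedI (ha.1.trans_lt hat) htb hb
  have ht' := mem_openInterval_zero.1 ht
  have hg := h.ne_top ht
  have h1 : prim g b - prim g t ≤ (g t).toReal * (b - t) :=
    prim_sub_le h.fin ht'.1.le htb.le hb ENNReal.toReal_nonneg fun x hx => by
      rw [ENNReal.ofReal_toReal hg]
      exact h.anti hx.1.le
  have h2 : w s * (b - t) ≤ wprim w b - wprim w t :=
    le_prim_sub h.weight.fin ht'.1.le htb.le hb (h.weight.nonneg s hs) fun x hx =>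
      h.weight.antitoneOn_ofReal (mem_openInterval_of_closedI (ht'.1.trans hx.1) hx.2 hb) hs
        (hx.2.le.trans hbs)
  have h3 := hlev.ge hat.le htb.le
  rw [← ENNReal.ofReal_toReal hg]
  refine ENNReal.ofReal_le_ofReal (le_of_mul_le_mul_right ?_ (sub_pos.2 htb))
  nlinarith [mul_le_mul_of_nonneg_left h2 hl]

end LevelPair

/-! ### The slopes of the concave majorant and the level function -/

theorem IsWeight.tendsto_wprim {w : ℝ → ℝ} (hw : IsWeight ⊤ w) :
    Tendsto (wprim w) atTop atTop := by
  have hmem : ∀ t : ℝ, 0 ≤ t → t ∈ closedI ⊤ := fun t ht => ⟨ht, le_top⟩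
  refine tendsto_atTop.2 fun c => ?_
  obtain ⟨n, hn⟩ := (hw.tendsto_intOver.eventually
    (lt_mem_nhds (ENNReal.ofReal_lt_top (r := c)))).exists
  rw [← ofReal_prim hw.fin (hmem n n.cast_nonneg)] at hn
  filter_upwards [eventually_ge_atTop (n : ℝ)] with t ht
  have h1 : c < wprim w n := (ENNReal.ofReal_lt_ofReal_iff' .. |>.1 hn).1
  exact h1.le.trans (prim_mono hw.fin (hmem n n.cast_nonneg)
    (hmem t (n.cast_nonneg.trans ht)) ht)

theorem IsSlopeOn.nonneg {E : Set ℝ} {F W : ℝ → ℝ} {t m a b : ℝ} (h : LevelData E F W)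
    (hs : IsSlopeOn E F W t m a b) : 0 ≤ m := by
  have ha := hs.left_mem
  rcases hs.cases with ⟨rfl, rfl, -, s, hs', hlt⟩ | ⟨h1, h2, hm⟩
  · have hle : b ≤ s := le_of_lt (lt_of_not_ge fun hsa => (h.monoW hs' ha hsa).not_gt hlt)
    have h1 := hs.right s hs' hle
    have h2 := h.monoF ha hs' hle
    exact nonneg_of_mul_nonneg_left (by linarith) (sub_pos.2 hlt)
  · have h3 := h.monoF ha hs.right_mem hm.lev.lt.le
    have h4 := hm.lev.eq
    exact nonneg_of_mul_nonneg_left (by linarith) (sub_pos.2 hm.lev.wlt)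

open Classical in
/-- The slope of the concave majorant of the primitive of `g`, and `0` where there is none. -/
noncomputable def slope (γ : ℝ≥0∞) (w : ℝ → ℝ) (g : ℝ → ℝ≥0∞) (t : ℝ) : ℝ :=
  if h : ∃ m a b, IsSlopeOn (closedI γ) (prim g) (wprim w) t m a b then h.choose else 0

namespace LevelPair

variable {γ : ℝ≥0∞} {w : ℝ → ℝ} {g : ℝ → ℝ≥0∞}

theorem slope_spec {t : ℝ} (ht : ∃ m a b, IsSlopeOn (closedI γ) (prim g) (wprim w) t m a b) :
    ∃ a b, IsSlopeOn (closedI γ) (prim g) (wprim w) t (slope γ w g t) a b := by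
  rw [slope, dif_pos ht]
  exact ht.choose_spec

theorem slope_nonneg (h : LevelPair γ w g) (t : ℝ) : 0 ≤ slope γ w g t := by
  by_cases ht : ∃ m a b, IsSlopeOn (closedI γ) (prim g) (wprim w) t m a b
  · obtain ⟨a, b, hs⟩ := slope_spec ht
    exact hs.nonneg h.levelData
  · rw [slope, dif_neg ht]

/-- If the averages of `g` vanish at infinity, the level intervals with positive average around a
given one are bounded. -/
theorem exists_bound (h : LevelPair γ w g)
    (hvan : γ = ⊤ → Tendsto (fun t => prim g t / wprim w t) atTop (nhds 0)) {l a b : ℝ}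
    (ha : a ∈ closedI γ) (hb : b ∈ closedI γ) (hlev : Lev (prim g) (wprim w) l a b) (hl : 0 < l) :
    ∃ q ∈ closedI γ, ∀ l' a' b', a' ∈ closedI γ → b' ∈ closedI γ → a' ≤ a → b ≤ b' →
      Lev (prim g) (wprim w) l' a' b' → 0 ≤ a' ∧ b' ≤ q := by
  rcases eq_or_ne γ ⊤ with rfl | hγ
  swap
  · refine ⟨γ.toReal, ⟨ENNReal.toReal_nonneg, (ENNReal.ofReal_toReal hγ).le⟩,
      fun l' a' b' ha' hb' _ _ _ => ⟨ha'.1, ?_⟩⟩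
    exact (ENNReal.ofReal_le_iff_le_toReal hγ).1 hb'.2
  set δ := prim g b - prim g a with hδ
  have hδ0 : 0 < δ := by
    rw [hδ, hlev.eq]
    exact mul_pos hl (sub_pos.2 hlev.wlt)
  have hWa0 : 0 ≤ wprim w a := ENNReal.toReal_nonneg
  have hWb : 0 < wprim w b := hWa0.trans_lt hlev.wlt
  have hκ : 0 < δ / wprim w b := by positivity
  have h1 : ∀ᶠ t in atTop, prim g t / wprim w t < δ / wprim w b / 2 :=
    (hvan rfl).eventually (gt_mem_nhds (half_pos hκ))
  have h2 : ∀ᶠ t in atTop, 2 * wprim w a + 1 ≤ wprim w t :=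
    h.weight.tendsto_wprim.eventually_ge_atTop _
  obtain ⟨q, hq⟩ := (h1.and h2).exists_forall_of_atTop
  refine ⟨max q 0, ⟨le_max_right _ _, le_top⟩, fun l' a' b' ha' hb' haa hbb hlev' => ⟨ha'.1, ?_⟩⟩
  by_contra hcon
  push Not at hcon
  obtain ⟨h3, h4⟩ := hq b' ((le_max_left _ _).trans hcon.le)
  rw [div_lt_iff₀ (by linarith)] at h3
  have h5 := hlev'.le b (haa.trans hlev.lt.le) hbb
  have h6 := prim_mono h.fin ha' ha haa
  have h7 := prim_mono h.weight.fin ha' ha haa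
  have h8 := hlev'.eq
  have h9 : 0 ≤ prim g a' := ENNReal.toReal_nonneg
  have h10 : 0 ≤ wprim w a' := ENNReal.toReal_nonneg
  have h11 : δ / wprim w b ≤ l' := by
    have hl' : 0 < l' := by
      by_contra hcon'
      nlinarith [hlev.wlt, not_lt.1 hcon']
    rw [div_le_iff₀ hWb]
    nlinarith
  have h12 : δ / wprim w b * (wprim w b' - wprim w a') ≤ l' * (wprim w b' - wprim w a') :=
    mul_le_mul_of_nonneg_right h11 (sub_nonneg.2 hlev'.wlt.le)
  nlinarith

/-- Where the concave majorant has no slope, `g` vanishes from there on. -/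
theorem exists_slope_or_flat (h : LevelPair γ w g)
    (hvan : γ = ⊤ → Tendsto (fun t => prim g t / wprim w t) atTop (nhds 0)) {t : ℝ}
    (ht : t ∈ openInterval 0 γ) :
    (∃ m a b, IsSlopeOn (closedI γ) (prim g) (wprim w) t m a b) ∨
      ((∀ e ∈ closedI γ, t ≤ e → prim g e = prim g t) ∧ ∀ l a b, a ∈ closedI γ → b ∈ closedI γ →
        Lev (prim g) (wprim w) l a b → a < t → t < b → l ≤ 0) := by
  have hd := h.levelData
  have ht' := openInterval_subset_closedI ht
  have ht0 := (mem_openInterval_zero.1 ht).1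
  by_cases hpos : ∃ l a b, a ∈ closedI γ ∧ b ∈ closedI γ ∧ Lev (prim g) (wprim w) l a b ∧
      a < t ∧ t < b ∧ 0 < l
  · obtain ⟨l, a, b, ha, hb, hlev, hat, htb, hl⟩ := hpos
    obtain ⟨q, hq, hbd⟩ := h.exists_bound hvan ha hb hlev hl
    obtain ⟨l', a', b', h1, h2, hm⟩ := hd.exists_maxLev zero_mem_closedI hq ha hb hlev hbd
    exact Or.inl ⟨_, _, _, hd.isSlopeOn_of_maxLev hm (h1.trans_lt hat) (htb.trans_le h2)⟩
  push Not at hpos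
  by_cases hint : NotInterior (closedI γ) (prim g) (wprim w) t
  · by_cases hs : ∃ s ∈ closedI γ, wprim w t < wprim w s
    · obtain ⟨s, hs, hts⟩ := hs
      obtain ⟨m, -, hm⟩ := hd.exists_slope_of_notInterior ht' hint zero_mem_closedI ht0 hs hts
      exact Or.inl ⟨_, _, _, hm⟩
    · push Not at hs
      refine Or.inr ⟨fun e he hte => ?_, fun l a b ha hb hlev hat htb =>
        absurd ⟨hat, htb⟩ (hint l a b ha hb hlev)⟩
      refine le_antisymm (not_lt.1 fun hlt => ?_) (prim_mono h.fin ht' he hte)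
      have hte' : t < e := hte.lt_of_ne (by rintro rfl; exact hlt.false)
      have hWt := h.weight.wprim_pos ht0 ht'
      have hWe := le_antisymm (hs e he) (prim_mono h.weight.fin ht' he hte)
      obtain ⟨a, b, ha, hb, -, hat, htb, -, hlev⟩ := hd.exists_lev
        (l := (prim g t + 1) / wprim w t) zero_mem_closedI he ht0 hte'
        (by
          have h1 : wprim w 0 = 0 := prim_zero
          rw [div_mul_cancel₀ _ hWt.ne', h1, prim_zero]
          linarith)
        (by rw [hWe]; linarith)
      exact hint _ a b ha hb hlev ⟨hat, htb⟩
  · unfold NotInterior at hint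
    push Not at hint
    obtain ⟨l, a, b, ha, hb, hlev, hat, htb⟩ := hint
    refine Or.inr ⟨fun e he hte => ?_, hpos⟩
    have hl := hpos l a b ha hb hlev hat htb
    have heq : prim g a = prim g b := by
      have h1 := prim_mono h.fin ha hb hlev.lt.le
      have h2 := hlev.eq
      nlinarith [hlev.wlt]
    rw [prim_flat h.fin (h.anti.antitoneOn _) ha.1 hb he hlev.lt heq (hat.le.trans hte),
      prim_flat h.fin (h.anti.antitoneOn _) ha.1 hb ht' hlev.lt heq hat.le]

theorem slope_antitoneOn (h : LevelPair γ w g)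
    (hvan : γ = ⊤ → Tendsto (fun t => prim g t / wprim w t) atTop (nhds 0)) :
    AntitoneOn (slope γ w g) (openInterval 0 γ) := by
  intro t ht t' ht' htt
  rcases htt.eq_or_lt with rfl | htt
  · exact le_rfl
  by_cases hs' : ∃ m a b, IsSlopeOn (closedI γ) (prim g) (wprim w) t' m a b
  swap
  · rw [slope, dif_neg hs']
    exact h.slope_nonneg t
  obtain ⟨a', b', hm'⟩ := slope_spec hs'
  rcases h.exists_slope_or_flat hvan ht with hs | ⟨hflat, hlev⟩
  · obtain ⟨a, b, hm⟩ := slope_spec hs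
    exact h.levelData.slope_anti htt hm hm'
  · refine le_trans ?_ (h.slope_nonneg t)
    have hcl := openInterval_subset_closedI ht
    have hcl' := openInterval_subset_closedI ht'
    rcases hm'.cases with ⟨rfl, rfl, -, z, hz, hlt⟩ | ⟨h1, h2, hmax⟩
    · have h3 := hm'.left t hcl htt.le
      rw [hflat b' hcl' htt.le, sub_self] at h3
      have h4 := h.levelData.lt_of_lt hcl hcl' hz htt hlt
      nlinarith
    · rcases lt_or_ge a' t with hat | hta
      · exact hlev _ _ _ hmax.left_mem hmax.right_mem hmax.lev hat (htt.trans h2)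
      · have h3 := hmax.lev.eq
        rw [hflat _ hmax.right_mem (htt.trans h2).le, hflat _ hmax.left_mem hta] at h3
        nlinarith [hmax.lev.wlt]

theorem slope_eq_of_maxLev (h : LevelPair γ w g) {l a b t : ℝ}
    (hm : MaxLev (prim g) (wprim w) (closedI γ) l a b) (hat : a < t) (htb : t < b) :
    slope γ w g t = l := by
  obtain ⟨a', b', hs⟩ := slope_spec ⟨_, _, _, h.levelData.isSlopeOn_of_maxLev hm hat htb⟩
  rcases hs.cases with ⟨-, -, hn, -⟩ | ⟨h1, h2, hm'⟩
  · exact absurd ⟨hat, htb⟩ (hn _ _ _ hm.left_mem hm.right_mem hm.lev)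
  · rcases h.levelData.disjoint hm hm' with h3 | h3 | h3
    · linarith
    · linarith
    · exact h3.2.2.symm

/-- Off the maximal level intervals, the slope is the quotient of the functions. -/
theorem eq_slope_mul (h : LevelPair γ w g)
    (hvan : γ = ⊤ → Tendsto (fun t => prim g t / wprim w t) atTop (nhds 0)) {t : ℝ}
    (ht : t ∈ openInterval 0 γ) (hcont : ContinuousAt g t)
    (hno : ∀ l a b, MaxLev (prim g) (wprim w) (closedI γ) l a b → ¬ (a < t ∧ t < b)) :
    g t = ENNReal.ofReal (slope γ w g t * w t) := by
  have ht' := openInterval_subset_closedI ht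
  have htt := mem_openInterval_zero.1 ht
  have hleft : Tendsto g (nhdsWithin t (Set.Iio t)) (nhds (g t)) := hcont.continuousWithinAt
  have hright : Tendsto g (nhdsWithin t (Set.Ioi t)) (nhds (g t)) := hcont.continuousWithinAt
  have hevl : ∀ᶠ r in nhdsWithin t (Set.Iio t), 0 < r ∧ r < t := by
    filter_upwards [self_mem_nhdsWithin, mem_nhdsWithin_of_mem_nhds (Ioi_mem_nhds htt.1)] with r h1 h2
    exact ⟨h2, h1⟩
  have hevr : ∀ᶠ s in nhdsWithin t (Set.Ioi t), t < s ∧ ENNReal.ofReal s < γ := by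
    have := (ENNReal.continuous_ofReal.tendsto t).eventually (gt_mem_nhds htt.2)
    filter_upwards [self_mem_nhdsWithin, mem_nhdsWithin_of_mem_nhds this] with s h1 h2
    exact ⟨h1, h2⟩
  by_cases hs : ∃ m a b, IsSlopeOn (closedI γ) (prim g) (wprim w) t m a b
  · obtain ⟨a, b, hm⟩ := slope_spec hs
    have hm0 := h.slope_nonneg t
    set m := slope γ w g t
    rcases hm.cases with ⟨rfl, rfl, -⟩ | ⟨h1, h2, hmax⟩
    swap
    · exact absurd ⟨h1, h2⟩ (hno _ _ _ hmax)
    have hwa := h.weight.nonneg b ht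
    refine le_antisymm ?_ ?_
    · refine le_of_tendsto hright (hevr.mono fun s hs => ?_)
      have hs' : s ∈ openInterval 0 γ := mem_openInterval_zero.2 ⟨htt.1.trans hs.1, hs.2⟩
      have hcs := openInterval_subset_closedI hs'
      have hg := h.ne_top hs'
      have h1 := hm.right s hcs hs.1.le
      have h2 : (g s).toReal * (s - b) ≤ prim g s - prim g b :=
        le_prim_sub h.fin htt.1.le hs.1.le hcs ENNReal.toReal_nonneg fun x hx => by
          rw [ENNReal.ofReal_toReal hg]
          exact h.anti hx.2.le
      have h3 : wprim w s - wprim w b ≤ w b * (s - b) :=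
        prim_sub_le h.weight.fin htt.1.le hs.1.le hcs hwa fun x hx =>
          h.weight.antitoneOn_ofReal ht
            (mem_openInterval_of_closedI (htt.1.trans hx.1) hx.2 hcs) hx.1.le
      rw [← ENNReal.ofReal_toReal hg]
      refine ENNReal.ofReal_le_ofReal (le_of_mul_le_mul_right ?_ (sub_pos.2 hs.1))
      nlinarith [mul_le_mul_of_nonneg_left h3 hm0]
    · refine ge_of_tendsto hleft (hevl.mono fun r hr => ?_)
      have hr' : r ∈ openInterval 0 γ := mem_openInterval_of_closedI hr.1 hr.2 ht'
      have hg := h.ne_top hr'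
      have h1 := hm.left r (openInterval_subset_closedI hr') hr.2.le
      have h2 : prim g b - prim g r ≤ (g r).toReal * (b - r) :=
        prim_sub_le h.fin hr.1.le hr.2.le ht' ENNReal.toReal_nonneg fun x hx => by
          rw [ENNReal.ofReal_toReal hg]
          exact h.anti hx.1.le
      have h3 : w b * (b - r) ≤ wprim w b - wprim w r :=
        le_prim_sub h.weight.fin hr.1.le hr.2.le ht' hwa fun x hx =>
          h.weight.antitoneOn_ofReal
            (mem_openInterval_of_closedI (hr.1.trans hx.1) hx.2 ht') ht hx.2.le
      rw [← ENNReal.ofReal_toReal hg]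
      refine ENNReal.ofReal_le_ofReal (le_of_mul_le_mul_right ?_ (sub_pos.2 hr.2))
      nlinarith [mul_le_mul_of_nonneg_left h3 hm0]
  · rw [slope, dif_neg hs, zero_mul, ENNReal.ofReal_zero]
    have hflat := ((h.exists_slope_or_flat hvan ht).resolve_left hs).1
    refine le_antisymm (le_of_tendsto hright (hevr.mono fun s hs => ?_)) zero_le
    have hs' : s ∈ openInterval 0 γ := mem_openInterval_zero.2 ⟨htt.1.trans hs.1, hs.2⟩
    obtain ⟨e, he1, he2⟩ : ∃ e ∈ closedI γ, s < e := by
      obtain ⟨x, hx1, hx2⟩ := exists_between hs.2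
      refine ⟨x.toReal, ⟨ENNReal.toReal_nonneg, ?_⟩, ?_⟩
      · rw [ENNReal.ofReal_toReal (hx2.trans_le le_top).ne]
        exact hx2.le
      · rwa [← ENNReal.ofReal_lt_iff_lt_toReal (htt.1.trans hs.1).le (hx2.trans_le le_top).ne]
    exact (h.eq_zero_of_prim_eq htt.1.le he1 (hflat e he1 (hs.1.trans he2).le).symm hs.1 he2).le

/-- If the averages of `g` vanish at infinity, so does the average over each half-line. -/
theorem average_top (h : LevelPair ⊤ w g)
    (hvan : Tendsto (fun t => prim g t / wprim w t) atTop (nhds 0)) {a : ℝ} (ha : 0 ≤ a) :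
    average w g (ENNReal.ofReal a) ⊤ = 0 := by
  rw [average, if_pos rfl]
  refine Tendsto.limsup_eq ?_
  have hmem : ∀ t : ℝ, 0 ≤ t → t ∈ closedI ⊤ := fun t ht => ⟨ht, le_top⟩
  have h0 : Tendsto (fun t => ENNReal.ofReal (2 * (prim g t / wprim w t))) atTop (nhds 0) := by
    rw [← ENNReal.ofReal_zero]
    exact ENNReal.tendsto_ofReal (by simpa using hvan.const_mul 2)
  refine tendsto_of_tendsto_of_tendsto_of_le_of_le' tendsto_const_nhds h0
    (Eventually.of_forall fun _ => zero_le) ?_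
  filter_upwards [h.weight.tendsto_wprim.eventually_ge_atTop (2 * wprim w a + 1),
    eventually_ge_atTop a] with t h1 h2
  have h3 : 0 ≤ wprim w a := ENNReal.toReal_nonneg
  have h4 : 0 ≤ prim g a := ENNReal.toReal_nonneg
  have h5 : 0 ≤ prim g t := ENNReal.toReal_nonneg
  have h6 : 0 < wprim w t := by linarith
  rw [intOver_eq_ofReal h.fin ha h2 (hmem t (ha.trans h2)),
    intOver_eq_ofReal h.weight.fin ha h2 (hmem t (ha.trans h2)),
    ← ENNReal.ofReal_div_of_pos (by linarith)]
  refine ENNReal.ofReal_le_ofReal ?_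
  rw [div_le_iff₀ (by linarith), ← mul_div_assoc, div_mul_eq_mul_div, le_div_iff₀ h6]
  nlinarith

/-- If `g` has average `0` over a level interval `(a, ∞]`, then it has no mass beyond `a`. -/
theorem prim_eq_of_level_top (h : LevelPair ⊤ w g) {a : ℝ} (ha : 0 ≤ a)
    (hlev : IsLevelInterval ⊤ w g (ENNReal.ofReal a) ⊤)
    (h0 : average w g (ENNReal.ofReal a) ⊤ = 0) {t : ℝ} (hat : a ≤ t) : prim g t = prim g a := by
  have hmem : ∀ t : ℝ, 0 ≤ t → t ∈ closedI ⊤ := fun t ht => ⟨ht, le_top⟩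
  rcases hat.eq_or_lt with rfl | hat
  · rfl
  have ht := hmem t (ha.trans hat.le)
  have h1 := hlev.2.2 (ENNReal.ofReal t) ((ENNReal.ofReal_lt_ofReal_iff (ha.trans_lt hat)).2 hat)
    le_top
  rw [h0, h.average_eq ha hat.le ht, nonpos_iff_eq_zero, ENNReal.div_eq_zero_iff] at h1
  have h2 := ENNReal.ofReal_eq_zero.1 (h1.resolve_right ENNReal.ofReal_ne_top)
  have h3 := prim_mono h.fin (hmem a ha) ht hat.le
  linarith

/-- The level function is the product of the slope of the concave majorant and the weight. -/
theorem levelFunction_eq (h : LevelPair γ w g)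
    (hvan : γ = ⊤ → Tendsto (fun t => prim g t / wprim w t) atTop (nhds 0)) {t : ℝ}
    (ht : t ∈ openInterval 0 γ) (hcont : ContinuousAt g t) :
    levelFunction γ w g t = ENNReal.ofReal (slope γ w g t) * ENNReal.ofReal (w t) := by
  have ht' := openInterval_subset_closedI ht
  have htt := mem_openInterval_zero.1 ht
  rw [← ENNReal.ofReal_mul (h.slope_nonneg t)]
  -- beyond the left end point of a level interval that reaches to infinity everything vanishes
  have htop : γ = ⊤ → ∀ a : ℝ, 0 ≤ a → a < t → IsLevelInterval γ w g (ENNReal.ofReal a) ⊤ →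
      g t = 0 ∧ ∀ l c d, MaxLev (prim g) (wprim w) (closedI γ) l c d → c < t → t < d → l = 0 := by
    rintro rfl a ha hat hlev
    have hflat : ∀ s, a ≤ s → prim g s = prim g a := fun s hs =>
      h.prim_eq_of_level_top ha hlev (h.average_top (hvan rfl) ha) hs
    have hmem : ∀ t : ℝ, 0 ≤ t → t ∈ closedI ⊤ := fun t ht => ⟨ht, le_top⟩
    refine ⟨h.eq_zero_of_prim_eq ha (hmem (t + 1) (by linarith))
      (hflat (t + 1) (by linarith)).symm hat (by linarith), fun l c d hm hct htd => ?_⟩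
    have hl0 : 0 ≤ l := (h.levelData.isSlopeOn_of_maxLev hm hct htd).nonneg h.levelData
    have hd := hm.lev.eq
    rcases le_total a c with hac | hca
    · rw [hflat c hac, hflat d (by linarith), sub_self] at hd
      exact (mul_eq_zero.1 hd.symm).resolve_right (sub_pos.2 hm.lev.wlt).ne'
    · have h1 := hm.lev.le a hca (by linarith)
      rw [← hflat d (by linarith), hd] at h1
      have h2 : wprim w a < wprim w d := by
        have had : a < d := hat.trans htd
        refine (prim_mono h.weight.fin (hmem a ha) hm.right_mem had.le).lt_of_ne fun heq => ?_
        obtain ⟨e, h3, h4⟩ := ((h.weight.tendsto_wprim.eventually_gt_atTop (wprim w a)).and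
          (eventually_ge_atTop a)).exists
        exact h3.ne' (h.levelData.flat a d e (hmem a ha) hm.right_mem (hmem e (ha.trans h4)) had
          heq h4)
      nlinarith
  have hmax : ∀ l a b, MaxLev (prim g) (wprim w) (closedI γ) l a b → a < t → t < b →
      slope γ w g t = l := fun l a b hm h1 h2 => h.slope_eq_of_maxLev hm h1 h2
  have hzero : g t = 0 → (∀ l c d, MaxLev (prim g) (wprim w) (closedI γ) l c d → c < t → t < d →
      l = 0) → ENNReal.ofReal (slope γ w g t * w t) = 0 := by
    intro h1 h2
    by_cases hno : ∀ l a b, MaxLev (prim g) (wprim w) (closedI γ) l a b → ¬ (a < t ∧ t < b)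
    · rw [← h.eq_slope_mul hvan ht hcont hno, h1]
    · push Not at hno
      obtain ⟨l, a, b, hm, h3, h4⟩ := hno
      rw [hmax l a b hm h3 h4, h2 l a b hm h3 h4, zero_mul, ENNReal.ofReal_zero]
  by_cases hex : ∃ p : ℝ≥0∞ × ℝ≥0∞,
      IsMaximalLevelInterval γ w g p.1 p.2 ∧ t ∈ openInterval p.1 p.2
  · rw [levelFunction, dif_pos hex]
    obtain ⟨hp, hpt⟩ := hex.choose_spec
    set p := hex.choose
    have hp1 : p.1 ≠ ⊤ := (hpt.1.trans ENNReal.ofReal_lt_top).ne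
    have ea := (ENNReal.ofReal_toReal hp1).symm
    have ha0 : 0 ≤ p.1.toReal := ENNReal.toReal_nonneg
    have hat : p.1.toReal < t := by
      have := hpt.1
      rw [ea] at this
      exact (ENNReal.ofReal_lt_ofReal_iff_of_nonneg ha0).1 this
    rw [ea] at hp ⊢
    set a := p.1.toReal
    rcases eq_or_ne p.2 ⊤ with hp2 | hp2
    · have hγ : γ = ⊤ := top_le_iff.1 (hp2 ▸ hp.1.2.1)
      rw [hp2] at hp ⊢
      obtain ⟨h1, h2⟩ := htop hγ a ha0 hat hp.1
      rw [hzero h1 h2]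
      subst hγ
      rw [h.average_top (hvan rfl) ha0, zero_mul]
    · have eb := (ENNReal.ofReal_toReal hp2).symm
      have htb : t < p.2.toReal := by
        have := hpt.2
        rw [eb] at this
        exact (ENNReal.ofReal_lt_ofReal_iff_of_nonneg htt.1.le).1 this
      rw [eb] at hp ⊢
      have hb : p.2.toReal ∈ closedI γ := ⟨ENNReal.toReal_nonneg, hp.1.2.1⟩
      set b := p.2.toReal
      have ha := mem_closedI_of_le ha0 (hat.trans htb).le hb
      rcases (prim_mono h.weight.fin ha hb (hat.trans htb).le).eq_or_lt with heq | hlt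
      · have hwt := OrliczLorentz.eq_zero_of_prim_eq h.weight.fin h.weight.antitoneOn_ofReal ha0 hb
          heq hat htb
        rw [ENNReal.ofReal_mul (h.slope_nonneg t), hwt, mul_zero, mul_zero]
      · have hm := h.maxLev_of_isMaximal ha0 hb hlt hp
        rw [hmax _ _ _ hm hat htb, ENNReal.ofReal_mul, h.average_eq_ofReal ha0 (hat.trans htb).le hb
          hlt]
        exact (h.levelData.isSlopeOn_of_maxLev hm hat htb).nonneg h.levelData
  · rw [levelFunction, dif_neg hex]
    by_cases hno : ∀ l a b, MaxLev (prim g) (wprim w) (closedI γ) l a b → ¬ (a < t ∧ t < b)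
    · exact h.eq_slope_mul hvan ht hcont hno
    · push Not at hno
      obtain ⟨l, a, b, hm, hat, htb⟩ := hno
      have hb0 : 0 < b := htt.1.trans htb
      have hlev := h.isLevelInterval_of_lev hm.left_mem.1 hm.right_mem hm.lev
      -- a level interval that is larger than a maximal bounded one is unbounded
      obtain ⟨a', h1, h2, hγ⟩ : ∃ a' : ℝ≥0∞, IsLevelInterval γ w g a' ⊤ ∧
          a' ≤ ENNReal.ofReal a ∧ γ = ⊤ := by
        by_contra hcon
        push Not at hcon
        refine hex ⟨(ENNReal.ofReal a, ENNReal.ofReal b), ⟨hlev, fun a' b' hl' h1 h2 => ?_⟩,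
          (ENNReal.ofReal_lt_ofReal_iff htt.1).2 hat, (ENNReal.ofReal_lt_ofReal_iff hb0).2 htb⟩
        simp only at h1 h2
        rcases eq_or_ne b' ⊤ with rfl | hb'
        · exact absurd (top_le_iff.1 hl'.2.1) (hcon a' hl' h1)
        · have ea := (ENNReal.ofReal_toReal (h1.trans_lt ENNReal.ofReal_lt_top).ne).symm
          have eb := (ENNReal.ofReal_toReal hb').symm
          rw [ea] at hl' h1 ⊢
          rw [eb] at hl' h2 ⊢
          have ha0 : 0 ≤ a'.toReal := ENNReal.toReal_nonneg
          have hb'' : b'.toReal ∈ closedI γ := ⟨ENNReal.toReal_nonneg, hl'.2.1⟩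
          have h1' := (ENNReal.ofReal_le_ofReal_iff hm.left_mem.1).1 h1
          have h2' := (ENNReal.ofReal_le_ofReal_iff hb''.1).1 h2
          have hlt : a'.toReal < b'.toReal := h1'.trans_lt (hm.lev.lt.trans_le h2')
          have ha'' := mem_closedI_of_le ha0 hlt.le hb''
          have hW : wprim w a'.toReal < wprim w b'.toReal :=
            (prim_mono h.weight.fin ha'' hm.left_mem h1').trans_lt
              (hm.lev.wlt.trans_le (prim_mono h.weight.fin hm.right_mem hb'' h2'))
          obtain ⟨h3, h4⟩ := hm.max _ _ _ ha'' hb'' ((h.isLevelInterval_iff ha0 hlt hb'' hW).1 hl')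
            h1' h2'
          rw [h3, h4]
          exact ⟨rfl, rfl⟩
      have ea := (ENNReal.ofReal_toReal (h2.trans_lt ENNReal.ofReal_lt_top).ne).symm
      rw [ea] at h1 h2
      have h3 := (ENNReal.ofReal_le_ofReal_iff hm.left_mem.1).1 h2
      obtain ⟨h4, h5⟩ := htop hγ _ ENNReal.toReal_nonneg (h3.trans_lt hat) h1
      rw [h4, hzero h4 h5]

end LevelPair

/-! ### The two modulars coincide where one of them is finite -/

/-- The maximal level intervals. -/
abbrev MaxIntervals (γ : ℝ≥0∞) (w : ℝ → ℝ) (g : ℝ → ℝ≥0∞) : Type :=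
  {p : ℝ × ℝ // ∃ l, MaxLev (prim g) (wprim w) (closedI γ) l p.1 p.2}

namespace LevelPair

variable {γ : ℝ≥0∞} {w : ℝ → ℝ} {g : ℝ → ℝ≥0∞} {φ : ℝ → ℝ}

theorem pairwise_disjoint (h : LevelPair γ w g) : Pairwise fun p q : MaxIntervals γ w g =>
    Disjoint (Set.Ioo p.1.1 p.1.2) (Set.Ioo q.1.1 q.1.2) := by
  rintro ⟨⟨a, b⟩, l, hm⟩ ⟨⟨a', b'⟩, l', hm'⟩ hne
  rw [Set.disjoint_left]
  rintro t ⟨h1, h2⟩ ⟨h3, h4⟩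
  simp only at h1 h2 h3 h4
  rcases h.levelData.disjoint hm hm' with h5 | h5 | ⟨rfl, rfl, -⟩
  · linarith
  · linarith
  · exact hne rfl

theorem countable_maxIntervals (h : LevelPair γ w g) : Countable (MaxIntervals γ w g) := by
  have := Set.PairwiseDisjoint.countable_of_isOpen (ι := MaxIntervals γ w g)
    (s := fun p => Set.Ioo p.1.1 p.1.2) (a := Set.univ)
    (fun p _ q _ hpq => h.pairwise_disjoint hpq) (fun _ _ => isOpen_Ioo) fun p _ => by
      obtain ⟨l, hm⟩ := p.2
      exact Set.nonempty_Ioo.2 hm.lev.lt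
  exact Set.countable_univ_iff.1 this

theorem ae_continuousAt (h : LevelPair γ w g) : ∀ᵐ t, ContinuousAt g t := by
  have := h.anti.countable_not_continuousAt
  exact this.ae_notMem _ |>.mono fun t ht => by simpa using ht

theorem Ioo_subset {a b : ℝ} (ha : a ∈ closedI γ) (hb : b ∈ closedI γ) :
    Set.Ioo a b ⊆ openInterval 0 γ := fun _ ht =>
  mem_openInterval_of_closedI (ha.1.trans_lt ht.1) ht.2 hb

theorem restrict_Ioo {a b : ℝ} (ha : a ∈ closedI γ) (hb : b ∈ closedI γ) :
    ((volume : Measure ℝ).restrict (openInterval 0 γ)).restrict (Set.Ioo a b) =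
      (volume : Measure ℝ).restrict (Set.Ioo a b) := by
  rw [Measure.restrict_restrict measurableSet_Ioo, Set.inter_eq_left.2 (Ioo_subset ha hb)]

theorem lintegral_eq_of_lev (h : LevelPair γ w g) {l a b : ℝ} (hl : 0 ≤ l) (ha : a ∈ closedI γ)
    (hb : b ∈ closedI γ) (hlev : Lev (prim g) (wprim w) l a b) :
    ∫⁻ t in Set.Ioo a b, g t =
      ENNReal.ofReal l * ∫⁻ t in Set.Ioo a b, ENNReal.ofReal (w t) := by
  rw [← prim_sub_eq h.fin ha.1 hlev.lt.le hb, ← prim_sub_eq h.weight.fin ha.1 hlev.lt.le hb,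
    hlev.eq, ENNReal.ofReal_mul hl]

theorem MaxLev.avg_nonneg (h : LevelPair γ w g) {l a b : ℝ}
    (hm : MaxLev (prim g) (wprim w) (closedI γ) l a b) : 0 ≤ l := by
  obtain ⟨t, h1, h2⟩ := exists_between hm.lev.lt
  exact (h.levelData.isSlopeOn_of_maxLev hm h1 h2).nonneg h.levelData

/-- The right hand side bounds the modular `P` of a function with rearrangement `g` from below. The
hypotheses of `lintegral_le_lintegral_integrand` hold, because `g` and the slope times the weight
have the same integral over the level intervals and agree elsewhere, and because the superlevel sets
of the slope are intervals at `0`. -/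
theorem lintegral_slope_le (h : LevelPair γ w g)
    (hvan : γ = ⊤ → Tendsto (fun t => prim g t / wprim w t) atTop (nhds 0)) (hφ : IsOrlicz φ)
    {v : ℝ → ℝ} (hv : Submajorized γ w v) :
    intOver (fun t => ENNReal.ofReal (φ (slope γ w g t)) * ENNReal.ofReal (w t)) 0 γ ≤
      intOver (fun t => integrand φ (g t) (ENNReal.ofReal (v t))) 0 γ := by
  have hanti := h.slope_antitoneOn hvan
  have hmeas := measurableSet_openInterval 0 γ
  have hγ := h.weight.pos
  have hsm : AEMeasurable (slope γ w g) (volume.restrict (openInterval 0 γ)) :=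
    aemeasurable_restrict_of_antitoneOn hmeas hanti
  refine lintegral_le_lintegral_integrand hφ h.slope_nonneg hsm h.weight.submajorized.aemeasurable
    hv.aemeasurable (fun _ => ENNReal.ofReal_ne_top) (fun S => ?_) (fun U hU => ?_) fun ε hε => ?_
  · have := h.countable_maxIntervals
    refine lintegral_le_of_partition (J := fun p : MaxIntervals γ w g => Set.Ioo p.1.1 p.1.2)
      (fun _ => measurableSet_Ioo) h.pairwise_disjoint ?_ ?_
    · rintro ⟨⟨a, b⟩, l, hm⟩
      simp only
      have hl := MaxLev.avg_nonneg h hm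
      have hW : AEMeasurable (fun t => ENNReal.ofReal (w t)) (volume.restrict (Set.Ioo a b)) :=
        h.weight.submajorized.aemeasurable.mono_measure
          (Measure.restrict_mono (Ioo_subset hm.left_mem hm.right_mem) le_rfl)
      rw [restrict_Ioo hm.left_mem hm.right_mem]
      calc _ = ∫⁻ t in Set.Ioo a b, S l * (ENNReal.ofReal l * ENNReal.ofReal (w t)) :=
            setLIntegral_congr_fun measurableSet_Ioo fun t ht => by
              rw [h.slope_eq_of_maxLev hm ht.1 ht.2]
        _ = ∫⁻ t in Set.Ioo a b, S l * g t := by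
            rw [lintegral_const_mul'' _ (hW.const_mul _), lintegral_const_mul'' _ hW,
              lintegral_const_mul _ h.anti.measurable,
              h.lintegral_eq_of_lev hl hm.left_mem hm.right_mem hm.lev]
        _ ≤ _ := (setLIntegral_congr_fun measurableSet_Ioo fun t ht => by
              rw [h.slope_eq_of_maxLev hm ht.1 ht.2]).le
    · filter_upwards [ae_restrict_mem hmeas, ae_restrict_of_ae h.ae_continuousAt] with t ht hc hno
      rw [h.eq_slope_mul hvan ht hc fun l a b hm hab => hno (Set.mem_iUnion.2 ⟨⟨(a, b), l, hm⟩, hab⟩),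
        ENNReal.ofReal_mul (h.slope_nonneg t)]
  · have hnull : NullMeasurableSet (slope γ w g ⁻¹' U) (volume.restrict (openInterval 0 γ)) :=
      hsm.nullMeasurable hU.ordConnected.measurableSet
    rw [Measure.restrict_restrict₀ hnull]
    -- the set in question is an interval at `0`
    set A := slope γ w g ⁻¹' U ∩ openInterval 0 γ with hA
    have hAdown : ∀ s t, 0 < s → s ≤ t → t ∈ A → s ∈ A := fun s t hs hst ht => by
      have hs' := mem_openInterval_of_lt hs hst (mem_openInterval_zero.1 ht.2).2
      exact ⟨hU (hanti hs' ht.2 hst) ht.1, hs'⟩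
    have hAe : ∃ b ≤ γ, A =ᵐ[volume] openInterval 0 b := by
      set b : ℝ≥0∞ := ⨆ t ∈ A, ENNReal.ofReal t with hb
      refine ⟨b, iSup₂_le fun t ht => (mem_openInterval_zero.1 ht.2).2.le, ?_⟩
      have h1 : openInterval 0 b ⊆ A := fun t ht => by
        obtain ⟨h2, h3⟩ := mem_openInterval_zero.1 ht
        rw [hb] at h3
        simp only [lt_iSup_iff] at h3
        obtain ⟨s, hs, h4⟩ := h3
        exact hAdown t s h2 (ENNReal.ofReal_lt_ofReal_iff_of_nonneg h2.le |>.1 h4).le hs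
      have h2 : A ⊆ insert b.toReal (openInterval 0 b) := fun t ht => by
        have h3 : ENNReal.ofReal t ≤ b := le_iSup₂_of_le t ht le_rfl
        have h4 := (mem_openInterval_zero.1 ht.2).1
        rcases h3.eq_or_lt with h5 | h5
        · left
          rw [← h5, ENNReal.toReal_ofReal h4.le]
        · exact Or.inr (mem_openInterval_zero.2 ⟨h4, h5⟩)
      refine Filter.EventuallyLE.antisymm ?_ (Eventually.of_forall h1)
      exact (LE.le.eventuallyLE h2).trans (insert_ae_eq_self _ _).le
    obtain ⟨b, hb, hAb⟩ := hAe
    rw [setLIntegral_congr hAb, setLIntegral_congr hAb]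
    exact hv.le hγ hb
  · rcases eq_or_ne γ ⊤ with rfl | hγt
    swap
    · exact lt_of_le_of_lt (setLIntegral_le_lintegral _ _)
        (h.weight.intOver_lt_top le_rfl hγt.lt_top)
    have hmem : ∀ t : ℝ, 0 ≤ t → t ∈ closedI ⊤ := fun t ht => ⟨ht, le_top⟩
    obtain ⟨q, hq⟩ := ((hvan rfl).eventually (gt_mem_nhds hε)).exists_forall_of_atTop
    have hsub : ∀ t ∈ openInterval 0 ⊤, ε ≤ slope ⊤ w g t → t ≤ max q 0 := by
      intro t ht hεt
      by_cases hs : ∃ m a b, IsSlopeOn (closedI ⊤) (prim g) (wprim w) t m a b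
      swap
      · rw [slope, dif_neg hs] at hεt
        linarith
      obtain ⟨a, b, hm⟩ := slope_spec hs
      have htb : t ≤ b := by
        rcases hm.cases with ⟨-, rfl, -⟩ | ⟨-, h2, -⟩
        · exact le_rfl
        · exact h2.le
      by_contra hcon
      push Not at hcon
      have h1 := hq b ((le_max_left _ _).trans (hcon.le.trans htb))
      have hb0 : 0 < b := (mem_openInterval_zero.1 ht).1.trans_le htb
      have hWb := h.weight.wprim_pos hb0 hm.right_mem
      rw [div_lt_iff₀ hWb] at h1
      have h2 := hm.left 0 zero_mem_closedI hm.left_mem.1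
      have h3 := hm.eq
      have h4 : wprim w 0 = 0 := prim_zero
      rw [h4, prim_zero] at h2
      nlinarith
    refine lt_of_le_of_lt (b := intOver (fun s => ENNReal.ofReal (w s)) 0
      (ENNReal.ofReal (max q 0 + 1))) ?_ (h.weight.locallyIntegrable _ ENNReal.ofReal_lt_top)
    rw [Measure.restrict_restrict₀' hmeas.nullMeasurableSet, intOver]
    refine lintegral_mono_set fun t ht => ?_
    rw [openInterval_zero_ofReal]
    exact ⟨(mem_openInterval_zero.1 ht.2).1, by linarith [hsub t ht.2 ht.1]⟩

end LevelPair

section Modulars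

variable {γ : ℝ≥0∞} {φ w : ℝ → ℝ}

/-- If `P` is finite, the rearrangement is locally integrable, and its averages with respect to the
weight vanish at infinity. -/
theorem levelPair_of_modularP_lt_top (hφ : IsOrlicz φ) (hw : IsWeight γ w) {f : L0 γ}
    (hf : modularP φ w f < ⊤) : LevelPair γ w (rearrangement f) ∧ (γ = ⊤ →
      Tendsto (fun t => prim (rearrangement f) t / wprim w t) atTop (nhds 0)) := by
  obtain ⟨v, hv, hlt⟩ := exists_of_modularP_lt hf
  set C := intOver (fun t => integrand φ (rearrangement f t) (ENNReal.ofReal (v t))) 0 γ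
  have hfin : ∀ t ∈ closedI γ, intOver (rearrangement f) 0 (ENNReal.ofReal t) ≠ ⊤ := by
    intro t ht htop
    have h1 := intOver_rearrangement_le hφ hw.pos (f := rearrangement f) hv one_pos ht.2
    rw [htop, ENNReal.mul_top (by simpa using hφ.pos 1 one_pos)] at h1
    refine h1.not_gt (ENNReal.add_lt_top.2 ⟨hlt, ENNReal.mul_lt_top ENNReal.ofReal_lt_top ?_⟩)
    exact (hw.fin t ht).lt_top
  refine ⟨⟨hw, rearrangement_antitone f, hfin⟩, ?_⟩
  rintro rfl
  have hmem : ∀ t : ℝ, 0 ≤ t → t ∈ closedI ⊤ := fun t ht => ⟨ht, le_top⟩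
  have key : ∀ u : ℝ, 0 < u → ∀ t : ℝ, 0 ≤ t →
      φ u / u * prim (rearrangement f) t ≤ C.toReal + φ u * wprim w t := by
    intro u hu t ht
    have h1 := intOver_rearrangement_le hφ hw.pos (f := rearrangement f) hv hu (hmem t ht).2
    have h0 := hφ.pos u hu
    have hW0 : 0 ≤ wprim w t := ENNReal.toReal_nonneg
    change _ ≤ C + _ at h1
    rw [← ofReal_prim hfin (hmem t ht), ← ofReal_prim hw.fin (hmem t ht),
      ← ENNReal.ofReal_mul (by positivity), ← ENNReal.ofReal_mul h0.le,
      ← ENNReal.ofReal_toReal (show C ≠ ⊤ from hlt.ne), ← ENNReal.ofReal_add ENNReal.toReal_nonneg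
        (mul_nonneg h0.le hW0)] at h1
    exact (ENNReal.ofReal_le_ofReal_iff (add_nonneg ENNReal.toReal_nonneg
      (mul_nonneg h0.le hW0))).1 h1
  rw [Metric.tendsto_atTop]
  intro ε hε
  have h0 := hφ.pos (ε / 2) (by positivity)
  obtain ⟨T, hT⟩ := (hw.tendsto_wprim.eventually_gt_atTop
    (C.toReal / φ (ε / 2))).exists_forall_of_atTop
  refine ⟨max T 1, fun t ht => ?_⟩
  have ht1 : 1 ≤ t := (le_max_right _ _).trans ht
  have hWt := hw.wprim_pos (by linarith) (hmem t (by linarith))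
  have h1 := hT t ((le_max_left _ _).trans ht)
  have h2 := key (ε / 2) (by positivity) t (by linarith)
  have h3 : 0 ≤ prim (rearrangement f) t := ENNReal.toReal_nonneg
  rw [Real.dist_eq, sub_zero, abs_of_nonneg (by positivity), div_lt_iff₀ hWt]
  rw [div_lt_iff₀ h0] at h1
  rw [div_mul_eq_mul_div, div_le_iff₀ (by positivity)] at h2
  refine lt_of_mul_lt_mul_left ?_ h0.le
  nlinarith

/-- The modular `Q` in terms of the slope of the concave majorant. -/
theorem modularQ_eq (hw : IsWeight γ w) {f : L0 γ} (h : LevelPair γ w (rearrangement f))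
    (hvan : γ = ⊤ → Tendsto (fun t => prim (rearrangement f) t / wprim w t) atTop (nhds 0))
    (hφ : IsOrlicz φ) : modularQ φ w f = intOver (fun t =>
      ENNReal.ofReal (φ (slope γ w (rearrangement f) t)) * ENNReal.ofReal (w t)) 0 γ := by
  rw [modularQ, lintegral_I, intOver, intOver]
  refine lintegral_congr_ae ?_
  filter_upwards [ae_restrict_mem (measurableSet_openInterval 0 γ),
    ae_restrict_of_ae h.ae_continuousAt] with t ht hc
  rw [h.levelFunction_eq hvan ht hc]
  have hs := h.slope_nonneg t
  rcases (hw.nonneg t ht).eq_or_lt with h0 | h0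
  · simp [← h0]
  · rw [← ENNReal.ofReal_mul hs, integrand_ofReal hφ (mul_nonneg hs h0.le) h0,
      mul_div_cancel_right₀ _ h0.ne', ENNReal.ofReal_mul (hφ.nonneg hs)]

theorem modularQ_le_modularP (hφ : IsOrlicz φ) (hw : IsWeight γ w) {f : L0 γ}
    (hf : modularP φ w f < ⊤) : modularQ φ w f ≤ modularP φ w f := by
  obtain ⟨h, hvan⟩ := levelPair_of_modularP_lt_top hφ hw hf
  rw [modularQ_eq hw h hvan hφ]
  exact le_modularP fun v hv => h.lintegral_slope_le hvan hφ hv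

end Modulars

namespace LevelPair

variable {γ : ℝ≥0∞} {w : ℝ → ℝ} {g : ℝ → ℝ≥0∞}

theorem wprim_strictMono (h : LevelPair ⊤ w g) {a b : ℝ} (ha : 0 ≤ a) (hab : a < b) :
    wprim w a < wprim w b := by
  have hmem : ∀ t : ℝ, 0 ≤ t → t ∈ closedI ⊤ := fun t ht => ⟨ht, le_top⟩
  have hb := hmem b (ha.trans hab.le)
  refine (prim_mono h.weight.fin (hmem a ha) hb hab.le).lt_of_ne fun heq => ?_
  obtain ⟨e, h3, h4⟩ := ((h.weight.tendsto_wprim.eventually_gt_atTop (wprim w a)).and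
    (eventually_ge_atTop a)).exists
  exact h3.ne' (h.levelData.flat a b e (hmem a ha) hb (hmem e (ha.trans h4)) hab heq h4)

/-- The bounded maximal level intervals with positive average. -/
abbrev PosIntervals (γ : ℝ≥0∞) (w : ℝ → ℝ) (g : ℝ → ℝ≥0∞) : Type :=
  {p : MaxIntervals γ w g // prim g p.1.1 < prim g p.1.2 ∧
    IsMaximalLevelInterval γ w g (ENNReal.ofReal p.1.1) (ENNReal.ofReal p.1.2)}

/-- The average of `g` over a bounded maximal level interval. -/
noncomputable def avg (p : PosIntervals γ w g) : ℝ :=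
  (prim g p.1.1.2 - prim g p.1.1.1) / (wprim w p.1.1.2 - wprim w p.1.1.1)

theorem maxLev_avg (p : PosIntervals γ w g) :
    MaxLev (prim g) (wprim w) (closedI γ) (avg p) p.1.1.1 p.1.1.2 := by
  obtain ⟨⟨⟨a, b⟩, l, hm⟩, hp⟩ := p
  have : l = avg ⟨⟨⟨a, b⟩, l, hm⟩, hp⟩ := by
    simp only [avg]
    rw [hm.lev.eq, mul_div_cancel_right₀ _ (sub_pos.2 hm.lev.wlt).ne']
  rwa [this] at hm

theorem avg_pos (p : PosIntervals γ w g) : 0 < avg p :=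
  div_pos (sub_pos.2 p.2.1) (sub_pos.2 (maxLev_avg p).lev.wlt)

theorem eq_of_mem (h : LevelPair γ w g) {p q : PosIntervals γ w g} {t : ℝ}
    (hp : t ∈ Set.Ioo p.1.1.1 p.1.1.2) (hq : t ∈ Set.Ioo q.1.1.1 q.1.1.2) : p = q := by
  by_contra hne
  exact Set.disjoint_left.1 (h.pairwise_disjoint fun he => hne (Subtype.ext he)) hp hq

theorem exists_ofReal_eq {c d : ℝ≥0∞} {t : ℝ} (ht : t ∈ openInterval c d) :
    ∃ c', 0 ≤ c' ∧ c' < t ∧ c = ENNReal.ofReal c' := by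
  have hc := (ENNReal.ofReal_toReal (ht.1.trans ENNReal.ofReal_lt_top).ne).symm
  refine ⟨c.toReal, ENNReal.toReal_nonneg, ?_, hc⟩
  have := ht.1
  rw [hc] at this
  exact (ENNReal.ofReal_lt_ofReal_iff_of_nonneg ENNReal.toReal_nonneg).1 this

theorem exists_ofReal_eq_right {c d : ℝ≥0∞} {t : ℝ} (ht0 : 0 ≤ t) (ht : t ∈ openInterval c d)
    (hd : d ≠ ⊤) : ∃ d', t < d' ∧ d = ENNReal.ofReal d' := by
  have hd' := (ENNReal.ofReal_toReal hd).symm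
  refine ⟨d.toReal, ?_, hd'⟩
  have := ht.2
  rw [hd'] at this
  exact (ENNReal.ofReal_lt_ofReal_iff_of_nonneg ht0).1 this

/-- A maximal level interval around a point at which `g` does not vanish is bounded and has
positive average. -/
theorem exists_posInterval (h : LevelPair γ w g)
    (h0 : ∀ a, 0 ≤ a → IsMaximalLevelInterval γ w g (ENNReal.ofReal a) ⊤ →
      average w g (ENNReal.ofReal a) ⊤ = 0) {c d : ℝ≥0∞}
    (hq : IsMaximalLevelInterval γ w g c d) {t : ℝ} (ht : t ∈ openInterval c d) (hg : g t ≠ 0) :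
    ∃ p : PosIntervals γ w g, t ∈ Set.Ioo p.1.1.1 p.1.1.2 := by
  obtain ⟨a, ha0, hat, rfl⟩ := exists_ofReal_eq ht
  rcases eq_or_ne d ⊤ with rfl | hd
  · obtain rfl : γ = ⊤ := top_le_iff.1 hq.1.2.1
    have hflat : ∀ s, a ≤ s → prim g s = prim g a := fun s hs =>
      h.prim_eq_of_level_top ha0 hq.1 (h0 a ha0 hq) hs
    have ht1 : t < t + 1 := by linarith
    exact absurd (h.eq_zero_of_prim_eq ha0 ⟨by linarith, le_top⟩
      (hflat (t + 1) (by linarith)).symm hat ht1) hg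
  obtain ⟨b, htb, rfl⟩ := exists_ofReal_eq_right (ha0.trans hat.le) ht hd
  have hb : b ∈ closedI γ := ⟨by linarith, hq.1.2.1⟩
  have ha := mem_closedI_of_le ha0 (hat.trans htb).le hb
  have ht' := mem_closedI_of_le (ha0.trans hat.le) htb.le hb
  rcases (prim_mono h.weight.fin ha hb (hat.trans htb).le).eq_or_lt with heq | hlt
  · exfalso
    have hWa : 0 < wprim w a :=
      (h.weight.wprim_pos (by linarith) hb).trans_eq heq.symm
    have hW0 : wprim w 0 = 0 := prim_zero
    have hapos : 0 < a := ha0.lt_of_ne (by rintro rfl; exact hWa.ne' hW0)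
    have hFt := h.prim_lt ha0 hat ht' le_rfl hg
    have hWt := h.levelData.flat a b t ha hb ht' (hat.trans htb) heq hat.le
    obtain ⟨x, y, hx, hy, -, hxa, hay, hyt, hlev⟩ := h.levelData.exists_lev
      (l := (prim g a + 1) / wprim w a) zero_mem_closedI ht' hapos hat
      (by rw [div_mul_cancel₀ _ hWa.ne', hW0, prim_zero]; linarith) (by rw [hWt]; linarith)
    obtain ⟨n, hn⟩ := hlev.extend_flat (hyt.trans htb.le)
      ((prim_mono h.fin).mono (h.levelData.icc_subset hx hb))
      (h.levelData.monoW.mono (h.levelData.icc_subset hx hb)) (by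
        rw [h.levelData.flat a b b ha hb hb (hat.trans htb) heq (hat.trans htb).le,
          h.levelData.flat a b y ha hb hy (hat.trans htb) heq hay.le])
    have h1 := (hq.2 _ _ (h.isLevelInterval_of_lev hx.1 hb hn) (ENNReal.ofReal_le_ofReal hxa.le)
      le_rfl).1
    exact hxa.ne ((ENNReal.ofReal_eq_ofReal_iff hx.1 ha0).1 h1)
  · exact ⟨⟨⟨(a, b), _, h.maxLev_of_isMaximal ha0 hb hlt hq⟩, h.prim_lt ha0 hat hb htb.le hg, hq⟩,
      hat, htb⟩

/-- A maximal level interval that meets a bounded one with positive average coincides with it. -/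
theorem eq_posInterval (h : LevelPair γ w g)
    (h0 : ∀ a, 0 ≤ a → IsMaximalLevelInterval γ w g (ENNReal.ofReal a) ⊤ →
      average w g (ENNReal.ofReal a) ⊤ = 0) {c d : ℝ≥0∞}
    (hq : IsMaximalLevelInterval γ w g c d) {t : ℝ} (ht : t ∈ openInterval c d)
    (p : PosIntervals γ w g) (hp : t ∈ Set.Ioo p.1.1.1 p.1.1.2) :
    c = ENNReal.ofReal p.1.1.1 ∧ d = ENNReal.ofReal p.1.1.2 := by
  have hm := maxLev_avg p
  have hl := avg_pos p
  have hpF := p.2.1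
  set l := avg p
  set a := p.1.1.1
  set b := p.1.1.2
  obtain ⟨hat, htb⟩ := hp
  obtain ⟨c, hc0, hct, rfl⟩ := exists_ofReal_eq ht
  rcases eq_or_ne d ⊤ with rfl | hd
  · exfalso
    obtain rfl : γ = ⊤ := top_le_iff.1 hq.1.2.1
    have hflat : ∀ s, c ≤ s → prim g s = prim g c := fun s hs =>
      h.prim_eq_of_level_top hc0 hq.1 (h0 c hc0 hq) hs
    rcases le_total c a with hca | hac
    · rw [hflat a hca, hflat b (by linarith)] at hpF
      exact hpF.false
    · have h1 := hm.lev.le c hac (by linarith)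
      have h2 := hm.lev.eq
      rw [hflat b (by linarith)] at h2
      have h3 := h.wprim_strictMono hc0 (hct.trans htb)
      nlinarith
  obtain ⟨d, htd, rfl⟩ := exists_ofReal_eq_right (hc0.trans hct.le) ht hd
  have hd : d ∈ closedI γ := ⟨by linarith, hq.1.2.1⟩
  have hcd := hct.trans htd
  have hc := mem_closedI_of_le hc0 hcd.le hd
  rcases (prim_mono h.weight.fin hc hd hcd.le).eq_or_lt with heq | hlt
  · exfalso
    have hflat : ∀ s ∈ closedI γ, c ≤ s → wprim w s = wprim w c := fun s hs hcs =>
      h.levelData.flat c d s hc hd hs hcd heq hcs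
    rcases le_or_gt c a with hca | hac
    · have := hm.lev.wlt
      rw [hflat a hm.left_mem hca, hflat b hm.right_mem (by linarith)] at this
      exact this.false
    · rcases lt_or_ge b d with hbd | hdb
      · obtain ⟨n, hn⟩ := hm.lev.extend_flat hbd.le
          ((prim_mono h.fin).mono (h.levelData.icc_subset hm.left_mem hd))
          (h.levelData.monoW.mono (h.levelData.icc_subset hm.left_mem hd))
          (by rw [hflat d hd hcd.le, hflat b hm.right_mem (by linarith)])
        exact hbd.ne' (hm.max n a d hm.left_mem hd hn le_rfl hbd.le).2
      · have h1 := (hq.2 _ _ p.2.2.1 (ENNReal.ofReal_le_ofReal hac.le)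
          (ENNReal.ofReal_le_ofReal hdb)).1
        exact hac.ne ((ENNReal.ofReal_eq_ofReal_iff hm.left_mem.1 hc0).1 h1)
  · have hm' := h.maxLev_of_isMaximal hc0 hd hlt hq
    rcases h.levelData.disjoint hm hm' with h1 | h1 | ⟨h1, h2, -⟩
    · linarith
    · linarith
    · rw [← h1, ← h2]
      exact ⟨rfl, rfl⟩

theorem levelFunction_of_forall_eq {c d : ℝ≥0∞} {t : ℝ} (hmax : IsMaximalLevelInterval γ w g c d)
    (ht : t ∈ openInterval c d) (h : ∀ c' d', IsMaximalLevelInterval γ w g c' d' →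
      t ∈ openInterval c' d' → c' = c ∧ d' = d) :
    levelFunction γ w g t = average w g c d * ENNReal.ofReal (w t) := by
  have hex : ∃ p : ℝ≥0∞ × ℝ≥0∞,
      IsMaximalLevelInterval γ w g p.1 p.2 ∧ t ∈ openInterval p.1 p.2 := ⟨(c, d), hmax, ht⟩
  rw [levelFunction, dif_pos hex]
  obtain ⟨h1, h2⟩ := h _ _ hex.choose_spec.1 hex.choose_spec.2
  rw [h1, h2]

/-- If `Q` is finite, then `g` has average `0` over an unbounded maximal level interval, because
otherwise the level function is a multiple of the weight near infinity. -/
theorem average_eq_zero_of_isMaximal_top (h : LevelPair γ w g) {φ : ℝ → ℝ} (hφ : IsOrlicz φ)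
    (hQ : intOver (fun t => integrand φ (levelFunction γ w g t) (ENNReal.ofReal (w t))) 0 γ < ⊤)
    {a : ℝ} (ha : 0 ≤ a) (hmax : IsMaximalLevelInterval γ w g (ENNReal.ofReal a) ⊤) :
    average w g (ENNReal.ofReal a) ⊤ = 0 := by
  obtain rfl : γ = ⊤ := top_le_iff.1 hmax.1.2.1
  by_contra hne
  set Λ := average w g (ENNReal.ofReal a) ⊤
  have hmem : ∀ t : ℝ, 0 ≤ t → t ∈ closedI ⊤ := fun t ht => ⟨ht, le_top⟩
  obtain ⟨T, haT, hT⟩ : ∃ T, a ≤ T ∧ ∀ l c d, MaxLev (prim g) (wprim w) (closedI ⊤) l c d →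
      c < a → a < d → d ≤ T := by
    by_cases hex : ∃ l c d, MaxLev (prim g) (wprim w) (closedI ⊤) l c d ∧ c < a ∧ a < d
    · obtain ⟨l, c, d, hm, hca, had⟩ := hex
      refine ⟨d, had.le, fun l' c' d' hm' h1 h2 => ?_⟩
      rcases h.levelData.disjoint hm hm' with h3 | h3 | h3 <;> linarith
    · push Not at hex
      exact ⟨a, le_rfl, fun l c d hm h1 h2 => absurd (hex l c d hm h1) (not_le.2 h2)⟩
  have hval : ∀ t, T < t → levelFunction ⊤ w g t = Λ * ENNReal.ofReal (w t) := by
    intro t ht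
    have hat : a < t := haT.trans_lt ht
    refine levelFunction_of_forall_eq hmax
      ⟨(ENNReal.ofReal_lt_ofReal_iff (ha.trans_lt hat)).2 hat, ENNReal.ofReal_lt_top⟩
      fun c d hq htq => ?_
    obtain ⟨c, hc0, hct, rfl⟩ := exists_ofReal_eq htq
    rcases eq_or_ne d ⊤ with rfl | hd
    · rcases le_total c a with hca | hac
      · exact hmax.2 _ _ hq.1 (ENNReal.ofReal_le_ofReal hca) le_rfl
      · have := hq.2 _ _ hmax.1 (ENNReal.ofReal_le_ofReal hac) le_rfl
        exact ⟨this.1.symm, rfl⟩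
    · exfalso
      obtain ⟨d, htd, rfl⟩ := exists_ofReal_eq_right (hc0.trans hct.le) htq hd
      rcases le_or_gt a c with hac | hca
      · exact hd (hq.2 _ _ hmax.1 (ENNReal.ofReal_le_ofReal hac) le_top).2.symm
      · have hm := h.maxLev_of_isMaximal hc0 (hmem d (by linarith))
          (h.wprim_strictMono hc0 (hct.trans htd)) hq
        have := hT _ _ _ hm hca (by linarith)
        linarith
  have hext : extend φ Λ ≠ 0 := by
    unfold extend
    split_ifs with h1
    · exact ENNReal.top_ne_zero
    · have := hφ.pos Λ.toReal (ENNReal.toReal_pos hne h1)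
      simpa using this
  have hT0 : 0 ≤ T := ha.trans haT
  have hW : ∫⁻ t in Set.Ioi T, ENNReal.ofReal (w t) = ⊤ := by
    by_contra hfin
    have h1 := h.weight.infinite rfl
    rw [← ENNReal.ofReal_zero, intOver, openInterval_ofReal_top le_rfl,
      ← Set.Ioc_union_Ioi_eq_Ioi hT0] at h1
    refine (lt_of_le_of_lt (lintegral_union_le _ _ _) (ENNReal.add_lt_top.2 ⟨?_,
      lt_top_iff_ne_top.2 hfin⟩)).ne h1
    have := h.weight.locallyIntegrable (ENNReal.ofReal T) ENNReal.ofReal_lt_top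
    rwa [intOver, openInterval_zero_ofReal, setLIntegral_congr Ioo_ae_eq_Ioc] at this
  have hsub : Set.Ioi T ⊆ openInterval 0 ⊤ := fun t ht =>
    mem_openInterval_zero.2 ⟨hT0.trans_lt ht, ENNReal.ofReal_lt_top⟩
  refine hQ.not_ge ?_
  calc (⊤ : ℝ≥0∞) = extend φ Λ * ∫⁻ t in Set.Ioi T, ENNReal.ofReal (w t) := by
        rw [hW, ENNReal.mul_top hext]
    _ ≤ ∫⁻ t in Set.Ioi T, extend φ Λ * ENNReal.ofReal (w t) := lintegral_const_mul_le _ _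
    _ ≤ ∫⁻ t in Set.Ioi T, integrand φ (levelFunction ⊤ w g t) (ENNReal.ofReal (w t)) := by
        refine setLIntegral_mono' measurableSet_Ioi fun t ht => ?_
        rw [hval t ht]
        rcases eq_or_ne (ENNReal.ofReal (w t)) 0 with h1 | h1
        · simp [h1]
        · rw [integrand_of_ne (mul_ne_zero hne h1) h1,
            ENNReal.mul_div_cancel_right h1 ENNReal.ofReal_ne_top]
    _ ≤ _ := lintegral_mono_set hsub

open Classical in
/-- The function `v` for which the modular `P` attains the value of `Q`: the quotient of `g` and
its average on the level intervals, and `w` elsewhere. -/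
noncomputable def optimal (γ : ℝ≥0∞) (w : ℝ → ℝ) (g : ℝ → ℝ≥0∞) (t : ℝ) : ℝ :=
  if g t = 0 then 0 else
    if h : ∃ p : PosIntervals γ w g, t ∈ Set.Ioo p.1.1.1 p.1.1.2 then (g t).toReal / avg h.choose
    else w t

theorem optimal_of_mem (h : LevelPair γ w g) {t : ℝ} (p : PosIntervals γ w g)
    (ht : t ∈ Set.Ioo p.1.1.1 p.1.1.2) : optimal γ w g t = (g t).toReal / avg p := by
  rw [optimal]
  split_ifs with h1 h2
  · simp [h1]
  · rw [h.eq_of_mem h2.choose_spec ht]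
  · exact absurd ⟨p, ht⟩ h2

theorem optimal_of_notMem {t : ℝ} (ht : ¬ ∃ p : PosIntervals γ w g, t ∈ Set.Ioo p.1.1.1 p.1.1.2)
    (hg : g t ≠ 0) : optimal γ w g t = w t := by
  rw [optimal, if_neg hg, dif_neg ht]

/-- On a level interval `optimal` lies between the values of the weight beyond the right end point
and before the left one, whence it decreases; its primitive is below `W`, because the graph of
`prim g` over a level interval is below the chord. -/
theorem optimal_submajorized (h : LevelPair γ w g) : Submajorized γ w (optimal γ w g) := by
  have hnn : ∀ t ∈ openInterval 0 γ, 0 ≤ optimal γ w g t := fun t ht => by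
    by_cases hp : ∃ p : PosIntervals γ w g, t ∈ Set.Ioo p.1.1.1 p.1.1.2
    · obtain ⟨p, hp⟩ := hp
      rw [h.optimal_of_mem p hp]
      exact div_nonneg ENNReal.toReal_nonneg (avg_pos p).le
    · by_cases hg : g t = 0
      · rw [optimal, if_pos hg]
      · rw [optimal_of_notMem hp hg]
        exact h.weight.nonneg t ht
  refine ⟨hnn, ?_, ?_⟩
  · intro s hs t ht hst
    by_cases hgt : g t = 0
    · rw [show optimal γ w g t = 0 by rw [optimal, if_pos hgt]]
      exact hnn s hs
    have hgs : g s ≠ 0 := fun h0 => hgt (le_antisymm (h0 ▸ h.anti hst) zero_le)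
    have hhi : ∀ p : PosIntervals γ w g, t ∈ Set.Ioo p.1.1.1 p.1.1.2 →
        ∀ x ∈ openInterval 0 γ, x ≤ p.1.1.1 → optimal γ w g t ≤ w x := fun p hp x hx hxa => by
      have hm := maxLev_avg p
      have h1 := h.le_mul_of_lev (avg_pos p).le hm.left_mem hm.right_mem hm.lev hp.1 hp.2 hx hxa
      rw [h.optimal_of_mem p hp, div_le_iff₀ (avg_pos p), mul_comm]
      exact ENNReal.toReal_le_of_le_ofReal (mul_nonneg (avg_pos p).le (h.weight.nonneg x hx)) h1
    have hlo : ∀ p : PosIntervals γ w g, s ∈ Set.Ioo p.1.1.1 p.1.1.2 →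
        ∀ x ∈ openInterval 0 γ, p.1.1.2 ≤ x → w x ≤ optimal γ w g s := fun p hp x hx hxb => by
      have hm := maxLev_avg p
      have h1 := h.mul_le_of_lev (avg_pos p).le hm.left_mem hm.right_mem hm.lev hp.1 hp.2 hx hxb
      rw [h.optimal_of_mem p hp, le_div_iff₀ (avg_pos p), mul_comm]
      rw [← ENNReal.ofReal_toReal (h.ne_top hs)] at h1
      exact (ENNReal.ofReal_le_ofReal_iff ENNReal.toReal_nonneg).1 h1
    by_cases hp : ∃ p : PosIntervals γ w g, t ∈ Set.Ioo p.1.1.1 p.1.1.2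
    · obtain ⟨p, hp⟩ := hp
      by_cases hsp : p.1.1.1 < s
      · rw [h.optimal_of_mem p hp, h.optimal_of_mem p ⟨hsp, hst.trans_lt hp.2⟩]
        exact div_le_div_of_nonneg_right (ENNReal.toReal_mono (h.ne_top hs) (h.anti hst))
          (avg_pos p).le
      push Not at hsp
      by_cases hq : ∃ q : PosIntervals γ w g, s ∈ Set.Ioo q.1.1.1 q.1.1.2
      · obtain ⟨q, hq⟩ := hq
        have hqp : q.1.1.2 ≤ p.1.1.1 := by
          rcases h.levelData.disjoint (maxLev_avg q) (maxLev_avg p) with h1 | h1 | ⟨h1, h2, -⟩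
          · exact h1
          · linarith [hq.1, hp.2]
          · linarith [hq.1]
        have hx : q.1.1.2 ∈ openInterval 0 γ := mem_openInterval_of_lt
          ((mem_openInterval_zero.1 hs).1.trans hq.2) (hqp.trans hp.1.le)
          (mem_openInterval_zero.1 ht).2
        exact (hhi p hp _ hx hqp).trans (hlo q hq _ hx le_rfl)
      · rw [optimal_of_notMem hq hgs]
        exact hhi p hp s hs hsp
    · rw [optimal_of_notMem hp hgt]
      by_cases hq : ∃ q : PosIntervals γ w g, s ∈ Set.Ioo q.1.1.1 q.1.1.2
      · obtain ⟨q, hq⟩ := hq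
        refine hlo q hq t ht (not_lt.1 fun h1 => hp ⟨q, hq.1.trans_le hst, h1⟩)
      · rw [optimal_of_notMem hq hgs]
        exact h.weight.antitone hs ht hst
  · intro t ht
    have htt := (ENNReal.ofReal_toReal (ht.trans_le le_top).ne).symm
    have := h.countable_maxIntervals
    refine lintegral_le_of_partition
      (J := fun p : PosIntervals γ w g => Set.Ioo p.1.1.1 p.1.1.2) (fun _ => measurableSet_Ioo)
      (fun p q hpq => h.pairwise_disjoint fun he => hpq (Subtype.ext he)) (fun p => ?_) ?_
    · have hm := maxLev_avg p
      have hl := avg_pos p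
      set a := p.1.1.1 with ha
      set b := p.1.1.2 with hb
      rw [Measure.restrict_restrict measurableSet_Ioo, htt, openInterval_zero_ofReal,
        Set.Ioo_inter_Ioo, max_eq_left hm.left_mem.1]
      set m := min b t.toReal
      rcases le_or_gt m a with hma | ham
      · simp [Set.Ioo_eq_empty_of_le hma]
      have hmb : m ≤ b := min_le_left _ _
      have hm' : m ∈ closedI γ := mem_closedI_of_le (hm.left_mem.1.trans ham.le) hmb hm.right_mem
      calc ∫⁻ s in Set.Ioo a m, ENNReal.ofReal (optimal γ w g s)
          = ∫⁻ s in Set.Ioo a m, ENNReal.ofReal (avg p)⁻¹ * g s := by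
            refine setLIntegral_congr_fun measurableSet_Ioo fun s hs => ?_
            have hs' : s ∈ openInterval 0 γ := Ioo_subset hm.left_mem hm' hs
            rw [h.optimal_of_mem p ⟨hs.1, hs.2.trans_le hmb⟩, div_eq_inv_mul,
              ENNReal.ofReal_mul (inv_nonneg.2 hl.le), ENNReal.ofReal_toReal (h.ne_top hs')]
        _ = ENNReal.ofReal ((avg p)⁻¹ * (prim g m - prim g a)) := by
            rw [lintegral_const_mul _ h.anti.measurable,
              ← prim_sub_eq h.fin hm.left_mem.1 ham.le hm', ENNReal.ofReal_mul (inv_nonneg.2 hl.le)]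
        _ ≤ ENNReal.ofReal (wprim w m - wprim w a) := by
            refine ENNReal.ofReal_le_ofReal ?_
            rw [inv_mul_le_iff₀ hl]
            exact hm.lev.le m ham.le hmb
        _ = _ := prim_sub_eq h.weight.fin hm.left_mem.1 ham.le hm'
    · filter_upwards [ae_restrict_mem (measurableSet_openInterval 0 t)] with s hs hno
      by_cases hg : g s = 0
      · simp [optimal, hg]
      · rw [optimal_of_notMem (fun ⟨p, hp⟩ => hno (Set.mem_iUnion.2 ⟨p, hp⟩)) hg]

end LevelPair

section Modulars

variable {γ : ℝ≥0∞} {φ w : ℝ → ℝ}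

/-- If the rearrangement is not integrable near `0`, then all of `(0, γ]` is a level interval with
infinite average, so that `Q` is infinite. -/
theorem levelPair_of_modularQ_lt_top (hw : IsWeight γ w) {f : L0 γ}
    (hf : modularQ φ w f < ⊤) : LevelPair γ w (rearrangement f) := by
  refine ⟨hw, rearrangement_antitone f, fun t₀ ht₀ htop => ?_⟩
  have ht0 : 0 < t₀ := ht₀.1.lt_of_ne (by
    rintro rfl
    simp [intOver, openInterval] at htop)
  set g := rearrangement f
  have hanti : Antitone g := rearrangement_antitone f
  have hall : ∀ s : ℝ, 0 < s → intOver g 0 (ENNReal.ofReal s) = ⊤ := by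
    intro s hs
    by_contra hne
    have hst : s < t₀ := by
      by_contra hcon
      exact hne (top_le_iff.1 (htop ▸ intOver_mono g (ENNReal.ofReal_le_ofReal (not_lt.1 hcon))))
    refine (intOver_lt_top hs (hanti.antitoneOn _) hst (lt_top_iff_ne_top.2 hne) ?_).ne htop
    refine lt_top_iff_ne_top.2 fun hgs => hne (top_le_iff.1 ?_)
    calc (⊤ : ℝ≥0∞) = ∫⁻ _ in Set.Ioo 0 s, ⊤ := by
          rw [setLIntegral_const, Real.volume_Ioo, ENNReal.top_mul]
          simpa using hs
      _ ≤ _ := by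
          rw [intOver, openInterval_zero_ofReal]
          exact setLIntegral_mono' measurableSet_Ioo fun x hx => hgs ▸ hanti hx.2.le
  -- the whole interval is a level interval with infinite average
  have hγ := hw.pos
  have havg : average w g 0 γ = ⊤ := by
    rw [average]
    split_ifs with h1
    · subst h1
      have : ∀ᶠ t : ℝ in atTop, intOver g 0 (ENNReal.ofReal t) /
          intOver (fun s => ENNReal.ofReal (w s)) 0 (ENNReal.ofReal t) = ⊤ := by
        filter_upwards [eventually_gt_atTop 0] with t ht
        rw [hall t ht, ENNReal.top_div_of_ne_top (hw.fin t ⟨ht.le, le_top⟩)]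
      rw [limsup_congr this, limsup_const]
    · have h2 := ENNReal.ofReal_toReal h1
      rw [← h2, hall _ (ENNReal.toReal_pos hγ.ne' h1),
        ENNReal.top_div_of_ne_top (hw.fin _ ⟨ENNReal.toReal_nonneg, h2.le⟩)]
  have hmax : IsMaximalLevelInterval γ w g 0 γ :=
    ⟨⟨hγ, le_rfl, fun t _ _ => havg ▸ le_top⟩, fun a' b' h1 h2 h3 =>
      ⟨le_antisymm h2 zero_le, le_antisymm h1.2.1 h3⟩⟩
  obtain ⟨s, hs, hws⟩ := hw.exists_pos
  have hs' := mem_openInterval_zero.1 hs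
  refine hf.not_ge ?_
  rw [modularQ, lintegral_I]
  calc (⊤ : ℝ≥0∞) = ∫⁻ _ in Set.Ioo 0 s, ⊤ := by
        rw [setLIntegral_const, Real.volume_Ioo, ENNReal.top_mul]
        simpa using hs'.1
    _ ≤ ∫⁻ t in Set.Ioo 0 s, integrand φ (levelFunction γ w g t) (ENNReal.ofReal (w t)) := by
        refine setLIntegral_mono' measurableSet_Ioo fun t ht => ?_
        have ht' := mem_openInterval_of_lt ht.1 ht.2.le hs'.2
        have hwt : 0 < w t := hws.trans_le (hw.antitone ht' hs ht.2.le)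
        have h1 : ENNReal.ofReal (w t) ≠ 0 := by simpa using hwt
        rw [LevelPair.levelFunction_of_forall_eq hmax ht' fun c d hq _ => by
          have := hq.2 _ _ hmax.1 zero_le hq.1.2.1
          exact ⟨this.1.symm, this.2.symm⟩, havg, ENNReal.top_mul h1,
          integrand_top ENNReal.ofReal_ne_top]
    _ ≤ _ := lintegral_mono_set fun t ht => mem_openInterval_of_lt ht.1 ht.2.le hs'.2

theorem modularP_le_modularQ (hφ : IsOrlicz φ) (hw : IsWeight γ w) {f : L0 γ}
    (hf : modularQ φ w f < ⊤) : modularP φ w f ≤ modularQ φ w f := by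
  have h := levelPair_of_modularQ_lt_top hw hf
  have hQ := hf
  rw [modularQ, lintegral_I] at hQ
  have h0 : ∀ a, 0 ≤ a → IsMaximalLevelInterval γ w (rearrangement f) (ENNReal.ofReal a) ⊤ →
      average w (rearrangement f) (ENNReal.ofReal a) ⊤ = 0 := fun a ha hmax =>
    h.average_eq_zero_of_isMaximal_top hφ hQ ha hmax
  refine (modularP_le f h.optimal_submajorized).trans ?_
  rw [modularQ, lintegral_I]
  have hmeas := measurableSet_openInterval 0 γ
  have := h.countable_maxIntervals
  refine lintegral_integrand_le_of_level
    (J := fun p : LevelPair.PosIntervals γ w (rearrangement f) => Set.Ioo p.1.1.1 p.1.1.2)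
    (fun _ => measurableSet_Ioo)
    (fun p q hpq => h.pairwise_disjoint fun he => hpq (Subtype.ext he)) LevelPair.avg_pos ?_
    (fun _ => ENNReal.ofReal_ne_top) (measurable_rearrangement f) (fun p => ?_)
    (fun p x hx _ => ?_) (fun p x hx => ?_) (ae_of_all _ fun x hx hg => ?_) ?_
  · filter_upwards [ae_restrict_mem hmeas] with t ht using h.ne_top ht
  · have hm := LevelPair.maxLev_avg p
    rw [LevelPair.restrict_Ioo hm.left_mem hm.right_mem]
    exact h.lintegral_eq_of_lev (LevelPair.avg_pos p).le hm.left_mem hm.right_mem hm.lev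
  · have hm := LevelPair.maxLev_avg p
    rw [h.optimal_of_mem p hx, ENNReal.ofReal_div_of_pos (LevelPair.avg_pos p),
      ENNReal.ofReal_toReal (h.ne_top (LevelPair.Ioo_subset hm.left_mem hm.right_mem hx))]
  · have hm := LevelPair.maxLev_avg p
    have hx0 := hm.left_mem.1.trans_lt hx.1
    rw [LevelPair.levelFunction_of_forall_eq p.2.2
      ⟨(ENNReal.ofReal_lt_ofReal_iff hx0).2 hx.1,
        (ENNReal.ofReal_lt_ofReal_iff (hx0.trans hx.2)).2 hx.2⟩
      fun c d hq hxq => h.eq_posInterval h0 hq hxq p hx,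
      h.average_eq_ofReal hm.left_mem.1 hm.lev.lt.le hm.right_mem hm.lev.wlt]
    rfl
  · rw [LevelPair.optimal_of_notMem (fun ⟨p, hp⟩ => hx (Set.mem_iUnion.2 ⟨p, hp⟩)) hg]
  · refine ae_of_all _ fun x hx hg => ?_
    rw [levelFunction, dif_neg]
    rintro ⟨p, hp, hxp⟩
    obtain ⟨q, hq⟩ := h.exists_posInterval h0 hp hxp hg
    exact hx (Set.mem_iUnion.2 ⟨q, hq⟩)

theorem modularP_lt_top_iff (hφ : IsOrlicz φ) (hw : IsWeight γ w) (f : L0 γ) :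
    modularP φ w f < ⊤ ↔ modularQ φ w f < ⊤ :=
  ⟨fun h => (modularQ_le_modularP hφ hw h).trans_lt h,
    fun h => (modularP_le_modularQ hφ hw h).trans_lt h⟩

theorem finiteQ_eq_finiteP (hφ : IsOrlicz φ) (hw : IsWeight γ w) :
    finiteQ γ φ w = finiteP γ φ w := by
  ext f
  exact forall₂_congr fun k _ => (modularP_lt_top_iff hφ hw _).symm

end Modulars

/-! ### Sequences as step functions -/

/-- Jensen's inequality for the integrand, as a function of its second argument. -/
theorem integrand_lintegral_le {α : Type*} [MeasurableSpace α] {μ : Measure α}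
    [IsProbabilityMeasure μ] {φ : ℝ → ℝ} (hφ : IsOrlicz φ) (X : ℝ≥0∞) {v : α → ℝ≥0∞}
    (hv : AEMeasurable v μ) (hvt : ∀ t, v t ≠ ⊤) (hfin : ∫⁻ t, v t ∂μ ≠ ⊤) :
    integrand φ X (∫⁻ t, v t ∂μ) ≤ ∫⁻ t, integrand φ X (v t) ∂μ := by
  have htop : (∀ᵐ t ∂μ, integrand φ X (v t) = ⊤) → ∫⁻ t, integrand φ X (v t) ∂μ = ⊤ := fun h => by
    rw [lintegral_congr_ae h, lintegral_const, measure_univ, mul_one]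
  rcases eq_or_ne X 0 with rfl | hX0
  · simp
  rcases eq_or_ne X ⊤ with rfl | hX
  · rw [htop (ae_of_all _ fun t => integrand_top (hvt t))]
    exact le_top
  rcases eq_or_ne (∫⁻ t, v t ∂μ) 0 with h0 | h0
  · rw [htop]
    · exact le_top
    · filter_upwards [(lintegral_eq_zero_iff' hv).1 h0] with t ht
      rw [ht]
      simp [integrand, hX0]
  obtain ⟨x, hx, rfl⟩ : ∃ r : ℝ, 0 < r ∧ X = ENNReal.ofReal r :=
    ⟨X.toReal, ENNReal.toReal_pos hX0 hX, (ENNReal.ofReal_toReal hX).symm⟩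
  obtain ⟨V, hV, hVe⟩ : ∃ r : ℝ, 0 < r ∧ ∫⁻ t, v t ∂μ = ENNReal.ofReal r :=
    ⟨_, ENNReal.toReal_pos h0 hfin, (ENNReal.ofReal_toReal hfin).symm⟩
  have hz : 0 < x / V := by positivity
  obtain ⟨s, hs, hsub⟩ := hφ.exists_subgradient hz
  have hc : 0 ≤ s * (x / V) - φ (x / V) := by
    have := hsub 0 le_rfl
    rw [hφ.zero] at this
    linarith
  have h1 : ENNReal.ofReal s * ENNReal.ofReal x ≤ ∫⁻ t, integrand φ (ENNReal.ofReal x) (v t) ∂μ +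
      ENNReal.ofReal (s * (x / V) - φ (x / V)) * ENNReal.ofReal V := by
    rw [← hVe, ← lintegral_const_mul'' _ hv, ← lintegral_add_right' _ (hv.const_mul _)]
    calc _ = ∫⁻ _, ENNReal.ofReal s * ENNReal.ofReal x ∂μ := by
          rw [lintegral_const, measure_univ, mul_one]
      _ ≤ _ := lintegral_mono fun t => tangent_le_integrand hφ hs hc
          (fun u hu => by have := hsub u hu; linarith) _ (hvt t)
  rw [hVe, integrand_ofReal hφ hx.le hV]
  rw [← ENNReal.ofReal_mul hs, ← ENNReal.ofReal_mul hc] at h1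
  have h2 : s * x = φ (x / V) * V + (s * (x / V) - φ (x / V)) * V := by
    field_simp
    ring
  rw [h2, ENNReal.ofReal_add (mul_nonneg (hφ.nonneg hz.le) hV.le) (mul_nonneg hc hV.le)] at h1
  exact (ENNReal.add_le_add_iff_right ENNReal.ofReal_ne_top).1 h1

/-- The step function with the value `x n` on `[n, n + 1)`. -/
noncomputable def step {β : Type*} (x : ℕ → β) (t : ℝ) : β := x ⌊t⌋₊

theorem step_of_mem {β : Type*} (x : ℕ → β) {n : ℕ} {t : ℝ} (ht : t ∈ Set.Ico (n : ℝ) (n + 1)) :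
    step x t = x n := by
  rw [step, Nat.floor_eq_on_Ico n t ht]

theorem measurable_step {β : Type*} [MeasurableSpace β] (x : ℕ → β) : Measurable (step x) :=
  (measurable_from_nat (f := x)).comp Nat.measurable_floor

theorem I_top : I ⊤ = Set.Ici 0 := by
  ext t
  simp [I]

/-- The integer part maps Lebesgue measure on the half-line to counting measure. -/
theorem map_floor : Measure.map (fun t : ℝ => ⌊t⌋₊) ((volume : Measure ℝ).restrict (I ⊤)) =
    Measure.count := by
  refine Measure.ext_of_singleton fun n => ?_
  rw [Measure.map_apply Nat.measurable_floor (measurableSet_singleton n),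
    Measure.restrict_apply (Nat.measurable_floor (measurableSet_singleton n)),
    Measure.count_singleton]
  have : (fun t : ℝ => ⌊t⌋₊) ⁻¹' {n} ∩ I ⊤ = Set.Ico (n : ℝ) (n + 1) := by
    ext t
    rw [I_top]
    constructor
    · rintro ⟨h1, h2⟩
      exact (Nat.floor_eq_iff h2).1 h1
    · intro h
      exact ⟨(Nat.floor_eq_iff (n.cast_nonneg.trans h.1)).2 h, n.cast_nonneg.trans h.1⟩
  rw [this, Real.volume_Ico]
  simp

theorem lintegral_step (h : ℕ → ℝ≥0∞) : ∫⁻ t in I ⊤, step h t = ∑' n, h n := by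
  rw [← lintegral_count, ← map_floor, lintegral_map measurable_from_nat Nat.measurable_floor]
  rfl

theorem intOver_step (h : ℕ → ℝ≥0∞) (n : ℕ) :
    intOver (step h) 0 (ENNReal.ofReal n) = ∑ i ∈ Finset.range n, h i := by
  induction n with
  | zero => simp [intOver, openInterval]
  | succ n ih =>
    have hn : (0 : ℝ) ≤ n := n.cast_nonneg
    rw [Finset.sum_range_succ, ← ih, intOver_split _ hn (b := ((n + 1 : ℕ) : ℝ)) (by simp)]
    congr 1
    rw [intOver, openInterval_ofReal hn, setLIntegral_congr_fun measurableSet_Ioo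
      (g := fun _ => h n) fun t ht => step_of_mem h ⟨ht.1.le, by exact_mod_cast ht.2⟩,
      setLIntegral_const, Real.volume_Ioo]
    simp

theorem ofReal_step (w : ℕ → ℝ) :
    (fun s => ENNReal.ofReal (step w s)) = step fun i => ENNReal.ofReal (w i) := rfl

section Weight

variable {w : ℕ → ℝ}

theorem antitone_step {x : ℕ → ℝ} (hx : Antitone x) : Antitone (step x) := fun _ _ hst =>
  hx (Nat.floor_mono hst)

theorem IsSeqWeight.isWeight (hw : IsSeqWeight w) : IsWeight ⊤ (step w) := by
  have htop : intOver (fun s => ENNReal.ofReal (step w s)) 0 ⊤ = ⊤ := by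
    rw [← lintegral_I, ofReal_step, lintegral_step, hw.infinite]
  refine ⟨fun t _ => hw.nonneg _, (antitone_step hw.antitone).antitoneOn _, fun t ht => ?_, ?_,
    fun _ => htop⟩
  · obtain ⟨n, hn⟩ := ENNReal.exists_nat_gt ht.ne
    refine lt_of_le_of_lt (intOver_mono _ hn.le) ?_
    rw [← ENNReal.ofReal_natCast, ofReal_step, intOver_step]
    exact ENNReal.sum_lt_top.2 fun i _ => ENNReal.ofReal_lt_top
  · rw [htop]
    exact ENNReal.zero_lt_top

theorem sum_ofReal {x : ℕ → ℝ} (hx : ∀ i, 0 ≤ x i) (s : Finset ℕ) :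
    ∑ i ∈ s, ENNReal.ofReal (x i) = ENNReal.ofReal (∑ i ∈ s, x i) :=
  (ENNReal.ofReal_sum_of_nonneg fun i _ => hx i).symm

theorem SeqSubmajorized.step (hw : IsSeqWeight w) {v : ℕ → ℝ} (hv : SeqSubmajorized w v) :
    Submajorized ⊤ (step w) (step v) := by
  refine ⟨fun t _ => hv.1 _, (antitone_step hv.2.1).antitoneOn _, fun t ht => ?_⟩
  have htt := (ENNReal.ofReal_toReal ht.ne).symm
  rw [htt, ofReal_step, ofReal_step]
  have ht0 : 0 ≤ t.toReal := ENNReal.toReal_nonneg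
  generalize t.toReal = r at ht0
  set n := ⌊r⌋₊
  have hn1 : (n : ℝ) ≤ r := Nat.floor_le ht0
  have hn2 : r < n + 1 := Nat.lt_floor_add_one r
  have key : ∀ x : ℕ → ℝ, (∀ i, 0 ≤ x i) →
      intOver (OrliczLorentz.step fun i => ENNReal.ofReal (x i)) 0 (ENNReal.ofReal r) =
        ENNReal.ofReal (∑ i ∈ Finset.range n, x i + x n * (r - n)) := fun x hx => by
    rw [intOver_split _ n.cast_nonneg hn1, intOver_step, sum_ofReal hx,
      ENNReal.ofReal_add (Finset.sum_nonneg fun i _ => hx i)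
        (mul_nonneg (hx n) (sub_nonneg.2 hn1))]
    congr 1
    rw [intOver, openInterval_ofReal n.cast_nonneg, setLIntegral_congr_fun measurableSet_Ioo
      (g := fun _ => ENNReal.ofReal (x n)) fun t ht => step_of_mem _ ⟨ht.1.le, ht.2.trans hn2⟩,
      setLIntegral_const, Real.volume_Ioo, ENNReal.ofReal_mul (hx n)]
  rw [key v hv.1, key w hw.nonneg]
  refine ENNReal.ofReal_le_ofReal ?_
  -- the values at a point between integers are convex combinations of those at the integers
  have h1 := hv.2.2 n
  have h2 := hv.2.2 (n + 1)
  rw [Finset.sum_range_succ, Finset.sum_range_succ] at h2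
  nlinarith [mul_le_mul_of_nonneg_left h2 (sub_nonneg.2 hn1),
    mul_le_mul_of_nonneg_left h1 (show 0 ≤ 1 - (r - n) by linarith)]

end Weight

/-- The class of the step function of a sequence. -/
noncomputable def stepL0 (x : ℕ → ℝ) : L0 ⊤ :=
  AEEqFun.mk (step x) (measurable_step x).aestronglyMeasurable

theorem coeFn_stepL0 (x : ℕ → ℝ) :
    stepL0 x =ᵐ[(volume : Measure ℝ).restrict (I ⊤)] step x := AEEqFun.coeFn_mk _ _

theorem stepL0_smul (k : ℝ) (x : ℕ → ℝ) : stepL0 (k • x) = k • stepL0 x := by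
  refine AEEqFun.ext ?_
  filter_upwards [coeFn_stepL0 (k • x), coeFn_stepL0 x, AEEqFun.coeFn_smul k (stepL0 x)]
    with t h1 h2 h3
  rw [h1, h3, Pi.smul_apply, h2]
  rfl

theorem stepL0_sub (x y : ℕ → ℝ) : stepL0 (x - y) = stepL0 x - stepL0 y := by
  refine AEEqFun.ext ?_
  filter_upwards [coeFn_stepL0 (x - y), coeFn_stepL0 x, coeFn_stepL0 y,
    AEEqFun.coeFn_sub (stepL0 x) (stepL0 y)] with t h1 h2 h3 h4
  rw [h1, h4, Pi.sub_apply, h2, h3]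
  rfl

theorem distribution_stepL0 (x : ℕ → ℝ) (c : ℝ≥0) :
    distribution (stepL0 x) c = seqDistribution x c := by
  rw [seqDistribution, ← map_floor, Measure.map_apply Nat.measurable_floor
    (Set.to_countable _).measurableSet]
  refine measure_congr ?_
  filter_upwards [coeFn_stepL0 x] with t ht
  change ((c : ℝ) < |stepL0 x t|) = ((c : ℝ) < |x ⌊t⌋₊|)
  rw [ht]
  rfl

theorem count_le_ofReal_iff (S : Set ℕ) {t : ℝ} (ht : 0 ≤ t) :
    (Measure.count : Measure ℕ) S ≤ ENNReal.ofReal t ↔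
      (Measure.count : Measure ℕ) S < (⌊t⌋₊ : ℝ≥0∞) + 1 := by
  by_cases hS : S.Finite
  · rw [Measure.count_apply_finite S hS, ← ENNReal.ofReal_natCast, ENNReal.ofReal_le_ofReal_iff ht,
      ← Nat.le_floor_iff ht, ENNReal.ofReal_natCast]
    norm_cast
    exact Nat.lt_succ_iff.symm
  · rw [Measure.count_apply_infinite hS]
    simp

/-- The rearrangement of a step function is the step function of the rearrangement. -/
theorem rearrangement_stepL0 (x : ℕ → ℝ) {t : ℝ} (ht : 0 ≤ t) :
    rearrangement (stepL0 x) t = step (seqRearrangement x) t := by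
  simp only [rearrangement, step, seqRearrangement, distribution_stepL0]
  refine iInf_congr fun c => iInf_congr fun _ => ?_
  rw [seqDistribution]
  simp only [count_le_ofReal_iff _ ht]

theorem seqRearrangement_antitone (x : ℕ → ℝ) : Antitone (seqRearrangement x) := fun i j hij => by
  have h := rearrangement_antitone (stepL0 x) (Nat.cast_le (α := ℝ).2 hij)
  rw [rearrangement_stepL0 x i.cast_nonneg, rearrangement_stepL0 x j.cast_nonneg] at h
  simpa [step] using h

/-- The modular `p` of a sequence is `P` of the step function: by Jensen's inequality, the averages
of a competitor `v` over the unit intervals form a sequence that does at least as well. -/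
theorem seqModularP_eq {φ : ℝ → ℝ} {w : ℕ → ℝ} (hφ : IsOrlicz φ) (hw : IsSeqWeight w)
    (x : ℕ → ℝ) : seqModularP φ w x = modularP φ (step w) (stepL0 x) := by
  have hI : ∀ t ∈ openInterval 0 ⊤, (0 : ℝ) ≤ t := fun t ht => (mem_openInterval_zero.1 ht).1.le
  refine le_antisymm ?_ ?_
  · refine le_modularP fun v hv => ?_
    -- the averages of `v` over the unit intervals
    have hvfin : ∀ t ∈ closedI ⊤, intOver (fun s => ENNReal.ofReal (v s)) 0 (ENNReal.ofReal t) ≠ ⊤ :=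
      fun t ht => ((hv.2.2 _ ENNReal.ofReal_lt_top).trans_lt
        (hw.isWeight.fin t ht).lt_top).ne
    have hmem : ∀ n : ℕ, (n : ℝ) ∈ closedI ⊤ := fun n => ⟨n.cast_nonneg, le_top⟩
    have hcast : ∀ n : ℕ, (n : ℝ) ≤ (n + 1 : ℕ) := fun n => Nat.cast_le.2 n.le_succ
    have hpos : ∀ (n : ℕ) (t : ℝ), (n : ℝ) < t → t ∈ openInterval 0 ⊤ := fun n t ht =>
      mem_openInterval_zero.2 ⟨n.cast_nonneg.trans_lt ht, ENNReal.ofReal_lt_top⟩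
    set V := prim fun s => ENNReal.ofReal (v s)
    set a : ℕ → ℝ := fun n => V (n + 1 : ℕ) - V n with ha
    have haint : ∀ n : ℕ, ENNReal.ofReal (a n) =
        ∫⁻ t in Set.Ioo (n : ℝ) (n + 1 : ℕ), ENNReal.ofReal (v t) := fun n =>
      prim_sub_eq hvfin n.cast_nonneg (hcast n) (hmem (n + 1))
    have hV0 : V 0 = 0 := prim_zero
    have hsub : SeqSubmajorized w a := by
      refine ⟨fun n => sub_nonneg.2 (prim_mono hvfin (hmem n) (hmem (n + 1)) (hcast n)), ?_,
        fun n => ?_⟩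
      · refine antitone_nat_of_succ_le fun n => ?_
        have hn1 : ((n + 1 : ℕ) : ℝ) ∈ openInterval 0 ⊤ := hpos n _ (by simp)
        have h1 := prim_sub_le hvfin (n + 1).cast_nonneg (hcast (n + 1)) (hmem (n + 1 + 1))
          (hv.1 _ hn1) fun t ht => ENNReal.ofReal_le_ofReal (hv.2.1 hn1 (hpos _ _ ht.1) ht.1.le)
        have h2 := le_prim_sub hvfin n.cast_nonneg (hcast n) (hmem (n + 1)) (hv.1 _ hn1)
          fun t ht => ENNReal.ofReal_le_ofReal (hv.2.1 (hpos _ _ ht.1) hn1 ht.2.le)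
        push_cast at h1 h2
        simp only [ha]
        push_cast
        linarith
      · have h1 : ∑ i ∈ Finset.range n, a i = V n := by
          rw [ha, Finset.sum_range_sub (fun i : ℕ => V i)]
          simp [hV0]
        have h2 := hv.2.2 (ENNReal.ofReal n) ENNReal.ofReal_lt_top
        rw [ofReal_step, intOver_step, sum_ofReal hw.nonneg, ← ofReal_prim hvfin (hmem n)] at h2
        rw [h1]
        exact (ENNReal.ofReal_le_ofReal_iff (Finset.sum_nonneg fun i _ => hw.nonneg i)).1 h2
    refine (iInf₂_le a hsub).trans ?_
    have hU : (⋃ n : ℕ, Set.Ioo (n : ℝ) (n + 1 : ℕ)) ⊆ openInterval 0 ⊤ :=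
      Set.iUnion_subset fun n t ht => hpos n t ht.1
    refine le_trans ?_ (lintegral_mono_set hU)
    rw [lintegral_iUnion (fun _ => measurableSet_Ioo) fun n m hnm => ?_]
    · refine ENNReal.tsum_le_tsum fun n => ?_
      have : IsProbabilityMeasure ((volume : Measure ℝ).restrict (Set.Ioo (n : ℝ) (n + 1 : ℕ))) :=
        ⟨by simp⟩
      have hvm : AEMeasurable (fun t => ENNReal.ofReal (v t))
          (volume.restrict (Set.Ioo (n : ℝ) (n + 1 : ℕ))) :=
        hv.aemeasurable.mono_measure (Measure.restrict_mono (fun t ht => hpos n t ht.1) le_rfl)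
      have h1 := integrand_lintegral_le hφ (seqRearrangement x n) hvm
        (fun _ => ENNReal.ofReal_ne_top) (by rw [← haint]; exact ENNReal.ofReal_ne_top)
      rw [← haint] at h1
      refine h1.trans (setLIntegral_congr_fun measurableSet_Ioo fun t ht => ?_).le
      rw [rearrangement_stepL0 x (n.cast_nonneg.trans ht.1.le),
        step_of_mem _ ⟨ht.1.le, by exact_mod_cast ht.2⟩]
    · rw [Function.onFun, Set.disjoint_left]
      rintro t ⟨h1, h2⟩ ⟨h3, h4⟩
      have h5 : n < m + 1 := by exact_mod_cast h1.trans h4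
      have h6 : m < n + 1 := by exact_mod_cast h3.trans h2
      omega
  · refine le_iInf₂ fun v hv => (modularP_le _ (hv.step hw)).trans ?_
    rw [← lintegral_step, lintegral_I]
    exact (setLIntegral_congr_fun (measurableSet_openInterval 0 ⊤) fun t ht => by
      rw [rearrangement_stepL0 x (hI t ht)]; rfl).le

section Spaces

variable {φ : ℝ → ℝ} {w : ℕ → ℝ}

theorem seqModularP_smul_eq (hφ : IsOrlicz φ) (hw : IsSeqWeight w) (k : ℝ) (x : ℕ → ℝ) :
    seqModularP φ w (k • x) = modularP φ (step w) (k • stepL0 x) := by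
  rw [seqModularP_eq hφ hw, stepL0_smul]

theorem seqNormM_eq (hφ : IsOrlicz φ) (hw : IsSeqWeight w) (x : ℕ → ℝ) :
    seqNormM φ w x = normM φ (step w) (stepL0 x) := by
  simp only [seqNormM, normM, seqModularP_smul_eq hφ hw]

theorem mem_seqFiniteP_iff (hφ : IsOrlicz φ) (hw : IsSeqWeight w) (x : ℕ → ℝ) :
    x ∈ seqFiniteP φ w ↔ stepL0 x ∈ finiteP ⊤ φ (step w) := by
  change (∀ k : ℝ, 0 < k → _) ↔ ∀ k : ℝ, 0 < k → _
  simp only [seqModularP_smul_eq hφ hw]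

end Spaces

/-! ### Level sequences -/

/-- The sums over `{i : i < n}`. -/
def sprim (x : ℕ → ℝ) (n : ℕ) : ℝ := ∑ i ∈ Finset.range n, x i

section Sums

variable {x : ℕ → ℝ}

theorem sprim_succ (x : ℕ → ℝ) (n : ℕ) : sprim x (n + 1) = sprim x n + x n :=
  Finset.sum_range_succ _ _

theorem sprim_sub (x : ℕ → ℝ) {a b : ℕ} (hab : a ≤ b) :
    sprim x b - sprim x a = ∑ i ∈ Finset.Ico a b, x i := (Finset.sum_Ico_eq_sub _ hab).symm

theorem sprim_mono (hx : ∀ i, 0 ≤ x i) : Monotone (sprim x) :=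
  monotone_nat_of_le_succ fun n => by rw [sprim_succ]; linarith [hx n]

theorem sprim_sub_le {a b : ℕ} (hab : a ≤ b) {c : ℝ} (hc : ∀ i, a ≤ i → i < b → x i ≤ c) :
    sprim x b - sprim x a ≤ c * (b - a) := by
  rw [sprim_sub x hab]
  refine (Finset.sum_le_card_nsmul _ _ c fun i hi => ?_).trans ?_
  · exact hc i (Finset.mem_Ico.1 hi).1 (Finset.mem_Ico.1 hi).2
  · rw [Nat.card_Ico, nsmul_eq_mul, Nat.cast_sub hab, mul_comm]

end Sums

theorem IsSeqWeight.wprim_eq {w : ℕ → ℝ} (hw : IsSeqWeight w) (n : ℕ) :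
    wprim (step w) n = sprim w n := by
  rw [wprim, prim, ofReal_step, intOver_step, sum_ofReal hw.nonneg,
    ENNReal.toReal_ofReal (Finset.sum_nonneg fun i _ => hw.nonneg i), sprim]

theorem IsSeqWeight.tendsto_sprim {w : ℕ → ℝ} (hw : IsSeqWeight w) :
    Tendsto (sprim w) atTop atTop :=
  (hw.isWeight.tendsto_wprim.comp tendsto_natCast_atTop_atTop).congr hw.wprim_eq

theorem IsSeqWeight.pos {w : ℕ → ℝ} (hw : IsSeqWeight w) (i : ℕ) : 0 < w i := by
  by_contra hcon
  obtain ⟨n, h1, h2⟩ := ((hw.tendsto_sprim.eventually_gt_atTop (sprim w i)).and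
    (eventually_ge_atTop i)).exists
  have := sprim_sub_le (x := w) h2 (c := 0) fun j hj _ => (hw.antitone hj).trans (not_lt.1 hcon)
  linarith

theorem IsSeqWeight.strictMono {w : ℕ → ℝ} (hw : IsSeqWeight w) : StrictMono (sprim w) :=
  strictMono_nat_of_lt_succ fun n => by rw [sprim_succ]; linarith [hw.pos n]

/-- A finite decreasing sequence and a weight. -/
structure SeqPair (w : ℕ → ℝ) (g : ℕ → ℝ≥0∞) : Prop where
  weight : IsSeqWeight w
  anti : Antitone g
  fin : g 0 ≠ ⊤

/-- The sums of a sequence with values in `[0, ∞]`, as real numbers. -/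
noncomputable abbrev gprim (g : ℕ → ℝ≥0∞) : ℕ → ℝ := sprim fun i => (g i).toReal

/-- Maximal level intervals `{i : a ≤ i < b}` of a sequence. -/
abbrev SeqMaxLev (w : ℕ → ℝ) (g : ℕ → ℝ≥0∞) (l : ℝ) (a b : ℕ) : Prop :=
  MaxLev (gprim g) (sprim w) Set.univ l a b

namespace SeqPair

variable {w : ℕ → ℝ} {g : ℕ → ℝ≥0∞}

theorem ne_top (h : SeqPair w g) (i : ℕ) : g i ≠ ⊤ :=
  ((h.anti (Nat.zero_le i)).trans_lt (lt_top_iff_ne_top.2 h.fin)).ne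

theorem gprim_mono : Monotone (gprim g) := sprim_mono fun _ => ENNReal.toReal_nonneg

theorem gprim_lt (h : SeqPair w g) {a i b : ℕ} (hai : a ≤ i) (hib : i < b) (hg : g i ≠ 0) :
    gprim g a < gprim g b := by
  have h1 : gprim g (i + 1) ≤ gprim g b := gprim_mono hib
  have h2 : gprim g a ≤ gprim g i := gprim_mono hai
  have h3 := ENNReal.toReal_pos hg (h.ne_top i)
  have h4 : gprim g (i + 1) = gprim g i + (g i).toReal := sprim_succ _ _
  linarith

theorem sum_eq (h : SeqPair w g) {a b : ℕ} (hab : a ≤ b) :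
    ∑ i ∈ Finset.Ico a b, g i = ENNReal.ofReal (gprim g b - gprim g a) := by
  rw [sprim_sub _ hab, ENNReal.ofReal_sum_of_nonneg fun i _ => ENNReal.toReal_nonneg]
  exact Finset.sum_congr rfl fun i _ => (ENNReal.ofReal_toReal (h.ne_top i)).symm

theorem sum_weight_eq (h : SeqPair w g) {a b : ℕ} (hab : a ≤ b) :
    ∑ i ∈ Finset.Ico a b, ENNReal.ofReal (w i) = ENNReal.ofReal (sprim w b - sprim w a) := by
  rw [sprim_sub _ hab, ENNReal.ofReal_sum_of_nonneg fun i _ => h.weight.nonneg i]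

theorem seqQuotient_eq (h : SeqPair w g) {a b : ℕ} (hab : a < b) : seqQuotient w g a b =
    ENNReal.ofReal ((gprim g b - gprim g a) / (sprim w b - sprim w a)) := by
  rw [seqQuotient, h.sum_eq hab.le, h.sum_weight_eq hab.le,
    ENNReal.ofReal_div_of_pos (sub_pos.2 (h.weight.strictMono hab))]

theorem seqAverage_coe (w : ℕ → ℝ) (g : ℕ → ℝ≥0∞) (a b : ℕ) :
    seqAverage w g a (b : ℕ∞) = seqQuotient w g a b := by
  rw [seqAverage, if_neg (ENat.natCast_ne_top b), ENat.toNat_natCast]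

theorem isSeqLevelInterval_iff (h : SeqPair w g) {a b : ℕ} (hab : a < b) :
    IsSeqLevelInterval w g a b ↔ Lev (gprim g) (sprim w)
      ((gprim g b - gprim g a) / (sprim w b - sprim w a)) a b := by
  have hpos := sub_pos.2 (h.weight.strictMono hab)
  have hF : 0 ≤ gprim g b - gprim g a := sub_nonneg.2 (gprim_mono hab.le)
  have key : ∀ t, a < t → t ≤ b → (seqAverage w g a (t : ℕ∞) ≤ seqAverage w g a (b : ℕ∞) ↔
      gprim g t - gprim g a ≤
        (gprim g b - gprim g a) / (sprim w b - sprim w a) * (sprim w t - sprim w a)) := by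
    intro t h1 h2
    rw [seqAverage_coe, seqAverage_coe, h.seqQuotient_eq h1, h.seqQuotient_eq hab,
      ENNReal.ofReal_le_ofReal_iff (div_nonneg hF hpos.le),
      div_le_iff₀ (sub_pos.2 (h.weight.strictMono h1))]
  constructor
  · rintro ⟨-, hlev⟩
    refine ⟨hab, h.weight.strictMono hab, (div_mul_cancel₀ _ hpos.ne').symm, fun t h1 h2 => ?_⟩
    rcases h1.eq_or_lt with rfl | h1
    · simp
    · exact (key t h1 h2).1 (hlev t (Nat.cast_lt.2 h1) (Nat.cast_le.2 h2))
  · intro hlev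
    refine ⟨Nat.cast_lt.2 hab, fun t h1 h2 => ?_⟩
    lift t to ℕ using (h2.trans_lt (ENat.natCast_lt_top b)).ne
    exact (key t (Nat.cast_lt.1 h1) (Nat.cast_le.1 h2)).2
      (hlev.le t (Nat.cast_lt.1 h1).le (Nat.cast_le.1 h2))

theorem isSeqLevelInterval_of_lev (h : SeqPair w g) {l : ℝ} {a b : ℕ}
    (hlev : Lev (gprim g) (sprim w) l a b) : IsSeqLevelInterval w g a b := by
  rw [h.isSeqLevelInterval_iff hlev.lt, hlev.eq,
    mul_div_cancel_right₀ _ (sub_pos.2 hlev.wlt).ne']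
  exact hlev

theorem maxLev_of_isMaximal (h : SeqPair w g) {a b : ℕ} (hmax : IsMaximalSeqLevelInterval w g a b) :
    SeqMaxLev w g ((gprim g b - gprim g a) / (sprim w b - sprim w a)) a b := by
  have hab : a < b := Nat.cast_lt.1 hmax.1.1
  refine ⟨trivial, trivial, (h.isSeqLevelInterval_iff hab).1 hmax.1,
    fun l' a' b' _ _ hlev h1 h2 => ?_⟩
  obtain ⟨h3, h4⟩ := hmax.2 a' b' (h.isSeqLevelInterval_of_lev hlev) h1 (Nat.cast_le.2 h2)
  exact ⟨h3, Nat.cast_injective h4⟩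

/-- A level interval that overlaps a maximal one is contained in it. -/
theorem subset_of_overlap (h : SeqPair w g) {l l' : ℝ} {a b a' b' : ℕ} (hm : SeqMaxLev w g l a b)
    (hlev : Lev (gprim g) (sprim w) l' a' b') (h1 : a' < b) (h2 : a < b') :
    a ≤ a' ∧ b' ≤ b := by
  have hW := h.weight.strictMono
  rcases le_or_gt a a' with haa | haa <;> rcases le_or_gt b' b with hbb | hbb
  · exact ⟨haa, hbb⟩
  · obtain ⟨n, hn⟩ := hm.lev.union hlev haa h1.le hbb.le (hW.monotone.monotoneOn _) (Or.inl (hW h1))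
    exact absurd (hm.max n a b' trivial trivial hn le_rfl hbb.le).2 hbb.ne'
  · obtain ⟨n, hn⟩ := hlev.union hm.lev haa.le h2.le hbb (hW.monotone.monotoneOn _) (Or.inl (hW h2))
    exact absurd (hm.max n a' b trivial trivial hn haa.le le_rfl).1 haa.ne
  · exact absurd (hm.max l' a' b' trivial trivial hlev haa.le hbb.le).1 haa.ne

/-- Distinct maximal level intervals are disjoint. -/
theorem eq_of_mem (h : SeqPair w g) {l l' : ℝ} {a b a' b' i : ℕ} (hm : SeqMaxLev w g l a b)
    (hm' : SeqMaxLev w g l' a' b') (hai : a ≤ i) (hib : i < b) (hai' : a' ≤ i) (hib' : i < b') :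
    a = a' ∧ b = b' ∧ l = l' := by
  obtain ⟨h1, h2⟩ := h.subset_of_overlap hm hm'.lev (hai'.trans_lt hib) (hai.trans_lt hib')
  obtain ⟨h3, h4⟩ := h.subset_of_overlap hm' hm.lev (hai.trans_lt hib') (hai'.trans_lt hib)
  obtain rfl := le_antisymm h1 h3
  obtain rfl := le_antisymm h2 h4
  exact ⟨rfl, rfl, mul_right_cancel₀ (sub_pos.2 hm.lev.wlt).ne' (hm.lev.eq.symm.trans hm'.lev.eq)⟩

theorem avg_nonneg {l : ℝ} {a b : ℕ} (hlev : Lev (gprim g) (sprim w) l a b) : 0 ≤ l := by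
  have h1 : gprim g a ≤ gprim g b := gprim_mono hlev.lt.le
  have h2 := hlev.eq
  exact nonneg_of_mul_nonneg_left (by linarith) (sub_pos.2 hlev.wlt)

theorem avg_eq_zero (h : SeqPair w g) {l : ℝ} {a b i : ℕ} (hlev : Lev (gprim g) (sprim w) l a b)
    (hai : a ≤ i) (hib : i < b) (heq : gprim g b = gprim g i) : l = 0 := by
  have h1 := hlev.ge hai hib.le
  have h2 := h.weight.strictMono hib
  have h3 := avg_nonneg hlev
  rw [heq, sub_self] at h1
  nlinarith

theorem gprim_eq_of_zero (h : SeqPair w g) {i n : ℕ} (hin : i ≤ n) (hg : g i = 0) :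
    gprim g n = gprim g i := by
  have h1 := sprim_sub_le (x := fun j => (g j).toReal) hin (c := 0) fun j hj _ => by
    have : g j = 0 := le_antisymm (hg ▸ h.anti hj) zero_le
    simp [this]
  have h2 : gprim g i ≤ gprim g n := gprim_mono hin
  linarith

theorem eq_zero_of_gprim_eq (h : SeqPair w g) {a i : ℕ} (hai : a ≤ i)
    (heq : gprim g (i + 1) = gprim g a) : g i = 0 := by
  by_contra hg
  exact (h.gprim_lt hai (Nat.lt_succ_self i) hg).ne' heq

/-- If the averages of `g` vanish at infinity, so does the average over each half-line. -/
theorem seqAverage_top (h : SeqPair w g)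
    (hvan : Tendsto (fun n => gprim g n / sprim w n) atTop (nhds 0)) (a : ℕ) :
    seqAverage w g a ⊤ = 0 := by
  rw [seqAverage, if_pos rfl]
  refine Tendsto.limsup_eq ?_
  have h0 : Tendsto (fun n => ENNReal.ofReal (2 * (gprim g n / sprim w n))) atTop (nhds 0) := by
    rw [← ENNReal.ofReal_zero]
    exact ENNReal.tendsto_ofReal (by simpa using hvan.const_mul 2)
  refine tendsto_of_tendsto_of_tendsto_of_le_of_le' tendsto_const_nhds h0
    (Eventually.of_forall fun _ => zero_le) ?_
  filter_upwards [h.weight.tendsto_sprim.eventually_ge_atTop (2 * sprim w a + 1),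
    eventually_gt_atTop a] with n h1 h2
  have h3 : 0 ≤ sprim w a := Finset.sum_nonneg fun i _ => h.weight.nonneg i
  have h4 : 0 ≤ gprim g a := Finset.sum_nonneg fun i _ => ENNReal.toReal_nonneg
  have h5 : 0 ≤ gprim g n := Finset.sum_nonneg fun i _ => ENNReal.toReal_nonneg
  have h6 : 0 < sprim w n := by linarith
  rw [h.seqQuotient_eq h2]
  refine ENNReal.ofReal_le_ofReal ?_
  rw [div_le_iff₀ (by linarith), ← mul_div_assoc, div_mul_eq_mul_div, le_div_iff₀ h6]
  nlinarith

theorem gprim_eq_of_level_top (h : SeqPair w g) {a : ℕ} (hlev : IsSeqLevelInterval w g a ⊤)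
    (h0 : seqAverage w g a ⊤ = 0) {n : ℕ} (han : a ≤ n) : gprim g n = gprim g a := by
  rcases han.eq_or_lt with rfl | han
  · rfl
  have h1 := hlev.2 n (Nat.cast_lt.2 han) le_top
  rw [h0, seqAverage_coe, h.seqQuotient_eq han, nonpos_iff_eq_zero, ENNReal.ofReal_eq_zero,
    div_le_iff₀ (sub_pos.2 (h.weight.strictMono han)), zero_mul] at h1
  have h3 : gprim g a ≤ gprim g n := gprim_mono han.le
  linarith

end SeqPair

/-! ### The slopes of the concave majorant of a sequence -/

open Classical in
/-- The average of `g` over the maximal level interval around `i`, and `0` if there is none. -/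
noncomputable def seqSlope (w : ℕ → ℝ) (g : ℕ → ℝ≥0∞) (i : ℕ) : ℝ :=
  if h : ∃ l a b, SeqMaxLev w g l a b ∧ a ≤ i ∧ i < b then h.choose else 0

namespace SeqPair

variable {w : ℕ → ℝ} {g : ℕ → ℝ≥0∞}

theorem seqSlope_eq (h : SeqPair w g) {l : ℝ} {a b i : ℕ} (hm : SeqMaxLev w g l a b) (hai : a ≤ i)
    (hib : i < b) : seqSlope w g i = l := by
  have hex : ∃ l a b, SeqMaxLev w g l a b ∧ a ≤ i ∧ i < b := ⟨l, a, b, hm, hai, hib⟩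
  rw [seqSlope, dif_pos hex]
  obtain ⟨a', b', hm', h1, h2⟩ := hex.choose_spec
  exact (h.eq_of_mem hm hm' hai hib h1 h2).2.2.symm

theorem seqSlope_nonneg (h : SeqPair w g) (i : ℕ) : 0 ≤ seqSlope w g i := by
  by_cases hex : ∃ l a b, SeqMaxLev w g l a b ∧ a ≤ i ∧ i < b
  · obtain ⟨l, a, b, hm, h1, h2⟩ := hex
    rw [h.seqSlope_eq hm h1 h2]
    exact avg_nonneg hm.lev
  · rw [seqSlope, dif_neg hex]

theorem seqSlope_eq_zero (h : SeqPair w g) {i : ℕ} (hg : g i = 0) : seqSlope w g i = 0 := by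
  by_cases hex : ∃ l a b, SeqMaxLev w g l a b ∧ a ≤ i ∧ i < b
  · obtain ⟨l, a, b, hm, h1, h2⟩ := hex
    rw [h.seqSlope_eq hm h1 h2]
    exact h.avg_eq_zero hm.lev h1 h2 (h.gprim_eq_of_zero h2.le hg)
  · rw [seqSlope, dif_neg hex]

/-- If the averages of `g` vanish at infinity, the support of `g` is covered by maximal level
intervals. -/
theorem exists_seqMaxLev (h : SeqPair w g)
    (hvan : Tendsto (fun n => gprim g n / sprim w n) atTop (nhds 0)) {i : ℕ} (hg : g i ≠ 0) :
    ∃ l a b, SeqMaxLev w g l a b ∧ a ≤ i ∧ i < b := by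
  have hW := h.weight.strictMono
  have hW0 : ∀ n, 0 ≤ sprim w n := fun n => Finset.sum_nonneg fun i _ => h.weight.nonneg i
  have hF0 : ∀ n, 0 ≤ gprim g n := fun n => Finset.sum_nonneg fun i _ => ENNReal.toReal_nonneg
  have hgi := ENNReal.toReal_pos hg (h.ne_top i)
  have hWi : 0 < sprim w (i + 1) := (hW0 i).trans_lt (hW (Nat.lt_succ_self i))
  set κ := (g i).toReal / sprim w (i + 1) with hκ
  have hκ0 : 0 < κ := by positivity
  obtain ⟨q, hq⟩ := ((hvan.eventually (gt_mem_nhds (half_pos hκ0))).and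
    (h.weight.tendsto_sprim.eventually_ge_atTop (2 * sprim w i + 1))).exists_forall_of_atTop
  -- the level intervals around `i` are bounded
  have hbd : ∀ l a b, Lev (gprim g) (sprim w) l a b → a ≤ i → i < b → b < q := by
    intro l a b hlev hai hib
    by_contra hcon
    obtain ⟨h1, h2⟩ := hq b (not_lt.1 hcon)
    rw [div_lt_iff₀ (by linarith [hW0 i])] at h1
    have h3 := hlev.le (i + 1) (by omega) hib
    have h4 : gprim g (i + 1) = gprim g i + (g i).toReal := sprim_succ _ _
    have h5 : gprim g a ≤ gprim g i := gprim_mono hai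
    have h6 := hW.monotone hai
    have h7 := hlev.eq
    have h8 := avg_nonneg hlev
    have h9 : κ ≤ l := by
      rw [hκ, div_le_iff₀ hWi]
      nlinarith [hW0 a]
    nlinarith [mul_le_mul_of_nonneg_right h9 (sub_nonneg.2 hlev.wlt.le), hF0 a]
  set S : Set (ℕ × ℕ) := {p | p.1 ≤ i ∧ i < p.2 ∧ ∃ l, Lev (gprim g) (sprim w) l p.1 p.2}
  have hS : S.Finite := ((Set.finite_Iic i).prod (Set.finite_Iio q)).subset fun p hp => by
    obtain ⟨h1, h2, l, h3⟩ := hp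
    exact ⟨h1, hbd l _ _ h3 h1 h2⟩
  have hsing : Lev (gprim g) (sprim w) ((gprim g (i + 1) - gprim g i) /
      (sprim w (i + 1) - sprim w i)) i (i + 1) := by
    have hpos := sub_pos.2 (hW (Nat.lt_succ_self i))
    refine ⟨Nat.lt_succ_self i, hW (Nat.lt_succ_self i), (div_mul_cancel₀ _ hpos.ne').symm,
      fun t h1 h2 => ?_⟩
    rcases h1.eq_or_lt with rfl | h1
    · simp
    · obtain rfl : t = i + 1 := le_antisymm h2 h1
      exact (div_mul_cancel₀ _ hpos.ne').ge
  obtain ⟨⟨a, b⟩, ⟨h1, h2, l, h3⟩, hmax⟩ := Set.exists_max_image S (fun p => (p.2 : ℤ) - p.1) hS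
    ⟨(i, i + 1), le_rfl, Nat.lt_succ_self i, _, hsing⟩
  refine ⟨l, a, b, ⟨trivial, trivial, h3, fun l' a' b' _ _ hlev h4 h5 => ?_⟩, h1, h2⟩
  have := hmax (a', b') ⟨h4.trans h1, h2.trans_le h5, l', hlev⟩
  simp only at this
  omega

theorem seqSlope_antitone (h : SeqPair w g)
    (hvan : Tendsto (fun n => gprim g n / sprim w n) atTop (nhds 0)) :
    Antitone (seqSlope w g) := by
  refine antitone_nat_of_succ_le fun i => ?_
  by_cases hg : g (i + 1) = 0
  · rw [h.seqSlope_eq_zero hg]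
    exact h.seqSlope_nonneg i
  have hg' : g i ≠ 0 := fun h0 => hg (le_antisymm (h0 ▸ h.anti (Nat.le_succ i)) zero_le)
  obtain ⟨l, a, b, hm, h1, h2⟩ := h.exists_seqMaxLev hvan hg'
  obtain ⟨l', a', b', hm', h3, h4⟩ := h.exists_seqMaxLev hvan hg
  rw [h.seqSlope_eq hm h1 h2, h.seqSlope_eq hm' h3 h4]
  rcases lt_or_ge (i + 1) b with h5 | h5
  · exact (h.eq_of_mem hm hm' (by omega) h5 h3 h4).2.2.ge
  rcases le_or_gt a' i with h6 | h6
  · exact (h.eq_of_mem hm hm' h1 h2 h6 (by omega)).2.2.ge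
  obtain rfl : b = i + 1 := by omega
  obtain rfl : a' = i + 1 := by omega
  by_contra hcon
  obtain ⟨n, hn⟩ := hm.lev.union hm'.lev (by omega) le_rfl (by omega)
    (h.weight.strictMono.monotone.monotoneOn _) (Or.inr (not_le.1 hcon).le)
  have := (hm.max n a b' trivial trivial hn le_rfl (by omega)).2
  omega

/-- The supporting line at the left end point of a maximal level interval. -/
theorem le_of_seqMaxLev (h : SeqPair w g)
    (hvan : Tendsto (fun n => gprim g n / sprim w n) atTop (nhds 0)) (a : ℕ) :
    ∀ l b, SeqMaxLev w g l a b → g a ≠ 0 → l * sprim w a ≤ gprim g a := by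
  induction a using Nat.strong_induction_on with
  | _ a ih =>
    intro l b hm hg
    rcases Nat.eq_zero_or_pos a with rfl | ha
    · simp [sprim]
    obtain ⟨c, rfl⟩ : ∃ c, a = c + 1 := ⟨a - 1, by omega⟩
    have hgc : g c ≠ 0 := fun h0 => hg (le_antisymm (h0 ▸ h.anti (Nat.le_succ c)) zero_le)
    obtain ⟨l', a', b', hm', h1, h2⟩ := h.exists_seqMaxLev hvan hgc
    have hga : g a' ≠ 0 := fun h0 => hgc (le_antisymm (h0 ▸ h.anti h1) zero_le)
    have h3 := ih a' (by omega) l' b' hm' hga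
    have hb' : b' = c + 1 := by
      by_contra hne
      have := (h.eq_of_mem hm hm' le_rfl hm.lev.lt (by omega) (by omega)).1
      omega
    subst hb'
    have h4 := h.seqSlope_antitone hvan (Nat.le_succ c)
    rw [Nat.succ_eq_add_one, h.seqSlope_eq hm le_rfl hm.lev.lt, h.seqSlope_eq hm' h1 h2] at h4
    have h5 := hm'.lev.eq
    have h6 : 0 ≤ sprim w (c + 1) := Finset.sum_nonneg fun i _ => h.weight.nonneg i
    nlinarith [mul_le_mul_of_nonneg_right h4 h6]

/-- If the averages of `g` vanish at infinity, so do the slopes of the concave majorant. -/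
theorem exists_seqSlope_lt (h : SeqPair w g)
    (hvan : Tendsto (fun n => gprim g n / sprim w n) atTop (nhds 0)) {ε : ℝ} (hε : 0 < ε) :
    ∃ N, ∀ i, N ≤ i → seqSlope w g i < ε := by
  obtain ⟨q, hq⟩ := (hvan.eventually (gt_mem_nhds hε)).exists_forall_of_atTop
  refine ⟨q, fun i hi => ?_⟩
  by_contra hcon
  push Not at hcon
  have hg : g i ≠ 0 := fun h0 => by
    rw [h.seqSlope_eq_zero h0] at hcon
    linarith
  obtain ⟨l, a, b, hm, h1, h2⟩ := h.exists_seqMaxLev hvan hg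
  have hga : g a ≠ 0 := fun h0 => hg (le_antisymm (h0 ▸ h.anti h1) zero_le)
  rw [h.seqSlope_eq hm h1 h2] at hcon
  have h3 := hq b (by omega)
  have hW : 0 < sprim w b := lt_of_le_of_lt (Finset.sum_nonneg fun i _ => h.weight.nonneg i)
    hm.lev.wlt
  rw [div_lt_iff₀ hW] at h3
  have h4 := h.le_of_seqMaxLev hvan a l b hm hga
  have h5 := hm.lev.eq
  nlinarith [mul_le_mul_of_nonneg_right hcon hW.le]

/-- The level sequence is the product of the slope of the concave majorant and the weight. -/
theorem levelSequence_eq (h : SeqPair w g)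
    (hvan : Tendsto (fun n => gprim g n / sprim w n) atTop (nhds 0)) (i : ℕ) :
    levelSequence w g i = ENNReal.ofReal (seqSlope w g i) * ENNReal.ofReal (w i) := by
  have htop : ∀ a, a ≤ i → IsSeqLevelInterval w g a ⊤ → g i = 0 := fun a hai hlev => by
    have h0 := h.seqAverage_top hvan a
    exact h.eq_zero_of_gprim_eq hai (h.gprim_eq_of_level_top hlev h0 (by omega))
  by_cases hex : ∃ p : ℕ × ℕ∞,
      IsMaximalSeqLevelInterval w g p.1 p.2 ∧ p.1 ≤ i ∧ (i : ℕ∞) < p.2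
  · rw [levelSequence, dif_pos hex]
    obtain ⟨hp, h1, h2⟩ := hex.choose_spec
    generalize hex.choose = p at hp h1 h2
    obtain ⟨a, b⟩ := p
    simp only at hp h1 h2 ⊢
    rcases eq_or_ne b ⊤ with rfl | hb
    · rw [h.seqAverage_top hvan, zero_mul, h.seqSlope_eq_zero (htop a h1 hp.1)]
      simp
    · lift b to ℕ using hb
      have hm := h.maxLev_of_isMaximal hp
      rw [h.seqSlope_eq hm h1 (Nat.cast_lt.1 h2), seqAverage_coe, h.seqQuotient_eq hm.lev.lt]
  · rw [levelSequence, dif_neg hex]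
    by_cases hg : g i = 0
    · rw [h.seqSlope_eq_zero hg, hg]
      simp
    · exfalso
      obtain ⟨l, a, b, hm, h1, h2⟩ := h.exists_seqMaxLev hvan hg
      refine hex ⟨(a, (b : ℕ∞)), ⟨h.isSeqLevelInterval_of_lev hm.lev, fun a' b' hlev h3 h4 => ?_⟩,
        h1, Nat.cast_lt.2 h2⟩
      simp only at h3 h4
      rcases eq_or_ne b' ⊤ with rfl | hb
      · exact absurd (htop a' (h3.trans h1) hlev) hg
      · lift b' to ℕ using hb
        have h5 : b ≤ b' := Nat.cast_le.1 h4
        have hlt : a' < b' := by have := hm.lev.lt; omega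
        obtain ⟨h6, h7⟩ := hm.max _ _ _ trivial trivial ((h.isSeqLevelInterval_iff hlt).1 hlev) h3 h5
        rw [h6, h7]
        exact ⟨rfl, rfl⟩

theorem setLIntegral_count_Ico (f : ℕ → ℝ≥0∞) (a b : ℕ) :
    ∫⁻ i in Set.Ico a b, f i ∂(Measure.count : Measure ℕ) = ∑ i ∈ Finset.Ico a b, f i := by
  rw [← Finset.coe_Ico, lintegral_finset]
  simp

theorem sum_eq_of_lev (h : SeqPair w g) {l : ℝ} {a b : ℕ}
    (hlev : Lev (gprim g) (sprim w) l a b) : ∑ i ∈ Finset.Ico a b, g i =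
      ENNReal.ofReal l * ∑ i ∈ Finset.Ico a b, ENNReal.ofReal (w i) := by
  rw [h.sum_eq hlev.lt.le, h.sum_weight_eq hlev.lt.le, hlev.eq, ENNReal.ofReal_mul (avg_nonneg hlev)]

/-- The counterpart of `LevelPair.lintegral_slope_le` for counting measure. -/
theorem tsum_seqSlope_le (h : SeqPair w g)
    (hvan : Tendsto (fun n => gprim g n / sprim w n) atTop (nhds 0)) {φ : ℝ → ℝ} (hφ : IsOrlicz φ)
    {v : ℕ → ℝ} (hv : SeqSubmajorized w v) :
    ∑' i, ENNReal.ofReal (φ (seqSlope w g i)) * ENNReal.ofReal (w i) ≤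
      ∑' i, integrand φ (g i) (ENNReal.ofReal (v i)) := by
  have hanti := h.seqSlope_antitone hvan
  have hsum : ∀ n : ℕ, ∑ i ∈ Finset.range n, ENNReal.ofReal (v i) ≤
      ∑ i ∈ Finset.range n, ENNReal.ofReal (w i) := fun n => by
    rw [sum_ofReal hv.1, sum_ofReal h.weight.nonneg]
    exact ENNReal.ofReal_le_ofReal (hv.2.2 n)
  have hmeas : ∀ f : ℕ → ℝ≥0∞, AEMeasurable f (Measure.count : Measure ℕ) := fun f =>
    measurable_from_nat.aemeasurable
  rw [← lintegral_count, ← lintegral_count]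
  refine lintegral_le_lintegral_integrand hφ h.seqSlope_nonneg measurable_from_nat.aemeasurable
    (hmeas _) (hmeas _) (fun _ => ENNReal.ofReal_ne_top) (fun S => ?_) (fun U hU => ?_)
    fun ε hε => ?_
  · refine lintegral_le_of_partition
      (J := fun p : {p : ℕ × ℕ // ∃ l, SeqMaxLev w g l p.1 p.2} => Set.Ico p.1.1 p.1.2)
      (fun _ => measurableSet_Ico) ?_ ?_ (ae_of_all _ fun i hi => ?_)
    · rintro ⟨⟨a, b⟩, l, hm⟩ ⟨⟨a', b'⟩, l', hm'⟩ hne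
      rw [Set.disjoint_left]
      rintro i ⟨h1, h2⟩ ⟨h3, h4⟩
      obtain ⟨h5, h6, -⟩ := h.eq_of_mem hm hm' h1 h2 h3 h4
      exact hne (Subtype.ext (Prod.ext h5 h6))
    · rintro ⟨⟨a, b⟩, l, hm⟩
      simp only
      rw [setLIntegral_count_Ico, setLIntegral_count_Ico]
      have hval : ∀ i ∈ Finset.Ico a b, seqSlope w g i = l := fun i hi =>
        h.seqSlope_eq hm (Finset.mem_Ico.1 hi).1 (Finset.mem_Ico.1 hi).2
      refine le_of_eq ?_
      trans S l * ENNReal.ofReal l * ∑ i ∈ Finset.Ico a b, ENNReal.ofReal (w i)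
      · rw [Finset.mul_sum]
        exact Finset.sum_congr rfl fun i hi => by rw [hval i hi, mul_assoc]
      · rw [mul_assoc, ← h.sum_eq_of_lev hm.lev, Finset.mul_sum]
        exact Finset.sum_congr rfl fun i hi => by rw [hval i hi]
    · have hg : g i = 0 := by
        by_contra hg
        obtain ⟨l, a, b, hm, h1, h2⟩ := h.exists_seqMaxLev hvan hg
        exact hi (Set.mem_iUnion.2 ⟨⟨(a, b), l, hm⟩, h1, h2⟩)
      simp [h.seqSlope_eq_zero hg, hg]
  · -- the set in question is an initial segment of the natural numbers
    by_cases hall : ∀ i, seqSlope w g i ∈ U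
    · rw [show seqSlope w g ⁻¹' U = Set.univ from Set.eq_univ_of_forall hall, setLIntegral_univ,
        setLIntegral_univ, lintegral_count, lintegral_count]
      refine ENNReal.tsum_le_of_sum_range_le fun n => (hsum n).trans ?_
      exact ENNReal.sum_le_tsum _
    · push Not at hall
      classical
      have hset : seqSlope w g ⁻¹' U = Set.Ico 0 (Nat.find hall) := by
        ext i
        simp only [Set.mem_preimage, Set.mem_Ico, Nat.zero_le, true_and]
        constructor
        · intro hi
          by_contra hcon
          exact Nat.find_spec hall (hU (hanti (not_lt.1 hcon)) hi)
        · intro hi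
          exact not_not.1 (Nat.find_min hall hi)
      rw [hset, setLIntegral_count_Ico, setLIntegral_count_Ico, ← Finset.range_eq_Ico]
      exact hsum _
  · obtain ⟨N, hN⟩ := h.exists_seqSlope_lt hvan hε
    refine lt_of_le_of_lt (lintegral_mono_set (t := Set.Ico 0 N) fun i hi => ?_) ?_
    · refine ⟨Nat.zero_le i, ?_⟩
      by_contra hcon
      exact absurd (hN i (not_lt.1 hcon)) (not_lt.2 hi)
    · rw [setLIntegral_count_Ico]
      exact ENNReal.sum_lt_top.2 fun _ _ => ENNReal.ofReal_lt_top

end SeqPair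

section Modulars

variable {φ : ℝ → ℝ} {w : ℕ → ℝ}

theorem seqPair_of_seqModularP_lt_top (hφ : IsOrlicz φ) (hw : IsSeqWeight w) {x : ℕ → ℝ}
    (hx : seqModularP φ w x < ⊤) : SeqPair w (seqRearrangement x) ∧
      Tendsto (fun n => gprim (seqRearrangement x) n / sprim w n) atTop (nhds 0) := by
  rw [seqModularP_eq hφ hw] at hx
  obtain ⟨h, hvan⟩ := levelPair_of_modularP_lt_top hφ hw.isWeight hx
  have hmem : ∀ n : ℕ, (n : ℝ) ∈ closedI ⊤ := fun n => ⟨n.cast_nonneg, le_top⟩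
  have hint : ∀ n : ℕ, intOver (rearrangement (stepL0 x)) 0 (ENNReal.ofReal n) =
      ∑ i ∈ Finset.range n, seqRearrangement x i := fun n => by
    rw [← intOver_step]
    exact setLIntegral_congr_fun (measurableSet_openInterval _ _) fun t ht =>
      rearrangement_stepL0 x (mem_openInterval_zero.1 ht).1.le
  have hfin : seqRearrangement x 0 ≠ ⊤ := by
    have := h.fin _ (hmem 1)
    rw [hint] at this
    simpa using this
  have hpair : SeqPair w (seqRearrangement x) := ⟨hw, seqRearrangement_antitone x, hfin⟩
  refine ⟨hpair, ((hvan rfl).comp tendsto_natCast_atTop_atTop).congr fun n => ?_⟩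
  rw [Function.comp, hw.wprim_eq, prim, hint,
    ENNReal.toReal_sum fun i _ => hpair.ne_top i]
  rfl

theorem seqModularQ_eq (hφ : IsOrlicz φ) {x : ℕ → ℝ} (h : SeqPair w (seqRearrangement x))
    (hvan : Tendsto (fun n => gprim (seqRearrangement x) n / sprim w n) atTop (nhds 0)) :
    seqModularQ φ w x = ∑' i, ENNReal.ofReal (φ (seqSlope w (seqRearrangement x) i)) *
      ENNReal.ofReal (w i) := by
  refine tsum_congr fun i => ?_
  have hs := h.seqSlope_nonneg i
  have hw := h.weight.pos i
  rw [h.levelSequence_eq hvan, ← ENNReal.ofReal_mul hs,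
    integrand_ofReal hφ (mul_nonneg hs hw.le) hw, mul_div_cancel_right₀ _ hw.ne',
    ENNReal.ofReal_mul (hφ.nonneg hs)]

theorem seqModularQ_le_seqModularP (hφ : IsOrlicz φ) (hw : IsSeqWeight w) {x : ℕ → ℝ}
    (hx : seqModularP φ w x < ⊤) : seqModularQ φ w x ≤ seqModularP φ w x := by
  obtain ⟨h, hvan⟩ := seqPair_of_seqModularP_lt_top hφ hw hx
  rw [seqModularQ_eq hφ h hvan]
  exact le_iInf₂ fun v hv => h.tsum_seqSlope_le hvan hφ hv

end Modulars

/-! ### Equality of the sequence modulars -/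

namespace SeqPair

variable {w : ℕ → ℝ} {g : ℕ → ℝ≥0∞}

theorem levelSequence_of_forall_eq {i a : ℕ} {b : ℕ∞} (hmax : IsMaximalSeqLevelInterval w g a b)
    (hai : a ≤ i) (hib : (i : ℕ∞) < b) (h : ∀ c d, IsMaximalSeqLevelInterval w g c d →
      c ≤ i → (i : ℕ∞) < d → c = a ∧ d = b) :
    levelSequence w g i = seqAverage w g a b * ENNReal.ofReal (w i) := by
  have hex : ∃ p : ℕ × ℕ∞,
      IsMaximalSeqLevelInterval w g p.1 p.2 ∧ p.1 ≤ i ∧ (i : ℕ∞) < p.2 := ⟨(a, b), hmax, hai, hib⟩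
  rw [levelSequence, dif_pos hex]
  obtain ⟨h1, h2⟩ := h _ _ hex.choose_spec.1 hex.choose_spec.2.1 hex.choose_spec.2.2
  rw [h1, h2]

/-- If the modular `q` is finite, then `g` has average `0` over an unbounded maximal level interval,
because otherwise the level sequence is a multiple of the weight from some index on. -/
theorem seqAverage_eq_zero_of_isMaximal_top (h : SeqPair w g) {φ : ℝ → ℝ} (hφ : IsOrlicz φ)
    (hQ : ∑' i, integrand φ (levelSequence w g i) (ENNReal.ofReal (w i)) < ⊤)
    {a : ℕ} (hmax : IsMaximalSeqLevelInterval w g a ⊤) : seqAverage w g a ⊤ = 0 := by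
  by_contra hne
  set Λ := seqAverage w g a ⊤
  obtain ⟨T, haT, hT⟩ : ∃ T, a ≤ T ∧ ∀ l c d, SeqMaxLev w g l c d → c < a → a < d → d ≤ T := by
    by_cases hex : ∃ l c d, SeqMaxLev w g l c d ∧ c < a ∧ a < d
    · obtain ⟨l, c, d, hm, hca, had⟩ := hex
      exact ⟨d, had.le, fun l' c' d' hm' h1 h2 => (h.eq_of_mem hm hm' hca.le had h1.le h2).2.1.ge⟩
    · push Not at hex
      exact ⟨a, le_rfl, fun l c d hm h1 h2 => absurd (hex l c d hm h1) (not_le.2 h2)⟩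
  have hval : ∀ i, T ≤ i → levelSequence w g i = Λ * ENNReal.ofReal (w i) := by
    intro i hi
    refine levelSequence_of_forall_eq hmax (haT.trans hi) (ENat.natCast_lt_top i)
      fun c d hq hci hid => ?_
    rcases eq_or_ne d ⊤ with rfl | hd
    · rcases le_total c a with hca | hac
      · exact hmax.2 _ _ hq.1 hca le_rfl
      · exact ⟨(hq.2 _ _ hmax.1 hac le_rfl).1.symm, rfl⟩
    · exfalso
      rcases le_or_gt a c with hac | hca
      · exact hd (hq.2 _ _ hmax.1 hac le_top).2.symm
      · lift d to ℕ using hd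
        have hid' : i < d := Nat.cast_lt.1 hid
        have := hT _ _ _ (h.maxLev_of_isMaximal hq) hca (by omega)
        omega
  have hext : extend φ Λ ≠ 0 := by
    unfold extend
    split_ifs with h1
    · exact ENNReal.top_ne_zero
    · have := hφ.pos Λ.toReal (ENNReal.toReal_pos hne h1)
      simpa using this
  have hW : ∑' i, ENNReal.ofReal (w (i + T)) = ⊤ := by
    by_contra hfin
    have h1 := h.weight.infinite
    rw [← ENNReal.summable.sum_add_tsum_nat_add' (k := T)] at h1
    exact (ENNReal.add_lt_top.2 ⟨ENNReal.sum_lt_top.2 fun _ _ => ENNReal.ofReal_lt_top,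
      lt_top_iff_ne_top.2 hfin⟩).ne h1
  refine hQ.not_ge ?_
  calc (⊤ : ℝ≥0∞) = ∑' i, extend φ Λ * ENNReal.ofReal (w (i + T)) := by
        rw [ENNReal.tsum_mul_left, hW, ENNReal.mul_top hext]
    _ = ∑' i, integrand φ (levelSequence w g (i + T)) (ENNReal.ofReal (w (i + T))) := by
        refine tsum_congr fun i => ?_
        have h1 : ENNReal.ofReal (w (i + T)) ≠ 0 := by simpa using h.weight.pos (i + T)
        rw [hval _ (Nat.le_add_left T i), integrand_of_ne (mul_ne_zero hne h1) h1,
          ENNReal.mul_div_cancel_right h1 ENNReal.ofReal_ne_top]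
    _ ≤ _ := ENNReal.tsum_comp_le_tsum_of_injective (add_left_injective T) _

/-- The initial sums of the level sequence dominate those of the sequence itself. -/
theorem sum_le_sum_levelSequence (h : SeqPair w g)
    (h0 : ∀ a, IsMaximalSeqLevelInterval w g a ⊤ → seqAverage w g a ⊤ = 0) (n : ℕ) :
    ∑ i ∈ Finset.range n, g i ≤ ∑ i ∈ Finset.range n, levelSequence w g i := by
  have hbdd : ∀ i a b, g i ≠ 0 → IsMaximalSeqLevelInterval w g a b → a ≤ i → (i : ℕ∞) < b →
      ∃ b' : ℕ, b = b' ∧ i < b' := by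
    intro i a b hg hmax hai hib
    have hb : b ≠ ⊤ := by
      rintro rfl
      exact hg (h.eq_zero_of_gprim_eq hai (h.gprim_eq_of_level_top hmax.1 (h0 a hmax) (by omega)))
    lift b to ℕ using hb
    exact ⟨b, rfl, Nat.cast_lt.1 hib⟩
  induction n using Nat.strong_induction_on with
  | _ n ih =>
    rcases Nat.eq_zero_or_pos n with rfl | hn
    · simp
    obtain ⟨m, rfl⟩ : ∃ m, n = m + 1 := ⟨n - 1, by omega⟩
    by_cases hg : g m = 0
    · rw [Finset.sum_range_succ, hg, add_zero, Finset.sum_range_succ]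
      exact (ih m (Nat.lt_succ_self m)).trans le_self_add
    by_cases hex : ∃ p : ℕ × ℕ∞,
        IsMaximalSeqLevelInterval w g p.1 p.2 ∧ p.1 ≤ m ∧ (m : ℕ∞) < p.2
    · obtain ⟨⟨a, b⟩, hmax, ham, hmb⟩ := hex
      simp only at hmax ham hmb
      obtain ⟨b, rfl, hmb'⟩ := hbdd m a b hg hmax ham hmb
      have hm := h.maxLev_of_isMaximal hmax
      have hab : a < b := by omega
      set l := (gprim g b - gprim g a) / (sprim w b - sprim w a)
      have hval : ∀ i ∈ Finset.Ico a (m + 1),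
          levelSequence w g i = ENNReal.ofReal l * ENNReal.ofReal (w i) := by
        intro i hi
        obtain ⟨hai, him⟩ := Finset.mem_Ico.1 hi
        have hgi : g i ≠ 0 := fun h1 =>
          hg (le_antisymm (h1 ▸ h.anti (Nat.lt_succ_iff.1 him)) zero_le)
        rw [levelSequence_of_forall_eq hmax hai (Nat.cast_lt.2 (by omega)), seqAverage_coe,
          h.seqQuotient_eq hab]
        intro c d hq hci hid
        obtain ⟨d, rfl, hid'⟩ := hbdd i c d hgi hq hci hid
        obtain ⟨h1, h2, -⟩ := h.eq_of_mem hm (h.maxLev_of_isMaximal hq) hai (by omega) hci hid'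
        rw [h1, h2]
        exact ⟨rfl, rfl⟩
      rw [← Finset.sum_range_add_sum_Ico g (by omega : a ≤ m + 1),
        ← Finset.sum_range_add_sum_Ico (levelSequence w g) (by omega : a ≤ m + 1)]
      refine add_le_add (ih a (by omega)) ?_
      rw [Finset.sum_congr rfl hval, ← Finset.mul_sum, h.sum_eq (by omega),
        h.sum_weight_eq (by omega), ← ENNReal.ofReal_mul (avg_nonneg hm.lev)]
      exact ENNReal.ofReal_le_ofReal (hm.lev.le _ (by omega) hmb')
    · rw [Finset.sum_range_succ, Finset.sum_range_succ]
      refine add_le_add (ih m (Nat.lt_succ_self m)) ?_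
      rw [levelSequence, dif_neg hex]

/-- If the modular `q` is finite, the averages of `g` vanish at infinity. -/
theorem tendsto_of_tsum_lt_top (h : SeqPair w g) {φ : ℝ → ℝ} (hφ : IsOrlicz φ)
    (hQ : ∑' i, integrand φ (levelSequence w g i) (ENNReal.ofReal (w i)) < ⊤) :
    Tendsto (fun n => gprim g n / sprim w n) atTop (nhds 0) := by
  have hF0 : ∀ n, 0 ≤ gprim g n := fun n => Finset.sum_nonneg fun i _ => ENNReal.toReal_nonneg
  have hle := h.sum_le_sum_levelSequence fun a hmax =>
    h.seqAverage_eq_zero_of_isMaximal_top hφ hQ hmax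
  obtain ⟨Q, hQ0, hQe⟩ : ∃ r : ℝ, 0 ≤ r ∧
      ∑' i, integrand φ (levelSequence w g i) (ENNReal.ofReal (w i)) = ENNReal.ofReal r :=
    ⟨_, ENNReal.toReal_nonneg, (ENNReal.ofReal_toReal hQ.ne).symm⟩
  rw [Metric.tendsto_nhds]
  intro ε hε
  obtain ⟨s, hs, hsub⟩ := hφ.exists_subgradient hε
  have hc : 0 ≤ s * ε - φ ε := by
    have := hsub 0 le_rfl
    rw [hφ.zero] at this
    linarith
  have hφε := hφ.pos ε hε
  filter_upwards [h.weight.tendsto_sprim.eventually_gt_atTop (Q / φ ε),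
    h.weight.tendsto_sprim.eventually_gt_atTop 0] with n hn hn0
  rw [div_lt_iff₀ hφε] at hn
  have key : ENNReal.ofReal (s * gprim g n) ≤
      ENNReal.ofReal (Q + (s * ε - φ ε) * sprim w n) := by
    have hg := h.sum_eq (Nat.zero_le n)
    have hw := h.sum_weight_eq (Nat.zero_le n)
    rw [← Finset.range_eq_Ico, show gprim g 0 = 0 from rfl, sub_zero] at hg
    rw [← Finset.range_eq_Ico, show sprim w 0 = 0 from rfl, sub_zero] at hw
    rw [ENNReal.ofReal_mul hs, ENNReal.ofReal_add hQ0 (mul_nonneg hc hn0.le),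
      ENNReal.ofReal_mul hc, ← hg, ← hw, ← hQe]
    calc _ ≤ ENNReal.ofReal s * ∑ i ∈ Finset.range n, levelSequence w g i := by
          exact mul_le_mul' le_rfl (hle n)
      _ ≤ ∑ i ∈ Finset.range n, (integrand φ (levelSequence w g i) (ENNReal.ofReal (w i)) +
            ENNReal.ofReal (s * ε - φ ε) * ENNReal.ofReal (w i)) := by
          rw [Finset.mul_sum]
          exact Finset.sum_le_sum fun i _ => tangent_le_integrand hφ hs hc
            (fun u hu => by have := hsub u hu; linarith) _ ENNReal.ofReal_ne_top
      _ ≤ _ := by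
          rw [Finset.sum_add_distrib, ← Finset.mul_sum]
          exact add_le_add_left (ENNReal.sum_le_tsum _) _
  rw [ENNReal.ofReal_le_ofReal_iff (add_nonneg hQ0 (mul_nonneg hc hn0.le))] at key
  rw [Real.dist_eq, sub_zero, abs_of_nonneg (div_nonneg (hF0 n) hn0.le), div_lt_iff₀ hn0]
  refine lt_of_mul_lt_mul_left (a := s) ?_ hs
  nlinarith

theorem seqSlope_pos (h : SeqPair w g)
    (hvan : Tendsto (fun n => gprim g n / sprim w n) atTop (nhds 0)) {i : ℕ} (hg : g i ≠ 0) :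
    0 < seqSlope w g i := by
  obtain ⟨l, a, b, hm, h1, h2⟩ := h.exists_seqMaxLev hvan hg
  rw [h.seqSlope_eq hm h1 h2]
  have h3 := h.gprim_lt h1 h2 hg
  rw [← sub_pos, hm.lev.eq] at h3
  exact pos_of_mul_pos_left h3 (sub_pos.2 hm.lev.wlt).le

/-- The quotient of a sequence and its averages over the maximal level intervals is submajorized by
the weight. -/
theorem div_seqSlope_submajorized (h : SeqPair w g)
    (hvan : Tendsto (fun n => gprim g n / sprim w n) atTop (nhds 0)) :
    SeqSubmajorized w fun i => (g i).toReal / seqSlope w g i := by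
  have hnn : ∀ i, 0 ≤ (g i).toReal / seqSlope w g i := fun i =>
    div_nonneg ENNReal.toReal_nonneg (h.seqSlope_nonneg i)
  refine ⟨hnn, antitone_nat_of_succ_le fun i => ?_, fun n => ?_⟩
  · by_cases hg : g (i + 1) = 0
    · simpa [hg] using hnn i
    have hg' : g i ≠ 0 := fun h0 => hg (le_antisymm (h0 ▸ h.anti (Nat.le_succ i)) zero_le)
    have hl := h.seqSlope_pos hvan hg'
    have hl' := h.seqSlope_pos hvan hg
    obtain ⟨l, a, b, hm, h1, h2⟩ := h.exists_seqMaxLev hvan hg'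
    obtain ⟨l', a', b', hm', h3, h4⟩ := h.exists_seqMaxLev hvan hg
    have e1 := h.seqSlope_eq hm h1 h2
    have e2 := h.seqSlope_eq hm' h3 h4
    have hsame : a = a' ∧ b = b' ∧ l = l' →
        (g (i + 1)).toReal / seqSlope w g (i + 1) ≤ (g i).toReal / seqSlope w g i := by
      rintro ⟨-, -, rfl⟩
      rw [e1, e2]
      exact div_le_div_of_nonneg_right (ENNReal.toReal_mono (h.ne_top i) (h.anti (Nat.le_succ i)))
        (e1 ▸ hl.le)
    rcases lt_or_ge (i + 1) b with h5 | h5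
    · exact hsame (h.eq_of_mem hm hm' (by omega) h5 h3 h4)
    rcases le_or_gt a' i with h6 | h6
    · exact hsame (h.eq_of_mem hm hm' h1 h2 h6 (by omega))
    obtain rfl : b = i + 1 := by omega
    obtain rfl : a' = i + 1 := by omega
    have h7 := hm.lev.ge h1 h2.le
    have h8 := hm'.lev.le (i + 1 + 1) (by omega) (by omega)
    have hF : ∀ k, gprim g (k + 1) - gprim g k = (g k).toReal := fun k =>
      sub_eq_of_eq_add' (sprim_succ _ k)
    have hW : ∀ k, sprim w (k + 1) - sprim w k = w k := fun k => sub_eq_of_eq_add' (sprim_succ w k)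
    rw [hF, hW] at h7 h8
    calc _ ≤ w (i + 1) := by rwa [div_le_iff₀ hl', e2, mul_comm]
      _ ≤ w i := h.weight.antitone (Nat.le_succ i)
      _ ≤ _ := by rwa [le_div_iff₀ hl, e1, mul_comm]
  · change sprim _ n ≤ sprim w n
    induction n using Nat.strong_induction_on with
    | _ n ih =>
      rcases Nat.eq_zero_or_pos n with rfl | hn
      · exact le_rfl
      obtain ⟨m, rfl⟩ : ∃ m, n = m + 1 := ⟨n - 1, by omega⟩
      by_cases hg : g m = 0
      · rw [sprim_succ]
        simpa [hg] using (ih m (Nat.lt_succ_self m)).trans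
          (h.weight.strictMono (Nat.lt_succ_self m)).le
      obtain ⟨l, a, b, hm, h1, h2⟩ := h.exists_seqMaxLev hvan hg
      have hl : 0 < l := h.seqSlope_eq hm h1 h2 ▸ h.seqSlope_pos hvan hg
      have h3 := ih a (by omega)
      have h4 : sprim (fun i => (g i).toReal / seqSlope w g i) (m + 1) -
          sprim (fun i => (g i).toReal / seqSlope w g i) a =
          (gprim g (m + 1) - gprim g a) / l := by
        rw [sprim_sub _ (by omega), sprim_sub _ (by omega), Finset.sum_div]
        refine Finset.sum_congr rfl fun i hi => ?_
        rw [h.seqSlope_eq hm (Finset.mem_Ico.1 hi).1 (by have := (Finset.mem_Ico.1 hi).2; omega)]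
      have h5 := hm.lev.le (m + 1) (by omega) h2
      rw [← div_le_iff₀' hl] at h5
      linarith

/-- The sequence `g / seqSlope` witnesses that `p` is at most `q`. -/
theorem tsum_div_seqSlope_le (h : SeqPair w g)
    (hvan : Tendsto (fun n => gprim g n / sprim w n) atTop (nhds 0)) (φ : ℝ → ℝ) :
    ∑' i, integrand φ (g i) (ENNReal.ofReal ((g i).toReal / seqSlope w g i)) ≤
      ∑' i, integrand φ (levelSequence w g i) (ENNReal.ofReal (w i)) := by
  have hsub : ∀ i, i ∉ ⋃ p : {p : ℕ × ℕ // ∃ l, 0 < l ∧ SeqMaxLev w g l p.1 p.2},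
      Set.Ico p.1.1 p.1.2 → g i = 0 := fun i hi => by
    by_contra hg
    obtain ⟨l, a, b, hm, h1, h2⟩ := h.exists_seqMaxLev hvan hg
    exact hi (Set.mem_iUnion.2 ⟨⟨(a, b), l,
      h.seqSlope_eq hm h1 h2 ▸ h.seqSlope_pos hvan hg, hm⟩, h1, h2⟩)
  rw [← lintegral_count, ← lintegral_count]
  refine lintegral_integrand_le_of_level
    (J := fun p : {p : ℕ × ℕ // ∃ l, 0 < l ∧ SeqMaxLev w g l p.1 p.2} => Set.Ico p.1.1 p.1.2)
    (fun _ => measurableSet_Ico) ?_ (l := fun p => p.2.choose) (fun p => p.2.choose_spec.1)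
    (ae_of_all _ h.ne_top) (fun _ => ENNReal.ofReal_ne_top) measurable_from_nat (fun p => ?_)
    (fun p i hi _ => ?_) (fun p i hi => ?_) (ae_of_all _ fun i hi hg => absurd (hsub i hi) hg)
    (ae_of_all _ fun i hi hg => absurd (hsub i hi) hg)
  · rintro ⟨⟨a, b⟩, l, hl, hm⟩ ⟨⟨a', b'⟩, l', hl', hm'⟩ hne
    rw [Set.disjoint_left]
    rintro i ⟨h1, h2⟩ ⟨h3, h4⟩
    obtain ⟨h5, h6, -⟩ := h.eq_of_mem hm hm' h1 h2 h3 h4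
    exact hne (Subtype.ext (Prod.ext h5 h6))
  · rw [setLIntegral_count_Ico, setLIntegral_count_Ico, h.sum_eq_of_lev p.2.choose_spec.2.lev]
  · rw [h.seqSlope_eq p.2.choose_spec.2 hi.1 hi.2, ENNReal.ofReal_div_of_pos p.2.choose_spec.1,
      ENNReal.ofReal_toReal (h.ne_top i)]
  · rw [h.levelSequence_eq hvan, h.seqSlope_eq p.2.choose_spec.2 hi.1 hi.2]

end SeqPair

section Modulars

variable {φ : ℝ → ℝ} {w : ℕ → ℝ}

/-- If the largest term is infinite, then all of `ℕ` is a level interval with infinite average, so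
that the modular `q` is infinite. -/
theorem seqPair_of_seqModularQ_lt_top (hw : IsSeqWeight w) {x : ℕ → ℝ}
    (hx : seqModularQ φ w x < ⊤) : SeqPair w (seqRearrangement x) := by
  refine ⟨hw, seqRearrangement_antitone x, fun htop => hx.ne ?_⟩
  set g := seqRearrangement x
  have hquot : ∀ n, 0 < n → seqQuotient w g 0 n = ⊤ := fun n hn => by
    rw [seqQuotient, ENNReal.sum_eq_top.2 ⟨0, Finset.mem_Ico.2 ⟨le_rfl, hn⟩, htop⟩,
      ENNReal.top_div_of_ne_top (ENNReal.sum_lt_top.2 fun _ _ => ENNReal.ofReal_lt_top).ne]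
  -- the whole of `ℕ` is a level interval with infinite average
  have havg : seqAverage w g 0 ⊤ = ⊤ := by
    rw [seqAverage, if_pos rfl,
      limsup_congr ((eventually_gt_atTop 0).mono hquot), limsup_const]
  have hmax : IsMaximalSeqLevelInterval w g 0 ⊤ :=
    ⟨⟨ENat.natCast_lt_top 0, fun t _ _ => havg ▸ le_top⟩, fun a' b' h1 h2 h3 =>
      ⟨Nat.le_zero.1 h2, top_le_iff.1 h3⟩⟩
  have h1 : ENNReal.ofReal (w 0) ≠ 0 := by simpa using hw.pos 0
  refine ENNReal.tsum_eq_top_of_eq_top ⟨0, ?_⟩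
  rw [SeqPair.levelSequence_of_forall_eq hmax le_rfl (ENat.natCast_lt_top 0) fun c d hq _ _ => by
    have := hq.2 _ _ hmax.1 (Nat.zero_le _) le_top
    exact ⟨this.1.symm, this.2.symm⟩, havg, ENNReal.top_mul h1, integrand_top ENNReal.ofReal_ne_top]

theorem seqModularP_le_seqModularQ (hφ : IsOrlicz φ) (hw : IsSeqWeight w) {x : ℕ → ℝ}
    (hx : seqModularQ φ w x < ⊤) : seqModularP φ w x ≤ seqModularQ φ w x := by
  have h := seqPair_of_seqModularQ_lt_top hw hx
  have hvan := h.tendsto_of_tsum_lt_top hφ hx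
  exact (iInf₂_le _ (h.div_seqSlope_submajorized hvan)).trans (h.tsum_div_seqSlope_le hvan φ)

theorem seqFiniteP_eq_seqFiniteQ (hφ : IsOrlicz φ) (hw : IsSeqWeight w) :
    seqFiniteP φ w = seqFiniteQ φ w := by
  ext x
  exact forall₂_congr fun k _ => ⟨fun h => (seqModularQ_le_seqModularP hφ hw h).trans_lt h,
    fun h => (seqModularP_le_seqModularQ hφ hw h).trans_lt h⟩

end Modulars

/-! ### Growth condition and separability for sequence spaces -/

section Sequences

variable {φ : ℝ → ℝ} {w : ℕ → ℝ}

/-- The proof passes to the modular `q`, because only finitely many of the averages over the level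
intervals exceed the bound up to which the growth condition holds. -/
theorem seqModularP_two_smul_lt_top (hφ : IsOrlicz φ) (hw : IsSeqWeight w) (h : DeltaTwoZero φ)
    {x : ℕ → ℝ} (hx : seqModularP φ w x < ⊤) : seqModularP φ w ((2 : ℝ) • x) < ⊤ := by
  obtain ⟨K, u₀, hK, hu₀, hKu⟩ := h
  obtain ⟨hp, hvan⟩ := seqPair_of_seqModularP_lt_top hφ hw hx
  have hφ2 : IsOrlicz fun u => φ (2 * u) := hφ.scale two_pos
  have hQ := (seqModularQ_le_seqModularP hφ hw hx).trans_lt hx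
  rw [seqModularQ_eq hφ hp hvan] at hQ
  rw [seqModularP_smul_eq hφ hw, modularP_smul _ two_pos, ← seqModularP_eq hφ2 hw]
  refine (iInf₂_le _ (hp.div_seqSlope_submajorized hvan)).trans_lt
    ((hp.tsum_div_seqSlope_le hvan _).trans_lt ?_)
  rw [← seqModularQ, seqModularQ_eq hφ2 hp hvan]
  set y := seqSlope w (seqRearrangement x)
  obtain ⟨N, hN⟩ := hp.exists_seqSlope_lt hvan hu₀
  rw [← ENNReal.summable.sum_add_tsum_nat_add' (k := N)]
  refine ENNReal.add_lt_top.2 ⟨ENNReal.sum_lt_top.2 fun _ _ =>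
    ENNReal.mul_lt_top ENNReal.ofReal_lt_top ENNReal.ofReal_lt_top, ?_⟩
  calc ∑' i, ENNReal.ofReal (φ (2 * y (i + N))) * ENNReal.ofReal (w (i + N))
      ≤ ∑' i, ENNReal.ofReal K * (ENNReal.ofReal (φ (y (i + N))) * ENNReal.ofReal (w (i + N))) := by
        refine ENNReal.tsum_le_tsum fun i => ?_
        rw [← mul_assoc, ← ENNReal.ofReal_mul (p := K) (by linarith)]
        exact mul_le_mul' (ENNReal.ofReal_le_ofReal
          (hKu _ (hp.seqSlope_nonneg _) (hN _ (Nat.le_add_left N i)).le)) le_rfl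
    _ ≤ ENNReal.ofReal K * ∑' i, ENNReal.ofReal (φ (y i)) * ENNReal.ofReal (w i) := by
        rw [ENNReal.tsum_mul_left]
        exact mul_le_mul' le_rfl (ENNReal.tsum_comp_le_tsum_of_injective (add_left_injective N)
          fun i => ENNReal.ofReal (φ (y i)) * ENNReal.ofReal (w i))
    _ < ⊤ := ENNReal.mul_lt_top ENNReal.ofReal_lt_top hQ

theorem seqSpaceM_eq_seqFiniteP (hφ : IsOrlicz φ) (hw : IsSeqWeight w) (h : DeltaTwoZero φ) :
    seqSpaceM φ w = seqFiniteP φ w := by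
  refine Set.Subset.antisymm ?_ fun x hx => ⟨1, one_pos, hx 1 one_pos⟩
  rintro x ⟨k, hk, hx⟩ l hl
  have h1 : ∀ n : ℕ, seqModularP φ w (((2 : ℝ) ^ n * k) • x) < ⊤ := by
    intro n
    induction n with
    | zero => simpa using hx
    | succ n ih =>
      have := seqModularP_two_smul_lt_top hφ hw h ih
      rwa [smul_smul, ← mul_assoc, ← pow_succ'] at this
  obtain ⟨n, hn⟩ := pow_unbounded_of_one_lt (l / k) (one_lt_two (α := ℝ))
  have h2 := h1 n
  rw [seqModularP_smul_eq hφ hw] at h2 ⊢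
  exact (modularP_smul_mono hφ _ hl ((div_lt_iff₀ hk).1 hn).le).trans_lt h2

/-- The rational approximation may be taken between `0` and `y`, so that it and the error are
dominated by `y`. -/
theorem exists_rat_abs_sub_le (y : ℝ) {ε : ℝ} (hε : 0 < ε) :
    ∃ q : ℚ, |(q : ℝ)| ≤ |y| ∧ |y - q| ≤ |y| ∧ |y - q| ≤ ε := by
  rcases lt_trichotomy y 0 with hy | rfl | hy
  · obtain ⟨q, h1, h2⟩ := exists_rat_btwn (lt_min hy (lt_add_of_pos_right y hε))
    obtain ⟨h3, h4⟩ := lt_min_iff.1 h2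
    refine ⟨q, ?_, ?_, ?_⟩
    · rw [abs_of_neg h3, abs_of_neg hy]
      linarith
    · rw [abs_of_neg (by linarith), abs_of_neg hy]
      linarith
    · rw [abs_of_neg (by linarith)]
      linarith
  · exact ⟨0, by simp, by simp, by simpa using hε.le⟩
  · obtain ⟨q, h1, h2⟩ := exists_rat_btwn (max_lt hy (sub_lt_self y hε))
    obtain ⟨h3, h4⟩ := max_lt_iff.1 h1
    refine ⟨q, ?_, ?_, ?_⟩
    · rw [abs_of_pos h3, abs_of_pos hy]
      exact h2.le
    · rw [abs_of_pos (by linarith), abs_of_pos hy]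
      linarith
    · rw [abs_of_pos (by linarith)]
      linarith

/-- The rational sequences with finite support are dense. -/
theorem seqSeparableFor_of_eq (hφ : IsOrlicz φ) (hw : IsSeqWeight w)
    (h : seqSpaceM φ w = seqFiniteP φ w) : SeparableFor (seqNormM φ w) (seqSpaceM φ w) := by
  refine ⟨(Set.range fun (r : ℕ →₀ ℚ) (i : ℕ) => (r i : ℝ)) ∩ seqSpaceM φ w,
    Set.inter_subset_right, (Set.countable_range _).mono Set.inter_subset_left,
    fun x hx ε hε => ?_⟩
  have hpos : ∀ n : ℕ, (0 : ℝ) < 1 / (n + 1) := fun n => by positivity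
  choose q hq1 hq2 hq3 using fun (n i : ℕ) => exists_rat_abs_sub_le (x i) (hpos n)
  set r : ℕ → ℕ →₀ ℚ := fun n =>
    Finsupp.onFinset (Finset.range n) (fun i => if i < n then q n i else 0) (fun i hi => by
      by_contra hcon
      rw [Finset.mem_range] at hcon
      simp [hcon] at hi)
  set u : ℕ → ℕ → ℝ := fun n i => (r n i : ℝ)
  have hu : ∀ n i, u n i = if i < n then (q n i : ℝ) else 0 := fun n i => by
    simp only [u, r, Finsupp.onFinset_apply]
    split_ifs <;> simp
  have hle1 : ∀ n i, |u n i| ≤ |x i| := fun n i => by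
    rw [hu]
    split_ifs
    · exact hq1 n i
    · simp
  have hle2 : ∀ n i, |(x - u n) i| ≤ |x i| := fun n i => by
    rw [Pi.sub_apply, hu]
    split_ifs
    · exact hq2 n i
    · simp
  have habs : ∀ y z : ℕ → ℝ, (∀ i, |y i| ≤ |z i|) →
      ∀ᵐ t ∂(volume : Measure ℝ).restrict (I ⊤), |stepL0 y t| ≤ |stepL0 z t| := fun y z hyz => by
    filter_upwards [coeFn_stepL0 y, coeFn_stepL0 z] with t h1 h2
    rw [h1, h2]
    exact hyz _
  have hfin : stepL0 x ∈ finiteP ⊤ φ (step w) := (mem_seqFiniteP_iff hφ hw x).1 (h ▸ hx)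
  have hP : modularP φ (step w) (stepL0 x) < ⊤ := by simpa using hfin 1 one_pos
  obtain ⟨δ, hδ, hδε⟩ : ∃ δ : ℝ, 0 < δ ∧ ENNReal.ofReal δ < ε := by
    obtain ⟨c, hc0, hc⟩ := ENNReal.lt_iff_exists_nnreal_btwn.1 hε
    exact ⟨c, by simpa using hc0, by rwa [ENNReal.ofReal_coe_nnreal]⟩
  have hlim : ∀ c : ℝ≥0, 0 < c → Tendsto (fun n => distribution (stepL0 (x - u n)) c) atTop
      (nhds 0) := fun c hc => by
    have hfinite : {i | (c : ℝ) < |x i|}.Finite := by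
      have := distribution_lt_top hφ hw.isWeight hP hc
      rw [distribution_stepL0] at this
      exact Measure.count_apply_lt_top.1 this
    obtain ⟨N, hN⟩ := hfinite.bddAbove
    have hc' : (0 : ℝ) < c := hc
    refine tendsto_const_nhds.congr' ?_
    filter_upwards [eventually_gt_atTop N,
      tendsto_one_div_add_atTop_nhds_zero_nat.eventually (gt_mem_nhds hc')] with n h1 h2
    rw [distribution_stepL0, seqDistribution]
    symm
    rw [Measure.count_eq_zero_iff]
    refine Set.eq_empty_of_forall_notMem fun i hi => ?_
    have hi' : (c : ℝ) < |(x - u n) i| := hi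
    have hiN : i ≤ N := hN (show (c : ℝ) < |x i| from hi'.trans_le (hle2 n i))
    rw [Pi.sub_apply, hu, if_pos (by omega)] at hi'
    linarith [hq3 n i]
  obtain ⟨n, hn⟩ := (eventually_normM_le hφ hfin (u := fun n => stepL0 (x - u n))
    (fun n => habs _ _ (hle2 n)) hlim hδ).exists
  refine ⟨u n, ⟨⟨r n, rfl⟩, 1, one_pos, ?_⟩, ?_⟩
  · rw [one_smul, seqModularP_eq hφ hw]
    exact (modularP_mono hφ (habs _ _ (hle1 n))).trans_lt hP
  · rw [seqNormM_eq hφ hw]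
    exact hn.trans_lt hδε

theorem seq_not_separableFor_and_ne (hφ : IsOrlicz φ) (hw : IsSeqWeight w)
    (h : ¬ DeltaTwoZero φ) : ¬ SeparableFor (seqNormM φ w) (seqSpaceM φ w) ∧
      seqSpaceM φ w ≠ seqFiniteP φ w := by
  obtain ⟨l, a, b, L, hb⟩ := exists_bumpData_of_not_deltaTwoZero hφ hw.isWeight h
  set L' : ℝ → ℝ := fun t => L ⌊t⌋₊
  set x : Set ℕ → ℕ → ℝ := fun S i =>
    bump (step w) (fun n => (a n : ℝ)) (fun n => (b n : ℝ)) L' S (i : ℝ)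
  have hx : ∀ S, stepL0 (x S) =ᵐ[(volume : Measure ℝ).restrict (I ⊤)]
      bump (step w) (fun n => (a n : ℝ)) (fun n => (b n : ℝ)) L' S := fun S => by
    filter_upwards [coeFn_stepL0 (x S), ae_mem_openInterval ⊤] with t h1 h2
    have ht : 0 ≤ t := (mem_openInterval_zero.1 h2).1.le
    rw [h1]
    -- the intervals have integer end points, so that they contain `t` and `⌊t⌋₊` at the same time
    have hmem : ((⌊t⌋₊ : ℝ) ∈ ⋃ n ∈ S, Set.Ico (a n : ℝ) (b n)) ↔
        t ∈ ⋃ n ∈ S, Set.Ico (a n : ℝ) (b n) := by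
      simp only [Set.mem_iUnion, Set.mem_Ico, Nat.cast_le, Nat.cast_lt, Nat.le_floor_iff ht,
        Nat.floor_lt ht]
    by_cases hc : t ∈ ⋃ n ∈ S, Set.Ico (a n : ℝ) (b n)
    · simp only [x, step, bump, Set.indicator_of_mem hc, Set.indicator_of_mem (hmem.2 hc), L',
        Nat.floor_natCast]
    · simp only [x, step, bump, Set.indicator_of_notMem hc,
        Set.indicator_of_notMem (mt hmem.1 hc)]
  have hM : ∀ S, x S ∈ seqSpaceM φ w := fun S => ⟨1, one_pos, by
    rw [one_smul, seqModularP_eq hφ hw]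
    exact (hb.modularP_le_one hφ hw.isWeight (hx S)).trans_lt ENNReal.one_lt_top⟩
  refine ⟨not_separableFor hM (ε := ENNReal.ofReal (1 / 64)) (by simp) fun S T d h1 h2 => ?_,
    fun he => ?_⟩
  · rw [seqNormM_eq hφ hw, stepL0_sub] at h1 h2
    exact hb.eq_of_normM_lt hφ hw.isWeight (hx S) (hx T) h1 h2
  · have h1 := hM Set.univ
    rw [he, mem_seqFiniteP_iff hφ hw] at h1
    exact hb.notMem_finiteP hφ hw.isWeight (hx Set.univ) h1

end Sequences

section Functions

variable {γ : ℝ≥0∞} {φ w : ℝ → ℝ}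

theorem not_separableFor_and_ne (hφ : IsOrlicz φ) (hw : IsWeight γ w)
    (h : ¬ AppropriateDeltaTwo γ φ) : ¬ SeparableFor (normM φ w) (spaceM γ φ w) ∧
      spaceM γ φ w ≠ finiteP γ φ w := by
  by_cases h1 : DeltaTwoInfty φ
  · obtain rfl : γ = ⊤ := by
      by_contra hγ
      exact h ⟨fun _ => h1, fun h2 => absurd h2 hγ⟩
    have h2 : ¬ DeltaTwoZero φ := fun h2 => h ⟨fun _ => h1, fun _ => ⟨h2, h1⟩⟩
    obtain ⟨l, a, b, L, hb⟩ := exists_bumpData_of_not_deltaTwoZero hφ hw h2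
    exact hb.not_separableFor_and_ne hφ hw
  · obtain ⟨l, a, b, L, hb⟩ := exists_bumpData_of_not_deltaTwoInfty hφ hw h1
    exact hb.not_separableFor_and_ne hφ hw

end Functions

end OrliczLorentz

theorem mainTheorem3 (φ : ℝ → ℝ) (hφ : OrliczLorentz.IsOrlicz φ) :
    (∀ (γ : ℝ≥0∞) (w : ℝ → ℝ), 0 < γ → OrliczLorentz.IsWeight γ w →
      ((OrliczLorentz.spaceM γ φ w = OrliczLorentz.finiteQ γ φ w ∧
          OrliczLorentz.finiteQ γ φ w = OrliczLorentz.finiteP γ φ w) ↔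
        OrliczLorentz.AppropriateDeltaTwo γ φ) ∧
      (OrliczLorentz.SeparableFor (OrliczLorentz.normM φ w) (OrliczLorentz.spaceM γ φ w) ↔
        OrliczLorentz.AppropriateDeltaTwo γ φ)) ∧
    (∀ w : ℕ → ℝ, OrliczLorentz.IsSeqWeight w →
      ((OrliczLorentz.seqSpaceM φ w = OrliczLorentz.seqFiniteP φ w ∧
          OrliczLorentz.seqFiniteP φ w = OrliczLorentz.seqFiniteQ φ w) ↔
        OrliczLorentz.DeltaTwoZero φ) ∧
      (OrliczLorentz.SeparableFor (OrliczLorentz.seqNormM φ w) (OrliczLorentz.seqSpaceM φ w) ↔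
        OrliczLorentz.DeltaTwoZero φ)) := by
  refine ⟨fun γ w hγ hw => ?_, fun w hw => ?_⟩
  · have heq := OrliczLorentz.finiteQ_eq_finiteP hφ hw
    have hfwd : OrliczLorentz.AppropriateDeltaTwo γ φ →
        OrliczLorentz.spaceM γ φ w = OrliczLorentz.finiteP γ φ w := fun h =>
      OrliczLorentz.spaceM_eq_finiteP_of_forall_two hφ fun _ hf =>
        OrliczLorentz.modularP_two_smul_lt_top hφ hγ hw h hf
    refine ⟨⟨fun h => ?_, fun h => ⟨heq ▸ hfwd h, heq⟩⟩, fun h => ?_,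
      fun h => OrliczLorentz.separableFor_of_eq hφ hw (hfwd h)⟩
    · by_contra hcon
      exact (OrliczLorentz.not_separableFor_and_ne hφ hw hcon).2 (h.1.trans h.2)
    · by_contra hcon
      exact (OrliczLorentz.not_separableFor_and_ne hφ hw hcon).1 h
  · have hfwd := OrliczLorentz.seqSpaceM_eq_seqFiniteP hφ hw
    refine ⟨⟨fun h => ?_, fun h => ⟨hfwd h, OrliczLorentz.seqFiniteP_eq_seqFiniteQ hφ hw⟩⟩,
      fun h => ?_, fun h => OrliczLorentz.seqSeparableFor_of_eq hφ hw (hfwd h)⟩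
    · by_contra hcon
      exact (OrliczLorentz.seq_not_separableFor_and_ne hφ hw hcon).2 h.1
    · by_contra hcon
      exact (OrliczLorentz.seq_not_separableFor_and_ne hφ hw hcon).1 h
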